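/- **Setting.** Let $X_1,X_2,\dots$ be i.i.d. and $C_1,C_2,\dots$ be i.i.d. real random variables, the two sequences being independent, and observe $Z_i=\min(X_i,C_i)$, $e_i=1\{X_i\le C_i\}$. Let $\xi,\xi_c,\beta,\beta_c,C,C_c>0$ and $D,D_c\in\mathbb R$, and assume the Hall–Welsh conditions: as $x\to\infty$, $$x^{1/\xi}P(X_1>x)=C\,(1+Dx^{-\beta})+o(x^{-\beta}),\qquad x^{1/\xi_c}P(C_1>x)=C_c\,(1+D_cx^{-\beta_c})+o(x^{-\beta_c}).$$ Put $\xi_z=\frac{\xi\xi_c}{\xi+\xi_c}$, $p=\frac{\xi_c}{\xi+\xi_c}$, $\beta_z=\min(\beta,\beta_c)$, $D_z=D1_{\beta\le\beta_c}+D_c1_{\beta_c\le\beta}$, $\rho_z=-\beta_z\xi_z$, $Q_{0,z}(t)=-\xi_z^2\beta_zD_z(CC_c)^{\rho_z}t^{\rho_z}$ and $\kappa_z=-\frac{D\xi 1_{\beta\le\beta_c}-D_c\xi_c1_{\beta_c\le\beta}}{D_z\,\xi\,\xi_c}$, and assume $D_z\neq0$. Let $Z_{1,n}\le\dots\le Z_{n,n}$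 be the order statistics of $Z_1,\dots,Z_n$ (ties broken by order of observation) and $e_{i,n}$ the corresponding indicators. Put $p_k=\frac1k\sum_{i=1}^ke_{n-i+1,n}$, $V_j=j\log\frac{Z_{n-j+1,n}}{Z_{n-j,n}}$ and $$H_k^{\mathcal K}=\frac1k\sum_{i=1}^k\frac{\mathcal K(\frac i{k+1},p_k)}{\log\frac{k+1}i}\log\frac{Z_{n-i+1,n}}{Z_{n-k,n}},$$ $$\widetilde{\mathcal K}(u,q)=\frac1u\int_0^u\frac{\mathcal K(v,q)}{\log(1/v)}\,dv,\qquad \widetilde{\mathcal K}_k\big(\tfrac j{k+1},q\big)=\frac{k+1}{j}\cdot\frac1{k+1}\sum_{i=1}^j\frac{\mathcal K(\frac i{k+1},q)}{\log\frac{k+1}i}.$$ **Kernels.** A kernel is a function $\mathcal K\ge0$ with $\int_0^1\mathcal K(u,q)\,du=1/q$ for all $q\in(0,1]$. For a weight $w$ on $(0,1)$ call it $w$-regular at $p$ if $\mathcal K(\cdot,p)$ is continuous on $(0,1)$ and there are $\delta>0$ and a nonincreasing $\varphi$ on $(0,1)$ with $\int_0^1\varphi w<\infty$ such that for $u\in(0,1)$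 and $|q-p|<\delta$ the function $\mathcal K(u,\cdot)$ is differentiable at $q$, $\partial_q\mathcal K$ is jointly continuous there, and $|\mathcal K(u,q)|,|\partial_q\mathcal K(u,q)|\le\varphi(u)w(u)$. The kernels considered are those for which (a) $\mathcal K$ is $\log(1/u)$-regular at $p$; or (b) $\mathcal K$ is $1$-regular at $p$ and, moreover, the Hall–Welsh expansions may be differentiated: with $S(x)=P(X_1>x)$, $S$ is differentiable for large $x$ and $-xS'(x)/S(x)=1/\xi+\beta Dx^{-\beta}+o(x^{-\beta})$, and likewise for $C_1$ with $(\xi_c,\beta_c,D_c)$. For instance, $\log(1/u)/q$ and $(u^{q-1}-1)/(1-q)$ (read as $\log(1/u)$ at $q=1$) fall under (a), while $u^{q-1}$ falls under (b). **Theorem.** Let $k=k_n$ be integers with $k\to\infty$ and $k/n\to0$ as $n\to\infty$. After enlarging the probability space there are, for each $n$, a standard normal variable $N=N_n$ and i.i.d. standard exponential variables $E_j=E_{j,n}$, $j\ge1$, with $N$ independent of $(E_j)_j$, such that the following hold, where $o_p(1)$ stands for real random variables tending to $0$ in probability as $n\to\infty$. 1. $p_k-p=\sqrt{p(1-p)}\,\frac{N}{\sqrt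 k}\,(1+o_p(1))+Q_{0,z}(n/k)\big\{\frac{\kappa_z}{1-\rho_z}+o_p(1)\big\}$. 2. $V_j=\big(\xi_z+Q_{0,z}(n/k)(\frac j{k+1})^{-\rho_z}\big)E_j+R_{j,n}$ for $1\le j\le k$, with $\big|\sum_{j=i}^kR_{j,n}/j\big|\le o_p(1)\,|Q_{0,z}(n/k)|\max(\log\frac{k+1}i,1)$ for all $1\le i\le k$ simultaneously. 3. For every kernel $\mathcal K$ as in (a) or (b), $$\begin{aligned}H_k^{\mathcal K}-\xi={}&-\sqrt{p(1-p)}\,\frac{\xi_z}{p^2}\frac N{\sqrt k}\,(1+o_p(1))+\xi_z\frac1k\sum_{j=1}^k\widetilde{\mathcal K}_k\big(\tfrac j{k+1},p\big)(E_j-1)\\&+Q_{0,z}(n/k)\Big\{\frac{-\kappa_z\xi_z}{p^2(1-\rho_z)}+\int_0^1u^{-\rho_z}\widetilde{\mathcal K}(u,p)\,du+o_p(1)\Big\}+\xi_z\Big(\frac1k\sum_{j=1}^k\widetilde{\mathcal K}_k\big(\tfrac j{k+1},p\big)-\frac1p\Big).\end{aligned}$$ The variables $N$ and $E_j$ do not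 depend on $\mathcal K$. -/

import Mathlib

open MeasureTheory ProbabilityTheory Filter Topology Asymptotics

universe u

noncomputable section

/-! Parameters of the limit model. -/

/-- Tail index of `Z = min(X, C)`. -/
def xiZ (ξ ξc : ℝ) : ℝ := ξ * ξc / (ξ + ξc)

/-- Limiting proportion `p = ξ_z / ξ` of non-censored observations. -/
def pLim (ξ ξc : ℝ) : ℝ := ξc / (ξ + ξc)

def betaZ (β βc : ℝ) : ℝ := min β βc

def dZ (β βc D Dc : ℝ) : ℝ := (if β ≤ βc then D else 0) + (if βc ≤ β then Dc else 0)

def rhoZ (ξ ξc β βc : ℝ) : ℝ := -(betaZ β βc * xiZ ξ ξc)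

/-- The second order rate function `Q_{0,z}`; the scale constant of the tail of `Z` is `Cst * Cstc`. -/
def q0Z (ξ ξc β βc D Dc Cst Cstc t : ℝ) : ℝ :=
  -(xiZ ξ ξc ^ 2 * betaZ β βc * dZ β βc D Dc) *
    (Cst * Cstc) ^ (rhoZ ξ ξc β βc) * t ^ (rhoZ ξ ξc β βc)

def kappaZ (ξ ξc β βc D Dc : ℝ) : ℝ :=
  -((if β ≤ βc then D * ξ else 0) - (if βc ≤ β then Dc * ξc else 0)) /
    (dZ β βc D Dc * ξ * ξc)

/-! Tail conditions. -/

/-- The Hall-Welsh condition on a survival function `S = 1 - F`: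
`x ^ (1/ξ) * S x = Cst * (1 + D x ^ (-β)) + o(x ^ (-β))` as `x → ∞`. -/
structure HallWelsh (S : ℝ → ℝ) (ξ Cst D β : ℝ) : Prop where
  xi_pos : 0 < ξ
  cst_pos : 0 < Cst
  beta_pos : 0 < β
  expansion : (fun x : ℝ => x ^ (1 / ξ) * S x - Cst * (1 + D * x ^ (-β)))
    =o[atTop] fun x : ℝ => x ^ (-β)

/-- The differentiated Hall-Welsh expansion:
`S` is differentiable far out and `- x S'(x) / S(x) = 1/ξ + β D x ^ (-β) + o(x ^ (-β))`. -/
structure HallWelshDeriv (S : ℝ → ℝ) (ξ D β : ℝ) : Prop where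
  differentiable : ∀ᶠ x in atTop, DifferentiableAt ℝ S x
  expansion : (fun x : ℝ => -(x * deriv S x) / S x - (1 / ξ + β * D * x ^ (-β)))
    =o[atTop] fun x : ℝ => x ^ (-β)

/-! The censored sample: `z` lists the observed values, `e` the indicators, and a sample of
size `n` consists of the entries with indices `0, …, n - 1`. -/

/-- Index, in the sample, of the `m`-th smallest observation (`1 ≤ m ≤ n`);
ties are broken by the order of observation. -/
def orderIndex (z : ℕ → ℝ) (n m : ℕ) : ℕ :=
  if h : m - 1 < n then ((Tuple.sort (fun i : Fin n => z i)) ⟨m - 1, h⟩ : ℕ) else 0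

/-- The order statistic `Z_{m,n}` (`1 ≤ m ≤ n`). -/
def orderStat (z : ℕ → ℝ) (n m : ℕ) : ℝ := z (orderIndex z n m)

/-- The indicator `e_{m,n}` that belongs to `Z_{m,n}`. -/
def concomitant (z e : ℕ → ℝ) (n m : ℕ) : ℝ := e (orderIndex z n m)

/-- `p_k`, the fraction of non-censored data among the top `k` of `n` observations. -/
def topFraction (z e : ℕ → ℝ) (n k : ℕ) : ℝ :=
  (1 / (k : ℝ)) * ∑ i ∈ Finset.Icc 1 k, concomitant z e n (n - i + 1)

/-- The scaled log-spacing `V_j = j log (Z_{n-j+1,n} / Z_{n-j,n})`. -/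
def spacing (z : ℕ → ℝ) (n j : ℕ) : ℝ :=
  (j : ℝ) * Real.log (orderStat z n (n - j + 1) / orderStat z n (n - j))

/-- The kernel estimator `H_k^K`. -/
def kernelEstimator (K : ℝ → ℝ → ℝ) (z e : ℕ → ℝ) (n k : ℕ) : ℝ :=
  (1 / (k : ℝ)) * ∑ i ∈ Finset.Icc 1 k,
    K ((i : ℝ) / ((k : ℝ) + 1)) (topFraction z e n k) *
      (1 / Real.log (((k : ℝ) + 1) / i)) *
      Real.log (orderStat z n (n - i + 1) / orderStat z n (n - k))

/-- The observed values `Z_i = min(X_i, C_i)` at the outcome `ω`. -/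
def obsZ {Ω : Type u} (X C : ℕ → Ω → ℝ) (ω : Ω) (i : ℕ) : ℝ := min (X i ω) (C i ω)

open Classical in
/-- The indicators `e_i = 1{X_i ≤ C_i}` at the outcome `ω`. -/
def obsE {Ω : Type u} (X C : ℕ → Ω → ℝ) (ω : Ω) (i : ℕ) : ℝ := if X i ω ≤ C i ω then 1 else 0

/-! Kernels. -/

/-- The discrete associated kernel `K̃_k(j/(k+1), p)`. -/
def tildeKDisc (K : ℝ → ℝ → ℝ) (k j : ℕ) (p : ℝ) : ℝ :=
  (1 / ((j : ℝ) / ((k : ℝ) + 1))) * ((1 / ((k : ℝ) + 1)) * ∑ i ∈ Finset.Icc 1 j,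
    K ((i : ℝ) / ((k : ℝ) + 1)) p * (1 / Real.log (((k : ℝ) + 1) / i)))

/-- The associated kernel `K̃(u, p) = u⁻¹ ∫_0^u K(v, p) / log(1/v) dv`. -/
def tildeK (K : ℝ → ℝ → ℝ) (u p : ℝ) : ℝ :=
  (1 / u) * ∫ v in (0 : ℝ)..u, K v p / Real.log (1 / v)

/-- A (nonnegative) kernel with `∫_0^1 K(u, p) du = 1/p` for all `p` in `(0, 1]`. The right-hand
side is nonzero, so the identity includes the integrability of `K(·, p)`. -/
structure IsKernel (K : ℝ → ℝ → ℝ) : Prop where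
  nonneg : ∀ u ∈ Set.Ioo (0 : ℝ) 1, ∀ p ∈ Set.Ioc (0 : ℝ) 1, 0 ≤ K u p
  norming : ∀ p ∈ Set.Ioc (0 : ℝ) 1, ∫ u in (0 : ℝ)..1, K u p = 1 / p

/-- Regularity of a kernel near the parameter value `p`: `K(·, p)` is continuous on `(0, 1)`, `K` is
continuously differentiable in its second variable near `p`, and `K` and that derivative are
bounded, near `p`, by `φ(u) w(u)` with a nonincreasing `φ` such that `φ w` is integrable. -/
def KernelRegular (K : ℝ → ℝ → ℝ) (p : ℝ) (w : ℝ → ℝ) : Prop :=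
  ContinuousOn (fun u => K u p) (Set.Ioo 0 1) ∧
  ∃ δ > 0, ∃ φ : ℝ → ℝ, AntitoneOn φ (Set.Ioo 0 1) ∧
    IntegrableOn (fun u => φ u * w u) (Set.Ioo 0 1) ∧
    ContinuousOn (fun x : ℝ × ℝ => deriv (K x.1) x.2) (Set.Ioo 0 1 ×ˢ Set.Ioo (p - δ) (p + δ)) ∧
    ∀ u ∈ Set.Ioo (0 : ℝ) 1, ∀ q ∈ Set.Ioo (p - δ) (p + δ),
      DifferentiableAt ℝ (K u) q ∧ |K u q| ≤ φ u * w u ∧ |deriv (K u) q| ≤ φ u * w u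

end

/-! The top of the censored sample is turned into a sample of exponential variables carrying
independent marks. If `Z` had a continuous law, `-log P(Z > ·)` would send `Z_i` to a standard
exponential `y_i`. Far out, an observation is uncensored with probability close to `p`, so `e_i` is
nearly a mark `1{v_i ≤ p}` with `v_i` uniform and independent of `y_i`. For such pairs Rényi's
representation (`map_renyi`) does two things at once: the normalized spacings `E_j = j (Y_{n-j+1,n}
- Y_{n-j,n})` are i.i.d. exponential, and they are independent of the marks read in the order of the
`y_i`. The number of marks among the top `k` is therefore binomial and independent of the `E_j`; `N`
is a normal variable coupled to its standardization (`exists_gaussian_coupling`).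

Continuity is not assumed, and the conditional probability of `e = 1` given `Z` is not controlled
pointwise. Hence only the cells of a fine geometric grid around `t = (C C_c n / k)^{ξ_z}` are
matched: given the cell of `Z_i` and the indicator `e_i`, the pair `(y_i, v_i)` is redrawn
(`exists_redraw`, `exists_coupled_sample`) so that `y_i` lies in the corresponding cell and `e_i` is
the mark of level equal to the conditional probability of that cell. These levels are `p + o(1)` if
the cells are not too short compared with the bias `Q = Q_{0,z}(n/k)` (`eventually_cell`), and for
arbitrarily short cells if the tail expansions may be differentiated (`eventually_cell_of_deriv`).

Fraction of uncensored data (`smallP_topFraction`). The order of the `Z_i` is replaced by that of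
the `y_i`, which costs few ranks because only ranks inside one cell are confused. The marks of level
`p` give the normal term. The remaining differences of marks are summed beyond the image of `t`
instead of over the top `k`; this i.i.d. sum has mean `(n/k)(P(Z > t, X ≤ C) - p P(Z > t))` per top
observation, which is the bias term, and negligible variance since the two marks rarely differ.

Log-ratios (`exists_log_ratio_expansion`). Inverting the second order expansion of `P(Z > ·)` gives
`log(Z_{n-i+1,n}/Z_{n-k,n}) = ξ_z ∑ E_j/j + Q ∑ (j/(k+1))^{-ρ_z} E_j/j`, sums over `i ≤ j ≤ k`, up
to `o_p(|Q|)(∑ E_j/j + θ)`, where `θ` is the resolution of the grid. The second sum comes from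
telescoping exponentials of the order statistics. Dividing by `log((k+1)/i)` or `1` gives the
statement on the spacings.

Kernel estimators (`smallP_kernel_mean`). The kernel is linearized at `p`; the mean of its divided
differences tends to `∫ ∂_p K = (1/p)' = -1/p²`, which carries the expansion of `p_k` into that of
the estimator. Interchanging sums produces the associated kernels, and Riemann sums converge by
domination with an antitone integrable function. The term `θ` is multiplied by the mean of `K /
log(1/u)`: this is bounded in case (a), but can be of order `k` in case (b), where the
differentiated expansions allow `θ = 1/(k+1)`.

All remainders are `o_p(k^{-1/2} + |Q|)`. Since `1/N` is bounded in probability, such a remainder is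
a relative error of the normal term plus a relative error of the bias term (`SmallP.exists_split`).
-/

open scoped ENNReal
open Real (exp log rpow_pos_of_pos norm_eq_abs rpow_add log_div exp_pos exp_le_exp log_le_log
  exp_add exp_log add_one_le_exp rpow_mul log_exp sqrt_pos log_pos log_mul log_inv exp_neg
  rpow_le_rpow_of_nonpos one_le_exp exp_le_one_iff)
open Finset (Icc Ico mem_Icc range sum_le_sum sum_congr sum_sub_distrib sum_nonneg mul_sum
  mem_filter mem_range measurable_sum Ico_succ_right_eq_Icc sum_const)
open Set (Ioo Ioi Ioc Iic mem_ofPred_eq univ indicator indicator_of_mem mem_union uIcc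
  indicator_of_notMem)
open Filter.Eventually (of_forall)
open ENNReal (ofReal ofReal_le_ofReal half_pos add_halves)
open MeasureTheory.Measure (map_apply infinitePi map_prod_map prod_apply prod_prod
  isProbabilityMeasure_map)
open Tuple (sort)
open Function (uncurry)

noncomputable section

/-! ### Convergence to zero and boundedness in probability -/

section SmallBdd

variable {Ω : Type*} [MeasurableSpace Ω] {P : Measure Ω} {X Y Z : ℕ → Ω → ℝ}

/-- Convergence to zero in probability (no measurability is required). -/
def SmallP (P : Measure Ω) (X : ℕ → Ω → ℝ) : Prop :=
  ∀ δ : ℝ, 0 < δ → ∀ e : ℝ≥0∞, 0 < e → ∀ᶠ n in atTop, P {ω | δ ≤ |X n ω|} ≤ e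

/-- Boundedness in probability (no measurability is required). -/
def BddP (P : Measure Ω) (X : ℕ → Ω → ℝ) : Prop :=
  ∀ e : ℝ≥0∞, 0 < e → ∃ M : ℝ, 0 < M ∧ ∀ᶠ n in atTop, P {ω | M ≤ |X n ω|} ≤ e

theorem SmallP.tendstoInMeasure (h : SmallP P X) : TendstoInMeasure P X atTop (fun _ => 0) := by
  rw [tendstoInMeasure_iff_norm]
  intro ε hε
  rw [ENNReal.tendsto_nhds_zero]
  intro e he
  simpa using h ε hε e he

theorem measure_le_add_of_subset_union {A B C : Set Ω} {e₁ e₂ e : ℝ≥0∞} (h : A ⊆ B ∪ C)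
    (hB : P B ≤ e₁) (hC : P C ≤ e₂) (he : e₁ + e₂ ≤ e) : P A ≤ e :=
  (measure_mono h).trans ((measure_union_le B C).trans ((add_le_add hB hC).trans he))

/-- Domination is needed only off events of vanishing probability; the later estimates are made on
such good events, and no measurability is asked for. -/
theorem SmallP.of_le_off {B : ℕ → Set Ω} (hY : SmallP P Y)
    (hB : Tendsto (fun n => P (B n)) atTop (𝓝 0))
    (h : ∀ᶠ n in atTop, ∀ᵐ ω ∂P, ω ∉ B n → |X n ω| ≤ |Y n ω|) : SmallP P X := by
  intro δ hδ e he
  have he2 : 0 < e / 2 := half_pos he.ne'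
  filter_upwards [hY δ hδ _ he2, ENNReal.tendsto_nhds_zero.1 hB _ he2, h] with n h1 h2 h3
  have h4 : P {ω | δ ≤ |X n ω|} ≤ P ({ω | δ ≤ |Y n ω|} ∪ B n) := by
    apply measure_mono_ae
    filter_upwards [h3] with ω hω hx
    by_cases hb : ω ∈ B n
    · exact Or.inr hb
    · exact Or.inl (le_trans (show δ ≤ |X n ω| from hx) (hω hb))
  exact h4.trans ((measure_union_le _ _).trans ((add_le_add h1 h2).trans (add_halves e).le))

theorem SmallP.of_le (hY : SmallP P Y)
    (h : ∀ᶠ n in atTop, ∀ᵐ ω ∂P, |X n ω| ≤ |Y n ω|) : SmallP P X :=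
  hY.of_le_off (B := fun _ => ∅) (by simp) (by grind)

theorem BddP.of_le_off {B : ℕ → Set Ω} (hY : BddP P Y) (hB : Tendsto (fun n => P (B n)) atTop (𝓝 0))
    (h : ∀ᶠ n in atTop, ∀ᵐ ω ∂P, ω ∉ B n → |X n ω| ≤ |Y n ω|) : BddP P X := by
  intro e he
  have he2 : 0 < e / 2 := half_pos he.ne'
  obtain ⟨M, hM, hY⟩ := hY _ he2
  refine ⟨M, hM, ?_⟩
  filter_upwards [hY, ENNReal.tendsto_nhds_zero.1 hB _ he2, h] with n h1 h2 h3
  have h4 : P {ω | M ≤ |X n ω|} ≤ P ({ω | M ≤ |Y n ω|} ∪ B n) := by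
    apply measure_mono_ae
    filter_upwards [h3] with ω hω hx
    by_cases hb : ω ∈ B n
    · exact Or.inr hb
    · exact Or.inl (le_trans (show M ≤ |X n ω| from hx) (hω hb))
  exact h4.trans ((measure_union_le _ _).trans ((add_le_add h1 h2).trans (add_halves e).le))

theorem BddP.of_le (hY : BddP P Y) (h : ∀ᶠ n in atTop, ∀ᵐ ω ∂P, |X n ω| ≤ |Y n ω|) : BddP P X :=
  hY.of_le_off (B := fun _ => ∅) (by simp) (by grind)

theorem SmallP.bddP (h : SmallP P X) : BddP P X := fun e he => ⟨1, one_pos, h 1 one_pos e he⟩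

theorem SmallP.add (hX : SmallP P X) (hY : SmallP P Y) : SmallP P (fun n ω => X n ω + Y n ω) := by
  intro δ hδ e he
  have he2 : 0 < e / 2 := half_pos he.ne'
  filter_upwards [hX (δ / 2) (by positivity) _ he2, hY (δ / 2) (by positivity) _ he2] with n h1 h2
  refine measure_le_add_of_subset_union ?_ h1 h2 (add_halves e).le
  intro ω hω
  by_contra hcon
  simp only [mem_union, mem_ofPred_eq, not_or, not_le] at hcon hω
  grind

theorem BddP.add (hX : BddP P X) (hY : BddP P Y) : BddP P (fun n ω => X n ω + Y n ω) := by
  intro e he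
  have he2 : 0 < e / 2 := half_pos he.ne'
  obtain ⟨M, hM, hX⟩ := hX _ he2
  obtain ⟨M', hM', hY⟩ := hY _ he2
  refine ⟨M + M', by positivity, ?_⟩
  filter_upwards [hX, hY] with n h1 h2
  refine measure_le_add_of_subset_union ?_ h1 h2 (add_halves e).le
  intro ω hω
  by_contra hcon
  simp only [mem_union, mem_ofPred_eq, not_or, not_le] at hcon hω
  grind

theorem SmallP.mul_bddP (hX : SmallP P X) (hY : BddP P Y) :
    SmallP P (fun n ω => X n ω * Y n ω) := by
  intro δ hδ e he
  have he2 : 0 < e / 2 := half_pos he.ne'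
  obtain ⟨M, hM, hY⟩ := hY _ he2
  filter_upwards [hX (δ / M) (by positivity) _ he2, hY] with n h1 h2
  refine measure_le_add_of_subset_union ?_ h1 h2 (add_halves e).le
  intro ω hω
  by_contra hcon
  simp only [mem_union, mem_ofPred_eq, not_or, not_le, abs_mul] at hcon hω
  have h3 : |X n ω| * |Y n ω| ≤ |X n ω| * M := mul_le_mul_of_nonneg_left hcon.2.le (abs_nonneg _)
  have h4 : |X n ω| * M < δ := by rw [← lt_div_iff₀ hM]; exact hcon.1
  linarith

theorem BddP.mul (hX : BddP P X) (hY : BddP P Y) : BddP P (fun n ω => X n ω * Y n ω) := by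
  intro e he
  have he2 : 0 < e / 2 := half_pos he.ne'
  obtain ⟨M, hM, hX⟩ := hX _ he2
  obtain ⟨M', hM', hY⟩ := hY _ he2
  refine ⟨M * M', by positivity, ?_⟩
  filter_upwards [hX, hY] with n h1 h2
  refine measure_le_add_of_subset_union ?_ h1 h2 (add_halves e).le
  intro ω hω
  by_contra hcon
  simp only [mem_union, mem_ofPred_eq, not_or, not_le, abs_mul] at hcon hω
  have := mul_lt_mul'' hcon.1 hcon.2 (abs_nonneg _) (abs_nonneg _)
  linarith

theorem bddP_of_bounded {a : ℕ → ℝ} (C : ℝ) (ha : ∀ᶠ n in atTop, |a n| ≤ C) :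
    BddP P (fun n _ => a n) := by
  intro e _
  refine ⟨|C| + 1, by positivity, ?_⟩
  filter_upwards [ha] with n hn
  have : {ω : Ω | |C| + 1 ≤ |a n|} = ∅ := by grind
  simp [this]

theorem bddP_const (c : ℝ) : BddP P (fun _ _ => c) := bddP_of_bounded |c| (by simp)

theorem smallP_of_tendsto {a : ℕ → ℝ} (ha : Tendsto a atTop (𝓝 0)) : SmallP P (fun n _ => a n) := by
  intro δ hδ e _
  filter_upwards [(tendsto_zero_iff_abs_tendsto_zero _).1 ha |>.eventually (gt_mem_nhds hδ)]
    with n hn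
  have : {ω : Ω | δ ≤ |a n|} = ∅ := by ext ω; simpa using hn
  simp [this]

theorem SmallP.const_mul (hX : SmallP P X) (c : ℝ) : SmallP P (fun n ω => c * X n ω) := by
  have := hX.mul_bddP (bddP_const (P := P) c)
  grind

theorem SmallP.neg (hX : SmallP P X) : SmallP P (fun n ω => -X n ω) := hX.of_le (by simp)

theorem SmallP.sub (hX : SmallP P X) (hY : SmallP P Y) : SmallP P (fun n ω => X n ω - Y n ω) := by
  simpa [sub_eq_add_neg] using hX.add hY.neg

theorem SmallP.abs (hX : SmallP P X) : SmallP P (fun n ω => |X n ω|) := hX.of_le (by simp)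

theorem BddP.abs (hX : BddP P X) : BddP P (fun n ω => |X n ω|) := hX.of_le (by simp)

theorem BddP.const_mul (hX : BddP P X) (c : ℝ) : BddP P (fun n ω => c * X n ω) :=
  (bddP_const c).mul hX

theorem measure_abs_ge_le_of_integral_le [IsProbabilityMeasure P] {f : Ω → ℝ} (hf : Integrable f P)
    {δ C : ℝ} (hδ : 0 < δ) (hC : ∫ ω, |f ω| ∂P ≤ C) :
    P {ω | δ ≤ |f ω|} ≤ ofReal (C / δ) := by
  have h := mul_meas_ge_le_integral_of_nonneg (μ := P) (f := fun ω => |f ω|)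
    (ae_of_all _ fun ω => abs_nonneg _) hf.abs δ
  rw [← ENNReal.ofReal_toReal (measure_ne_top P {ω | δ ≤ |f ω|})]
  apply ofReal_le_ofReal
  rw [le_div_iff₀ hδ]
  simp only [Measure.real] at h
  linarith

theorem eventually_ofReal_le {a : ℕ → ℝ} (ha : Tendsto a atTop (𝓝 0)) {e : ℝ≥0∞} (he : 0 < e) :
    ∀ᶠ n in atTop, ofReal (a n) ≤ e := by
  have : Tendsto (fun n => ofReal (a n)) atTop (𝓝 0) := by simpa using ENNReal.tendsto_ofReal ha
  exact ENNReal.tendsto_nhds_zero.1 this e he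

theorem smallP_of_integral_abs [IsProbabilityMeasure P] {a : ℕ → ℝ}
    (hX : ∀ᶠ n in atTop, Integrable (X n) P) (ha : Tendsto a atTop (𝓝 0))
    (h : ∀ᶠ n in atTop, ∫ ω, |X n ω| ∂P ≤ a n) : SmallP P X := by
  intro δ hδ e he
  have h0 : Tendsto (fun n => a n / δ) atTop (𝓝 0) := by simpa using ha.div_const δ
  filter_upwards [hX, h, eventually_ofReal_le h0 he] with n h1 h2 h3
  exact (measure_abs_ge_le_of_integral_le h1 hδ h2).trans h3

theorem exists_ofReal_div_le (C : ℝ) {e : ℝ≥0∞} (he : 0 < e) :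
    ∃ M : ℝ, 1 ≤ M ∧ ofReal (C / M) ≤ e := by
  have h : Tendsto (fun n : ℕ => C / (n : ℝ)) atTop (𝓝 0) := tendsto_const_div_atTop_nhds_zero_nat C
  obtain ⟨n, hn, hn1⟩ := ((eventually_ofReal_le h he).and (eventually_ge_atTop 1)).exists
  exact ⟨n, by exact_mod_cast hn1, hn⟩

theorem bddP_of_integral_abs [IsProbabilityMeasure P] (C : ℝ)
    (hX : ∀ᶠ n in atTop, Integrable (X n) P)
    (h : ∀ᶠ n in atTop, ∫ ω, |X n ω| ∂P ≤ C) : BddP P X := by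
  intro e he
  obtain ⟨M, hM, hMe⟩ := exists_ofReal_div_le C he
  refine ⟨M, by linarith, ?_⟩
  filter_upwards [hX, h] with n h1 h2
  exact (measure_abs_ge_le_of_integral_le h1 (by linarith) h2).trans hMe

theorem measure_abs_ge_le_of_sq_integral_le [IsProbabilityMeasure P] {f : Ω → ℝ}
    (hf : MemLp f 2 P) {δ C : ℝ} (hδ : 0 < δ) (hC : ∫ ω, f ω ^ 2 ∂P ≤ C) :
    P {ω | δ ≤ |f ω|} ≤ ofReal (C / δ ^ 2) := by
  have h := measure_abs_ge_le_of_integral_le (P := P) (f := fun ω => f ω ^ 2) hf.integrable_sq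
    (δ := δ ^ 2) (C := C) (by positivity) (by simpa using hC)
  refine le_trans (measure_mono ?_) h
  intro ω hω
  simp only [mem_ofPred_eq, abs_pow] at hω ⊢
  gcongr

theorem smallP_of_sq_integral [IsProbabilityMeasure P] {a : ℕ → ℝ}
    (hX : ∀ᶠ n in atTop, MemLp (X n) 2 P) (ha : Tendsto a atTop (𝓝 0))
    (h : ∀ᶠ n in atTop, ∫ ω, X n ω ^ 2 ∂P ≤ a n) : SmallP P X := by
  intro δ hδ e he
  have h0 : Tendsto (fun n => a n / δ ^ 2) atTop (𝓝 0) := by simpa using ha.div_const (δ ^ 2)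
  filter_upwards [hX, h, eventually_ofReal_le h0 he] with n h1 h2 h3
  exact (measure_abs_ge_le_of_sq_integral_le h1 hδ h2).trans h3

/-- The function varies with `n`, so a limit along `atTop ×ˢ 𝓝 c` is required: it yields one
neighbourhood of `c` that serves all large `n`. -/
theorem SmallP.comp_of_tendsto {g : ℕ → ℝ → ℝ} {c : ℝ} (hX : SmallP P (fun n ω => X n ω - c))
    (hg : Tendsto (fun x : ℕ × ℝ => g x.1 x.2) (atTop ×ˢ 𝓝 c) (𝓝 0)) :
    SmallP P (fun n ω => g n (X n ω)) := by
  intro δ hδ e he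
  have h1 := (tendsto_zero_iff_abs_tendsto_zero _).1 hg |>.eventually (gt_mem_nhds hδ)
  rw [eventually_prod_iff] at h1
  obtain ⟨pa, hpa, pb, hpb, h⟩ := h1
  obtain ⟨η, hη, hball⟩ := Metric.eventually_nhds_iff.1 hpb
  filter_upwards [hpa, hX η hη e he] with n hn hn2
  refine (measure_mono ?_).trans hn2
  intro ω hω
  by_contra hcon
  simp only [mem_ofPred_eq, not_le] at hcon
  have := h hn (hball (by rwa [Real.dist_eq]))
  grind

end SmallBdd

/-- A diagonal choice of thresholds. -/
theorem exists_tendsto_zero_of_forall_eventually {Q : ℕ → ℝ → Prop}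
    (h : ∀ ε > 0, ∀ᶠ n in atTop, Q n ε) :
    ∃ ε : ℕ → ℝ, (∀ n, 0 < ε n) ∧ Tendsto ε atTop (𝓝 0) ∧ ∀ᶠ n in atTop, Q n (ε n) := by
  have h1 : ∀ m : ℕ, ∃ N, ∀ n ≥ N, Q n (1 / ((m : ℝ) + 1)) := fun m =>
    eventually_atTop.1 (h _ (by positivity))
  choose N hN using h1
  classical
  -- The accuracy at `n` is the finest one whose starting point has been passed; the bound `n` on
  -- the search makes the maximum exist.
  let m : ℕ → ℕ := fun n => Nat.findGreatest (fun j => N j ≤ n) n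
  have hm : Tendsto m atTop atTop := by
    rw [tendsto_atTop]
    intro b
    filter_upwards [eventually_ge_atTop (max b (N b))] with n hn
    exact Nat.le_findGreatest (le_trans (le_max_left _ _) hn) (le_trans (le_max_right _ _) hn)
  refine ⟨fun n => 1 / ((m n : ℝ) + 1), fun n => by positivity,
    tendsto_one_div_add_atTop_nhds_zero_nat.comp hm, ?_⟩
  filter_upwards [eventually_ge_atTop (N 0)] with n hn
  exact hN _ _ (Nat.findGreatest_spec (P := fun j => N j ≤ n) (Nat.zero_le n) hn)

/-! ### Kolmogorov's maximal inequality and sums of independent exponential variables -/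

section Kolmogorov

variable {Ω : Type*} [MeasurableSpace Ω] {P : Measure Ω} {X : ℕ → Ω → ℝ}

theorem integral_sq_sum_of_iIndepFun [IsProbabilityMeasure P] {ι : Type*} {X : ι → Ω → ℝ}
    (hi : iIndepFun X P) (h2 : ∀ i, MemLp (X i) 2 P) (h0 : ∀ i, ∫ ω, X i ω ∂P = 0)
    (s : Finset ι) :
    ∫ ω, (∑ i ∈ s, X i ω) ^ 2 ∂P = ∑ i ∈ s, ∫ ω, X i ω ^ 2 ∂P := by
  have hmem : MemLp (fun ω => ∑ i ∈ s, X i ω) 2 P := memLp_finsetSum s fun i _ => h2 i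
  have hmean : ∫ ω, ∑ i ∈ s, X i ω ∂P = 0 := by
    rw [integral_finsetSum s fun i _ => (h2 i).integrable one_le_two]
    simp_all
  have h := IndepFun.variance_sum (μ := P) (X := X) (s := s) (fun i _ => h2 i)
    (fun i _ j _ hij => hi.indepFun hij)
  have e1 : ∑ i ∈ s, X i = fun ω => ∑ i ∈ s, X i ω := by ext ω; simp
  rw [e1, variance_of_integral_eq_zero hmem.aemeasurable hmean] at h
  rw [h]
  exact sum_congr rfl fun i _ =>
    variance_of_integral_eq_zero (h2 i).aemeasurable (h0 i)

/-- Kolmogorov's argument run backwards: decompose by the last index `i` at which the tail sum is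
large. That event and the tail sum from `i` depend on the variables from `i` on, so the remaining
part `R` of the full sum is centred and orthogonal to them, and `S_m² ≥ S_i² + 2 S_i R` integrates
to the bound. -/
theorem kolmogorov_tail_ineq [IsProbabilityMeasure P] (hm : ∀ i, Measurable (X i))
    (hi : iIndepFun X P) (h2 : ∀ i, MemLp (X i) 2 P) (h0 : ∀ i, ∫ ω, X i ω ∂P = 0)
    (m k : ℕ) {x : ℝ} (hx : 0 < x) :
    P {ω | ∃ i ∈ Icc m k, x ≤ |∑ j ∈ Icc i k, X j ω|} ≤
      ofReal ((∑ j ∈ Icc m k, ∫ ω, X j ω ^ 2 ∂P) / x ^ 2) := by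
  classical
  set S : ℕ → Ω → ℝ := fun i ω => ∑ j ∈ Icc i k, X j ω with hS
  have hSm : ∀ i, Measurable (S i) := fun i => measurable_sum _ fun j _ => hm j
  have hS2 : ∀ i, MemLp (S i) 2 P := fun i => memLp_finsetSum _ fun j _ => h2 j
  let A : ℕ → Set Ω := fun i => {ω | x ≤ |S i ω| ∧ ∀ l ∈ Finset.Ioc i k, |S l ω| < x}
  have hAm : ∀ i, MeasurableSet (A i) := by
    intro i
    have e : A i = {ω | x ≤ |S i ω|} ∩ ⋂ l ∈ Finset.Ioc i k, {ω | |S l ω| < x} := by ext ω; simp [A]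
    rw [e]
    refine (measurableSet_le measurable_const (hSm i).abs).inter ?_
    exact Finset.measurableSet_biInter _ fun l _ => measurableSet_lt (hSm l).abs measurable_const
  have hsub : {ω | ∃ i ∈ Icc m k, x ≤ |S i ω|} ⊆ ⋃ i ∈ Icc m k, A i := by
    rintro ω ⟨i, hi1, hi2⟩
    let F := (Icc m k).filter fun i => x ≤ |S i ω|
    have hF : F.Nonempty := ⟨i, by simp [F, hi1, hi2]⟩
    have hmax := F.max'_mem hF
    simp only [F, mem_filter] at hmax
    simp only [Set.mem_iUnion]
    refine ⟨F.max' hF, hmax.1, hmax.2, fun l hl => ?_⟩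
    by_contra hcon
    have : l ∈ F := by grind
    have := F.le_max' l this
    grind
  have hdisj : Set.Pairwise (↑(Icc m k)) (Function.onFun Disjoint A) := by
    intro i hi j hj hij
    grind
  have hkey : ∀ i ∈ Icc m k, x ^ 2 * P.real (A i) ≤ ∫ ω in A i, S m ω ^ 2 ∂P := by
    intro i hik
    rw [mem_Icc] at hik
    let R : Ω → ℝ := fun ω => ∑ j ∈ Ico m i, X j ω
    have hR2 : MemLp R 2 P := memLp_finsetSum _ fun j _ => h2 j
    have hdec : ∀ ω, S m ω = R ω + S i ω := by
      intro ω
      simp only [hS, R]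
      rw [← Finset.sum_union]
      · congr 1; ext a; simp; omega
      · rw [Finset.disjoint_left]; intro a; simp; omega
    -- Extension by zero exhibits the indicator of `A i` times `S i` as a measurable function of the
    -- coordinates in `Icc i k` alone; `R` uses only those in `Ico m i`.
    let ext : (↥(Icc i k) → ℝ) → ℕ → ℝ := fun g j => if h : j ∈ Icc i k then g ⟨j, h⟩ else 0
    have hext : ∀ j, Measurable fun g => ext g j := by
      intro j
      by_cases h : j ∈ Icc i k
      · simp only [ext, h, dif_pos]; exact measurable_pi_apply _
      · simp only [ext, h, dif_neg, not_false_eq_true]; exact measurable_const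
    let Sg : (↥(Icc i k) → ℝ) → ℕ → ℝ := fun g l => ∑ j ∈ Icc l k, ext g j
    have hSg : ∀ l, Measurable fun g => Sg g l := fun l =>
      measurable_sum _ fun j _ => hext j
    let Bs : Set (↥(Icc i k) → ℝ) := {g | x ≤ |Sg g i|} ∩ ⋂ l ∈ Finset.Ioc i k, {g | |Sg g l| < x}
    have hBs : MeasurableSet Bs := (measurableSet_le measurable_const (hSg i).abs).inter
      (Finset.measurableSet_biInter _ fun l _ => measurableSet_lt (hSg l).abs measurable_const)
    let φ : (↥(Icc i k) → ℝ) → ℝ := Bs.indicator fun g => Sg g i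
    let ψ : (↥(Ico m i) → ℝ) → ℝ := fun g => ∑ j, g j
    have hSgS : ∀ ω l, i ≤ l → Sg (fun j => X j ω) l = S l ω := by
      intro ω l hl
      simp only [Sg, hS]
      refine sum_congr rfl fun j hj => ?_
      grind
    have hφ : (fun ω => φ fun j => X j ω) = (A i).indicator (S i) := by
      ext ω
      have : ((fun j : ↥(Icc i k) => X j ω) ∈ Bs) ↔ ω ∈ A i := by
        simp only [Bs, A, Set.mem_inter_iff, Set.mem_iInter, mem_ofPred_eq, hSgS ω i le_rfl]
        refine and_congr_right fun _ => forall₂_congr fun l hl => ?_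
        rw [hSgS ω l (by grind)]
      by_cases hA : ω ∈ A i
      · rw [indicator_of_mem hA, ← hSgS ω i le_rfl]
        exact indicator_of_mem (this.2 hA) _
      · rw [indicator_of_notMem hA]
        exact indicator_of_notMem (fun hc => hA (this.1 hc)) _
    have hψ : (fun ω => ψ fun j => X j ω) = R := by
      ext ω
      simp only [ψ, R]
      exact Finset.sum_coe_sort (Ico m i) fun j => X j ω
    have hind : IndepFun ((A i).indicator (S i)) R P := by
      have := hi.indepFun_finset (Icc i k) (Ico m i)
        (by rw [Finset.disjoint_left]; intro a; simp; omega) hm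
      have := this.comp (φ := φ) (ψ := ψ) ((hSg i).indicator hBs)
        (measurable_sum _ fun j _ => measurable_pi_apply j)
      simpa only [Function.comp_def, hφ, hψ] using this
    have hcross : ∫ ω, (A i).indicator (S i) ω * R ω ∂P = 0 := by
      rw [hind.integral_fun_mul_eq_mul_integral ((hSm i).indicator (hAm i)).aestronglyMeasurable
        hR2.aestronglyMeasurable]
      have : ∫ ω, R ω ∂P = 0 := by
        rw [integral_finsetSum _ fun i _ => (h2 i).integrable one_le_two]
        simp_all
      rw [this, mul_zero]
    have hcross' : ∫ ω in A i, S i ω * R ω ∂P = 0 := by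
      rw [← hcross, ← integral_indicator (hAm i)]
      congr 1; ext ω
      by_cases h : ω ∈ A i <;> simp [h]
    have hint1 : Integrable (fun ω => S i ω * R ω) P := (hS2 i).integrable_mul hR2
    calc x ^ 2 * P.real (A i) = ∫ ω in A i, x ^ 2 ∂P := by
          rw [setIntegral_const, smul_eq_mul, mul_comm]
      _ ≤ ∫ ω in A i, S i ω ^ 2 ∂P := by
          refine setIntegral_mono_on (integrable_const _).integrableOn
            (hS2 i).integrable_sq.integrableOn (hAm i) fun ω hω => ?_
          rw [← sq_abs (S i ω)]
          exact pow_le_pow_left₀ hx.le hω.1 2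
      _ = ∫ ω in A i, (S i ω ^ 2 + 2 * (S i ω * R ω)) ∂P := by
          rw [integral_add (hS2 i).integrable_sq.integrableOn (hint1.const_mul 2).integrableOn,
            integral_const_mul, hcross']
          simp
      _ ≤ ∫ ω in A i, S m ω ^ 2 ∂P := by
          refine setIntegral_mono ((hS2 i).integrable_sq.add (hint1.const_mul 2)).integrableOn
            (hS2 m).integrable_sq.integrableOn fun ω => ?_
          simp only [hdec ω]
          nlinarith [sq_nonneg (R ω)]
  have hsum : x ^ 2 * P.real (⋃ i ∈ Icc m k, A i) ≤ ∫ ω, S m ω ^ 2 ∂P := by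
    rw [measureReal_biUnion_finset hdisj fun i _ => hAm i, mul_sum]
    refine (sum_le_sum hkey).trans ?_
    rw [← integral_biUnion_finset _ (fun i _ => hAm i) hdisj
      fun i _ => (hS2 m).integrable_sq.integrableOn]
    exact setIntegral_le_integral (hS2 m).integrable_sq (ae_of_all _ fun ω => sq_nonneg _)
  rw [integral_sq_sum_of_iIndepFun hi h2 h0] at hsum
  refine (measure_mono hsub).trans ?_
  rw [← ENNReal.ofReal_toReal (measure_ne_top P (⋃ i ∈ Icc m k, A i))]
  apply ofReal_le_ofReal
  rw [le_div_iff₀ (by positivity)]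
  simp only [Measure.real] at hsum
  linarith

end Kolmogorov

section Exponential

theorem integral_pow_expMeasure (n : ℕ) : Integrable (fun x : ℝ => x ^ n) (expMeasure 1) ∧
      ∫ x, x ^ n ∂(expMeasure 1) = (n.factorial : ℝ) := by
  have hm : Measurable (gammaPDF 1 1) := (measurable_gammaPDFReal 1 1).ennreal_ofReal
  have e : ∀ x : ℝ, (gammaPDF 1 1 x).toReal • x ^ n =
      (Set.Ici (0 : ℝ)).indicator (fun x => exp (-x) * x ^ ((n : ℝ) + 1 - 1)) x := by
    intro x
    rw [gammaPDF, ENNReal.toReal_ofReal (gammaPDFReal_nonneg one_pos one_pos x), gammaPDFReal]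
    by_cases hx : 0 ≤ x
    · simp [hx]
    · simp [hx]
  have hint : IntegrableOn (fun x => exp (-x) * x ^ ((n : ℝ) + 1 - 1)) (Set.Ici 0) := by
    rw [integrableOn_Ici_iff_integrableOn_Ioi]
    exact Real.GammaIntegral_convergent (by positivity)
  constructor
  · rw [expMeasure, gammaMeasure, integrable_withDensity_iff_integrable_smul' hm
      (ae_of_all _ fun x => by simp [gammaPDF])]
    simp_rw [e]
    rwa [integrable_indicator_iff measurableSet_Ici]
  · rw [expMeasure, gammaMeasure, integral_withDensity_eq_integral_toReal_smul hm
      (ae_of_all _ fun x => by simp [gammaPDF])]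
    simp_rw [e]
    rw [integral_indicator measurableSet_Ici, integral_Ici_eq_integral_Ioi,
      ← Real.Gamma_eq_integral (by positivity), Real.Gamma_nat_eq_factorial]

instance : IsProbabilityMeasure (expMeasure 1) := isProbabilityMeasure_expMeasure one_pos

theorem ae_pos_expMeasure : ∀ᵐ x ∂(expMeasure 1), 0 < x := by
  rw [ae_iff]
  have : {x : ℝ | ¬ 0 < x} = Iic 0 := by ext x; simp
  rw [this, ← ofReal_cdf, cdf_expMeasure_eq one_pos]
  simp

variable {Ω : Type*} [MeasurableSpace Ω] {P : Measure Ω}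

/-- An i.i.d. sequence of standard exponential variables. -/
structure IsIidExp (P : Measure Ω) (E : ℕ → Ω → ℝ) : Prop where
  meas : ∀ j, Measurable (E j)
  law : ∀ j, P.map (E j) = expMeasure 1
  indep : iIndepFun E P

namespace IsIidExp

variable {E : ℕ → Ω → ℝ}

theorem isProb (h : IsIidExp P E) : IsProbabilityMeasure P := by
  constructor
  have := congrArg (fun μ => μ univ) (h.law 0)
  simpa [map_apply (h.meas 0) MeasurableSet.univ] using this

theorem ae_pos (h : IsIidExp P E) (j : ℕ) : ∀ᵐ ω ∂P, 0 < E j ω := by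
  have := ae_pos_expMeasure
  rw [← h.law j] at this
  exact ae_of_ae_map (h.meas j).aemeasurable this

theorem ae_forall_pos (h : IsIidExp P E) : ∀ᵐ ω ∂P, ∀ j, 0 < E j ω := ae_all_iff.2 h.ae_pos

theorem integrable_pow (h : IsIidExp P E) (j n : ℕ) : Integrable (fun ω => E j ω ^ n) P := by
  have h1 := (integral_pow_expMeasure n).1
  rw [← h.law j] at h1
  exact h1.comp_measurable (h.meas j)

theorem integral_pow (h : IsIidExp P E) (j n : ℕ) : ∫ ω, E j ω ^ n ∂P = (n.factorial : ℝ) := by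
  have h1 := (integral_pow_expMeasure n).2
  rw [← h.law j, integral_map (h.meas j).aemeasurable (by fun_prop)] at h1
  exact h1

theorem integrable (h : IsIidExp P E) (j : ℕ) : Integrable (E j) P := by
  simpa using h.integrable_pow j 1

theorem integral_eq (h : IsIidExp P E) (j : ℕ) : ∫ ω, E j ω ∂P = 1 := by
  simpa using h.integral_pow j 1

theorem memLp (h : IsIidExp P E) (j : ℕ) : MemLp (E j) 2 P :=
  (memLp_two_iff_integrable_sq (h.meas j).aestronglyMeasurable).2 (h.integrable_pow j 2)

theorem memLp_centered (h : IsIidExp P E) (a : ℝ) (j : ℕ) :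
    MemLp (fun ω => a * (E j ω - 1)) 2 P :=
  have := h.isProb
  ((h.memLp j).sub (memLp_const 1)).const_mul a

theorem integral_centered (h : IsIidExp P E) (a : ℝ) (j : ℕ) : ∫ ω, a * (E j ω - 1) ∂P = 0 := by
  have := h.isProb
  rw [integral_const_mul, integral_sub (h.integrable j) (integrable_const _), h.integral_eq]
  simp

theorem integral_sq_centered (h : IsIidExp P E) (a : ℝ) (j : ℕ) :
    ∫ ω, (a * (E j ω - 1)) ^ 2 ∂P = a ^ 2 := by
  have := h.isProb
  have e : ∀ ω, (a * (E j ω - 1)) ^ 2 = a ^ 2 * (E j ω ^ 2 - 2 * E j ω + 1) := fun ω => by ring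
  simp_rw [e]
  rw [integral_const_mul, integral_add _ (integrable_const _), integral_sub (h.integrable_pow j 2),
    integral_const_mul, h.integral_pow, h.integral_eq]
  · simp [Nat.factorial]
  · exact (h.integrable j).const_mul 2
  · exact (h.integrable_pow j 2).sub ((h.integrable j).const_mul 2)

theorem indep_centered (h : IsIidExp P E) (a : ℕ → ℝ) :
    iIndepFun (fun j ω => a j * (E j ω - 1)) P :=
  h.indep.comp (fun j x => a j * (x - 1)) fun j => by fun_prop

theorem integral_sq_sum (h : IsIidExp P E) (a : ℕ → ℝ) (s : Finset ℕ) :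
    ∫ ω, (∑ j ∈ s, a j * (E j ω - 1)) ^ 2 ∂P = ∑ j ∈ s, a j ^ 2 := by
  have := h.isProb
  rw [integral_sq_sum_of_iIndepFun (h.indep_centered a) (fun j => h.memLp_centered (a j) j)
    fun j => h.integral_centered (a j) j]
  exact sum_congr rfl fun j _ => h.integral_sq_centered (a j) j

theorem memLp_sum (h : IsIidExp P E) (a : ℕ → ℝ) (s : Finset ℕ) :
    MemLp (fun ω => ∑ j ∈ s, a j * (E j ω - 1)) 2 P :=
  memLp_finsetSum _ fun j _ => h.memLp_centered (a j) j

theorem maximal_ineq (h : IsIidExp P E) (a : ℕ → ℝ) (m k : ℕ) {x : ℝ} (hx : 0 < x) :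
    P {ω | ∃ i ∈ Icc m k, x ≤ |∑ j ∈ Icc i k, a j * (E j ω - 1)|} ≤
      ofReal ((∑ j ∈ Icc m k, a j ^ 2) / x ^ 2) := by
  have := h.isProb
  have := kolmogorov_tail_ineq (P := P) (X := fun j ω => a j * (E j ω - 1))
    (fun j => ((h.meas j).sub_const 1).const_mul (a j)) (h.indep_centered a)
    (fun j => h.memLp_centered (a j) j) (fun j => h.integral_centered (a j) j) m k hx
  simpa only [h.integral_sq_centered] using this

/-- Nonnegativity of a variance is `E|f| ≤ √(E f²)`, and independence makes the second moment a sum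
of squares. -/
theorem integral_abs_sum_le (h : IsIidExp P E) (a : ℕ → ℝ) (s : Finset ℕ) :
    ∫ ω, |∑ j ∈ s, a j * (E j ω - 1)| ∂P ≤ √(∑ j ∈ s, a j ^ 2) := by
  have := h.isProb
  set f : Ω → ℝ := fun ω => |∑ j ∈ s, a j * (E j ω - 1)| with hf
  have hf2 : MemLp f 2 P := (h.memLp_sum a s).norm
  apply Real.le_sqrt_of_sq_le
  have hv := variance_nonneg f P
  rw [variance_eq_sub hf2] at hv
  have e : ∫ ω, (f ^ 2) ω ∂P = ∑ j ∈ s, a j ^ 2 := by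
    rw [← h.integral_sq_sum]
    congr 1; ext ω; simp [f]
  linarith

end IsIidExp

end Exponential

/-! ### Harmonic sums and tail sums `∑_{j=i}^k E_j / j` -/

section Harmonic

def harmTail (k i : ℕ) : ℝ := ∑ j ∈ Icc i k, (1 : ℝ) / j

/-- The deterministic profile of the tail sums, that is `log(1/u)` at the node `u = i/(k+1)`. -/
def logW (k i : ℕ) : ℝ := log (((k : ℝ) + 1) / i)

theorem sum_Icc_eq_add_succ {f : ℕ → ℝ} {i k : ℕ} (h : i ≤ k) :
    ∑ j ∈ Icc i k, f j = f i + ∑ j ∈ Icc (i + 1) k, f j := by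
  rw [← Finset.insert_Icc_add_one_left_eq_Icc h, Finset.sum_insert (by simp)]

theorem sum_Icc_telescope (f : ℕ → ℝ) {i k : ℕ} (h : i ≤ k + 1) :
    ∑ j ∈ Icc i k, (f (j + 1) - f j) = f (k + 1) - f i := by
  obtain ⟨d, hd⟩ : ∃ d, k + 1 = i + d := ⟨k + 1 - i, by omega⟩
  induction d generalizing i with
  | zero =>
    rw [Finset.Icc_eq_empty (by omega)]
    simp [hd]
  | succ d ih =>
    rw [sum_Icc_eq_add_succ (by omega), ih (i := i + 1) (by omega) (by omega)]
    ring

theorem logW_eq {k i : ℕ} (hi : 1 ≤ i) : logW k i = log ((k : ℝ) + 1) - log i := by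
  have : (0 : ℝ) < i := by exact_mod_cast hi
  rw [logW, log_div (by positivity) this.ne']

theorem logW_nonneg {k i : ℕ} (hi : 1 ≤ i) (hik : i ≤ k + 1) : 0 ≤ logW k i := by
  have h1 : (0 : ℝ) < i := by exact_mod_cast hi
  have h2 : (i : ℝ) ≤ (k : ℝ) + 1 := by exact_mod_cast hik
  exact Real.log_nonneg (by rw [le_div_iff₀ h1]; linarith)

/-- At `i = k` the logarithm is only of order `1/k`; this limits the damage done by the divisions by
`logW` in the estimator. -/
theorem one_div_le_logW {k i : ℕ} (hi : 1 ≤ i) (hik : i ≤ k) : 1 / ((k : ℝ) + 1) ≤ logW k i := by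
  have h1 : (0 : ℝ) < i := by exact_mod_cast hi
  have h2 : (i : ℝ) ≤ (k : ℝ) := by exact_mod_cast hik
  have h3 := Real.one_sub_inv_le_log_of_pos (x := ((k : ℝ) + 1) / i) (by positivity)
  refine le_trans ?_ h3
  rw [inv_div, div_le_iff₀ (by positivity), sub_mul, div_mul_cancel₀ _ (by positivity)]
  linarith

theorem logW_pos {k i : ℕ} (hi : 1 ≤ i) (hik : i ≤ k) : 0 < logW k i :=
  lt_of_lt_of_le (by positivity) (one_div_le_logW hi hik)

theorem log_succ_sub_log_le {j : ℕ} (hj : 1 ≤ j) : log ((j + 1 : ℕ) : ℝ) - log j ≤ 1 / j := by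
  have h1 : (0 : ℝ) < j := by exact_mod_cast hj
  rw [← log_div (by positivity) h1.ne']
  refine (Real.log_le_sub_one_of_pos (by positivity)).trans (le_of_eq ?_)
  push_cast; field_simp; ring

theorem le_log_succ_sub_log {j : ℕ} (hj : 1 ≤ j) :
    1 / ((j : ℝ) + 1) ≤ log ((j + 1 : ℕ) : ℝ) - log j := by
  have h1 : (0 : ℝ) < j := by exact_mod_cast hj
  rw [← log_div (by positivity) h1.ne']
  refine le_trans (le_of_eq ?_) (Real.one_sub_inv_le_log_of_pos (by positivity))
  push_cast; field_simp; ring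

theorem logW_eq_sum {k i : ℕ} (hi : 1 ≤ i) (hik : i ≤ k + 1) :
    logW k i = ∑ j ∈ Icc i k, (log ((j + 1 : ℕ) : ℝ) - log j) := by
  rw [sum_Icc_telescope (fun j => log (j : ℝ)) hik, logW_eq hi]
  push_cast; ring

theorem logW_le_harmTail {k i : ℕ} (hi : 1 ≤ i) (hik : i ≤ k + 1) : logW k i ≤ harmTail k i := by
  rw [logW_eq_sum hi hik]
  exact sum_le_sum fun j hj => log_succ_sub_log_le (by simp at hj; omega)

theorem harmTail_le_logW_add {k i : ℕ} (hi : 1 ≤ i) (hik : i ≤ k + 1) :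
    harmTail k i ≤ logW k i + 1 / i := by
  have h : ∑ j ∈ Icc i k, ((1 : ℝ) / j - (log ((j + 1 : ℕ) : ℝ) - log j)) ≤
      ∑ j ∈ Icc i k, ((fun j : ℕ => -(1 / (j : ℝ))) (j + 1) - (fun j : ℕ => -(1 / (j : ℝ))) j) := by
    refine sum_le_sum fun j hj => ?_
    have := le_log_succ_sub_log (j := j) (by simp at hj; omega)
    grind
  rw [sum_Icc_telescope (fun j : ℕ => -(1 / (j : ℝ))) hik, sum_sub_distrib,
    ← logW_eq_sum hi hik] at h
  have : (0 : ℝ) ≤ 1 / ((k + 1 : ℕ) : ℝ) := by positivity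
  rw [harmTail]
  linarith

/-- Termwise `1/j ≤ 2/(j+1)`. A bound by a multiple of `logW` is what survives a division by `logW`.
-/
theorem harmTail_le_two_mul_logW {k i : ℕ} (hi : 1 ≤ i) (hik : i ≤ k + 1) :
    harmTail k i ≤ 2 * logW k i := by
  rw [logW_eq_sum hi hik, harmTail, mul_sum]
  refine sum_le_sum fun j hj => ?_
  have hj1 : 1 ≤ j := by simp at hj; omega
  have h1 : (1 : ℝ) ≤ j := by exact_mod_cast hj1
  refine le_trans ?_ (mul_le_mul_of_nonneg_left (le_log_succ_sub_log hj1) (by norm_num))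
  rw [mul_one_div, div_le_div_iff₀ (by positivity) (by positivity)]
  linarith

theorem sum_inv_sq_le {k i : ℕ} (hi : 1 ≤ i) : ∑ j ∈ Icc i k, ((1 : ℝ) / j) ^ 2 ≤ 2 / i := by
  rcases le_or_gt i (k + 1) with hik | hik
  · have h : ∑ j ∈ Icc i k, ((1 : ℝ) / j) ^ 2 ≤ ∑ j ∈ Icc i k,
        ((fun j : ℕ => -(2 / (j : ℝ))) (j + 1) - (fun j : ℕ => -(2 / (j : ℝ))) j) := by
      refine sum_le_sum fun j hj => ?_
      have h1 : (1 : ℝ) ≤ j := by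
        have : 1 ≤ j := by simp at hj; omega
        exact_mod_cast this
      have e : -(2 / ((j + 1 : ℕ) : ℝ)) - -(2 / (j : ℝ)) = 2 / (j * (j + 1)) := by
        push_cast; field_simp; ring
      simp only [e, div_pow, one_pow]
      rw [div_le_div_iff₀ (by positivity) (by positivity)]
      nlinarith
    rw [sum_Icc_telescope (fun j : ℕ => -(2 / (j : ℝ))) hik] at h
    have : (0 : ℝ) ≤ 2 / ((k + 1 : ℕ) : ℝ) := by positivity
    linarith
  · rw [Finset.Icc_eq_empty (by omega), Finset.sum_empty]
    positivity

theorem exp_neg_mul_logW {k i : ℕ} (hi : 1 ≤ i) (r : ℝ) :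
    ((i : ℝ) / ((k : ℝ) + 1)) ^ r = exp (-(r * logW k i)) := by
  have h1 : (0 : ℝ) < i := by exact_mod_cast hi
  rw [Real.rpow_def_of_pos (by positivity), logW_eq hi, log_div h1.ne' (by positivity)]
  congr 1; ring

end Harmonic

section TailSums

variable {Ω : Type*}

/-- In Rényi's representation this is the gap between the exponential order statistics of ranks `i`
and `k + 1` from the top, and the order statistic itself if `k` is the sample size. -/
def tailSum (E : ℕ → Ω → ℝ) (k i : ℕ) (ω : Ω) : ℝ := ∑ j ∈ Icc i k, E j ω / j

/-- The second order part of a log-ratio; it is used with `r = -ρ_z`. -/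
def wTailSum (r : ℝ) (E : ℕ → Ω → ℝ) (k i : ℕ) (ω : Ω) : ℝ :=
  ∑ j ∈ Icc i k, ((j : ℝ) / ((k : ℝ) + 1)) ^ r * E j ω / j

def cTailSum (E : ℕ → Ω → ℝ) (k i : ℕ) (ω : Ω) : ℝ := ∑ j ∈ Icc i k, (1 / (j : ℝ)) * (E j ω - 1)

/-- The largest absolute value of `F i` for `1 ≤ i ≤ k`. -/
def supIcc (k : ℕ) (F : ℕ → ℝ) : ℝ := ((Icc 1 k).sup fun i => ‖F i‖₊ : NNReal)

theorem le_supIcc {k i : ℕ} (F : ℕ → ℝ) (hi : i ∈ Icc 1 k) : |F i| ≤ supIcc k F := by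
  have := Finset.le_sup (f := fun i => ‖F i‖₊) hi
  rw [← norm_eq_abs, ← coe_nnnorm]
  exact NNReal.coe_le_coe.2 this

theorem supIcc_nonneg (k : ℕ) (F : ℕ → ℝ) : 0 ≤ supIcc k F := NNReal.coe_nonneg _

theorem supIcc_le {k : ℕ} {F : ℕ → ℝ} {M : ℝ} (hM : 0 ≤ M) (h : ∀ i ∈ Icc 1 k, |F i| ≤ M) :
    supIcc k F ≤ M := by
  lift M to NNReal using hM
  refine NNReal.coe_le_coe.2 (Finset.sup_le fun i hi => ?_)
  rw [← NNReal.coe_le_coe, coe_nnnorm, norm_eq_abs]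
  exact h i hi

variable {E : ℕ → Ω → ℝ} {k i : ℕ} {ω : Ω}

theorem tailSum_eq_add (k i : ℕ) (ω : Ω) : tailSum E k i ω = harmTail k i + cTailSum E k i ω := by
  simp only [tailSum, harmTail, cTailSum, ← Finset.sum_add_distrib]
  grind

theorem tailSum_succ (h : i ≤ k) : tailSum E k i ω = E i ω / i + tailSum E k (i + 1) ω :=
  sum_Icc_eq_add_succ h

theorem tailSum_anti (hE : ∀ j, 0 < E j ω) {i i' : ℕ} (h : i ≤ i') :
    tailSum E k i' ω ≤ tailSum E k i ω := by
  refine Finset.sum_le_sum_of_subset_of_nonneg (Finset.Icc_subset_Icc_left h) fun j _ _ => ?_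
  have := (hE j).le
  positivity

theorem tailSum_nonneg (hE : ∀ j, 0 < E j ω) : 0 ≤ tailSum E k i ω :=
  sum_nonneg fun j _ => by have := (hE j).le; positivity

theorem wTailSum_nonneg (r : ℝ) (hE : ∀ j, 0 < E j ω) : 0 ≤ wTailSum r E k i ω :=
  sum_nonneg fun j _ => by have := (hE j).le; positivity

theorem div_rpow_le_one {r : ℝ} (hr : 0 ≤ r) {j k : ℕ} (h : j ≤ k) :
    ((j : ℝ) / ((k : ℝ) + 1)) ^ r ≤ 1 := by
  have : (j : ℝ) ≤ k := by exact_mod_cast h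
  exact Real.rpow_le_one (by positivity) (by rw [div_le_one (by positivity)]; linarith) hr

theorem wTailSum_le_tailSum {r : ℝ} (hr : 0 ≤ r) (hE : ∀ j, 0 < E j ω) :
    wTailSum r E k i ω ≤ tailSum E k i ω := by
  refine sum_le_sum fun j hj => ?_
  have := (hE j).le
  rw [mul_div_assoc]
  refine mul_le_of_le_one_left (by positivity) (div_rpow_le_one hr ?_)
  simp at hj; omega

end TailSums

section TailSumsProb

variable {Ω : Type*} [MeasurableSpace Ω] {P : Measure Ω}

namespace IsIidExp

variable {E : ℕ → Ω → ℝ}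

theorem integrable_tailSum (h : IsIidExp P E) (k i : ℕ) : Integrable (tailSum E k i) P :=
  integrable_finsetSum _ fun j _ => (h.integrable j).div_const _

theorem integral_tailSum (h : IsIidExp P E) (k i : ℕ) : ∫ ω, tailSum E k i ω ∂P = harmTail k i := by
  simp only [tailSum]
  rw [integral_finsetSum _ fun j _ => (h.integrable j).div_const _]
  simp_rw [integral_div, h.integral_eq]
  rfl

theorem integrable_wTailSum (h : IsIidExp P E) (r : ℝ) (k i : ℕ) :
    Integrable (wTailSum r E k i) P :=
  integrable_finsetSum _ fun j _ => ((h.integrable j).const_mul _).div_const _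

theorem integral_wTailSum (h : IsIidExp P E) (r : ℝ) (k i : ℕ) : ∫ ω, wTailSum r E k i ω ∂P =
    ∑ j ∈ Icc i k, ((j : ℝ) / ((k : ℝ) + 1)) ^ r / j := by
  simp only [wTailSum]
  rw [integral_finsetSum _ fun j _ => ((h.integrable j).const_mul _).div_const _]
  simp_rw [integral_div, integral_const_mul, h.integral_eq, mul_one]

theorem memLp_cTailSum (h : IsIidExp P E) (k i : ℕ) : MemLp (cTailSum E k i) 2 P := h.memLp_sum _ _

theorem maximal_cTailSum (h : IsIidExp P E) {m k : ℕ} (hm : 1 ≤ m) {x : ℝ} (hx : 0 < x) :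
    P {ω | ∃ i ∈ Icc m k, x ≤ |cTailSum E k i ω|} ≤ ofReal ((2 / m) / x ^ 2) := by
  refine (h.maximal_ineq (fun j => 1 / (j : ℝ)) m k hx).trans (ofReal_le_ofReal ?_)
  gcongr
  exact sum_inv_sq_le hm

/-- The fluctuation contributes `√(2/i)` and the passage from harmonic sum to logarithm `1/i`. This
is good when `i` is large while `logW` stays away from zero. -/
theorem integral_abs_tailSum_sub_logW_le (h : IsIidExp P E) {k i : ℕ} (hi : 1 ≤ i) (hik : i ≤ k) :
    ∫ ω, |tailSum E k i ω - logW k i| ∂P ≤ √(2 / i) + 1 / i := by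
  have := h.isProb
  have hint : Integrable (fun ω => |cTailSum E k i ω|) P :=
    ((h.memLp_cTailSum k i).integrable one_le_two).abs
  have h1 : ∀ ω, |tailSum E k i ω - logW k i| ≤ |cTailSum E k i ω| + 1 / i := by
    intro ω
    have e : tailSum E k i ω - logW k i = cTailSum E k i ω + (harmTail k i - logW k i) := by
      rw [tailSum_eq_add]; ring
    rw [e]
    refine (abs_add_le _ _).trans (add_le_add le_rfl ?_)
    rw [abs_of_nonneg (by linarith [logW_le_harmTail hi (k := k) (by omega)])]
    linarith [harmTail_le_logW_add hi (k := k) (by omega)]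
  calc ∫ ω, |tailSum E k i ω - logW k i| ∂P ≤ ∫ ω, (|cTailSum E k i ω| + 1 / i) ∂P :=
        integral_mono ((h.integrable_tailSum k i).sub (integrable_const _)).abs
          (hint.add (integrable_const _)) h1
    _ = ∫ ω, |cTailSum E k i ω| ∂P + 1 / i := by rw [integral_add hint (integrable_const _)]; simp
    _ ≤ _ := by
        gcongr
        exact (h.integral_abs_sum_le (fun j => 1 / (j : ℝ)) _).trans
          (Real.sqrt_le_sqrt (sum_inv_sq_le hi))

theorem ae_nonneg_tailSum (h : IsIidExp P E) (k i : ℕ) : ∀ᵐ ω ∂P, 0 ≤ tailSum E k i ω := by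
  filter_upwards [h.ae_forall_pos] with ω hω using tailSum_nonneg hω

/-- Only the mean of the positive tail sum is used. The bound is proportional to `logW`, hence
useful for `i` near `k`, where `√(2/i)` exceeds `logW` itself. -/
theorem integral_abs_tailSum_sub_logW_le' (h : IsIidExp P E) {k i : ℕ} (hi : 1 ≤ i) (hik : i ≤ k) :
    ∫ ω, |tailSum E k i ω - logW k i| ∂P ≤ 3 * logW k i := by
  have := h.isProb
  calc ∫ ω, |tailSum E k i ω - logW k i| ∂P ≤ ∫ ω, (tailSum E k i ω + logW k i) ∂P := by
        refine integral_mono_ae ((h.integrable_tailSum k i).sub (integrable_const _)).abs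
          ((h.integrable_tailSum k i).add (integrable_const _)) ?_
        filter_upwards [h.ae_nonneg_tailSum k i] with ω hω
        have := logW_nonneg hi (k := k) (by omega)
        grind
    _ = harmTail k i + logW k i := by
        rw [integral_add (h.integrable_tailSum k i) (integrable_const _), h.integral_tailSum]; simp
    _ ≤ _ := by linarith [harmTail_le_two_mul_logW hi (k := k) (by omega)]

theorem integral_abs_wTailSum_sub_le (h : IsIidExp P E) {r : ℝ} (hr : 0 ≤ r) {k i : ℕ}
    (hi : 1 ≤ i) :
    ∫ ω, |wTailSum r E k i ω - ∑ j ∈ Icc i k, ((j : ℝ) / ((k : ℝ) + 1)) ^ r / j| ∂P ≤ √(2 / i) := by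
  have e : ∀ ω, wTailSum r E k i ω - ∑ j ∈ Icc i k, ((j : ℝ) / ((k : ℝ) + 1)) ^ r / j =
      ∑ j ∈ Icc i k, (((j : ℝ) / ((k : ℝ) + 1)) ^ r / j) * (E j ω - 1) := by
    intro ω
    rw [wTailSum, ← sum_sub_distrib]
    grind
  simp_rw [e]
  refine (h.integral_abs_sum_le _ _).trans (Real.sqrt_le_sqrt ?_)
  refine le_trans (sum_le_sum fun j hj => ?_) (sum_inv_sq_le (k := k) hi)
  gcongr
  exact div_rpow_le_one hr (by simp at hj; omega)

theorem integral_abs_wTailSum_sub_le' (h : IsIidExp P E) {r : ℝ} (hr : 0 ≤ r) {k i : ℕ} (hi : 1 ≤ i)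
    (hik : i ≤ k) :
    ∫ ω, |wTailSum r E k i ω - ∑ j ∈ Icc i k, ((j : ℝ) / ((k : ℝ) + 1)) ^ r / j| ∂P
      ≤ 4 * logW k i := by
  have := h.isProb
  have hs : ∑ j ∈ Icc i k, ((j : ℝ) / ((k : ℝ) + 1)) ^ r / j ≤ harmTail k i := by
    refine sum_le_sum fun j hj => ?_
    gcongr
    exact div_rpow_le_one hr (by simp at hj; omega)
  have h0 : 0 ≤ ∑ j ∈ Icc i k, ((j : ℝ) / ((k : ℝ) + 1)) ^ r / j :=
    sum_nonneg fun j _ => by positivity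
  set S := ∑ j ∈ Icc i k, ((j : ℝ) / ((k : ℝ) + 1)) ^ r / j with hS
  calc ∫ ω, |wTailSum r E k i ω - S| ∂P ≤ ∫ ω, (wTailSum r E k i ω + S) ∂P := by
        refine integral_mono_ae ((h.integrable_wTailSum r k i).sub (integrable_const _)).abs
          ((h.integrable_wTailSum r k i).add (integrable_const _)) ?_
        filter_upwards [h.ae_forall_pos] with ω hω
        have := wTailSum_nonneg (k := k) (i := i) r hω
        grind
    _ = S + S := by
        rw [integral_add (h.integrable_wTailSum r k i) (integrable_const _), h.integral_wTailSum]
        simp [hS]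
    _ ≤ _ := by linarith [harmTail_le_two_mul_logW hi (k := k) (by omega)]

/-- The weights `1/j` in the block are at least `1/k`, and the sum of its `l` exponentials has mean
and variance `l`; Chebyshev's inequality at distance `l/2` gives `4/l`. It will show that a block of
ranks is longer than a cell. -/
theorem measure_block_le (h : IsIidExp P E) {k l : ℕ} (hl : 1 ≤ l) (hlk : l < k) {x : ℝ}
    (hx : k * x ≤ l / 2) :
    P {ω | ∑ j ∈ Ico (k - l) k, E j ω / j ≤ x} ≤ ofReal (4 / l) := by
  have := h.isProb
  have hl0 : (0 : ℝ) < l := by exact_mod_cast hl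
  have hk0 : (0 : ℝ) < k := by exact_mod_cast (by omega : 0 < k)
  have hc : (((Ico (k - l) k).card : ℕ) : ℝ) = l := by rw [Nat.card_Ico]; congr 1; omega
  have h1 := measure_abs_ge_le_of_sq_integral_le (h.memLp_sum (fun _ => 1) (Ico (k - l) k))
    (δ := (l : ℝ) / 2) (C := l) (by positivity)
    (by rw [h.integral_sq_sum, sum_const, nsmul_eq_mul, hc]; simp)
  have e : (l : ℝ) / ((l : ℝ) / 2) ^ 2 = 4 / l := by field_simp; ring
  rw [e] at h1
  refine le_trans (measure_mono_ae ?_) h1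
  filter_upwards [h.ae_forall_pos] with ω hω hmem
  have hle : (∑ j ∈ Ico (k - l) k, E j ω) / k ≤ x := by
    refine le_trans ?_ (show ∑ j ∈ Ico (k - l) k, E j ω / j ≤ x from hmem)
    rw [Finset.sum_div]
    refine sum_le_sum fun j hj => ?_
    rw [Finset.mem_Ico] at hj
    have hj0 : (0 : ℝ) < j := by exact_mod_cast (by omega : 0 < j)
    exact div_le_div_of_nonneg_left (hω j).le hj0 (by exact_mod_cast hj.2.le)
  rw [div_le_iff₀ hk0] at hle
  have e2 : ∑ j ∈ Ico (k - l) k, 1 * (E j ω - 1) = ∑ j ∈ Ico (k - l) k, E j ω - l := by simp_all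
  change (l : ℝ) / 2 ≤ |_|
  grind

end IsIidExp

variable {E : ℕ → ℕ → Ω → ℝ} {k : ℕ → ℕ}

/-- The mean is at most `2 logW`, and the maximal inequality bounds the centred part uniformly in
`i`; the latter is why the normalization is not allowed below `1`. -/
theorem bddP_supIcc_tailSum (h : ∀ n, IsIidExp P (E n)) :
    BddP P fun n ω => supIcc (k n) fun i => tailSum (E n) (k n) i ω / max (logW (k n) i) 1 := by
  intro e he
  obtain ⟨M, hM, hMe⟩ := exists_ofReal_div_le 2 he
  refine ⟨M + 3, by linarith, of_forall fun n => ?_⟩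
  refine le_trans (measure_mono_ae ?_) (((h n).maximal_cTailSum (k := k n) le_rfl
    (by linarith : (0 : ℝ) < M)).trans ((ofReal_le_ofReal ?_).trans hMe))
  · filter_upwards [(h n).ae_forall_pos] with ω hω hmem
    by_contra hcon
    change ¬ ∃ i ∈ Icc 1 (k n), M ≤ |cTailSum (E n) (k n) i ω| at hcon
    push Not at hcon
    have : supIcc (k n) (fun i => tailSum (E n) (k n) i ω / max (logW (k n) i) 1) ≤ M + 2 := by
      refine supIcc_le (by linarith) fun i hi => ?_
      have h1 := hcon i hi
      rw [mem_Icc] at hi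
      have h0 : (0 : ℝ) < max (logW (k n) i) 1 := lt_max_of_lt_right one_pos
      rw [abs_of_nonneg (div_nonneg (tailSum_nonneg hω) h0.le), div_le_iff₀ h0, tailSum_eq_add]
      have h2 := harmTail_le_two_mul_logW hi.1 (k := k n) (by omega)
      have h3 := le_abs_self (cTailSum (E n) (k n) i ω)
      nlinarith [le_max_left (logW (k n) i) 1, le_max_right (logW (k n) i) 1]
    have h4 : M + 3 ≤ |supIcc (k n) (fun i => tailSum (E n) (k n) i ω / max (logW (k n) i) 1)| :=
      hmem
    rw [abs_of_nonneg (supIcc_nonneg _ _)] at h4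
    linarith
  · have : M ≤ M ^ 2 := by nlinarith
    have h2 : (2 / ((1 : ℕ) : ℝ)) = 2 := by norm_num
    rw [h2]
    exact div_le_div_of_nonneg_left (by norm_num) (by linarith) this

end TailSumsProb

/-! ### Uniform comparison of `(w_{k+1}^r - w_i^r)/r` with the weighted tail sums -/

section Compare

/-- `g y = (1 - e^{-y})/y`, written so that `g 0 = 1`. -/
def expQuot (y : ℝ) : ℝ := if y = 0 then 1 else (1 - exp (-y)) / y

theorem expQuot_mul (y : ℝ) : expQuot y * y = 1 - exp (-y) := by
  unfold expQuot
  simp_all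

theorem expQuot_le_one {y : ℝ} (hy : 0 ≤ y) : expQuot y ≤ 1 := by
  unfold expQuot
  split_ifs with h
  · exact le_rfl
  · have : 0 < y := lt_of_le_of_ne hy (Ne.symm h)
    rw [div_le_one this]
    linarith [add_one_le_exp (-y)]

theorem expQuot_nonneg {y : ℝ} (hy : 0 ≤ y) : 0 ≤ expQuot y := by
  unfold expQuot
  split_ifs with h
  · exact zero_le_one
  · exact div_nonneg (by simp_all) hy

theorem one_sub_expQuot_le {y : ℝ} (hy : 0 ≤ y) : 1 - expQuot y ≤ y := by
  rcases eq_or_lt_of_le hy with h | h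
  · simp [← h, expQuot]
  · have h1 : exp (-y) ≤ 1 - y + y ^ 2 := by
      rw [exp_neg, inv_le_iff_one_le_mul₀ (exp_pos y)]
      have := add_one_le_exp y
      have h2 : 0 ≤ 1 - y + y ^ 2 := by nlinarith [sq_nonneg (y - 1)]
      nlinarith [mul_le_mul_of_nonneg_left this h2, pow_pos h 3]
    have h2 : expQuot y = (1 - exp (-y)) / y := by simp [expQuot, h.ne']
    rw [h2, sub_le_comm, le_div_iff₀ h]
    nlinarith

variable {Ω : Type*}

/-- The relative difference of the increments. -/
def incrDiff (r s : ℝ) (E : ℕ → Ω → ℝ) (k j : ℕ) (ω : Ω) : ℝ :=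
  exp (-(r * (s + tailSum E k (j + 1) ω))) * expQuot (r * (E j ω / j)) -
    ((j : ℝ) / ((k : ℝ) + 1)) ^ r

/-- The difference of exponentials telescopes over the ranks `j`. Each increment is `r E_j/j` times
a factor that should be close to `(j/(k+1))^r`, and `incrDiff` is the error of that factor. -/
theorem abs_sub_wTailSum_le {r s : ℝ} (hr : 0 < r) {E : ℕ → Ω → ℝ} {k i : ℕ} {ω : Ω}
    (hE : ∀ j, 0 < E j ω) (hi : i ∈ Icc 1 k) :
    |(exp (-(r * s)) - exp (-(r * (s + tailSum E k i ω)))) / r - wTailSum r E k i ω| ≤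
      supIcc k (fun j => incrDiff r s E k j ω) * tailSum E k i ω := by
  rw [mem_Icc] at hi
  have h1 : exp (-(r * s)) - exp (-(r * (s + tailSum E k i ω))) =
      ∑ j ∈ Icc i k, (exp (-(r * (s + tailSum E k (j + 1) ω))) -
        exp (-(r * (s + tailSum E k j ω)))) := by
    rw [sum_Icc_telescope (fun j => exp (-(r * (s + tailSum E k j ω)))) (by omega)]
    congr 3
    simp [tailSum]
  have h2 : (exp (-(r * s)) - exp (-(r * (s + tailSum E k i ω)))) / r -
      wTailSum r E k i ω = ∑ j ∈ Icc i k, incrDiff r s E k j ω * (E j ω / j) := by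
    rw [h1, Finset.sum_div, wTailSum, ← sum_sub_distrib]
    refine sum_congr rfl fun j hj => ?_
    rw [mem_Icc] at hj
    have e := expQuot_mul (r * (E j ω / j))
    have e2 : exp (-(r * (s + tailSum E k j ω))) =
        exp (-(r * (s + tailSum E k (j + 1) ω))) * exp (-(r * (E j ω / j))) := by
      rw [tailSum_succ hj.2, ← exp_add]; congr 1; ring
    rw [e2, incrDiff, div_sub', div_eq_iff hr.ne']
    · grind
    · exact hr.ne'
  rw [h2, tailSum, mul_sum]
  refine (Finset.abs_sum_le_sum_abs _ _).trans (sum_le_sum fun j hj => ?_)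
  rw [mem_Icc] at hj
  have h3 : 0 ≤ E j ω / j := by have := (hE j).le; positivity
  rw [abs_mul, abs_of_nonneg h3]
  exact mul_le_mul_of_nonneg_right (le_supIcc (fun j => incrDiff r s E k j ω) (by simp; omega)) h3

/-- The first summand serves the ranks beyond about `ε (k+1)`, where exponents agree up to `3 r ε`;
the second serves the smaller ranks, where both compared quantities are nearly as small as `(2ε)^r`.
-/
def incrBound (r ε : ℝ) : ℝ := (exp (3 * r * ε) - 1 + 3 * r * ε) + (2 * ε) ^ r * exp (2 * r * ε)

theorem incrBound_tendsto {r : ℝ} (hr : 0 < r) : Tendsto (incrBound r) (𝓝[>] 0) (𝓝 0) := by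
  have h : ContinuousAt (incrBound r) 0 := by
    unfold incrBound
    have : ContinuousAt (fun ε : ℝ => (2 * ε) ^ r) 0 :=
      ContinuousAt.rpow_const (by fun_prop) (Or.inr hr.le)
    fun_prop
  have h0 : incrBound r 0 = 0 := by simp [incrBound, Real.zero_rpow hr.ne']
  have := h.tendsto
  rw [h0] at this
  exact this.mono_left nhdsWithin_le_nhds

/-- For `j ≥ m` the hypothesis `hL` puts the exponent within `3ε` of `logW k j`, and `E_j/j`, a
difference of consecutive tail sums, is itself at most `3ε`. For `j < m` nothing is known about
single terms, but monotonicity in `j` makes both compared quantities small because `r > 0`. -/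
theorem abs_incrDiff_le {r s ε : ℝ} (hr : 0 < r) (hε : 0 < ε) {E : ℕ → Ω → ℝ} {k m : ℕ} {ω : Ω}
    (hE : ∀ j, 0 < E j ω) (hs : |s| ≤ ε) (hm1 : 1 ≤ m) (hmk : m ≤ k) (hm2 : 1 / (m : ℝ) ≤ ε)
    (hm3 : (m : ℝ) ≤ 2 * ε * ((k : ℝ) + 1))
    (hL : ∀ i ∈ Icc m k, |cTailSum E k i ω| ≤ ε) {j : ℕ} (hj : j ∈ Icc 1 k) :
    |incrDiff r s E k j ω| ≤ incrBound r ε := by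
  rw [mem_Icc] at hj
  have hL' : ∀ i, m ≤ i → |cTailSum E k i ω| ≤ ε := by
    intro i hi
    by_cases h : i ≤ k
    · exact hL i (by simp; omega)
    · rw [cTailSum, Finset.Icc_eq_empty (by omega)]; simp [hε.le]
  have hx0 : 0 ≤ r * (E j ω / j) := by have := (hE j).le; positivity
  have hg1 := expQuot_le_one hx0
  have hg0 := expQuot_nonneg hx0
  have hexp : 0 ≤ (2 * ε) ^ r * exp (2 * r * ε) := by positivity
  have hA : 0 ≤ exp (3 * r * ε) - 1 + 3 * r * ε := by
    have := add_one_le_exp (3 * r * ε)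
    have : 0 ≤ 3 * r * ε := by positivity
    linarith
  have hj1 : (0 : ℝ) < j := by exact_mod_cast hj.1
  rcases le_or_gt m j with hmj | hmj
  · have hjm : 1 / (j : ℝ) ≤ ε := by
      refine le_trans ?_ hm2
      exact one_div_le_one_div_of_le (by exact_mod_cast hm1) (by exact_mod_cast hmj)
    set D := s + tailSum E k (j + 1) ω - logW k j with hD
    have a1 := logW_le_harmTail (i := j + 1) (k := k) (by omega) (by omega)
    have a2 := harmTail_le_logW_add (i := j + 1) (k := k) (by omega) (by omega)
    have a3 := log_succ_sub_log_le hj.1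
    have a4 : 0 ≤ log ((j + 1 : ℕ) : ℝ) - log j :=
      le_trans (by positivity) (le_log_succ_sub_log hj.1)
    have a5 : logW k j = logW k (j + 1) + (log ((j + 1 : ℕ) : ℝ) - log j) := by
      rw [logW_eq hj.1, logW_eq (i := j + 1) (by omega)]; ring
    have a6 := hL' (j + 1) (by omega)
    have a7 := hL' j hmj
    have a8 : (1 : ℝ) / ((j + 1 : ℕ) : ℝ) ≤ 1 / j :=
      one_div_le_one_div_of_le hj1 (by push_cast; linarith)
    have hDb : |D| ≤ 3 * ε := by
      rw [hD, tailSum_eq_add, a5]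
      grind
    have hx : r * (E j ω / j) ≤ 3 * r * ε := by
      have b1 : tailSum E k j ω = E j ω / j + tailSum E k (j + 1) ω := tailSum_succ hj.2
      rw [tailSum_eq_add, tailSum_eq_add] at b1
      have b2 : harmTail k j = 1 / j + harmTail k (j + 1) := sum_Icc_eq_add_succ hj.2
      rw [abs_le] at a6 a7
      have : E j ω / j ≤ 3 * ε := by linarith
      have := mul_le_mul_of_nonneg_left this hr.le
      linarith
    have e1 : incrDiff r s E k j ω =
        ((j : ℝ) / ((k : ℝ) + 1)) ^ r * (exp (-(r * D)) * expQuot (r * (E j ω / j)) - 1) := by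
      rw [incrDiff, exp_neg_mul_logW hj.1, mul_sub, ← mul_assoc, ← exp_add, mul_one]
      congr 3
      rw [hD]; ring
    have hrD : |r * D| ≤ 3 * r * ε := by
      rw [abs_mul, abs_of_pos hr]
      have := mul_le_mul_of_nonneg_left hDb hr.le
      linarith
    rw [abs_le] at hrD
    have e2 : |exp (-(r * D)) * expQuot (r * (E j ω / j)) - 1| ≤
        exp (3 * r * ε) - 1 + 3 * r * ε := by
      have c1 : exp (-(r * D)) ≤ exp (3 * r * ε) := by
        apply exp_le_exp.2
        linarith
      have c2 : 2 - exp (3 * r * ε) ≤ exp (-(r * D)) := by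
        have c3 : exp (-(3 * r * ε)) ≤ exp (-(r * D)) := by simp_all
        have c4 : 2 ≤ exp (3 * r * ε) + exp (-(3 * r * ε)) := by
          rw [exp_neg]
          have p := exp_pos (3 * r * ε)
          have : exp (3 * r * ε) + (exp (3 * r * ε))⁻¹ - 2 =
            (exp (3 * r * ε) - 1) ^ 2 * (exp (3 * r * ε))⁻¹ := by field_simp; ring
          nlinarith [mul_nonneg (sq_nonneg (exp (3 * r * ε) - 1)) (inv_pos.2 p).le]
        linarith
      have c5 := one_sub_expQuot_le hx0
      have c6 := mul_le_of_le_one_right (exp_pos (-(r * D))).le hg1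
      have c7 : 1 - expQuot (r * (E j ω / j)) ≤ 3 * r * ε := c5.trans hx
      have c8 := mul_le_mul_of_nonneg_right c2 hg0
      have c9 : 0 ≤ exp (3 * r * ε) - 1 := by linarith
      have c10 := mul_le_mul_of_nonneg_left hg1 c9
      grind
    rw [e1, abs_mul, abs_of_nonneg (by positivity)]
    have e3 := div_rpow_le_one hr.le hj.2
    refine le_trans (mul_le_of_le_one_left (abs_nonneg _) e3) ?_
    unfold incrBound
    linarith
  · have b1 : tailSum E k m ω ≤ tailSum E k (j + 1) ω := tailSum_anti hE (by omega)
    have b2 := logW_le_harmTail (i := m) (k := k) (by omega) (by omega)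
    have b3 := hL' m le_rfl
    have hm0 : (0 : ℝ) < m := by exact_mod_cast hm1
    have hm4 : ((m : ℝ) / ((k : ℝ) + 1)) ^ r ≤ (2 * ε) ^ r := by
      refine Real.rpow_le_rpow (by positivity) ?_ hr.le
      rw [div_le_iff₀ (by positivity)]; exact hm3
    have hj4 : ((j : ℝ) / ((k : ℝ) + 1)) ^ r ≤ (2 * ε) ^ r := by
      refine le_trans (Real.rpow_le_rpow (by positivity) ?_ hr.le) hm4
      gcongr
    have c1 : exp (-(r * (s + tailSum E k (j + 1) ω))) ≤ (2 * ε) ^ r * exp (2 * r * ε) := by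
      calc exp (-(r * (s + tailSum E k (j + 1) ω))) ≤ exp (-(r * logW k m) + 2 * r * ε) := by
            apply exp_le_exp.2
            rw [tailSum_eq_add] at b1
            rw [abs_le] at hs b3
            have : logW k m - 2 * ε ≤ s + tailSum E k (j + 1) ω := by linarith
            have := mul_le_mul_of_nonneg_left this hr.le
            linarith
        _ = ((m : ℝ) / ((k : ℝ) + 1)) ^ r * exp (2 * r * ε) := by rw [exp_add, exp_neg_mul_logW hm1]
        _ ≤ _ := by gcongr
    have c2 : (2 * ε) ^ r ≤ (2 * ε) ^ r * exp (2 * r * ε) :=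
      le_mul_of_one_le_right (by positivity) (one_le_exp (by positivity))
    have c3 : 0 ≤ ((j : ℝ) / ((k : ℝ) + 1)) ^ r := by positivity
    have c4 := exp_pos (-(r * (s + tailSum E k (j + 1) ω)))
    have c5 := mul_nonneg c4.le hg0
    have c6 := mul_le_of_le_one_right c4.le hg1
    unfold incrBound incrDiff
    grind

variable [MeasurableSpace Ω] {P : Measure Ω}

theorem smallP_supIcc_incrDiff {r : ℝ} (hr : 0 < r) {E : ℕ → ℕ → Ω → ℝ}
    (h : ∀ n, IsIidExp P (E n)) {k : ℕ → ℕ} (hk : Tendsto k atTop atTop) {s : ℕ → Ω → ℝ}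
    (hs : SmallP P s) :
    SmallP P fun n ω => supIcc (k n) fun j => incrDiff r (s n ω) (E n) (k n) j ω := by
  intro δ hδ e he
  have he2 : 0 < e / 2 := half_pos he.ne'
  obtain ⟨ε, hεb, hε0, hε1⟩ : ∃ ε, incrBound r ε < δ ∧ 0 < ε ∧ ε < 1 / 4 := by
    have h1 := (incrBound_tendsto hr).eventually (gt_mem_nhds hδ)
    have h2 : ∀ᶠ ε : ℝ in 𝓝[>] 0, ε ∈ Ioo (0 : ℝ) (1 / 4) :=
      Ioo_mem_nhdsGT (by norm_num : (0 : ℝ) < 1 / 4)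
    obtain ⟨ε, h3, h4⟩ := (h1.and h2).exists
    grind
  -- With `ε` fixed the cutoff tends to infinity, so the maximal inequality beyond it fails with
  -- probability at most `2/(m ε²)`, which vanishes.
  let m : ℕ → ℕ := fun n => ⌈ε * ((k n : ℝ) + 1)⌉₊
  have hkr : Tendsto (fun n => ε * ((k n : ℝ) + 1)) atTop atTop :=
    Tendsto.const_mul_atTop hε0 (tendsto_atTop_add_const_right _ _
      (tendsto_natCast_atTop_atTop.comp hk))
  have hmt : Tendsto (fun n => (m n : ℝ)) atTop atTop :=
    tendsto_atTop_mono (fun n => Nat.le_ceil _) hkr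
  have hP : Tendsto (fun n => 2 / (m n : ℝ) / ε ^ 2) atTop (𝓝 0) := by
    simpa using (hmt.const_div_atTop 2).div_const (ε ^ 2)
  filter_upwards [hs ε hε0 _ he2, eventually_ofReal_le hP he2, hkr.eventually_ge_atTop 1,
    hmt.eventually_ge_atTop (1 / ε), hk.eventually_ge_atTop 3]
    with n hn1 hn2 hn3 hn4 hn5
  have hk3 : (3 : ℝ) ≤ (k n : ℝ) := by exact_mod_cast hn5
  have hmlt : (m n : ℝ) < ε * ((k n : ℝ) + 1) + 1 := Nat.ceil_lt_add_one (by positivity)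
  have hm1 : 1 ≤ m n := by
    have : (1 : ℝ) ≤ m n := hn3.trans (Nat.le_ceil _)
    exact_mod_cast this
  have hm0 : (0 : ℝ) < m n := by exact_mod_cast hm1
  have hmk : m n ≤ k n := by
    have : (m n : ℝ) < (k n : ℝ) + 1 := by nlinarith
    have : m n < k n + 1 := by exact_mod_cast this
    omega
  have hmax := (h n).maximal_cTailSum (k := k n) hm1 hε0
  have hfin : P {ω | δ ≤ |supIcc (k n) fun j => incrDiff r (s n ω) (E n) (k n) j ω|} ≤
      P ({ω | ε ≤ |s n ω|} ∪ {ω | ∃ i ∈ Icc (m n) (k n), ε ≤ |cTailSum (E n) (k n) i ω|}) := by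
    apply measure_mono_ae
    filter_upwards [(h n).ae_forall_pos] with ω hω hmem
    by_contra hcon
    have hcon' : ¬ (ε ≤ |s n ω| ∨ ∃ i ∈ Icc (m n) (k n), ε ≤ |cTailSum (E n) (k n) i ω|) := hcon
    push Not at hcon'
    have hle : supIcc (k n) (fun j => incrDiff r (s n ω) (E n) (k n) j ω) ≤ incrBound r ε := by
      refine supIcc_le ?_ fun j hj => ?_
      · have : 0 ≤ exp (3 * r * ε) - 1 := by
          have := add_one_le_exp (3 * r * ε)
          have : 0 ≤ 3 * r * ε := by positivity
          linarith
        unfold incrBound; positivity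
      · exact abs_incrDiff_le hr hε0 hω hcon'.1.le hm1 hmk
          (by rw [div_le_iff₀ hm0]; rw [div_le_iff₀ hε0] at hn4; linarith)
          (by linarith) (fun i hi => (hcon'.2 i hi).le) hj
    have h4 : δ ≤ |supIcc (k n) (fun j => incrDiff r (s n ω) (E n) (k n) j ω)| := hmem
    rw [abs_of_nonneg (supIcc_nonneg _ _)] at h4
    linarith
  exact hfin.trans ((measure_union_le _ _).trans
    ((add_le_add hn1 (hmax.trans hn2)).trans (add_halves e).le))

end Compare

/-! ### Transfer of randomness and a Gaussian quantile coupling -/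

section Transfer

open unitInterval

/-- Given `f : β → α` and a law `ν` on `β`, a variable with law `ν` can be redrawn from its image
under `f` and an independent uniform variable. -/
theorem exists_transfer {α β : Type*} [MeasurableSpace α] [MeasurableSpace β]
    [StandardBorelSpace β] [Nonempty β] (ν : Measure β) [IsProbabilityMeasure ν] {f : β → α}
    (hf : Measurable f) :
    ∃ h : α → I → β, Measurable (uncurry h) ∧
      ((ν.map f).prod (volume : Measure I)).map (fun x => (x.1, h x.1 x.2)) =
        ν.map (fun b => (f b, b)) := by
  have := isProbabilityMeasure_map (μ := ν) hf.aemeasurable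
  -- The conditional law of the variable given its image is a Markov kernel into a standard Borel
  -- space, hence realized by a measurable function of an extra uniform variable.
  obtain ⟨h, hm, hh⟩ := Kernel.exists_measurable_map_eq_unitInterval (condDistrib (id : β → β) f ν)
  refine ⟨h, hm, ?_⟩
  have h1 := compProd_map_condDistrib (mβ := ‹MeasurableSpace α›) (X := f) (Y := (id : β → β))
    (μ := ν) aemeasurable_id
  simp only [id] at h1
  rw [← h1]
  have hm' : Measurable fun x : α × I => (x.1, h x.1 x.2) := measurable_fst.prodMk hm
  ext s hs
  rw [map_apply hm' hs, prod_apply (hm' hs), Measure.compProd_apply hs]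
  refine lintegral_congr fun a => ?_
  rw [← hh a, map_apply (by fun_prop) (measurable_prodMk_left hs)]
  rfl

end Transfer

section GaussianCoupling

open unitInterval

abbrev stdGauss : Measure ℝ := gaussianReal 0 1

theorem cdf_stdGauss_strictMono : StrictMono (cdf stdGauss) := by
  intro x y hxy
  rw [ProbabilityTheory.cdf_eq_real, ProbabilityTheory.cdf_eq_real]
  have h1 : stdGauss.real (Iic y) = stdGauss.real (Iic x) + stdGauss.real (Ioc x y) := by
    rw [← measureReal_union _ measurableSet_Ioc, Set.Iic_union_Ioc_eq_Iic hxy.le]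
    simp
  have h2 : stdGauss (Ioc x y) ≠ 0 := by
    intro h0
    have := gaussianReal_absolutelyContinuous' 0 (one_ne_zero) h0
    simp at this
    linarith
  have h3 : 0 < stdGauss.real (Ioc x y) := by
    rw [Measure.real]
    exact ENNReal.toReal_pos h2 (measure_ne_top _ _)
  linarith

theorem cdf_stdGauss_continuous : Continuous (cdf stdGauss) := by
  have h0 : ∀ x, stdGauss {x} = 0 := by
    intro x
    exact gaussianReal_absolutelyContinuous 0 one_ne_zero (by simp)
  rw [continuous_iff_continuousAt]
  intro x
  rw [(cdf stdGauss).mono.continuousAt_iff_leftLim_eq_rightLim, StieltjesFunction.rightLim_eq]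
  have h1 := (cdf stdGauss).measure_singleton x
  rw [measure_cdf, h0, eq_comm, ENNReal.ofReal_eq_zero] at h1
  exact le_antisymm ((cdf stdGauss).mono.leftLim_le le_rfl) (by linarith)

theorem cdf_stdGauss_pos (x : ℝ) : 0 < cdf stdGauss x :=
  lt_of_le_of_lt (cdf_nonneg _ _) (cdf_stdGauss_strictMono (sub_one_lt x))

theorem cdf_stdGauss_lt_one (x : ℝ) : cdf stdGauss x < 1 :=
  lt_of_lt_of_le (cdf_stdGauss_strictMono (lt_add_one x)) (cdf_le_one _ _)

theorem stdGauss_cdf_le {t : ℝ} (h0 : 0 ≤ t) (h1 : t ≤ 1) :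
    stdGauss {x | cdf stdGauss x ≤ t} = ofReal t := by
  rcases eq_or_lt_of_le h0 with h0 | h0
  · have : {x | cdf stdGauss x ≤ t} = ∅ := by ext x; simpa [← h0] using cdf_stdGauss_pos x
    rw [this, ← h0]; simp
  rcases eq_or_lt_of_le h1 with h1 | h1
  · have : {x | cdf stdGauss x ≤ t} = univ := by ext x; simpa [h1] using cdf_le_one _ x
    rw [this, h1]; simp
  obtain ⟨x₀, hx₀⟩ : ∃ x, cdf stdGauss x = t := by
    refine mem_range_of_exists_le_of_exists_ge cdf_stdGauss_continuous ?_ ?_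
    · exact (((tendsto_cdf_atBot _).eventually (gt_mem_nhds h0)).exists).imp fun _ h => le_of_lt h
    · exact (((tendsto_cdf_atTop _).eventually (lt_mem_nhds h1)).exists).imp fun _ h => le_of_lt h
  have : {x | cdf stdGauss x ≤ t} = Iic x₀ := by
    ext x
    rw [mem_ofPred_eq, ← hx₀, cdf_stdGauss_strictMono.le_iff_le, Set.mem_Iic]
  rw [this, ← ofReal_cdf, hx₀]

/-- The quantile transform of the standard normal law to `μ`. -/
def gaussQuantile (μ : Measure ℝ) (x : ℝ) : ℝ := sInf {w | cdf stdGauss x ≤ cdf μ w}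

variable (μ : Measure ℝ)

/-- The Galois connection of a quantile transform; the nontrivial direction is right continuity, by
which the infimum belongs to the set. -/
theorem gaussQuantile_le_iff (x w : ℝ) : gaussQuantile μ x ≤ w ↔ cdf stdGauss x ≤ cdf μ w := by
  have hne : {w | cdf stdGauss x ≤ cdf μ w}.Nonempty :=
    (((tendsto_cdf_atTop μ).eventually (lt_mem_nhds (cdf_stdGauss_lt_one x))).exists).imp
      fun _ h => le_of_lt h
  have hbdd : BddBelow {w | cdf stdGauss x ≤ cdf μ w} := by
    obtain ⟨b, hb⟩ := ((tendsto_cdf_atBot μ).eventually (gt_mem_nhds (cdf_stdGauss_pos x))).exists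
    refine ⟨b, fun w hw => ?_⟩
    by_contra hcon
    exact absurd (lt_of_le_of_lt (le_trans hw ((monotone_cdf μ) (not_le.1 hcon).le)) hb)
      (lt_irrefl _)
  constructor
  · intro h
    refine le_trans ?_ ((monotone_cdf μ) h)
    -- right continuity
    have hr : Tendsto (cdf μ) (𝓝[>] (gaussQuantile μ x)) (𝓝 (cdf μ (gaussQuantile μ x))) :=
      ((cdf μ).right_continuous _).tendsto.mono_left (nhdsWithin_mono _ Set.Ioi_subset_Ici_self)
    refine ge_of_tendsto hr ?_
    filter_upwards [self_mem_nhdsWithin] with y hy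
    obtain ⟨w', hw', hlt⟩ := (csInf_lt_iff hbdd hne).1 (show sInf _ < y from hy)
    exact le_trans hw' ((monotone_cdf μ) hlt.le)
  · intro h
    exact csInf_le hbdd h

theorem measurable_gaussQuantile : Measurable (gaussQuantile μ) := by
  refine Monotone.measurable fun x y hxy => ?_
  rw [gaussQuantile_le_iff]
  exact (monotone_cdf _ hxy).trans ((gaussQuantile_le_iff μ y _).1 le_rfl)

theorem map_gaussQuantile [IsProbabilityMeasure μ] : stdGauss.map (gaussQuantile μ) = μ := by
  have := isProbabilityMeasure_map (μ := stdGauss) (measurable_gaussQuantile μ).aemeasurable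
  refine Measure.ext_of_Iic _ _ fun w => ?_
  rw [map_apply (measurable_gaussQuantile μ) measurableSet_Iic, ← ofReal_cdf,
    ← stdGauss_cdf_le (cdf_nonneg _ _) (cdf_le_one _ _)]
  congr 1
  ext x
  exact gaussQuantile_le_iff μ x w

/-- Convergence of the distribution functions at the two points `x ± 2δ/3` and strict monotonicity
of the normal one control the quantiles on the whole ball of radius `δ/3` about `x`. Finitely many
balls cover a compact set of almost full mass. -/
theorem tendsto_gaussQuantile {μ : ℕ → Measure ℝ}
    (hμ : ∀ x, Tendsto (fun n => cdf (μ n) x) atTop (𝓝 (cdf stdGauss x))) {δ : ℝ} (hδ : 0 < δ) :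
    Tendsto (fun n => stdGauss {x | δ ≤ |x - gaussQuantile (μ n) x|}) atTop (𝓝 0) := by
  rw [ENNReal.tendsto_nhds_zero]
  intro e he
  obtain ⟨K, -, hK, hKe⟩ := MeasurableSet.univ.exists_isCompact_sdiff_lt (μ := stdGauss)
    (measure_ne_top _ _) he.ne'
  have hunif : ∀ᶠ n in atTop, ∀ x ∈ K, |x - gaussQuantile (μ n) x| < δ := by
    refine hK.induction_on (p := fun S => ∀ᶠ n in atTop, ∀ x ∈ S, |x - gaussQuantile (μ n) x| < δ)
      (by simp) (fun s t hst h => ?_) (fun s t hs ht => ?_) (fun x _ => ?_)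
    · filter_upwards [h] with n hn x hx using hn x (hst hx)
    · filter_upwards [hs, ht] with n h1 h2 x hx
      grind
    · refine ⟨Metric.ball x (δ / 3), mem_nhdsWithin_of_mem_nhds
        (Metric.ball_mem_nhds _ (by positivity)),
        ?_⟩
      have h1 := (hμ (x + 2 * δ / 3)).eventually (lt_mem_nhds
        (cdf_stdGauss_strictMono (show x + δ / 3 < x + 2 * δ / 3 by linarith)))
      have h2 := (hμ (x - 2 * δ / 3)).eventually (gt_mem_nhds
        (cdf_stdGauss_strictMono (show x - 2 * δ / 3 < x - δ / 3 by linarith)))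
      filter_upwards [h1, h2] with n h1 h2 z hz
      rw [Metric.mem_ball, Real.dist_eq, abs_lt] at hz
      have h3 : gaussQuantile (μ n) z ≤ x + 2 * δ / 3 := by
        rw [gaussQuantile_le_iff]
        exact (monotone_cdf _ (by linarith)).trans h1.le
      have h4 : x - 2 * δ / 3 < gaussQuantile (μ n) z := by
        rw [← not_le, gaussQuantile_le_iff, not_le]
        exact h2.trans_le (monotone_cdf _ (by linarith))
      grind
  filter_upwards [hunif] with n hn
  refine (measure_mono ?_).trans hKe.le
  grind

/-- If `μ n` tends to the standard normal law, then a standard normal variable can be drawn from a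
variable with law `μ n` and an independent uniform one, so that they are close in probability. -/
theorem exists_gaussian_coupling {μ : ℕ → Measure ℝ} [∀ n, IsProbabilityMeasure (μ n)]
    (hμ : ∀ x, Tendsto (fun n => cdf (μ n) x) atTop (𝓝 (cdf stdGauss x))) :
    ∃ h : ℕ → ℝ → I → ℝ, (∀ n, Measurable (uncurry (h n))) ∧
      (∀ n, ((μ n).prod (volume : Measure I)).map (uncurry (h n)) = stdGauss) ∧
      ∀ δ > 0, Tendsto (fun n => ((μ n).prod (volume : Measure I))
        {x | δ ≤ |h n x.1 x.2 - x.1|}) atTop (𝓝 0) := by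
  -- The normal variable and its quantile transform form a coupling; the transfer rebuilds the
  -- normal variable from the transform, which is the variable that is given.
  have h0 := fun n => exists_transfer stdGauss (measurable_gaussQuantile (μ n))
  choose h hm hh using h0
  simp only [map_gaussQuantile] at hh
  have hm' : ∀ n, Measurable fun x : ℝ × I => (x.1, h n x.1 x.2) :=
    fun n => measurable_fst.prodMk (hm n)
  have hg : ∀ n, Measurable fun b : ℝ => (gaussQuantile (μ n) b, b) :=
    fun n => (measurable_gaussQuantile (μ n)).prodMk measurable_id
  refine ⟨h, hm, fun n => ?_, fun δ hδ => ?_⟩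
  · have := congrArg (Measure.map Prod.snd) (hh n)
    rw [Measure.map_map measurable_snd (hm' n), Measure.map_map measurable_snd (hg n)] at this
    simpa [Function.comp_def, Function.uncurry_def, Measure.map_id'] using this
  · refine (tendsto_gaussQuantile hμ hδ).congr fun n => ?_
    have hS : MeasurableSet {x : ℝ × ℝ | δ ≤ |x.2 - x.1|} :=
      measurableSet_le measurable_const (by fun_prop)
    have := congrArg (fun ν => ν {x : ℝ × ℝ | δ ≤ |x.2 - x.1|}) (hh n)
    simp only [map_apply (hm' n) hS, map_apply (hg n) hS] at this
    exact this.symm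

/-- The central limit theorem; as the normal law has no atoms, weak convergence gives convergence of
the distribution functions at every point. -/
theorem tendsto_cdf_bernoulli_sum {p : ℝ} (hp0 : 0 < p) (hp1 : p < 1) {Ω : Type*}
    [MeasurableSpace Ω] {P : Measure Ω} [IsProbabilityMeasure P] {b : ℕ → Ω → ℝ}
    (hm : ∀ i, Measurable (b i)) (hi : iIndepFun b P)
    (hb : ∀ i ω, b i ω = 0 ∨ b i ω = 1) (hp : ∀ i, P {ω | b i ω = 1} = ofReal p)
    (x : ℝ) :
    Tendsto (fun n : ℕ => cdf (P.map fun ω => (√(n * (p * (1 - p))))⁻¹ *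
      ∑ i ∈ range n, (b i ω - p)) x) atTop (𝓝 (cdf stdGauss x)) := by
  have hpos : 0 < p * (1 - p) := mul_pos hp0 (by linarith)
  classical
  set s := √(p * (1 - p)) with hs
  have hs0 : 0 < s := sqrt_pos.2 hpos
  have hs2 : s ^ 2 = p * (1 - p) := Real.sq_sqrt hpos.le
  have hSm : ∀ i, MeasurableSet {ω | b i ω = 1} := fun i => hm i (measurableSet_singleton 1)
  have hind : ∀ i, b i = {ω | b i ω = 1}.indicator fun _ => (1 : ℝ) := by
    intro i; ext ω
    rcases hb i ω with h | h
    · simp_all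
    simp_all
  have hmean : ∀ i, ∫ ω, b i ω ∂P = p := by
    intro i
    rw [hind i, integral_indicator (hSm i)]
    simp [Measure.real, hp i, hp0.le]
  have hint : ∀ i, Integrable (b i) P := by
    intro i; rw [hind i]; exact (integrable_const _).indicator (hSm i)
  have hlaw : ∀ i, P.map (b i) = P.map (b 0) := by
    intro i
    have key : ∀ i (A : Set ℝ), MeasurableSet A → P.map (b i) A =
        (if (1 : ℝ) ∈ A then ofReal p else 0) + (if (0 : ℝ) ∈ A then 1 - ofReal p else 0) := by
      intro i A hA
      rw [map_apply (hm i) hA]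
      have e : b i ⁻¹' A = (if (1 : ℝ) ∈ A then {ω | b i ω = 1} else ∅) ∪
          (if (0 : ℝ) ∈ A then {ω | b i ω = 1}ᶜ else ∅) := by grind
      rw [e, measure_union]
      · congr 1
        · split_ifs <;> simp [hp i]
        · split_ifs
          · rw [prob_compl_eq_one_sub (hSm i), hp i]
          · simp
      · grind
      · split_ifs
        exacts [(hSm i).compl, MeasurableSet.empty]
    ext A hA
    rw [key i A hA, key 0 A hA]
  have hid : ∀ i, IdentDistrib (b i) (b 0) P P := fun i =>
    ⟨(hm i).aemeasurable, (hm 0).aemeasurable, hlaw i⟩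
  let X : ℕ → Ω → ℝ := fun i ω => (b i ω - p) / s
  have hX0 : P[X 0] = 0 := by
    simp only [X]
    rw [integral_div, integral_sub (hint 0) (integrable_const _), hmean]
    simp
  have hX1 : P[X 0 ^ 2] = 1 := by
    have e : ∀ ω, (X 0 ^ 2) ω = ((1 - 2 * p) * b 0 ω + p ^ 2) / s ^ 2 := by
      intro ω
      simp only [X, Pi.pow_apply, div_pow]
      grind
    simp_rw [e]
    rw [integral_div, integral_add ((hint 0).const_mul _) (integrable_const _), integral_const_mul,
      hmean, hs2]
    simp only [integral_const, probReal_univ, smul_eq_mul, one_mul]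
    grind
  have hclt := tendstoInDistribution_inv_sqrt_mul_sum (P := P) (P' := stdGauss) (X := X)
    (Y := id) ⟨aemeasurable_id, Measure.map_id⟩ hX0 hX1
    (hi.comp (fun _ y => (y - p) / s) fun _ => by fun_prop)
    (fun i => (hid i).comp (u := fun y => (y - p) / s) (by fun_prop))
  have ht := hclt.tendsto
  have hfr : (stdGauss.map id) (frontier (Iic x)) = 0 := by
    rw [Measure.map_id, frontier_Iic]
    exact gaussianReal_absolutelyContinuous 0 one_ne_zero (by simp)
  have h1 := ProbabilityMeasure.tendsto_measure_of_null_frontier_of_tendsto' ht (E := Iic x) hfr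
  simp only [Measure.map_id, ProbabilityMeasure.coe_mk] at h1
  have h2 := (ENNReal.tendsto_toReal (measure_ne_top stdGauss (Iic x))).comp h1
  have hmW : ∀ n : ℕ, Measurable fun ω => (√(n * (p * (1 - p))))⁻¹ *
      ∑ i ∈ range n, (b i ω - p) := fun n =>
    (measurable_sum _ fun i _ => (hm i).sub_const p).const_mul _
  have e2 : ∀ n : ℕ, (fun ω => (√(n * (p * (1 - p))))⁻¹ * ∑ i ∈ range n, (b i ω - p)) =
      fun ω => (√n)⁻¹ * ∑ i ∈ range n, X i ω := by
    intro n; ext ω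
    simp only [X]
    rw [← Finset.sum_div, Real.sqrt_mul (Nat.cast_nonneg n), ← hs, mul_inv]
    field_simp
  have h3 : ∀ n : ℕ, cdf (P.map fun ω => (√(n * (p * (1 - p))))⁻¹ *
      ∑ i ∈ range n, (b i ω - p)) x = ((P.map fun ω => (√n)⁻¹ *
        ∑ i ∈ range n, X i ω) (Iic x)).toReal := by
    intro n
    have := isProbabilityMeasure_map (μ := P) (hmW n).aemeasurable
    rw [ProbabilityTheory.cdf_eq_real, e2 n]; rfl
  simp only [h3, ProbabilityTheory.cdf_eq_real]
  exact h2

end GaussianCoupling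

/-! ### The Rényi representation -/

section PiDensity

theorem lintegral_pi_prod_eq (μ : Measure ℝ) [SigmaFinite μ] {g : ℝ → ℝ≥0∞} (hg : Measurable g)
    (n : ℕ) (s : Fin n → Set ℝ) :
    ∫⁻ x, ∏ i, g (x i) ∂(Measure.pi fun i => μ.restrict (s i)) = ∏ i, ∫⁻ x in s i, g x ∂μ := by
  induction n with
  | zero => simp
  | succ n ih =>
    have h := (measurePreserving_piFinSuccAbove (fun i => μ.restrict (s i)) 0).symm
    rw [← h.map_eq, lintegral_map_equiv]
    simp_rw [MeasurableEquiv.piFinSuccAbove_symm_apply, Fin.insertNthEquiv,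
      Fin.prod_univ_succ, Fin.insertNth_zero, Equiv.coe_fn_mk, Fin.cons_succ,
      Fin.zero_succAbove, cast_eq, Fin.cons_zero]
    rw [← ih (fun i => s i.succ)]
    have hm : Measurable fun y : Fin n → ℝ => ∏ i, g (y i) :=
      Finset.measurable_prod _ fun i _ => hg.comp (measurable_pi_apply i)
    exact lintegral_prod_mul (μ := μ.restrict (s 0))
      (ν := Measure.pi fun i : Fin n => μ.restrict (s i.succ)) hg.aemeasurable hm.aemeasurable

theorem pi_withDensity_eq {g : ℝ → ℝ≥0∞} (hg : Measurable g) (n : ℕ)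
    [SigmaFinite ((volume : Measure ℝ).withDensity g)] :
    Measure.pi (fun _ : Fin n => (volume : Measure ℝ).withDensity g) =
      (volume : Measure (Fin n → ℝ)).withDensity fun y => ∏ i, g (y i) := by
  refine Measure.pi_eq fun s hs => ?_
  rw [withDensity_apply _ (MeasurableSet.univ_pi hs), volume_pi, Measure.restrict_pi_pi,
    lintegral_pi_prod_eq _ hg]
  simp_all

theorem map_comp_perm_pi {ι α : Type*} [Fintype ι] [MeasurableSpace α] (μ : Measure α)
    [SigmaFinite μ] (τ : Equiv.Perm ι) :
    (Measure.pi fun _ : ι => μ).map (fun y => y ∘ τ) = Measure.pi fun _ => μ := by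
  refine (Measure.pi_eq fun s hs => ?_).symm
  have hm : Measurable fun y : ι → α => y ∘ τ :=
    measurable_pi_lambda _ fun i => measurable_pi_apply _
  rw [map_apply hm (MeasurableSet.univ_pi hs)]
  have : (fun y : ι → α => y ∘ τ) ⁻¹' univ.pi s = univ.pi fun i => s (τ.symm i) := by grind
  rw [this, Measure.pi_pi]
  exact Equiv.prod_comp τ.symm (fun i => μ (s i))

end PiDensity

section Renyi

variable {n : ℕ}

/-- The entry before the `r`-th one, `0` for `r = 0`. -/
def prevVal (y : Fin n → ℝ) (r : ℕ) : ℝ := if h : 0 < r ∧ r ≤ n then y ⟨r - 1, by omega⟩ else 0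

theorem prevVal_zero (y : Fin n → ℝ) : prevVal y 0 = 0 := by simp [prevVal]

theorem prevVal_succ (y : Fin n → ℝ) (i : Fin n) : prevVal y (i + 1) = y i := by
  have : (0 < (i : ℕ) + 1 ∧ (i : ℕ) + 1 ≤ n) := ⟨by omega, i.2⟩
  simp [prevVal, this]

/-- Normalized spacings of a vector, as a linear map. -/
def spacingMap (n : ℕ) : (Fin n → ℝ) →ₗ[ℝ] (Fin n → ℝ) where
  toFun y r := ((n : ℝ) - r) * (y r - prevVal y r)
  map_add' y y' := by
    ext r
    simp only [prevVal, Pi.add_apply]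
    split_ifs <;> ring
  map_smul' c y := by
    ext r
    simp only [prevVal, Pi.smul_apply, smul_eq_mul, RingHom.id_apply]
    split_ifs <;> ring

theorem spacingMap_apply (y : Fin n → ℝ) (r : Fin n) :
    spacingMap n y r = ((n : ℝ) - r) * (y r - prevVal y r) := rfl

theorem sub_fin_pos (r : Fin n) : 0 < (n : ℝ) - r := by simp

/-- The weights are positive, so signs are those of the increments. This identifies the preimage of
the orthant, the support of the exponential density, as a cone of ordered vectors. -/
theorem spacingMap_nonneg_iff (y : Fin n → ℝ) :
    (∀ r, 0 ≤ spacingMap n y r) ↔ (∀ r, 0 ≤ y r) ∧ Monotone y := by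
  simp only [spacingMap_apply]
  have h0 : ∀ r : Fin n, 0 ≤ ((n : ℝ) - r) * (y r - prevVal y r) ↔ prevVal y r ≤ y r := fun r => by
    simp
  simp only [h0]
  constructor
  · intro h
    have hnn : ∀ (m : ℕ) (hm : m < n), 0 ≤ y ⟨m, hm⟩ := by
      intro m
      induction m with
      | zero => intro hm; simpa [prevVal_zero] using h ⟨0, hm⟩
      | succ m ih =>
        intro hm
        refine (ih (by omega)).trans ?_
        simpa [prevVal_succ y ⟨m, by omega⟩] using h ⟨m + 1, hm⟩
    refine ⟨fun r => hnn r r.2, ?_⟩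
    have hmono : ∀ (m : ℕ) (i : Fin n) (hm : i + m < n), y i ≤ y ⟨i + m, hm⟩ := by
      intro m i
      induction m with
      | zero => intro hm; rfl
      | succ m ih =>
        intro hm
        refine (ih (by omega)).trans ?_
        have := h ⟨i + m + 1, by omega⟩
        have h2 := prevVal_succ y ⟨i + m, by omega⟩
        grind
    intro i j hij
    have := hmono (j - i) i (by omega)
    grind
  · rintro ⟨h1, h2⟩ r
    rcases Nat.eq_zero_or_pos (r : ℕ) with h | h
    · rw [h, prevVal_zero]; exact h1 r
    · have : (0 < (r : ℕ) ∧ (r : ℕ) ≤ n) := ⟨h, r.2.le⟩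
      rw [prevVal, dif_pos this]
      exact h2 (by rw [Fin.le_def]; simp)

/-- Abel summation: passing from `n` to `n + 1` adds one to every weight, which contributes a
telescoping sum. -/
theorem sum_weighted_increments (Y : ℕ → ℝ) (h0 : Y 0 = 0) (n : ℕ) :
    ∑ r ∈ range n, ((n : ℝ) - r) * (Y (r + 1) - Y r) = ∑ r ∈ range n, Y (r + 1) := by
  induction n with
  | zero => simp
  | succ n ih =>
    rw [Finset.sum_range_succ (fun r => Y (r + 1)), ← ih]
    have : ∑ r ∈ range (n + 1), (((n + 1 : ℕ) : ℝ) - r) * (Y (r + 1) - Y r) =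
        ∑ r ∈ range (n + 1), ((n : ℝ) - r) * (Y (r + 1) - Y r) +
          ∑ r ∈ range (n + 1), (Y (r + 1) - Y r) := by
      rw [← Finset.sum_add_distrib]
      grind
    rw [this, Finset.sum_range_sub, Finset.sum_range_succ, h0]
    simp

theorem sum_spacingMap (y : Fin n → ℝ) : ∑ r, spacingMap n y r = ∑ r, y r := by
  have h1 : ∑ r, spacingMap n y r =
      ∑ r : Fin n, (fun m : ℕ => ((n : ℝ) - m) * (prevVal y (m + 1) - prevVal y m)) r := by
    refine sum_congr rfl fun r _ => ?_
    simp only [spacingMap_apply, prevVal_succ]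
  have h2 : ∑ r, y r = ∑ r : Fin n, (fun m : ℕ => prevVal y (m + 1)) r :=
    sum_congr rfl fun r _ => (prevVal_succ y r).symm
  rw [h1, h2,
    Fin.sum_univ_eq_sum_range (fun m : ℕ => ((n : ℝ) - m) * (prevVal y (m + 1) - prevVal y m)),
    Fin.sum_univ_eq_sum_range (fun m : ℕ => prevVal y (m + 1)),
    sum_weighted_increments _ (prevVal_zero y)]

/-- The map is triangular with positive diagonal. Nonvanishing suffices, since the Jacobian constant
is recovered later from the total mass. -/
theorem det_spacingMap_ne_zero (n : ℕ) : LinearMap.det (spacingMap n) ≠ 0 := by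
  have hinj : Function.Injective (spacingMap n) := by
    rw [← LinearMap.ker_eq_bot, LinearMap.ker_eq_bot']
    intro y hy
    have h : ∀ r, y r = prevVal y r := by
      intro r
      have := congrFun hy r
      rw [spacingMap_apply, Pi.zero_apply, mul_eq_zero] at this
      rcases this with h | h
      · exact absurd h (sub_fin_pos r).ne'
      · linarith
    have : ∀ (m : ℕ) (hm : m < n), y ⟨m, hm⟩ = 0 := by
      intro m
      induction m with
      | zero => intro hm; rw [h]; exact prevVal_zero y
      | succ m ih =>
        intro hm
        rw [h]
        exact (prevVal_succ y ⟨m, by omega⟩).trans (ih _)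
    ext r
    exact this r r.2
  have := (LinearEquiv.ofInjectiveEndo (spacingMap n) hinj).isUnit_det'
  exact this.ne_zero

theorem measurable_spacingMap (n : ℕ) : Measurable (spacingMap n) :=
  (LinearMap.continuous_of_finiteDimensional (spacingMap n)).measurable

theorem measurableSet_monotone (n : ℕ) : MeasurableSet {y : Fin n → ℝ | Monotone y} := by
  have : {y : Fin n → ℝ | Monotone y} = ⋂ i, ⋂ j, ⋂ (_ : i ≤ j), {y | y i ≤ y j} := by
    ext y; simp [Monotone]
  rw [this]
  exact MeasurableSet.iInter fun i => MeasurableSet.iInter fun j => MeasurableSet.iInter fun _ =>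
    measurableSet_le (measurable_pi_apply i) (measurable_pi_apply j)

theorem measurableSet_sort_eq (τ : Equiv.Perm (Fin n)) :
    MeasurableSet {y : Fin n → ℝ | sort y = τ} := by
  have : {y : Fin n → ℝ | sort y = τ} = {y : Fin n → ℝ | Monotone (y ∘ τ)} ∩
        ⋂ i, ⋂ j, ⋂ (_ : i < j), ({y | y (τ i) = y (τ j)}ᶜ ∪ {_y | τ i < τ j}) := by
    ext y
    simp only [mem_ofPred_eq, Set.mem_inter_iff, Set.mem_iInter, mem_union, Set.mem_compl_iff]
    rw [eq_comm, Tuple.eq_sort_iff]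
    simp only [imp_iff_not_or]
  rw [this]
  have hm : Measurable fun y : Fin n → ℝ => y ∘ τ :=
    measurable_pi_lambda _ fun i => measurable_pi_apply _
  refine (hm (measurableSet_monotone n)).inter ?_
  refine MeasurableSet.iInter fun i => MeasurableSet.iInter fun j =>
    MeasurableSet.iInter fun _ => ?_
  refine MeasurableSet.union (MeasurableSet.compl ?_) (MeasurableSet.const _)
  exact measurableSet_eq_fun (measurable_pi_apply _) (measurable_pi_apply _)

abbrev expPi (n : ℕ) : Measure (Fin n → ℝ) := Measure.pi fun _ => expMeasure 1

theorem expPi_eq (n : ℕ) : expPi n =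
    (volume : Measure (Fin n → ℝ)).withDensity fun y => ∏ i, exponentialPDF 1 (y i) := by
  have h : (volume : Measure ℝ).withDensity (exponentialPDF 1) = expMeasure 1 := rfl
  have : SigmaFinite ((volume : Measure ℝ).withDensity (exponentialPDF 1)) := by
    rw [h]; infer_instance
  exact pi_withDensity_eq (measurable_gammaPDFReal 1 1).ennreal_ofReal n

theorem measurable_exponentialPDF_prod (n : ℕ) :
    Measurable fun y : Fin n → ℝ => ∏ i, exponentialPDF 1 (y i) :=
  Finset.measurable_prod _ fun i _ =>
    (measurable_gammaPDFReal 1 1).ennreal_ofReal.comp (measurable_pi_apply i)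

theorem exponentialPDF_prod (y : Fin n → ℝ) [Decidable (∀ i, 0 ≤ y i)] :
    ∏ i, exponentialPDF 1 (y i) = if ∀ i, 0 ≤ y i then ofReal (exp (-∑ i, y i)) else 0 := by
  split_ifs with h
  · rw [← Finset.sum_neg_distrib, Real.exp_sum, ENNReal.ofReal_prod_of_nonneg
      fun i _ => (exp_pos _).le]
    refine Finset.prod_congr rfl fun i _ => ?_
    rw [exponentialPDF_eq, if_pos (h i)]
    simp
  · push Not at h
    obtain ⟨i, hi⟩ := h
    refine Finset.prod_eq_zero (Finset.mem_univ i) ?_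
    rw [exponentialPDF_eq, if_neg (not_le.2 hi)]
    simp

/-- Ties lie in finitely many hyperplanes. They must be excluded because the tie-breaking rule makes
sorting depend on the order of the entries. -/
theorem ae_injective_expPi (n : ℕ) : ∀ᵐ y ∂(expPi n), Function.Injective y := by
  rw [expPi_eq]
  refine (withDensity_absolutelyContinuous _ _).ae_le ?_
  have h : ∀ i j : Fin n, i ≠ j → ∀ᵐ y ∂(volume : Measure (Fin n → ℝ)), y i ≠ y j := by
    intro i j hij
    let L : (Fin n → ℝ) →ₗ[ℝ] ℝ := (LinearMap.proj i : (Fin n → ℝ) →ₗ[ℝ] ℝ) - LinearMap.proj j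
    have hL : L.ker ≠ ⊤ := by
      intro h
      have : (Pi.single i 1 : Fin n → ℝ) ∈ L.ker := by rw [h]; trivial
      simp [L, hij] at this
    have := Measure.addHaar_submodule (volume : Measure (Fin n → ℝ)) _ hL
    rw [ae_iff]
    convert this using 2
    ext y
    simp [L, sub_eq_zero]
  have h2 : ∀ᵐ y ∂(volume : Measure (Fin n → ℝ)), ∀ i j, i ≠ j → y i ≠ y j :=
    ae_all_iff.2 fun i => ae_all_iff.2 fun j => by simp_all
  filter_upwards [h2] with y hy i j hij
  grind

/-- The exponential density depends on the sum of the entries alone. The linear map preserves this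
sum and pulls the orthant back to the ordered cone, so only a constant Jacobian appears. -/
theorem map_spacingMap_restrict (n : ℕ) : ∃ c : ℝ≥0∞,
    ((expPi n).restrict {y | Monotone y}).map (spacingMap n) = c • expPi n := by
  classical
  refine ⟨ofReal |(LinearMap.det (spacingMap n))⁻¹|, ?_⟩
  have h1 : (expPi n).restrict {y | Monotone y} = (volume : Measure (Fin n → ℝ)).withDensity
        ((fun y => ∏ i, exponentialPDF 1 (y i)) ∘ spacingMap n) := by
    rw [expPi_eq, restrict_withDensity (measurableSet_monotone n),
      ← withDensity_indicator (measurableSet_monotone n)]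
    congr 1
    ext y
    simp only [Function.comp, indicator, exponentialPDF_prod, spacingMap_nonneg_iff,
      sum_spacingMap, mem_ofPred_eq]
    grind
  rw [h1]
  ext s hs
  rw [map_apply (measurable_spacingMap n) hs, withDensity_apply _ (measurable_spacingMap n hs)]
  have h2 := setLIntegral_map (μ := (volume : Measure (Fin n → ℝ))) hs
    (measurable_exponentialPDF_prod n) (measurable_spacingMap n)
  simp only [Function.comp]
  rw [← h2, Real.map_linearMap_volume_pi_eq_smul_volume_pi (det_spacingMap_ne_zero n),
    Measure.restrict_smul, lintegral_smul_measure, expPi_eq, Measure.smul_apply,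
    withDensity_apply _ hs]

variable {β : Type*} [MeasurableSpace β]

theorem measurable_renyi (n : ℕ) : Measurable fun x : (Fin n → ℝ) × (Fin n → β) =>
    (spacingMap n (x.1 ∘ sort x.1), x.2 ∘ sort x.1) := by
  let : MeasurableSpace (Equiv.Perm (Fin n)) := ⊤
  have hs : Measurable fun x : (Fin n → ℝ) × (Fin n → β) => (x, sort x.1) := by
    refine measurable_id.prodMk ?_
    refine measurable_to_countable' fun τ => ?_
    exact measurable_fst (measurableSet_sort_eq τ)
  have hg : Measurable fun z : ((Fin n → ℝ) × (Fin n → β)) × Equiv.Perm (Fin n) =>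
      (spacingMap n (z.1.1 ∘ z.2), z.1.2 ∘ z.2) := by
    refine measurable_from_prod_countable_left fun τ => ?_
    refine ((measurable_spacingMap n).comp ?_).prodMk ?_
    · exact measurable_pi_lambda _ fun i => (measurable_pi_apply (τ i)).comp measurable_fst
    · exact measurable_pi_lambda _ fun i => (measurable_pi_apply (τ i)).comp measurable_snd
  exact hg.comp hs

/-- **Rényi representation**, with concomitants. The normalized spacings of i.i.d. standard
exponential variables are i.i.d. standard exponential, and independent of the concomitants. -/
theorem map_renyi (n : ℕ) (lam : Measure β) [IsProbabilityMeasure lam] :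
    ((expPi n).prod (Measure.pi fun _ : Fin n => lam)).map
      (fun x => (spacingMap n (x.1 ∘ sort x.1), x.2 ∘ sort x.1)) =
      (expPi n).prod (Measure.pi fun _ : Fin n => lam) := by
  classical
  let : MeasurableSpace (Equiv.Perm (Fin n)) := ⊤
  set L := Measure.pi fun _ : Fin n => lam
  obtain ⟨c, hc⟩ := map_spacingMap_restrict n
  set Φ := fun x : (Fin n → ℝ) × (Fin n → β) =>
    (spacingMap n (x.1 ∘ sort x.1), x.2 ∘ sort x.1) with hΦdef
  have hΦ : Measurable Φ := measurable_renyi n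
  have hM := measurableSet_monotone n
  -- On the event that sorting is by `τ`, permute both vectors by `τ` inverse. The product law is
  -- invariant and the event becomes the ordered cone up to ties, so every permutation contributes
  -- the same multiple of the product law.
  have hcell : ∀ (A : Set ((Fin n → ℝ) × (Fin n → β))), MeasurableSet A →
      ∀ τ : Equiv.Perm (Fin n), ((expPi n).prod L) (Φ ⁻¹' A ∩ {x | sort x.1 = τ}) =
        c * ((expPi n).prod L) A := by
    intro A hA τ
    have hS : MeasurableSet (Φ ⁻¹' A ∩ {x | sort x.1 = τ}) :=
      (hΦ hA).inter (measurable_fst (measurableSet_sort_eq τ))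
    have hT : ∀ {γ : Type _} [MeasurableSpace γ], Measurable fun y : Fin n → γ => y ∘ τ.symm :=
      fun {γ} _ => measurable_pi_lambda _ fun i => measurable_pi_apply _
    have hT' : ∀ {γ : Type _} [MeasurableSpace γ], Measurable fun y : Fin n → γ => y ∘ τ.symm :=
      fun {γ} _ => measurable_pi_lambda _ fun i => measurable_pi_apply _
    have hmap : ((expPi n).prod L).map
        (Prod.map (fun y : Fin n → ℝ => y ∘ τ.symm) (fun v : Fin n → β => v ∘ τ.symm)) =
          (expPi n).prod L := by
      rw [← map_prod_map _ _ hT hT', map_comp_perm_pi, map_comp_perm_pi]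
    have hae : ∀ᵐ x ∂((expPi n).prod L), Function.Injective x.1 := by
      have h1 : ((expPi n).prod L).map Prod.fst = expPi n := Measure.map_fst_prod.trans (by simp)
      have := ae_injective_expPi n
      rw [← h1] at this
      exact ae_of_ae_map measurable_fst.aemeasurable this
    have hL : Measurable (Prod.map (spacingMap n) (id : (Fin n → β) → _)) :=
      (measurable_spacingMap n).prodMap measurable_id
    rw [← hmap, map_apply (hT.prodMap hT') hS]
    have : (Prod.map (fun y : Fin n → ℝ => y ∘ τ.symm) (fun v : Fin n → β => v ∘ τ.symm)) ⁻¹'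
        (Φ ⁻¹' A ∩ {x | sort x.1 = τ}) =ᵐ[(expPi n).prod L]
          (Prod.map (spacingMap n) id ⁻¹' A ∩ ({y | Monotone y} ×ˢ univ) : Set _) := by
      filter_upwards [hae] with x hx
      refine propext ?_
      change x ∈ (Prod.map (fun y : Fin n → ℝ => y ∘ τ.symm) (fun v : Fin n → β => v ∘ τ.symm)) ⁻¹'
        (Φ ⁻¹' A ∩ {x | sort x.1 = τ}) ↔
          x ∈ (Prod.map (spacingMap n) id ⁻¹' A ∩ ({y | Monotone y} ×ˢ univ) : Set _)
      have h1 : sort (x.1 ∘ τ.symm) = τ ↔ Monotone x.1 := by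
        rw [eq_comm, Tuple.eq_sort_iff]
        have e : (x.1 ∘ τ.symm) ∘ τ = x.1 := by ext; simp
        grind
      simp only [Set.mem_preimage, Set.mem_inter_iff, Prod.map, mem_ofPred_eq, h1, id,
        Set.mem_prod, Set.mem_univ, and_true, hΦdef]
      refine and_congr_left fun hmono => ?_
      rw [h1.2 hmono]
      have e : (x.1 ∘ τ.symm) ∘ τ = x.1 := by ext; simp
      have e' : (x.2 ∘ τ.symm) ∘ τ = x.2 := by ext; simp
      rw [e, e']
    rw [measure_congr this, ← Measure.restrict_apply (hL hA), ← Measure.prod_restrict,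
      Measure.restrict_univ, ← map_apply hL hA,
      ← map_prod_map _ _ (measurable_spacingMap n) measurable_id, hc, Measure.map_id,
      Measure.prod_smul_left, Measure.smul_apply, smul_eq_mul, hmap]
  have hsum : ∀ A, MeasurableSet A → ((expPi n).prod L) (Φ ⁻¹' A) =
      (Fintype.card (Equiv.Perm (Fin n)) * c) * ((expPi n).prod L) A := by
    intro A hA
    have h := sum_measure_preimage_singleton (μ := ((expPi n).prod L).restrict (Φ ⁻¹' A))
      (Finset.univ : Finset (Equiv.Perm (Fin n)))
      (f := fun x : (Fin n → ℝ) × (Fin n → β) => sort x.1)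
      (fun τ _ => measurable_fst (measurableSet_sort_eq τ))
    simp only [Finset.coe_univ, Set.preimage_univ, Measure.restrict_apply_univ] at h
    rw [← h]
    have : ∀ τ : Equiv.Perm (Fin n), (((expPi n).prod L).restrict (Φ ⁻¹' A))
        ((fun x : (Fin n → ℝ) × (Fin n → β) => sort x.1) ⁻¹' {τ}) = c * ((expPi n).prod L) A := by
      intro τ
      have hm : MeasurableSet {x : (Fin n → ℝ) × (Fin n → β) | sort x.1 = τ} :=
        measurable_fst (measurableSet_sort_eq τ)
      rw [← hcell A hA τ, Set.inter_comm, ← Measure.restrict_apply hm]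
      rfl
    simp only [this, sum_const, Finset.card_univ, nsmul_eq_mul, mul_assoc]
  -- Total mass determines the constant, so the determinant is never computed.
  have hone : (Fintype.card (Equiv.Perm (Fin n)) * c : ℝ≥0∞) = 1 := by
    have := hsum univ MeasurableSet.univ
    simpa using this.symm
  ext A hA
  simp_all

end Renyi

/-! ### Construction of the coupling -/

section Independence

/-- Rectangles are a π-system generating the σ-algebra of each pair, and on rectangles the
probability factors by the three independence assumptions. -/
theorem iIndepFun_prodMk_of_indepFun {Ω ι α β : Type*} [MeasurableSpace Ω] [MeasurableSpace α]
    [MeasurableSpace β] {P : Measure Ω} [IsProbabilityMeasure P] {X : ι → Ω → α} {Y : ι → Ω → β}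
    (hXm : ∀ i, Measurable (X i)) (hYm : ∀ i, Measurable (Y i))
    (hX : iIndepFun X P) (hY : iIndepFun Y P)
    (hXY : IndepFun (fun ω i => X i ω) (fun ω i => Y i ω) P) :
    iIndepFun (fun i ω => (X i ω, Y i ω)) P := by
  classical
  let π : ι → Set (Set Ω) := fun i =>
    {s | ∃ A B, MeasurableSet A ∧ MeasurableSet B ∧ X i ⁻¹' A ∩ Y i ⁻¹' B = s}
  refine iIndepSets.iIndep (fun i => ((hXm i).prodMk (hYm i)).comap_le) π ?_ ?_ ?_
  · rintro i _ ⟨A, B, hA, hB, rfl⟩ _ ⟨A', B', hA', hB', rfl⟩ -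
    refine ⟨A ∩ A', B ∩ B', hA.inter hA', hB.inter hB', ?_⟩
    grind
  · intro i
    rw [← generateFrom_prod, MeasurableSpace.comap_generateFrom]
    congr 1
    ext s
    constructor
    · grind
    · rintro ⟨A, B, hA, hB, rfl⟩
      exact ⟨A ×ˢ B, ⟨A, hA, B, hB, rfl⟩, by ext; simp⟩
  · rw [iIndepSets_iff]
    intro s f hf
    have hf' : ∀ i, ∃ A B, i ∈ s → (MeasurableSet A ∧ MeasurableSet B ∧
        X i ⁻¹' A ∩ Y i ⁻¹' B = f i) := by
      intro i
      by_cases hi : i ∈ s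
      · grind
      simp_all
    choose A B hAB using hf'
    have e1 : ⋂ i ∈ s, f i = ((fun ω i => X i ω) ⁻¹' (Set.pi s A)) ∩
        ((fun ω i => Y i ω) ⁻¹' (Set.pi s B)) := by
      ext ω
      simp only [Set.mem_iInter, Set.mem_inter_iff, Set.mem_preimage, Set.mem_pi, Finset.mem_coe]
      grind
    have hmA : MeasurableSet (Set.pi (s : Set ι) A) :=
      MeasurableSet.pi s.countable_toSet fun i hi => (hAB i hi).1
    have hmB : MeasurableSet (Set.pi (s : Set ι) B) :=
      MeasurableSet.pi s.countable_toSet fun i hi => (hAB i hi).2.1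
    rw [e1, hXY.measure_inter_preimage_eq_mul _ _ hmA hmB]
    have e2 : (fun ω i => X i ω) ⁻¹' (Set.pi s A) = ⋂ i ∈ s, X i ⁻¹' A i := by ext; simp
    have e3 : (fun ω i => Y i ω) ⁻¹' (Set.pi s B) = ⋂ i ∈ s, Y i ⁻¹' B i := by ext; simp
    rw [e2, e3, hX.measure_inter_preimage_eq_mul s fun i hi => (hAB i hi).1,
      hY.measure_inter_preimage_eq_mul s fun i hi => (hAB i hi).2.1, ← Finset.prod_mul_distrib]
    refine Finset.prod_congr rfl fun i hi => ?_
    rw [← (hAB i hi).2.2]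
    exact ((hXY.comp (measurable_pi_apply i) (measurable_pi_apply i)).measure_inter_preimage_eq_mul
      _ _ (hAB i hi).1 (hAB i hi).2.1).symm

theorem iIndepFun_comp_measurePreserving {Ω Ω' ι α : Type*} [MeasurableSpace Ω]
    [MeasurableSpace Ω'] [MeasurableSpace α] {P : Measure Ω} {P' : Measure Ω'}
    [IsProbabilityMeasure P] [IsProbabilityMeasure P'] {π : Ω' → Ω} (hπ : MeasurePreserving π P' P)
    {X : ι → Ω → α} (hXm : ∀ i, Measurable (X i)) (hX : iIndepFun X P) :
    iIndepFun (fun i ω => X i (π ω)) P' := by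
  have hc : ∀ i, Measurable fun ω => X i (π ω) := fun i => (hXm i).comp hπ.measurable
  rw [iIndepFun_iff_map_fun_eq_infinitePi_map hc]
  have h1 := hX.map_fun_eq_infinitePi_map hXm
  have hm : Measurable fun ω i => X i ω := measurable_pi_lambda _ hXm
  have h2 : P'.map (fun ω i => X i (π ω)) = P.map fun ω i => X i ω := by
    rw [← hπ.map_eq, Measure.map_map hm hπ.measurable]; rfl
  rw [h2, h1]
  congr 1
  ext1 i
  rw [← hπ.map_eq, Measure.map_map (hXm i) hπ.measurable]; rfl

section FourFold

variable {Ω A B C D : Type*} [MeasurableSpace Ω] [MeasurableSpace A] [MeasurableSpace B]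
  [MeasurableSpace C] [MeasurableSpace D] {P : Measure Ω}
  {α : Measure A} {β : Measure B} {γ : Measure C} {δ : Measure D}
  [IsProbabilityMeasure α] [IsProbabilityMeasure β] [IsProbabilityMeasure γ]
  [IsProbabilityMeasure δ]

theorem measure_prod_four {S : Set (A × C)} {T : Set (B × D)} (hS : MeasurableSet S)
    (hT : MeasurableSet T) :
    ((α.prod β).prod (γ.prod δ)) ({x | (x.1.1, x.2.1) ∈ S} ∩ {x | (x.1.2, x.2.2) ∈ T}) =
      (α.prod γ) S * (β.prod δ) T := by
  have hm1 : Measurable fun x : (A × B) × (C × D) => (x.1.1, x.2.1) := by fun_prop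
  have hm2 : Measurable fun x : (A × B) × (C × D) => (x.1.2, x.2.2) := by fun_prop
  have hm : MeasurableSet ({x : (A × B) × (C × D) | (x.1.1, x.2.1) ∈ S} ∩
      {x | (x.1.2, x.2.2) ∈ T}) := (hm1 hS).inter (hm2 hT)
  rw [prod_apply hm, prod_apply hS, prod_apply hT,
    ← lintegral_prod_mul (measurable_measure_prodMk_left hS).aemeasurable
      (measurable_measure_prodMk_left hT).aemeasurable]
  refine lintegral_congr fun x => ?_
  rw [← prod_prod]
  congr 1

/-- Regrouping of four independent blocks. Blocks one and three will be the spacings and spare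
exponentials that form `E`; two and four the marks and the spare uniform variable that form `N`. -/
theorem fourfold_of_map_eq {Ψ : Ω → (A × B) × (C × D)} (hΨ : Measurable Ψ)
    (h : P.map Ψ = (α.prod β).prod (γ.prod δ)) :
    P.map (fun ω => ((Ψ ω).1.1, (Ψ ω).2.1)) = α.prod γ ∧
      P.map (fun ω => ((Ψ ω).1.2, (Ψ ω).2.2)) = β.prod δ ∧
      IndepFun (fun ω => ((Ψ ω).1.1, (Ψ ω).2.1)) (fun ω => ((Ψ ω).1.2, (Ψ ω).2.2)) P := by
  have hm1 : Measurable fun ω => ((Ψ ω).1.1, (Ψ ω).2.1) := by fun_prop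
  have hm2 : Measurable fun ω => ((Ψ ω).1.2, (Ψ ω).2.2) := by fun_prop
  have key : ∀ S T, MeasurableSet S → MeasurableSet T →
      P ((fun ω => ((Ψ ω).1.1, (Ψ ω).2.1)) ⁻¹' S ∩ (fun ω => ((Ψ ω).1.2, (Ψ ω).2.2)) ⁻¹' T) =
        (α.prod γ) S * (β.prod δ) T := by
    intro S T hS hT
    rw [← measure_prod_four hS hT, ← h, map_apply hΨ]
    · rfl
    · have hm1 : Measurable fun x : (A × B) × (C × D) => (x.1.1, x.2.1) := by fun_prop
      have hm2 : Measurable fun x : (A × B) × (C × D) => (x.1.2, x.2.2) := by fun_prop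
      exact (hm1 hS).inter (hm2 hT)
  have h1 : P.map (fun ω => ((Ψ ω).1.1, (Ψ ω).2.1)) = α.prod γ := by
    ext S hS
    rw [map_apply hm1 hS]
    simpa using key S univ hS MeasurableSet.univ
  have h2 : P.map (fun ω => ((Ψ ω).1.2, (Ψ ω).2.2)) = β.prod δ := by
    ext S hS
    rw [map_apply hm2 hS]
    simpa using key univ S MeasurableSet.univ hS
  refine ⟨h1, h2, ?_⟩
  rw [indepFun_iff_measure_inter_preimage_eq_mul]
  intro S T hS hT
  rw [key S T hS hT, ← h1, ← h2, map_apply hm1 hS, map_apply hm2 hT]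

end FourFold

end Independence

/-! ### Completing the `n` spacings to an infinite sequence -/

section Splice

/-- Replace the entries `1, …, n` of a sequence by a vector, in reverse order. -/
def splice (n : ℕ) (x : (Fin n → ℝ) × (ℕ → ℝ)) (j : ℕ) : ℝ :=
  if h : 1 ≤ j ∧ j ≤ n then x.1 ⟨n - j, by omega⟩ else x.2 j

theorem measurable_splice (n : ℕ) : Measurable (splice n) := by
  refine measurable_pi_lambda _ fun j => ?_
  by_cases h : 1 ≤ j ∧ j ≤ n
  · simp only [splice, h, and_self, dite_true]; fun_prop
  · simp only [splice, h, dite_false]; fun_prop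

/-- Checked on cylinders, each of which splits into the part with indices in `[1, n]`, read from the
vector, and the rest. The index `j` uses position `n - j`, whose spacing has weight `j`. -/
theorem map_splice (n : ℕ) :
    ((expPi n).prod (infinitePi fun _ : ℕ => expMeasure 1)).map (splice n) =
      infinitePi fun _ : ℕ => expMeasure 1 := by
  classical
  refine Measure.eq_infinitePi _ fun s t ht => ?_
  rw [map_apply (measurable_splice n) (MeasurableSet.pi s.countable_toSet fun i _ => ht i)]
  have e : splice n ⁻¹' (Set.pi s t) =
      (univ.pi fun r : Fin n => if n - (r : ℕ) ∈ s then t (n - r) else univ) ×ˢ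
        (Set.pi (s.filter fun j => ¬ (1 ≤ j ∧ j ≤ n) : Finset ℕ) t) := by
    ext x
    simp only [Set.mem_preimage, Set.mem_pi, Finset.mem_coe, Set.mem_prod, Set.mem_univ,
      true_implies, mem_filter]
    constructor
    · intro h
      refine ⟨fun r => ?_, fun j hj => ?_⟩
      · split_ifs with hr
        · have := h _ hr
          have hr2 := r.2
          have h1 : 1 ≤ n - (r : ℕ) ∧ n - (r : ℕ) ≤ n := ⟨by omega, by omega⟩
          rw [splice, dif_pos h1] at this
          grind
        · trivial
      · have := h j hj.1
        rwa [splice, dif_neg hj.2] at this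
    · rintro ⟨h1, h2⟩ j hj
      by_cases hjn : 1 ≤ j ∧ j ≤ n
      · rw [splice, dif_pos hjn]
        grind
      · rw [splice, dif_neg hjn]
        exact h2 j ⟨hj, hjn⟩
  rw [e, prod_prod, Measure.pi_pi, Measure.infinitePi_pi _ fun i _ => ht i,
    ← Finset.prod_filter_mul_prod_filter_not s fun j => 1 ≤ j ∧ j ≤ n]
  congr 1
  have h1 : ∀ r : Fin n, expMeasure 1 (if n - (r : ℕ) ∈ s then t (n - r) else univ) =
      if n - (r : ℕ) ∈ s then expMeasure 1 (t (n - r)) else 1 := by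
    intro r; split_ifs <;> simp
  simp only [h1]
  rw [← Finset.prod_filter]
  refine Finset.prod_bij (fun r _ => n - (r : ℕ)) ?_ ?_ ?_ ?_
  · grind
  · omega
  · intro j hj
    simp only [mem_filter] at hj
    refine ⟨⟨n - j, by omega⟩, ?_, ?_⟩
    · grind
    · simp only; omega
  · intros; rfl

end Splice

section Bernoulli

open unitInterval

def bern (p : ℝ) (v : I) : ℝ := if (v : ℝ) ≤ p then 1 else 0

theorem measurable_bern (p : ℝ) : Measurable (bern p) :=
  Measurable.ite (measurableSet_le measurable_subtype_coe measurable_const) measurable_const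
    measurable_const

theorem volume_coe_le {p : ℝ} (h0 : 0 ≤ p) (h1 : p ≤ 1) :
    (volume : Measure I) {v | (v : ℝ) ≤ p} = ofReal p := by
  rw [← volume_Iic ⟨p, h0, h1⟩]
  rfl

/-- Standardized sum of the indicators of `u i ≤ p`. -/
def bernSum (p : ℝ) (k : ℕ) (u : Fin k → I) : ℝ :=
  (√(k * (p * (1 - p))))⁻¹ * ∑ i, (bern p (u i) - p)

theorem measurable_bernSum (p : ℝ) (k : ℕ) : Measurable (bernSum p k) :=
  (measurable_sum _ fun i _ =>
    ((measurable_bern p).comp (measurable_pi_apply i)).sub_const p).const_mul _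

def bernLaw (p : ℝ) (k : ℕ) : Measure ℝ :=
  (Measure.pi fun _ : Fin k => (volume : Measure I)).map (bernSum p k)

instance (p : ℝ) (k : ℕ) : IsProbabilityMeasure (bernLaw p k) :=
  isProbabilityMeasure_map (measurable_bernSum p k).aemeasurable

theorem tendsto_cdf_bernLaw {p : ℝ} (hp0 : 0 < p) (hp1 : p < 1) (x : ℝ) :
    Tendsto (fun k => cdf (bernLaw p k) x) atTop (𝓝 (cdf stdGauss x)) := by
  have h := tendsto_cdf_bernoulli_sum (P := infinitePi fun _ : ℕ => (volume : Measure I))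
    hp0 hp1 (b := fun i v => bern p (v i))
    (fun i => (measurable_bern p).comp (measurable_pi_apply i))
    (iIndepFun_infinitePi (X := fun _ => bern p) fun _ => measurable_bern p)
    (fun i v => by by_cases h : (v i : ℝ) ≤ p <;> simp [bern, h])
    (fun i => by
      have : {v : ℕ → I | bern p (v i) = 1} = (fun v : ℕ → I => v i) ⁻¹' {v | (v : ℝ) ≤ p} := by
        ext v; by_cases h : (v i : ℝ) ≤ p <;> simp [bern, h]
      rw [this, ← map_apply (measurable_pi_apply i)
        (measurableSet_le measurable_subtype_coe measurable_const), Measure.infinitePi_map_eval,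
        volume_coe_le hp0.le hp1.le]) x
  refine h.congr fun k => ?_
  congr 2
  rw [bernLaw, ← Measure.infinitePi_eq_pi,
    ← Measure.map_infinitePi_infinitePi_of_inj (P := fun _ : ℕ => (volume : Measure I))
      (f := fun i : Fin k => (i : ℕ)) Fin.val_injective,
    Measure.map_map (measurable_bernSum p k) (by fun_prop)]
  congr 1
  ext v
  simp only [Function.comp, bernSum]
  rw [Fin.sum_univ_eq_sum_range (fun i => bern p (v i) - p)]

end Bernoulli

open unitInterval in
/-- An i.i.d. sequence of pairs of a standard exponential and an independent uniform variable. -/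
structure IsIidExpUnif {Ω : Type*} [MeasurableSpace Ω] (P : Measure Ω) (y : ℕ → Ω → ℝ)
    (v : ℕ → Ω → I) : Prop where
  meas_fst : ∀ i, Measurable (y i)
  meas_snd : ∀ i, Measurable (v i)
  indep : iIndepFun (fun i ω => (y i ω, v i ω)) P
  law : ∀ i, P.map (fun ω => (y i ω, v i ω)) = (expMeasure 1).prod (volume : Measure I)

/-! ### Redrawing continuous variables from discrete data -/

section Redraw

open unitInterval

/-- Each datum, with a uniform variable of its own, yields a draw from `ν` conditioned on having
that datum as image. Since the data have the law of the image of `ν`, the draws are unconditionally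
i.i.d. with law `ν`, while their images are still the data. -/
theorem exists_redraw {Ω β : Type*} [MeasurableSpace Ω] [MeasurableSpace β]
    [StandardBorelSpace β] [Nonempty β] (P : Measure Ω) [IsProbabilityMeasure P]
    {D : ℕ → Ω → ℕ × Bool} (hDm : ∀ i, Measurable (D i)) (hD : iIndepFun D P)
    (hDid : ∀ i, P.map (D i) = P.map (D 0)) (ν : Measure β) [IsProbabilityMeasure ν]
    {f : β → ℕ × Bool} (hf : Measurable f) (hlaw : ν.map f = P.map (D 0)) :
    ∃ g : ℕ × Bool → I → β, Measurable (uncurry g) ∧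
      iIndepFun (fun i (ω : Ω × (ℕ → I)) => g (D i ω.1) (ω.2 i))
        (P.prod (infinitePi fun _ : ℕ => (volume : Measure I))) ∧
      (∀ i, (P.prod (infinitePi fun _ : ℕ => (volume : Measure I))).map
        (fun ω => g (D i ω.1) (ω.2 i)) = ν) ∧
      ∀ᵐ ω ∂(P.prod (infinitePi fun _ : ℕ => (volume : Measure I))),
        ∀ i, f (g (D i ω.1) (ω.2 i)) = D i ω.1 := by
  obtain ⟨g, hgm, hg⟩ := exists_transfer ν hf
  set L := infinitePi fun _ : ℕ => (volume : Measure I)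
  have hfst : MeasurePreserving (Prod.fst : Ω × (ℕ → I) → Ω) (P.prod L) P := measurePreserving_fst
  have hsnd : MeasurePreserving (Prod.snd : Ω × (ℕ → I) → _) (P.prod L) L := measurePreserving_snd
  have hD' : iIndepFun (fun i (ω : Ω × (ℕ → I)) => D i ω.1) (P.prod L) :=
    iIndepFun_comp_measurePreserving hfst hDm hD
  have hA : iIndepFun (fun i (ω : Ω × (ℕ → I)) => ω.2 i) (P.prod L) :=
    iIndepFun_comp_measurePreserving hsnd (X := fun i (a : ℕ → I) => a i)
      (fun i => measurable_pi_apply i)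
      (iIndepFun_infinitePi (X := fun _ => id) fun _ => measurable_id)
  have hpair : iIndepFun (fun i (ω : Ω × (ℕ → I)) => (D i ω.1, ω.2 i)) (P.prod L) := by
    refine iIndepFun_prodMk_of_indepFun (fun i => (hDm i).comp measurable_fst)
      (fun i => (measurable_pi_apply i).comp measurable_snd) hD' hA ?_
    exact indepFun_prod (X := fun ω i => D i ω) (Y := fun a : ℕ → I => a)
      (measurable_pi_lambda _ hDm) measurable_id
  have hpm : ∀ i, Measurable fun ω : Ω × (ℕ → I) => (D i ω.1, ω.2 i) := fun i =>
    ((hDm i).comp measurable_fst).prodMk ((measurable_pi_apply i).comp measurable_snd)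
  have hplaw : ∀ i, (P.prod L).map (fun ω : Ω × (ℕ → I) => (D i ω.1, ω.2 i)) =
      (ν.map f).prod (volume : Measure I) := by
    intro i
    have := map_prod_map P L (hDm i) (measurable_pi_apply i)
    rw [Measure.infinitePi_map_eval, hDid, ← hlaw] at this
    exact this.symm
  have hgm' : Measurable fun x : (ℕ × Bool) × I => (x.1, g x.1 x.2) := measurable_fst.prodMk hgm
  have hfb : Measurable fun b => (f b, b) := hf.prodMk measurable_id
  refine ⟨g, hgm, hpair.comp (fun _ => uncurry g) fun _ => hgm, fun i => ?_, ?_⟩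
  · have h1 := congrArg (Measure.map Prod.snd) hg
    rw [Measure.map_map measurable_snd hgm', Measure.map_map measurable_snd hfb, ← hplaw i,
      Measure.map_map (measurable_snd.comp hgm') (hpm i)] at h1
    simpa [Function.comp_def, Measure.map_id'] using h1
  · rw [ae_all_iff]
    intro i
    have hS : MeasurableSet {x : (ℕ × Bool) × β | f x.2 = x.1} := by
      have : {x : (ℕ × Bool) × β | f x.2 = x.1} = ⋃ a : ℕ × Bool, ({a} ×ˢ (f ⁻¹' {a})) := by
        ext ⟨a, b⟩
        simp
      rw [this]
      exact MeasurableSet.iUnion fun a => (measurableSet_singleton a).prod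
        (hf (measurableSet_singleton a))
    have h1 : ∀ᵐ x ∂(ν.map fun b => (f b, b)), f x.2 = x.1 := by
      rw [ae_map_iff hfb.aemeasurable hS]
      simp
    rw [← hg, ← hplaw i, Measure.map_map hgm' (hpm i)] at h1
    exact ae_of_ae_map (hgm'.comp (hpm i)).aemeasurable h1

end Redraw

section Representation

open unitInterval

variable {Ω : Type*} [MeasurableSpace Ω] {P : Measure Ω} [IsProbabilityMeasure P]
  {y : ℕ → Ω → ℝ} {v : ℕ → Ω → I}

theorem IsIidExpUnif.map_fin (h : IsIidExpUnif P y v) (n : ℕ) :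
    P.map (fun ω => ((fun i : Fin n => y i ω), fun i : Fin n => v i ω)) =
      (expPi n).prod (Measure.pi fun _ : Fin n => (volume : Measure I)) := by
  have hm : ∀ i : Fin n, Measurable fun ω => (y i ω, v i ω) := fun i =>
    (h.meas_fst i).prodMk (h.meas_snd i)
  have h1 := (iIndepFun.precomp (g := fun i : Fin n => (i : ℕ)) Fin.val_injective
    h.indep).map_fun_eq_pi_map fun i => (hm i).aemeasurable
  simp only [h.law] at h1
  rw [← (measurePreserving_arrowProdEquivProdArrow ℝ I (Fin n) (fun _ => expMeasure 1)
    (fun _ => volume)).map_eq, ← h1, Measure.map_map (MeasurableEquiv.measurable _)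
      (measurable_pi_lambda _ hm)]
  rfl

/-- Summing the spacings back: position `n - j` carries weight `j`, so `E_j/j` is the gap between
consecutive order statistics. The induction starts at the smallest one, whose predecessor is `0` by
convention. -/
theorem orderStat_eq_tailSum {z : ℕ → ℝ} {n : ℕ} {Ω : Type*} {E : ℕ → Ω → ℝ} {ω : Ω}
    (hE : ∀ j (h : 1 ≤ j ∧ j ≤ n), E j ω = spacingMap n ((fun i : Fin n => z i) ∘
      sort fun i : Fin n => z i) ⟨n - j, by omega⟩) :
    ∀ j ∈ Icc 1 n, orderStat z n (n - j + 1) = tailSum E n j ω := by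
  set x : Fin n → ℝ := (fun i : Fin n => z i) ∘ sort fun i : Fin n => z i with hx
  have hos : ∀ m (hm : m < n), orderStat z n (m + 1) = x ⟨m, hm⟩ := by
    intro m hm
    have : m + 1 - 1 < n := by omega
    simp only [orderStat, orderIndex, dif_pos this, hx, Function.comp]
    rfl
  have key : ∀ m j, j + m = n → 1 ≤ j → orderStat z n (n - j + 1) = tailSum E n j ω := by
    intro m
    induction m with
    | zero =>
      intro j hj h1
      have hjn : 1 ≤ j ∧ j ≤ n := ⟨h1, by omega⟩
      have hj0 : (j : ℝ) ≠ 0 := by positivity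
      rw [tailSum_succ (by omega), hE j hjn, spacingMap_apply, hos (n - j) (by omega)]
      have e0 : n - j = 0 := by omega
      have e1 : tailSum E n (j + 1) ω = 0 := by
        rw [tailSum, Finset.Icc_eq_empty (by omega), Finset.sum_empty]
      have e2 : (n : ℝ) - ((n - j : ℕ) : ℝ) = j := by simp_all
      simp only [e1, add_zero, e2]
      rw [mul_div_cancel_left₀ _ hj0]
      simp only [e0, prevVal_zero, sub_zero]
    | succ m ih =>
      intro j hj h1
      have hjn : 1 ≤ j ∧ j ≤ n := ⟨h1, by omega⟩
      have hj0 : (j : ℝ) ≠ 0 := by positivity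
      rw [tailSum_succ (by omega), hE j hjn, spacingMap_apply, hos (n - j) (by omega),
        ← ih (j + 1) (by omega) (by omega)]
      have e2 : (n : ℝ) - ((n - j : ℕ) : ℝ) = j := by simp_all
      simp only [e2]
      rw [mul_div_cancel_left₀ _ hj0, hos (n - (j + 1)) (by omega)]
      have e3 := prevVal_succ x ⟨n - (j + 1), by omega⟩
      grind
  intro j hj
  rw [mem_Icc] at hj
  exact key (n - j) j (by omega) hj.1

/-- `N` is computed from marks and the spare uniform variable, `E` from spacings and spare
exponentials; independence of the blocks is independence of `N` and `E`. -/
theorem exists_of_blocks {Ω' : Type*} [MeasurableSpace Ω'] {P' : Measure Ω'}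
    (p : ℝ) {k n : ℕ} {g : Fin k → Fin n} (hg : Function.Injective g)
    {h : ℝ → I → ℝ} (hh : Measurable (uncurry h))
    {Ψ : Ω' → ((Fin n → ℝ) × (Fin n → I)) × ((ℕ → ℝ) × I)} (hΨ : Measurable Ψ)
    (hlaw : P'.map Ψ = ((expPi n).prod (Measure.pi fun _ : Fin n => (volume : Measure I))).prod
      ((infinitePi fun _ : ℕ => expMeasure 1).prod volume)) :
    ∃ (E : ℕ → Ω' → ℝ) (W N : Ω' → ℝ), IsIidExp P' E ∧ Measurable N ∧
      P'.map N = ((bernLaw p k).prod volume).map (uncurry h) ∧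
      IndepFun N (fun ω j => E j ω) P' ∧
      (∀ δ, P' {ω | δ ≤ |N ω - W ω|} = ((bernLaw p k).prod volume) {x | δ ≤ |h x.1 x.2 - x.1|}) ∧
      (∀ ω j (hj : 1 ≤ j ∧ j ≤ n), E j ω = (Ψ ω).1.1 ⟨n - j, by omega⟩) ∧
      ∀ ω, W ω = bernSum p k fun i => (Ψ ω).1.2 (g i) := by
  obtain ⟨f1, f2, f3⟩ := fourfold_of_map_eq hΨ hlaw
  have hgm : Measurable fun (w : Fin n → I) (i : Fin k) => w (g i) :=
    measurable_pi_lambda _ fun i => measurable_pi_apply _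
  have hS : Measurable fun w : Fin n → I => bernSum p k fun i => w (g i) :=
    (measurable_bernSum p k).comp hgm
  have hSlaw : (Measure.pi fun _ : Fin n => (volume : Measure I)).map
      (fun w => bernSum p k fun i => w (g i)) = bernLaw p k := by
    have := Measure.map_infinitePi_infinitePi_of_inj (P := fun _ : Fin n => (volume : Measure I)) hg
    rw [Measure.infinitePi_eq_pi, Measure.infinitePi_eq_pi] at this
    rw [bernLaw, ← this, Measure.map_map (measurable_bernSum p k) hgm]
    rfl
  have hΨ1 : Measurable fun ω => ((Ψ ω).1.1, (Ψ ω).2.1) := by fun_prop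
  have hΨ2 : Measurable fun ω => ((Ψ ω).1.2, (Ψ ω).2.2) := by fun_prop
  have hQ : Measurable fun x : (Fin n → I) × I => (bernSum p k (fun i => x.1 (g i)), x.2) :=
    hS.prodMap measurable_id
  have hWU : P'.map (fun ω => (bernSum p k (fun i => (Ψ ω).1.2 (g i)), (Ψ ω).2.2)) =
      (bernLaw p k).prod volume := by
    have h1 := congrArg
      (Measure.map fun x : (Fin n → I) × I => (bernSum p k (fun i => x.1 (g i)), x.2)) f2
    rw [Measure.map_map hQ hΨ2] at h1
    refine h1.trans ?_
    have := map_prod_map (Measure.pi fun _ : Fin n => (volume : Measure I))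
      (volume : Measure I) hS measurable_id
    rw [hSlaw, Measure.map_id] at this
    exact this.symm
  have hWUm : Measurable fun ω => (bernSum p k (fun i => (Ψ ω).1.2 (g i)), (Ψ ω).2.2) := hQ.comp hΨ2
  have hE1 : Measurable fun ω j => splice n ((Ψ ω).1.1, (Ψ ω).2.1) j :=
    (measurable_splice n).comp hΨ1
  have hEm : ∀ j, Measurable fun ω => splice n ((Ψ ω).1.1, (Ψ ω).2.1) j :=
    fun j => (measurable_pi_apply j).comp hE1
  have hElaw : P'.map (fun ω j => splice n ((Ψ ω).1.1, (Ψ ω).2.1) j) =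
      infinitePi fun _ : ℕ => expMeasure 1 := by
    have h1 := congrArg (Measure.map (splice n)) f1
    rw [Measure.map_map (measurable_splice n) hΨ1, map_splice] at h1
    exact h1
  have hElaw' : ∀ j, P'.map (fun ω => splice n ((Ψ ω).1.1, (Ψ ω).2.1) j) = expMeasure 1 := by
    intro j
    have h1 := congrArg (Measure.map fun x : ℕ → ℝ => x j) hElaw
    rw [Measure.map_map (measurable_pi_apply j) hE1, Measure.infinitePi_map_eval] at h1
    exact h1
  have hprob : IsProbabilityMeasure P' := by
    constructor
    have h1 := congrArg (fun μ => μ univ) (hElaw' 0)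
    simp only [map_apply (hEm 0) MeasurableSet.univ, Set.preimage_univ, measure_univ] at h1
    exact h1
  refine ⟨fun j ω => splice n ((Ψ ω).1.1, (Ψ ω).2.1) j,
    fun ω => bernSum p k fun i => (Ψ ω).1.2 (g i),
    fun ω => h (bernSum p k fun i => (Ψ ω).1.2 (g i)) (Ψ ω).2.2, ⟨hEm, hElaw', ?_⟩,
    hh.comp hWUm, ?_, ?_, fun δ => ?_, fun ω j hj => ?_, fun ω => rfl⟩
  · rw [iIndepFun_iff_map_fun_eq_infinitePi_map hEm, hElaw]
    simp only [hElaw']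
  · rw [← hWU, Measure.map_map hh hWUm]
    rfl
  · exact (f3.comp (measurable_splice n) (hh.comp hQ)).symm
  · have hS : MeasurableSet {x : ℝ × I | δ ≤ |h x.1 x.2 - x.1|} :=
      measurableSet_le measurable_const (Measurable.abs (hh.sub measurable_fst))
    rw [← hWU, map_apply hWUm hS]
    rfl
  · simp only [splice, dif_pos hj]

theorem IsIidExpUnif.exists_blocks (hyv : IsIidExpUnif P y v) (n : ℕ)
    {Ω₂ : Type*} [MeasurableSpace Ω₂] (Q : Measure Ω₂) [IsProbabilityMeasure Q] :
    ∃ Ψ : Ω × Ω₂ → ((Fin n → ℝ) × (Fin n → I)) × Ω₂, Measurable Ψ ∧ (P.prod Q).map Ψ =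
        ((expPi n).prod (Measure.pi fun _ : Fin n => (volume : Measure I))).prod Q ∧
      ∀ ω, (Ψ ω).1.1 = spacingMap n ((fun i : Fin n => y i ω.1) ∘ sort fun i : Fin n => y i ω.1) ∧
        (Ψ ω).1.2 = (fun i : Fin n => v i ω.1) ∘ sort fun i : Fin n => y i ω.1 := by
  have hA : Measurable fun ω => ((fun i : Fin n => y i ω), fun i : Fin n => v i ω) :=
    (measurable_pi_lambda (fun ω (i : Fin n) => y i ω) fun i => hyv.meas_fst i).prodMk
      (measurable_pi_lambda (fun ω (i : Fin n) => v i ω) fun i => hyv.meas_snd i)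
  have hR := measurable_renyi (β := I) n
  have h1 : P.map ((fun x : (Fin n → ℝ) × (Fin n → I) =>
      (spacingMap n (x.1 ∘ sort x.1), x.2 ∘ sort x.1)) ∘
        fun ω => ((fun i : Fin n => y i ω), fun i : Fin n => v i ω)) =
      (expPi n).prod (Measure.pi fun _ : Fin n => (volume : Measure I)) := by
    rw [← Measure.map_map hR hA, hyv.map_fin n]
    exact map_renyi n _
  refine ⟨Prod.map ((fun x : (Fin n → ℝ) × (Fin n → I) =>
      (spacingMap n (x.1 ∘ sort x.1), x.2 ∘ sort x.1)) ∘
        fun ω => ((fun i : Fin n => y i ω), fun i : Fin n => v i ω)) id,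
    (hR.comp hA).prodMap measurable_id, ?_, fun ω => ⟨rfl, rfl⟩⟩
  rw [← map_prod_map _ _ (hR.comp hA) measurable_id, h1, Measure.map_id]

/-- On a product with an i.i.d. exponential sequence and a uniform variable, the order statistics
are represented by an i.i.d. exponential sequence, independent of the concomitants. -/
theorem IsIidExpUnif.exists_representation (hyv : IsIidExpUnif P y v) (p : ℝ) {k n : ℕ}
    (hkn : k ≤ n) {h : ℝ → I → ℝ} (hh : Measurable (uncurry h)) :
    ∃ (E : ℕ → Ω × ((ℕ → ℝ) × I) → ℝ) (W N : Ω × ((ℕ → ℝ) × I) → ℝ),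
      IsIidExp (P.prod ((infinitePi fun _ : ℕ => expMeasure 1).prod volume)) E ∧
      Measurable N ∧
      (P.prod ((infinitePi fun _ : ℕ => expMeasure 1).prod volume)).map N =
        ((bernLaw p k).prod volume).map (uncurry h) ∧
      IndepFun N (fun ω j => E j ω) (P.prod ((infinitePi fun _ : ℕ => expMeasure 1).prod volume)) ∧
      (∀ δ, (P.prod ((infinitePi fun _ : ℕ => expMeasure 1).prod volume))
        {ω | δ ≤ |N ω - W ω|} = ((bernLaw p k).prod volume) {x | δ ≤ |h x.1 x.2 - x.1|}) ∧
      (∀ ω, ∀ j ∈ Icc 1 n, orderStat (fun i => y i ω.1) n (n - j + 1) = tailSum E n j ω) ∧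
      ∀ ω, W ω = (√(k * (p * (1 - p))))⁻¹ * ∑ j ∈ Icc 1 k,
        (bern p (v (orderIndex (fun i => y i ω.1) n (n - j + 1)) ω.1) - p) := by
  obtain ⟨Ψ, hΨ, hlaw, hval⟩ := hyv.exists_blocks n
    ((infinitePi fun _ : ℕ => expMeasure 1).prod (volume : Measure I))
  have hg : Function.Injective fun i : Fin k => (⟨n - 1 - i, by have := i.2; omega⟩ : Fin n) := by
    intro i j hij
    grind
  obtain ⟨E, W, N, h1, h2, h3, h4, h5, h6, h7⟩ := exists_of_blocks p hg hh hΨ hlaw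
  refine ⟨E, W, N, h1, h2, h3, h4, h5, fun ω => ?_, fun ω => ?_⟩
  · refine orderStat_eq_tailSum fun j hj => ?_
    rw [h6 ω j hj, (hval ω).1]
  · rw [h7, bernSum, (hval ω).2]
    congr 1
    refine Finset.sum_bij (fun i _ => (i : ℕ) + 1) ?_ ?_ ?_ ?_
    · simp
    · omega
    · intro j hj
      rw [mem_Icc] at hj
      exact ⟨⟨j - 1, by omega⟩, Finset.mem_univ _, by simp only; omega⟩
    · intro i _
      have := i.2
      have e2 : n - ((i : ℕ) + 1) + 1 - 1 = n - 1 - i := by omega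
      have e3 : n - 1 - (i : ℕ) < n := by omega
      simp only [orderIndex, Function.comp, e2, dif_pos e3]

end Representation

section Coupling

open unitInterval

theorem IsIidExpUnif.comp_measurePreserving {Ω Ω' : Type*} [MeasurableSpace Ω] [MeasurableSpace Ω']
    {P : Measure Ω} {P' : Measure Ω'} [IsProbabilityMeasure P] [IsProbabilityMeasure P']
    {π : Ω' → Ω} (hπ : MeasurePreserving π P' P) {y : ℕ → Ω → ℝ} {v : ℕ → Ω → I}
    (h : IsIidExpUnif P y v) :
    IsIidExpUnif P' (fun i ω => y i (π ω)) (fun i ω => v i (π ω)) where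
  meas_fst i := (h.meas_fst i).comp hπ.measurable
  meas_snd i := (h.meas_snd i).comp hπ.measurable
  indep := iIndepFun_comp_measurePreserving hπ
    (fun i => (h.meas_fst i).prodMk (h.meas_snd i)) h.indep
  law i := by
    rw [← h.law i, ← hπ.map_eq,
      Measure.map_map ((h.meas_fst i).prodMk (h.meas_snd i)) hπ.measurable]
    rfl

/-- On a countable space it is enough to compare points. The points with flag `true` are the
hypothesis `hpc`, and those with flag `false` follow by subtraction from the law of the first
coordinate. -/
theorem map_cell_eq {Ω : Type*} [MeasurableSpace Ω] {P : Measure Ω} [IsProbabilityMeasure P]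
    {D : Ω → ℕ × Bool} (hD : Measurable D) {cy : ℝ → ℕ} (hcy : Measurable cy) {pc : ℕ → ℝ}
    (hpc0 : ∀ m, 0 ≤ pc m) (hpc1 : ∀ m, pc m ≤ 1)
    (hlaw : ∀ m, P {ω | (D ω).1 = m} = expMeasure 1 {x | cy x = m})
    (hpc : ∀ m, P {ω | D ω = (m, true)} = ofReal (pc m) * P {ω | (D ω).1 = m}) :
    Measurable (fun x : ℝ × I => (cy x.1, decide ((x.2 : ℝ) ≤ pc (cy x.1)))) ∧
      ((expMeasure 1).prod (volume : Measure I)).map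
        (fun x : ℝ × I => (cy x.1, decide ((x.2 : ℝ) ≤ pc (cy x.1)))) = P.map D := by
  have hS : MeasurableSet {x : ℝ × I | (x.2 : ℝ) ≤ pc (cy x.1)} :=
    measurableSet_le (by fun_prop) ((measurable_of_countable pc).comp (hcy.comp measurable_fst))
  have hm : Measurable (fun x : ℝ × I => (cy x.1, decide ((x.2 : ℝ) ≤ pc (cy x.1)))) := by
    refine (hcy.comp measurable_fst).prodMk ?_
    refine measurable_to_bool ?_
    have : (fun x : ℝ × I => decide ((x.2 : ℝ) ≤ pc (cy x.1))) ⁻¹' {true} =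
        {x : ℝ × I | (x.2 : ℝ) ≤ pc (cy x.1)} := by ext; simp
    rw [this]
    exact hS
  refine ⟨hm, ?_⟩
  have htrue : ∀ m, ((expMeasure 1).prod (volume : Measure I)).map
      (fun x : ℝ × I => (cy x.1, decide ((x.2 : ℝ) ≤ pc (cy x.1)))) {(m, true)} =
        P.map D {(m, true)} := by
    intro m
    rw [map_apply hm (measurableSet_singleton _), map_apply hD (measurableSet_singleton _)]
    have e : (fun x : ℝ × I => (cy x.1, decide ((x.2 : ℝ) ≤ pc (cy x.1)))) ⁻¹' {(m, true)} =
        {x | cy x = m} ×ˢ {v : I | (v : ℝ) ≤ pc m} := by grind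
    have e' : D ⁻¹' {(m, true)} = {ω | D ω = (m, true)} := rfl
    rw [e, e', prod_prod, hpc, hlaw, volume_coe_le (hpc0 m) (hpc1 m), mul_comm]
  have hfst : ∀ m, ((expMeasure 1).prod (volume : Measure I)).map
      (fun x : ℝ × I => (cy x.1, decide ((x.2 : ℝ) ≤ pc (cy x.1)))) (Prod.fst ⁻¹' {m}) =
        P.map D (Prod.fst ⁻¹' {m}) := by
    intro m
    rw [map_apply hm (measurable_fst (measurableSet_singleton _)),
      map_apply hD (measurable_fst (measurableSet_singleton _))]
    have e : (fun x : ℝ × I => (cy x.1, decide ((x.2 : ℝ) ≤ pc (cy x.1)))) ⁻¹' (Prod.fst ⁻¹' {m}) =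
        {x | cy x = m} ×ˢ (univ : Set I) := by
      ext x; simp
    have e' : D ⁻¹' (Prod.fst ⁻¹' {m}) = {ω | (D ω).1 = m} := rfl
    simp_all
  have hu : ∀ m : ℕ, (Prod.fst ⁻¹' {m} : Set (ℕ × Bool)) = {(m, true)} ∪ {(m, false)} := by
    intro m
    ext ⟨a, b⟩
    cases b <;> simp
  have := isProbabilityMeasure_map (μ := P) hD.aemeasurable
  have := isProbabilityMeasure_map (μ := (expMeasure 1).prod (volume : Measure I)) hm.aemeasurable
  refine Measure.ext_of_singleton fun ⟨m, b⟩ => ?_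
  cases b with
  | true => exact htrue m
  | false =>
    have h1 := hfst m
    rw [hu, measure_union (by simp) (measurableSet_singleton _),
      measure_union (by simp) (measurableSet_singleton _), htrue m] at h1
    simp_all

/-- Discretized samples `c n (S i)` are represented by i.i.d. pairs of exponential and uniform
variables; the spacings of the former and a normal approximation of the number of the latter below
`p`, among the `k n` largest, are independent. -/
theorem exists_coupling {Ω : Type u} {γ : Type*} [MeasurableSpace Ω] [MeasurableSpace γ]
    (P : Measure Ω) [IsProbabilityMeasure P] {S : ℕ → Ω → γ} (hSm : ∀ i, Measurable (S i))
    (hS : iIndepFun S P) (hSid : ∀ i, P.map (S i) = P.map (S 0))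
    {c : ℕ → γ → ℕ × Bool} (hc : ∀ n, Measurable (c n)) {cy : ℕ → ℝ → ℕ}
    (hcy : ∀ n, Measurable (cy n)) {pc : ℕ → ℕ → ℝ} (hpc0 : ∀ n m, 0 ≤ pc n m)
    (hpc1 : ∀ n m, pc n m ≤ 1)
    (hlaw : ∀ n m, P {ω | (c n (S 0 ω)).1 = m} = expMeasure 1 {x | cy n x = m})
    (hpc : ∀ n m, P {ω | c n (S 0 ω) = (m, true)} = ofReal (pc n m) * P {ω | (c n (S 0 ω)).1 = m})
    {p : ℝ} (hp0 : 0 < p) (hp1 : p < 1) {k : ℕ → ℕ} (hk : Tendsto k atTop atTop)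
    (hkn : ∀ n, k n ≤ n) :
    ∃ (Ω' : Type u) (_ : MeasurableSpace Ω') (P' : Measure Ω') (π : Ω' → Ω),
      IsProbabilityMeasure P' ∧ MeasurePreserving π P' P ∧
      ∃ (y : ℕ → ℕ → Ω' → ℝ) (v : ℕ → ℕ → Ω' → I) (N : ℕ → Ω' → ℝ) (E : ℕ → ℕ → Ω' → ℝ),
        (∀ n, IsIidExpUnif P' (y n) (v n)) ∧ (∀ n, IsIidExp P' (E n)) ∧
        (∀ n, Measurable (N n) ∧ P'.map (N n) = gaussianReal 0 1 ∧
          IndepFun (N n) (fun ω j => E n j ω) P') ∧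
        SmallP P' (fun n ω => N n ω - (√(k n * (p * (1 - p))))⁻¹ * ∑ j ∈ Icc 1 (k n),
          (bern p (v n (orderIndex (fun i => y n i ω) n (n - j + 1)) ω) - p)) ∧
        (∀ n ω, ∀ j ∈ Icc 1 n, orderStat (fun i => y n i ω) n (n - j + 1) = tailSum (E n) n j ω) ∧
        ∀ᵐ ω ∂P', ∀ n i, c n (S i (π ω)) =
          (cy n (y n i ω), decide ((v n i ω : ℝ) ≤ pc n (cy n (y n i ω)))) := by
  obtain ⟨h, hhm, hhN, hhS⟩ := exists_gaussian_coupling (tendsto_cdf_bernLaw hp0 hp1)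
  have hred := fun n => exists_redraw P (D := fun i ω => c n (S i ω)) (fun i => (hc n).comp (hSm i))
    (hS.comp (fun _ => c n) fun _ => hc n)
    (fun i => by
      have e : ∀ i, P.map (fun ω => c n (S i ω)) = (P.map (S i)).map (c n) := fun i =>
        (Measure.map_map (hc n) (hSm i)).symm
      rw [e, e, hSid])
    ((expMeasure 1).prod (volume : Measure I))
    (map_cell_eq ((hc n).comp (hSm 0)) (hcy n) (hpc0 n) (hpc1 n) (hlaw n) (hpc n)).1
    (map_cell_eq ((hc n).comp (hSm 0)) (hcy n) (hpc0 n) (hpc1 n) (hlaw n) (hpc n)).2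
  choose g hgm hgi hgl hge using hred
  set P₁ := P.prod (infinitePi fun _ : ℕ => (volume : Measure I))
  have hYm : ∀ n i, Measurable fun ω : Ω × (ℕ → I) => g n (c n (S i ω.1)) (ω.2 i) := fun n i =>
    (hgm n).comp ((((hc n).comp (hSm i)).comp measurable_fst).prodMk
      ((measurable_pi_apply i).comp measurable_snd))
  have hyv : ∀ n, IsIidExpUnif P₁ (fun i ω => (g n (c n (S i ω.1)) (ω.2 i)).1)
      (fun i ω => (g n (c n (S i ω.1)) (ω.2 i)).2) := fun n =>
    ⟨fun i => (hYm n i).fst, fun i => (hYm n i).snd, hgi n, hgl n⟩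
  have hrep := fun n => (hyv n).exists_representation p (hkn n) (hhm (k n))
  choose E W N hE hNm hNl hNE hNW hos hW using hrep
  set Q := (infinitePi fun _ : ℕ => expMeasure 1).prod (volume : Measure I)
  have hfst : MeasurePreserving (Prod.fst : (Ω × (ℕ → I)) × ((ℕ → ℝ) × I) → _) (P₁.prod Q) P₁ :=
    measurePreserving_fst
  have hfst' : MeasurePreserving (Prod.fst : Ω × (ℕ → I) → Ω) P₁ P := measurePreserving_fst
  refine ⟨(Ω × (ℕ → I)) × ((ℕ → ℝ) × I), inferInstance, P₁.prod Q, fun ω => ω.1.1, inferInstance,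
    hfst'.comp hfst, fun n i ω => (g n (c n (S i ω.1.1)) (ω.1.2 i)).1,
    fun n i ω => (g n (c n (S i ω.1.1)) (ω.1.2 i)).2, N, E,
    fun n => (hyv n).comp_measurePreserving hfst, hE, fun n => ⟨hNm n, ?_, hNE n⟩, ?_, hos, ?_⟩
  · rw [hNl n, hhN]
  · intro δ hδ e he
    have h1 := ((hhS δ hδ).comp hk).eventually (ge_mem_nhds he)
    filter_upwards [h1] with n hn
    simp only [Function.comp] at hn
    rw [← hNW n δ] at hn
    grind
  · have h1 : ∀ᵐ ω ∂P₁, ∀ n i, c n (S i ω.1) = (cy n (g n (c n (S i ω.1)) (ω.2 i)).1,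
          decide (((g n (c n (S i ω.1)) (ω.2 i)).2 : ℝ) ≤
            pc n (cy n (g n (c n (S i ω.1)) (ω.2 i)).1))) := by
      rw [ae_all_iff]
      intro n
      filter_upwards [hge n] with ω hω i
      exact (hω i).symm
    exact hfst.quasiMeasurePreserving.ae h1

end Coupling

/-! ### Second order expansions of the tails -/

section Expansion

/-- This means `F x = a + d x^{-b} + o(x^{-b})`; in the form of a limit, the calculus of expansions
is the calculus of limits. The value `d = 0` is allowed. -/
def HasExpansion (F : ℝ → ℝ) (a d b : ℝ) : Prop := Tendsto (fun x => (F x - a) * x ^ b) atTop (𝓝 d)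

variable {F F' : ℝ → ℝ} {a a' d d' b b' : ℝ}

theorem HasExpansion.tendsto (h : HasExpansion F a d b) (hb : 0 < b) : Tendsto F atTop (𝓝 a) := by
  have h1 : Tendsto (fun x => (F x - a) * x ^ b * x ^ (-b) + a) atTop (𝓝 (d * 0 + a)) :=
    (Tendsto.mul h (tendsto_rpow_neg_atTop hb)).add_const a
  rw [mul_zero, zero_add] at h1
  refine h1.congr' ?_
  filter_upwards [eventually_gt_atTop 0] with x hx
  rw [mul_assoc, ← rpow_add hx]
  simp

theorem HasExpansion.congr (h : HasExpansion F a d b) (hF : F =ᶠ[atTop] F') :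
    HasExpansion F' a d b :=
  Tendsto.congr' (hF.mono fun x hx => by rw [hx]) h

/-- On a coarser scale the second coefficient survives only if the two scales coincide. This is
where the indicators in `D_z` and `κ_z` come from. -/
theorem HasExpansion.weaken (h : HasExpansion F a d b') (hbb : b ≤ b') :
    HasExpansion F a (if b' ≤ b then d else 0) b := by
  rcases hbb.eq_or_lt with rfl | hlt
  · simpa using h
  · rw [if_neg (not_le.2 hlt)]
    have h1 : Tendsto (fun x => (F x - a) * x ^ b' * x ^ (-(b' - b))) atTop (𝓝 (d * 0)) :=
      Tendsto.mul h (tendsto_rpow_neg_atTop (sub_pos.2 hlt))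
    rw [mul_zero] at h1
    refine h1.congr' ?_
    filter_upwards [eventually_gt_atTop 0] with x hx
    rw [mul_assoc, ← rpow_add hx]
    congr 2
    ring

theorem HasExpansion.mul (h : HasExpansion F a d b) (h' : HasExpansion F' a' d' b) (hb : 0 < b) :
    HasExpansion (fun x => F x * F' x) (a * a') (d * a' + a * d') b := by
  have h1 := (Tendsto.mul h (h'.tendsto hb)).add (Tendsto.const_mul a h')
  refine h1.congr fun x => ?_
  ring

theorem HasExpansion.add (h : HasExpansion F a d b) (h' : HasExpansion F' a' d' b) :
    HasExpansion (fun x => F x + F' x) (a + a') (d + d') b :=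
  (Tendsto.add h h').congr fun x => by ring

theorem HasExpansion.sub (h : HasExpansion F a d b) (h' : HasExpansion F' a' d' b) :
    HasExpansion (fun x => F x - F' x) (a - a') (d - d') b :=
  (Tendsto.sub h h').congr fun x => by ring

theorem HasExpansion.const_mul (h : HasExpansion F a d b) (c : ℝ) :
    HasExpansion (fun x => c * F x) (c * a) (c * d) b :=
  (Tendsto.const_mul c h).congr fun x => by ring

theorem HasExpansion.comp (h : HasExpansion F a d b) (hb : 0 < b) {g : ℝ → ℝ} {g' : ℝ}
    (hg : HasDerivAt g g' a) : HasExpansion (fun x => g (F x)) (g a) (g' * d) b := by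
  have h1 : ContinuousAt (dslope g a) a := continuousAt_dslope_same.2 hg.differentiableAt
  have h2 := Tendsto.mul (h1.tendsto.comp (h.tendsto hb)) h
  rw [dslope_same, hg.deriv] at h2
  refine h2.congr fun x => ?_
  have := sub_smul_dslope g a (F x)
  rw [smul_eq_mul] at this
  grind

theorem HasExpansion.div (h : HasExpansion F a d b) (h' : HasExpansion F' a' d' b) (hb : 0 < b)
    (ha' : a' ≠ 0) :
    HasExpansion (fun x => F x / F' x) (a / a') ((d - a / a' * d') / a') b := by
  have h1 := h.mul (h'.comp hb (hasDerivAt_inv ha')) hb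
  grind

end Expansion

section Tail

def sv (μ : Measure ℝ) (x : ℝ) : ℝ := μ.real (Ioi x)

/-- Ties `X = C` count as uncensored, so the closed tail of `C` is what is integrated against the
law of `X`; atoms are allowed, and the two tails may differ. -/
def svLeft (μ : Measure ℝ) (x : ℝ) : ℝ := μ.real (Set.Ici x)

variable {μ : Measure ℝ} [IsProbabilityMeasure μ] {ξ Cst D β : ℝ}

theorem sv_anti : Antitone (sv μ) := fun _ _ h => measureReal_mono (Set.Ioi_subset_Ioi h)

theorem svLeft_anti : Antitone (svLeft μ) := fun _ _ h => measureReal_mono (Set.Ici_subset_Ici.2 h)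

theorem sv_nonneg (x : ℝ) : 0 ≤ sv μ x := measureReal_nonneg

theorem sv_le_one (x : ℝ) : sv μ x ≤ 1 := measureReal_le_one

theorem svLeft_nonneg (x : ℝ) : 0 ≤ svLeft μ x := measureReal_nonneg

theorem svLeft_le_one (x : ℝ) : svLeft μ x ≤ 1 := measureReal_le_one

theorem sv_le_svLeft (x : ℝ) : sv μ x ≤ svLeft μ x := measureReal_mono Set.Ioi_subset_Ici_self

theorem svLeft_le_sv {x y : ℝ} (h : x < y) : svLeft μ y ≤ sv μ x :=
  measureReal_mono fun _ hz => lt_of_lt_of_le h hz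

theorem HallWelsh.hasExpansion (h : HallWelsh (sv μ) ξ Cst D β) :
    HasExpansion (fun x => x ^ (1 / ξ) * sv μ x) Cst (Cst * D) β := by
  have h1 := h.expansion.tendsto_div_nhds_zero
  have h2 := h1.add_const (Cst * D)
  rw [zero_add] at h2
  refine h2.congr' ?_
  filter_upwards [eventually_gt_atTop 0] with x hx
  have hxb : 0 < x ^ β := rpow_pos_of_pos hx β
  rw [Real.rpow_neg hx.le]
  field_simp
  ring

theorem tendsto_sv_left (x : ℝ) :
    Tendsto (fun n : ℕ => sv μ (x - 1 / ((n : ℝ) + 1))) atTop (𝓝 (svLeft μ x)) := by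
  have h := tendsto_measure_iInter_atTop (μ := μ) (s := fun n : ℕ => Ioi (x - 1 / ((n : ℝ) + 1)))
    (fun n => measurableSet_Ioi.nullMeasurableSet)
    (fun m n hmn => Set.Ioi_subset_Ioi (by
      have : 1 / ((n : ℝ) + 1) ≤ 1 / ((m : ℝ) + 1) :=
        one_div_le_one_div_of_le (by positivity) (by simpa using hmn)
      linarith)) ⟨0, measure_ne_top _ _⟩
  have e : ⋂ n : ℕ, Ioi (x - 1 / ((n : ℝ) + 1)) = Set.Ici x := by
    ext y
    simp only [Set.mem_iInter, Set.mem_Ioi, Set.mem_Ici]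
    constructor
    · intro hy
      by_contra hlt
      push Not at hlt
      obtain ⟨n, hn⟩ := exists_nat_one_div_lt (sub_pos.2 hlt)
      have := hy n
      linarith
    · intro hy n
      have : 0 < 1 / ((n : ℝ) + 1) := by positivity
      linarith
  rw [e] at h
  exact (ENNReal.tendsto_toReal (measure_ne_top _ _)).comp h

/-- The closed tail is the left limit of the open one, and a bound that holds on a half-line passes
to left limits. -/
theorem HallWelsh.hasExpansion_svLeft (h : HallWelsh (sv μ) ξ Cst D β) :
    HasExpansion (fun x => x ^ (1 / ξ) * svLeft μ x) Cst (Cst * D) β := by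
  rw [HasExpansion, Metric.tendsto_atTop]
  intro ε hε
  obtain ⟨x₀, hx₀⟩ := (Metric.tendsto_atTop.1 h.hasExpansion) (ε / 2) (half_pos hε)
  refine ⟨max x₀ 0 + 1, fun x hx => ?_⟩
  have hx1 : x₀ < x := by grind
  have hx2 : 0 < x := by grind
  have hy : Tendsto (fun n : ℕ => x - 1 / ((n : ℝ) + 1)) atTop (𝓝 x) := by
    simpa using tendsto_one_div_add_atTop_nhds_zero_nat.const_sub x
  have h1 : Tendsto (fun n : ℕ => ((x - 1 / ((n : ℝ) + 1)) ^ (1 / ξ) *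
      sv μ (x - 1 / ((n : ℝ) + 1)) - Cst) * (x - 1 / ((n : ℝ) + 1)) ^ β) atTop
      (𝓝 ((x ^ (1 / ξ) * svLeft μ x - Cst) * x ^ β)) :=
    ((((hy.rpow_const (Or.inl hx2.ne')).mul (tendsto_sv_left x)).sub_const Cst).mul
      (hy.rpow_const (Or.inl hx2.ne')))
  have h2 := h1.dist (tendsto_const_nhds (x := Cst * D))
  refine lt_of_le_of_lt (le_of_tendsto h2 ?_) (half_lt_self hε)
  filter_upwards [hy.eventually (lt_mem_nhds hx1)] with n hn
  exact (hx₀ _ hn.le).le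

theorem HallWelsh.sv_pos (h : HallWelsh (sv μ) ξ Cst D β) (x : ℝ) : 0 < sv μ x := by
  have h1 := (h.hasExpansion.tendsto h.beta_pos).eventually (lt_mem_nhds h.cst_pos)
  obtain ⟨y, hy, hxy, hy0⟩ := (h1.and ((eventually_ge_atTop x).and (eventually_gt_atTop 0))).exists
  refine lt_of_lt_of_le ?_ (sv_anti hxy)
  by_contra hcon
  have : sv μ y = 0 := le_antisymm (not_lt.1 hcon) (sv_nonneg _)
  simp_all

/-- The direct half of Karamata's theorem: an asymptotic power may be integrated. -/
theorem tendsto_integral_of_rpow {K : ℝ → ℝ} {γ κ : ℝ} (hγ : 0 ≤ γ) (hK : ∀ τ, 0 < τ →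
    IntervalIntegrable K volume 0 τ)
    (h : Tendsto (fun u => K u * u ^ (-γ)) (𝓝[>] 0) (𝓝 κ)) :
    Tendsto (fun τ => τ ^ (-(γ + 1)) * ∫ u in (0 : ℝ)..τ, K u) (𝓝[>] 0) (𝓝 (κ / (γ + 1))) := by
  rw [Metric.tendsto_nhdsWithin_nhds] at h ⊢
  intro ε hε
  obtain ⟨δ, hδ, hδK⟩ := h (ε / 2) (half_pos hε)
  refine ⟨δ, hδ, fun τ hτ hτd => ?_⟩
  have hτ0 : (0 : ℝ) < τ := hτ
  rw [Real.dist_eq, sub_zero, abs_of_pos hτ0] at hτd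
  have hI : ∫ u in (0 : ℝ)..τ, κ * u ^ γ = κ * (τ ^ (γ + 1) / (γ + 1)) := by
    rw [intervalIntegral.integral_const_mul, integral_rpow (Or.inl (by linarith)),
      Real.zero_rpow (by linarith), sub_zero]
  have hint : ∀ c : ℝ, IntervalIntegrable (fun u : ℝ => c * u ^ γ) volume 0 τ := fun c =>
    (intervalIntegral.intervalIntegrable_rpow' (by linarith)).const_mul c
  have hbound : |(∫ u in (0 : ℝ)..τ, K u) - κ * (τ ^ (γ + 1) / (γ + 1))| ≤
      ε / 2 * (τ ^ (γ + 1) / (γ + 1)) := by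
    rw [← hI, ← intervalIntegral.integral_sub (hK τ hτ0) (hint κ), ← norm_eq_abs]
    have h3 : ∫ u in (0 : ℝ)..τ, ε / 2 * u ^ γ = ε / 2 * (τ ^ (γ + 1) / (γ + 1)) := by
      rw [intervalIntegral.integral_const_mul, integral_rpow (Or.inl (by linarith)),
        Real.zero_rpow (by linarith), sub_zero]
    rw [← h3]
    refine intervalIntegral.norm_integral_le_of_norm_le hτ0.le ?_ (hint _)
    refine ae_of_all _ fun u hu => ?_
    have hu0 : 0 < u := hu.1
    have h4 := hδK hu0 (by rw [Real.dist_eq, sub_zero, abs_of_pos hu0]; exact hu.2.trans_lt hτd)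
    rw [Real.dist_eq] at h4
    have hup : 0 < u ^ γ := rpow_pos_of_pos hu0 γ
    have e : K u - κ * u ^ γ = (K u * u ^ (-γ) - κ) * u ^ γ := by
      rw [sub_mul, mul_assoc, ← rpow_add hu0]; simp
    rw [norm_eq_abs, e, abs_mul, abs_of_pos hup]
    exact mul_le_mul_of_nonneg_right h4.le hup.le
  have hτp : 0 < τ ^ (γ + 1) := rpow_pos_of_pos hτ0 _
  have hγ1 : 0 < γ + 1 := by linarith
  have e : τ ^ (-(γ + 1)) * (∫ u in (0 : ℝ)..τ, K u) - κ / (γ + 1) =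
      ((∫ u in (0 : ℝ)..τ, K u) - κ * (τ ^ (γ + 1) / (γ + 1))) / τ ^ (γ + 1) := by
    rw [Real.rpow_neg hτ0.le]
    field_simp
  rw [Real.dist_eq, e, abs_div, abs_of_pos hτp, div_lt_iff₀ hτp]
  refine hbound.trans_lt ?_
  have : τ ^ (γ + 1) / (γ + 1) ≤ τ ^ (γ + 1) := div_le_self hτp.le (by linarith)
  nlinarith

/-- These moments appear when the tail of `C` inside `uncMass` is replaced by the powers of its
expansion. -/
def negMoment (μ : Measure ℝ) (s t : ℝ) : ℝ := ∫ x in Ioi t, x ^ (-s) ∂μ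

theorem integrableOn_rpow_neg {s t : ℝ} (hs : 0 < s) (ht : 0 < t) :
    IntegrableOn (fun x : ℝ => x ^ (-s)) (Ioi t) μ := by
  refine Integrable.mono' (integrable_const (t ^ (-s))) (by fun_prop) ?_
  filter_upwards [ae_restrict_mem measurableSet_Ioi] with x hx
  rw [norm_eq_abs, abs_of_nonneg (Real.rpow_nonneg (ht.trans hx).le _)]
  exact rpow_le_rpow_of_nonpos ht (le_of_lt hx) (by linarith)

/-- The layer-cake formula for `x^{-s}`, playing the role of integration by parts for a law that may
have no density. -/
theorem negMoment_eq {s t : ℝ} (hs : 0 < s) (ht : 0 < t) :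
    negMoment μ s t = t ^ (-s) * sv μ t - ∫ u in (0 : ℝ)..t ^ (-s), sv μ (u ^ (-(1 / s))) := by
  have hτ : 0 < t ^ (-s) := rpow_pos_of_pos ht _
  have h := (integrableOn_rpow_neg (μ := μ) hs ht).integral_eq_integral_Ioc_meas_le
    (M := t ^ (-s)) (by
      filter_upwards [ae_restrict_mem measurableSet_Ioi] with x hx
      exact Real.rpow_nonneg (ht.trans hx).le _) (by
      filter_upwards [ae_restrict_mem measurableSet_Ioi] with x hx
      exact rpow_le_rpow_of_nonpos ht (le_of_lt hx) (by linarith))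
  have hmono : MonotoneOn (fun u : ℝ => sv μ (u ^ (-(1 / s)))) (Ioc 0 (t ^ (-s))) := by
    intro u hu u' hu' huu
    exact sv_anti (rpow_le_rpow_of_nonpos hu.1 huu (by have := one_div_pos.2 hs; linarith))
  have hint : IntegrableOn (fun u : ℝ => sv μ (u ^ (-(1 / s)))) (Ioc 0 (t ^ (-s))) := by
    refine Integrable.mono' (integrable_const (1 : ℝ))
      (aemeasurable_restrict_of_monotoneOn measurableSet_Ioc hmono).aestronglyMeasurable ?_
    refine ae_of_all _ fun u => ?_
    rw [norm_eq_abs, abs_of_nonneg (sv_nonneg _)]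
    exact sv_le_one _
  rw [negMoment, h, intervalIntegral.integral_of_le hτ.le]
  have h2 : ∀ u ∈ Ioc 0 (t ^ (-s)), (μ.restrict (Ioi t)).real {x | u ≤ x ^ (-s)} =
      sv μ t - sv μ (u ^ (-(1 / s))) := by
    intro u hu
    have hle : t ≤ u ^ (-(1 / s)) := by
      have := rpow_le_rpow_of_nonpos hu.1 hu.2 (z := -(1 / s)) (by
        have := one_div_pos.2 hs; linarith)
      rwa [← rpow_mul ht.le, show -s * -(1 / s) = 1 by field_simp, Real.rpow_one] at this
    have hset : {x : ℝ | u ≤ x ^ (-s)} ∩ Ioi t = Ioi t \ Ioi (u ^ (-(1 / s))) := by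
      ext x
      simp only [Set.mem_inter_iff, mem_ofPred_eq, Set.mem_Ioi, Set.mem_sdiff, not_lt]
      rw [and_comm]
      refine and_congr_right fun hx => ?_
      have hx0 : 0 < x := ht.trans hx
      constructor
      · intro h
        have := rpow_le_rpow_of_nonpos hu.1 h (z := -(1 / s)) (by
          have := one_div_pos.2 hs; linarith)
        rwa [← rpow_mul hx0.le, show -s * -(1 / s) = 1 by field_simp, Real.rpow_one] at this
      · intro h
        have := rpow_le_rpow_of_nonpos hx0 h (z := -s) (by linarith)
        rwa [← rpow_mul hu.1.le, show -(1 / s) * -s = 1 by field_simp, Real.rpow_one] at this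
    rw [measureReal_restrict_apply' measurableSet_Ioi, hset,
      measureReal_sdiff (Set.Ioi_subset_Ioi hle) measurableSet_Ioi]
    rfl
  rw [setIntegral_congr_fun measurableSet_Ioc h2, integral_sub (integrable_const _) hint]
  simp [hτ.le]

/-- After the substitution `u = x^{-s}` the leading power in the layer-cake integral integrates
exactly, and the remainder `K` behaves like `Cst D u^γ` at zero, so Karamata's theorem applies. -/
theorem HallWelsh.hasExpansion_negMoment (h : HallWelsh (sv μ) ξ Cst D β) {s : ℝ} (hs : 0 < s) :
    HasExpansion (fun t => t ^ (s + 1 / ξ) * negMoment μ s t) (Cst * (1 / ξ) / (s + 1 / ξ))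
      (Cst * D * (1 / ξ + β) / (s + 1 / ξ + β)) β := by
  have hα : 0 < 1 / ξ := one_div_pos.2 h.xi_pos
  have hβ := h.beta_pos
  set α := 1 / ξ with hαd
  set γ := (α + β) / s with hγ
  have hγ0 : 0 < γ := by positivity
  have hαs : 0 < α / s := by positivity
  let K : ℝ → ℝ := fun u => sv μ (u ^ (-(1 / s))) - Cst * u ^ (α / s)
  have hsvint : ∀ τ, 0 < τ → IntervalIntegrable (fun u : ℝ => sv μ (u ^ (-(1 / s)))) volume
      0 τ := by
    intro τ hτ
    rw [intervalIntegrable_iff_integrableOn_Ioc_of_le hτ.le]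
    have hmono : MonotoneOn (fun u : ℝ => sv μ (u ^ (-(1 / s)))) (Ioc 0 τ) := by
      intro u hu u' hu' huu
      exact sv_anti (rpow_le_rpow_of_nonpos hu.1 huu (by have := one_div_pos.2 hs; linarith))
    refine Integrable.mono' (integrable_const (1 : ℝ))
      (aemeasurable_restrict_of_monotoneOn measurableSet_Ioc hmono).aestronglyMeasurable ?_
    refine ae_of_all _ fun u => ?_
    rw [norm_eq_abs, abs_of_nonneg (sv_nonneg _)]
    exact sv_le_one _
  have hpint : ∀ τ, IntervalIntegrable (fun u : ℝ => Cst * u ^ (α / s)) volume 0 τ := fun τ =>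
    (intervalIntegral.intervalIntegrable_rpow' (by linarith)).const_mul _
  have hKint : ∀ τ, 0 < τ → IntervalIntegrable K volume 0 τ := fun τ hτ =>
    (hsvint τ hτ).sub (hpint τ)
  have hx : Tendsto (fun u : ℝ => u ^ (-(1 / s))) (𝓝[>] 0) atTop :=
    tendsto_rpow_neg_nhdsGT_zero (by simpa using hs)
  have hK : Tendsto (fun u => K u * u ^ (-γ)) (𝓝[>] 0) (𝓝 (Cst * D)) := by
    refine (Tendsto.comp h.hasExpansion hx).congr' ?_
    filter_upwards [self_mem_nhdsWithin] with u hu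
    have hu0 : 0 < u := hu
    simp only [Function.comp, K]
    rw [← rpow_mul hu0.le, ← rpow_mul hu0.le]
    have e1 : u ^ (-γ) = u ^ (-(1 / s) * α) * u ^ (-(1 / s) * β) := by
      rw [← rpow_add hu0, hγ]; congr 1; ring
    have e2 : u ^ (α / s) * u ^ (-(1 / s) * α) = 1 := by
      rw [← rpow_add hu0, show α / s + -(1 / s) * α = 0 by ring, Real.rpow_zero]
    grind
  have hτ : Tendsto (fun t : ℝ => t ^ (-s)) atTop (𝓝[>] 0) := by
    rw [tendsto_nhdsWithin_iff]
    refine ⟨tendsto_rpow_neg_atTop hs, ?_⟩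
    filter_upwards [eventually_gt_atTop 0] with t ht using rpow_pos_of_pos ht _
  have hJ := Tendsto.comp (tendsto_integral_of_rpow hγ0.le hKint hK) hτ
  have hfin := Tendsto.sub h.hasExpansion hJ
  have e3 : Cst * D * (α + β) / (s + α + β) = Cst * D - Cst * D / (γ + 1) := by
    rw [hγ]; field_simp; ring
  rw [e3]
  refine hfin.congr' ?_
  filter_upwards [eventually_gt_atTop 0] with t ht
  have hτ0 : 0 < t ^ (-s) := rpow_pos_of_pos ht _
  have hsplit : ∫ u in (0 : ℝ)..t ^ (-s), K u =
      (∫ u in (0 : ℝ)..t ^ (-s), sv μ (u ^ (-(1 / s)))) - Cst * ((t ^ (-s)) ^ (α / s + 1) /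
        (α / s + 1)) := by
    simp only [K]
    rw [intervalIntegral.integral_sub (hsvint _ hτ0) (hpint _), intervalIntegral.integral_const_mul,
      integral_rpow (Or.inl (by linarith)), Real.zero_rpow (by linarith), sub_zero]
  simp only [Function.comp]
  rw [hsplit, negMoment_eq hs ht, ← rpow_mul ht.le, ← rpow_mul ht.le]
  have e4 : t ^ (-s * -(γ + 1)) = t ^ (s + α) * t ^ β := by
    rw [← rpow_add ht, hγ]; congr 1; field_simp; ring
  have e5 : t ^ (s + α) * t ^ (-s * (α / s + 1)) = 1 := by
    rw [← rpow_add ht, show s + α + -s * (α / s + 1) = 0 by field_simp; ring, Real.rpow_zero]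
  have e6 : t ^ (s + α) * t ^ (-s) = t ^ α := by rw [← rpow_add ht]; congr 1; ring
  have e7 : Cst * α / (s + α) = Cst - Cst / (α / s + 1) := by field_simp; ring
  grind

end Tail

/-! ### Tails of the censored observations and of the uncensored part -/

section Censored

/-- Mass of the non-censored observations above `z`, for the laws `μ` of the data and `ν` of the
censoring variables. -/
def uncMass (μ ν : Measure ℝ) (z : ℝ) : ℝ := ∫ x in Ioi z, svLeft ν x ∂μ

def svMin (μ ν : Measure ℝ) (z : ℝ) : ℝ := sv μ z * sv ν z

variable {μ ν : Measure ℝ} [IsProbabilityMeasure μ] [IsProbabilityMeasure ν]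
  {ξ ξc Cst Cstc D Dc β βc : ℝ}

theorem svMin_anti : Antitone (svMin μ ν) := fun _ _ h =>
  mul_le_mul (sv_anti h) (sv_anti h) (sv_nonneg _) (sv_nonneg _)

theorem svMin_nonneg (z : ℝ) : 0 ≤ svMin μ ν z := mul_nonneg (sv_nonneg _) (sv_nonneg _)

theorem svMin_le_one (z : ℝ) : svMin μ ν z ≤ 1 :=
  mul_le_one₀ (sv_le_one _) (sv_nonneg _) (sv_le_one _)

theorem integrable_svLeft : Integrable (svLeft ν) μ := by
  refine Integrable.mono' (integrable_const (1 : ℝ)) svLeft_anti.measurable.aestronglyMeasurable ?_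
  refine ae_of_all _ fun u => ?_
  rw [norm_eq_abs, abs_of_nonneg (svLeft_nonneg _)]
  exact svLeft_le_one _

theorem one_div_xiZ (h : 0 < ξ) (hc : 0 < ξc) : 1 / xiZ ξ ξc = 1 / ξ + 1 / ξc := by
  rw [xiZ]; field_simp; ring

theorem xiZ_pos (h : 0 < ξ) (hc : 0 < ξc) : 0 < xiZ ξ ξc := by rw [xiZ]; positivity

theorem pLim_pos (h : 0 < ξ) (hc : 0 < ξc) : 0 < pLim ξ ξc := by rw [pLim]; positivity

theorem pLim_lt_one (h : 0 < ξ) (hc : 0 < ξc) : pLim ξ ξc < 1 := by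
  rw [pLim, div_lt_one (by positivity)]; linarith

theorem betaZ_pos (h : 0 < β) (hc : 0 < βc) : 0 < betaZ β βc := lt_min h hc

theorem ite_betaZ_left (a : ℝ) : (if β ≤ betaZ β βc then a else 0) = if β ≤ βc then a else 0 := by
  simp [betaZ]

theorem ite_betaZ_right (a : ℝ) : (if βc ≤ betaZ β βc then a else 0) = if βc ≤ β then a else 0 := by
  simp [betaZ]

theorem hasExpansion_svMin (h : HallWelsh (sv μ) ξ Cst D β) (hc : HallWelsh (sv ν) ξc Cstc Dc βc) :
    HasExpansion (fun z => z ^ (1 / xiZ ξ ξc) * svMin μ ν z) (Cst * Cstc)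
      (Cst * Cstc * dZ β βc D Dc) (betaZ β βc) := by
  have hb := betaZ_pos h.beta_pos hc.beta_pos
  have h1 := (h.hasExpansion.weaken (min_le_left β βc)).mul
    (hc.hasExpansion.weaken (min_le_right β βc)) hb
  have e : Cst * Cstc * dZ β βc D Dc = (if β ≤ min β βc then Cst * D else 0) * Cstc +
      Cst * (if βc ≤ min β βc then Cstc * Dc else 0) := by
    have h1 := ite_betaZ_left (β := β) (βc := βc) (Cst * D)
    have h2 := ite_betaZ_right (β := β) (βc := βc) (Cstc * Dc)
    rw [betaZ] at h1 h2
    rw [h1, h2, dZ]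
    split_ifs <;> ring
  rw [e]
  refine h1.congr ?_
  filter_upwards [eventually_gt_atTop 0] with z hz
  rw [one_div_xiZ h.xi_pos hc.xi_pos, rpow_add hz, svMin]
  ring

/-- The logarithm of the tail quantile relation, to second order. -/
def logTail (μ ν : Measure ℝ) (x c : ℝ) (z : ℝ) : ℝ := log z + x * log (svMin μ ν z) - x * log c

theorem svMin_pos (h : HallWelsh (sv μ) ξ Cst D β) (hc : HallWelsh (sv ν) ξc Cstc Dc βc) (z : ℝ) :
    0 < svMin μ ν z := mul_pos (h.sv_pos z) (hc.sv_pos z)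

theorem hasExpansion_logTail (h : HallWelsh (sv μ) ξ Cst D β)
    (hc : HallWelsh (sv ν) ξc Cstc Dc βc) :
    HasExpansion (logTail μ ν (xiZ ξ ξc) (Cst * Cstc)) 0 (xiZ ξ ξc * dZ β βc D Dc)
      (betaZ β βc) := by
  have hb := betaZ_pos h.beta_pos hc.beta_pos
  have hx := xiZ_pos h.xi_pos hc.xi_pos
  have hcc : 0 < Cst * Cstc := mul_pos h.cst_pos hc.cst_pos
  have h1 := ((hasExpansion_svMin h hc).comp hb (Real.hasDerivAt_log hcc.ne')).const_mul (xiZ ξ ξc)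
  have h2 := h1.sub (F' := fun _ => xiZ ξ ξc * log (Cst * Cstc))
    (a' := xiZ ξ ξc * log (Cst * Cstc)) (d' := 0) (by simp [HasExpansion])
  have e1 : xiZ ξ ξc * ((Cst * Cstc)⁻¹ * (Cst * Cstc * dZ β βc D Dc)) - 0 =
      xiZ ξ ξc * dZ β βc D Dc := by grind
  rw [sub_self, e1] at h2
  refine h2.congr ?_
  filter_upwards [eventually_gt_atTop 0] with z hz
  rw [logTail, log_mul (rpow_pos_of_pos hz _).ne' (svMin_pos h hc z).ne', Real.log_rpow hz]
  field_simp

/-- The tail of `C` under the integral is replaced by its two powers. The error is a small multiple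
of the second power, whose integral has exactly the order of the second term. The expansion of the
first moment adds the contribution of `β`, and `weaken` brings both to the scale `β_z`. -/
theorem hasExpansion_uncMass (h : HallWelsh (sv μ) ξ Cst D β)
    (hc : HallWelsh (sv ν) ξc Cstc Dc βc) :
    HasExpansion (fun z => z ^ (1 / xiZ ξ ξc) * uncMass μ ν z)
      (Cstc * (Cst * (1 / ξ) / (1 / ξc + 1 / ξ)))
      (Cstc * (if β ≤ βc then Cst * D * (1 / ξ + β) / (1 / ξc + 1 / ξ + β) else 0) +
        if βc ≤ β then Cstc * Dc * (Cst * (1 / ξ) / (1 / ξc + βc + 1 / ξ)) else 0)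
      (betaZ β βc) := by
  have hα : 0 < 1 / ξ := one_div_pos.2 h.xi_pos
  have hαc : 0 < 1 / ξc := one_div_pos.2 hc.xi_pos
  have hβc := hc.beta_pos
  set α := 1 / ξ with hαd
  set αc := 1 / ξc with hαcd
  have h1 := ((h.hasExpansion_negMoment hαc).weaken (min_le_left β βc)).const_mul Cstc
  have h2 : HasExpansion (fun t => t ^ (αc + α) * (uncMass μ ν t - Cstc * negMoment μ αc t)) 0
      (Cstc * Dc * (Cst * α / (αc + βc + α))) βc := by
    have hI := (h.hasExpansion_negMoment (show 0 < αc + βc by linarith)).tendsto h.beta_pos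
    have hlim : Tendsto (fun t => Cstc * Dc * (t ^ (αc + βc + α) * negMoment μ (αc + βc) t)) atTop
        (𝓝 (Cstc * Dc * (Cst * α / (αc + βc + α)))) := hI.const_mul _
    have hdiff : Tendsto (fun t => (t ^ (αc + α) * (uncMass μ ν t - Cstc * negMoment μ αc t) - 0) *
        t ^ βc - Cstc * Dc * (t ^ (αc + βc + α) * negMoment μ (αc + βc) t)) atTop (𝓝 0) := by
      have hpos : 0 < Cst * α / (αc + βc + α) := by have := h.cst_pos; positivity
      rw [Metric.tendsto_nhds]
      intro ε hε
      set L := Cst * α / (αc + βc + α) with hL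
      have hG := (Metric.tendsto_nhds.1 hc.hasExpansion_svLeft) (ε / (2 * L)) (by positivity)
      obtain ⟨t₀, ht₀⟩ := eventually_atTop.1 hG
      have hI2 := hI.eventually (gt_mem_nhds (show L < 2 * L by linarith))
      filter_upwards [hI2, eventually_ge_atTop t₀, eventually_gt_atTop 0] with t hIt htt ht
      have hs1 := integrableOn_rpow_neg (μ := μ) hαc ht
      have hs2 := integrableOn_rpow_neg (μ := μ) (show 0 < αc + βc by linarith) ht
      have hsv : IntegrableOn (svLeft ν) (Ioi t) μ := integrable_svLeft.integrableOn
      have e1 : uncMass μ ν t - Cstc * negMoment μ αc t - Cstc * Dc * negMoment μ (αc + βc) t =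
          ∫ x in Ioi t, (svLeft ν x - Cstc * x ^ (-αc) - Cstc * Dc * x ^ (-(αc + βc))) ∂μ := by
        have hs3 : IntegrableOn (fun x => svLeft ν x - Cstc * x ^ (-αc)) (Ioi t) μ :=
          hsv.sub (hs1.const_mul _)
        have i1 := integral_sub hs3 (hs2.const_mul (Cstc * Dc))
        have i2 := integral_sub hsv (hs1.const_mul Cstc)
        rw [integral_const_mul] at i1 i2
        rw [i1, i2]
        rfl
      have e2 : |uncMass μ ν t - Cstc * negMoment μ αc t -
          Cstc * Dc * negMoment μ (αc + βc) t| ≤ ε / (2 * L) * negMoment μ (αc + βc) t := by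
        rw [e1, negMoment, ← integral_const_mul, ← norm_eq_abs]
        refine norm_integral_le_of_norm_le (hs2.const_mul _) ?_
        filter_upwards [ae_restrict_mem measurableSet_Ioi] with x hx
        have hx0 : 0 < x := ht.trans hx
        have h3 := ht₀ x (htt.trans (le_of_lt hx))
        rw [Real.dist_eq] at h3
        have hxp : 0 < x ^ (-(αc + βc)) := rpow_pos_of_pos hx0 _
        have e3 : svLeft ν x - Cstc * x ^ (-αc) - Cstc * Dc * x ^ (-(αc + βc)) =
            ((x ^ αc * svLeft ν x - Cstc) * x ^ βc - Cstc * Dc) * x ^ (-(αc + βc)) := by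
          have a1 : x ^ αc * x ^ βc * x ^ (-(αc + βc)) = 1 := by
            rw [← rpow_add hx0, ← rpow_add hx0]; simp
          have a2 : x ^ βc * x ^ (-(αc + βc)) = x ^ (-αc) := by rw [← rpow_add hx0]; congr 1; ring
          grind
        rw [e3, norm_eq_abs, abs_mul, abs_of_pos hxp]
        exact mul_le_mul_of_nonneg_right h3.le hxp.le
      have htp : 0 < t ^ (αc + βc + α) := rpow_pos_of_pos ht _
      have e4 : (t ^ (αc + α) * (uncMass μ ν t - Cstc * negMoment μ αc t) - 0) * t ^ βc -
          Cstc * Dc * (t ^ (αc + βc + α) * negMoment μ (αc + βc) t) =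
          t ^ (αc + βc + α) * (uncMass μ ν t - Cstc * negMoment μ αc t -
            Cstc * Dc * negMoment μ (αc + βc) t) := by
        have a1 : t ^ (αc + βc + α) = t ^ (αc + α) * t ^ βc := by rw [← rpow_add ht]; congr 1; ring
        rw [a1]; ring
      rw [Real.dist_eq, sub_zero, e4, abs_mul, abs_of_pos htp]
      calc t ^ (αc + βc + α) * |uncMass μ ν t - Cstc * negMoment μ αc t -
            Cstc * Dc * negMoment μ (αc + βc) t|
          ≤ t ^ (αc + βc + α) * (ε / (2 * L) * negMoment μ (αc + βc) t) :=
            mul_le_mul_of_nonneg_left e2 htp.le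
        _ = ε / (2 * L) * (t ^ (αc + βc + α) * negMoment μ (αc + βc) t) := by ring
        _ < ε / (2 * L) * (2 * L) := mul_lt_mul_of_pos_left hIt (by positivity)
        _ = ε := by field_simp
    have := hdiff.add hlim
    rw [zero_add] at this
    exact this.congr fun t => by ring
  have h3 := h1.add (h2.weaken (min_le_right β βc))
  rw [add_zero] at h3
  have e1 := ite_betaZ_left (β := β) (βc := βc) (Cst * D * (α + β) / (αc + α + β))
  have e2 := ite_betaZ_right (β := β) (βc := βc) (Cstc * Dc * (Cst * α / (αc + βc + α)))
  rw [betaZ] at e1 e2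
  rw [e1, e2] at h3
  refine h3.congr ?_
  filter_upwards [eventually_gt_atTop 0] with z hz
  rw [one_div_xiZ h.xi_pos hc.xi_pos, ← hαd, ← hαcd, add_comm α αc]
  ring

/-- A quotient of expansions; the second coefficient is identified by distinguishing the order of
`β` and `βc`. Its form is chosen so that multiplication by `t^{-β_z}` gives `Q_{0,z}(n/k) κ_z / (1 -
ρ_z)`. -/
theorem hasExpansion_uncRatio (h : HallWelsh (sv μ) ξ Cst D β)
    (hc : HallWelsh (sv ν) ξc Cstc Dc βc) (hD : dZ β βc D Dc ≠ 0) :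
    HasExpansion (fun z => uncMass μ ν z / svMin μ ν z) (pLim ξ ξc)
      (-(xiZ ξ ξc ^ 2 * betaZ β βc * dZ β βc D Dc) *
        (kappaZ ξ ξc β βc D Dc / (1 - rhoZ ξ ξc β βc))) (betaZ β βc) := by
  have hb := betaZ_pos h.beta_pos hc.beta_pos
  have hξ := h.xi_pos
  have hξc := hc.xi_pos
  have hC := h.cst_pos
  have hCc := hc.cst_pos
  have hβ := h.beta_pos
  have hβc := hc.beta_pos
  have h1 := (hasExpansion_uncMass h hc).div (hasExpansion_svMin h hc) hb (mul_pos hC hCc).ne'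
  have e1 : Cstc * (Cst * (1 / ξ) / (1 / ξc + 1 / ξ)) / (Cst * Cstc) = pLim ξ ξc := by
    rw [pLim]; field_simp
  rw [e1] at h1
  have e2 : (Cstc * (if β ≤ βc then Cst * D * (1 / ξ + β) / (1 / ξc + 1 / ξ + β) else 0) +
        (if βc ≤ β then Cstc * Dc * (Cst * (1 / ξ) / (1 / ξc + βc + 1 / ξ)) else 0) -
        pLim ξ ξc * (Cst * Cstc * dZ β βc D Dc)) / (Cst * Cstc) =
      -(xiZ ξ ξc ^ 2 * betaZ β βc * dZ β βc D Dc) *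
        (kappaZ ξ ξc β βc D Dc / (1 - rhoZ ξ ξc β βc)) := by
    have hden : 1 - rhoZ ξ ξc β βc = 1 + betaZ β βc * xiZ ξ ξc := by rw [rhoZ]; ring
    have hdd : ∀ k : ℝ, -(xiZ ξ ξc ^ 2 * betaZ β βc * dZ β βc D Dc) *
        (-k / (dZ β βc D Dc * ξ * ξc) / (1 - rhoZ ξ ξc β βc)) =
        xiZ ξ ξc ^ 2 * betaZ β βc * k / (ξ * ξc * (1 + betaZ β βc * xiZ ξ ξc)) := by grind
    rw [kappaZ, hdd]
    rw [dZ, betaZ, xiZ, pLim]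
    rcases lt_trichotomy β βc with hlt | heq | hgt
    · rw [if_pos hlt.le, if_pos hlt.le, if_pos hlt.le, if_neg (not_le.2 hlt), if_neg (not_le.2 hlt),
        if_neg (not_le.2 hlt), min_eq_left hlt.le]
      field_simp
      ring
    · subst heq
      simp only [le_refl, if_true, min_self]
      field_simp
      ring
    · rw [if_neg (not_le.2 hgt), if_neg (not_le.2 hgt), if_neg (not_le.2 hgt), if_pos hgt.le,
        if_pos hgt.le, if_pos hgt.le, min_eq_right hgt.le]
      field_simp
      ring
  rw [e2] at h1
  refine h1.congr ?_
  filter_upwards [eventually_gt_atTop 0] with z hz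
  rw [mul_div_mul_left _ _ (rpow_pos_of_pos hz _).ne']

end Censored

/-! ### Approximation of the tails on cells, without derivatives -/

section Approximation

/-- Remainder of the second order expansion of `logTail`. -/
def logRem (μ ν : Measure ℝ) (ξ ξc β βc D Dc c : ℝ) (z : ℝ) : ℝ :=
  logTail μ ν (xiZ ξ ξc) c z - xiZ ξ ξc * dZ β βc D Dc * z ^ (-betaZ β βc)

/-- Approximations of the tails beyond `t / 4`, on the scale `ε |q|`, and on intervals of
logarithmic length `d`. -/
structure TailApprox (μ ν : Measure ℝ) (ξ ξc β βc D Dc c q κ : ℝ) (ε t d θ : ℝ) : Prop where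
  incr : ∀ z' z, t / 4 ≤ z' → z' ≤ z →
    |logRem μ ν ξ ξc β βc D Dc c z - logRem μ ν ξ ξc β βc D Dc c z'| ≤ ε * |q| * (log (z / z') + θ)
  bound : ∀ z, t / 4 ≤ z → |logRem μ ν ξ ξc β βc D Dc c z| ≤ ε * |q|
  cell : ∀ z, t / 4 ≤ z →
    |uncMass μ ν z - uncMass μ ν (z * exp d) - pLim ξ ξc * (svMin μ ν z - svMin μ ν (z * exp d))| ≤
      ε * (svMin μ ν z - svMin μ ν (z * exp d))
  level : |t ^ (1 / xiZ ξ ξc) / c * (uncMass μ ν t - pLim ξ ξc * svMin μ ν t) - q * κ| ≤ ε * |q|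

variable {μ ν : Measure ℝ} [IsProbabilityMeasure μ] [IsProbabilityMeasure ν]
  {ξ ξc Cst Cstc D Dc β βc : ℝ}

theorem tendsto_logRem (h : HallWelsh (sv μ) ξ Cst D β) (hc : HallWelsh (sv ν) ξc Cstc Dc βc) :
    Tendsto (fun z => logRem μ ν ξ ξc β βc D Dc (Cst * Cstc) z * z ^ betaZ β βc) atTop (𝓝 0) := by
  have h1 := Tendsto.sub_const (hasExpansion_logTail h hc) (xiZ ξ ξc * dZ β βc D Dc)
  rw [sub_self] at h1
  refine h1.congr' ?_
  filter_upwards [eventually_gt_atTop 0] with z hz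
  have e : z ^ (-betaZ β βc) * z ^ betaZ β βc = 1 := by rw [← rpow_add hz]; simp
  rw [logRem]
  grind

theorem eventually_abs_le_of_tendsto {F : ℝ → ℝ} {a b η : ℝ}
    (h : Tendsto (fun z => F z * z ^ b) atTop (𝓝 a)) (hη : 0 < η) :
    ∀ᶠ z in atTop, |F z - a * z ^ (-b)| ≤ η * z ^ (-b) := by
  have h1 := (Metric.tendsto_nhds.1 h) η hη
  filter_upwards [h1, eventually_gt_atTop 0] with z hz hz0
  rw [Real.dist_eq] at hz
  have hp : 0 < z ^ (-b) := rpow_pos_of_pos hz0 _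
  have e : F z - a * z ^ (-b) = (F z * z ^ b - a) * z ^ (-b) := by
    have : z ^ b * z ^ (-b) = 1 := by rw [← rpow_add hz0]; simp
    grind
  rw [e, abs_mul, abs_of_pos hp]
  exact mul_le_mul_of_nonneg_right hz.le hp.le

/-- The grid lives above `t/2`, so a range from `t/4` contains it with room to spare. -/
theorem eventually_forall_ge {p : ℝ → Prop} (h : ∀ᶠ z in atTop, p z) :
    ∀ᶠ t : ℝ in atTop, ∀ z, t / 4 ≤ z → p z := by
  obtain ⟨z₀, hz₀⟩ := eventually_atTop.1 h
  filter_upwards [eventually_ge_atTop (4 * z₀)] with t ht z hz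
  exact hz₀ z (by linarith)

theorem rpow_neg_le_of_div_four {b t z : ℝ} (hb : 0 < b) (ht : 0 < t) (hz : t / 4 ≤ z) :
    z ^ (-b) ≤ 4 ^ b * t ^ (-b) := by
  have h1 := rpow_le_rpow_of_nonpos (show 0 < t / 4 by linarith) hz (z := -b) (by linarith)
  refine h1.trans_eq ?_
  rw [Real.div_rpow ht.le (by norm_num), Real.rpow_neg (by norm_num : (0:ℝ) ≤ 4)]
  field_simp

theorem eventually_level (h : HallWelsh (sv μ) ξ Cst D β) (hc : HallWelsh (sv ν) ξc Cstc Dc βc)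
    (hD : dZ β βc D Dc ≠ 0) {ε : ℝ} (hε : 0 < ε) {Q κ : ℝ} (hQ : Q ≠ 0)
    (hQκ : Q * κ = -(xiZ ξ ξc ^ 2 * betaZ β βc * dZ β βc D Dc) *
        (kappaZ ξ ξc β βc D Dc / (1 - rhoZ ξ ξc β βc))) :
    ∀ᶠ t in atTop, |t ^ (1 / xiZ ξ ξc) / (Cst * Cstc) *
      (uncMass μ ν t - pLim ξ ξc * svMin μ ν t) - Q * t ^ (-betaZ β βc) * κ| ≤
        ε * |Q * t ^ (-betaZ β βc)| := by
  have hb := betaZ_pos h.beta_pos hc.beta_pos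
  have hcc : 0 < Cst * Cstc := mul_pos h.cst_pos hc.cst_pos
  have h1 := hasExpansion_uncRatio h hc hD
  rw [← hQκ] at h1
  have h2 := ((hasExpansion_svMin h hc).tendsto hb).div_const (Cst * Cstc)
  rw [div_self hcc.ne'] at h2
  have h3 := h2.mul h1
  rw [one_mul] at h3
  have h4 : Tendsto (fun t => (t ^ (1 / xiZ ξ ξc) / (Cst * Cstc) *
      (uncMass μ ν t - pLim ξ ξc * svMin μ ν t)) * t ^ betaZ β βc) atTop (𝓝 (Q * κ)) := by
    refine h3.congr fun t => ?_
    have := (svMin_pos h hc t).ne'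
    field_simp
  filter_upwards [eventually_abs_le_of_tendsto h4 (mul_pos hε (abs_pos.2 hQ)),
    eventually_gt_atTop 0] with t ht ht0
  have hp : 0 < t ^ (-betaZ β βc) := rpow_pos_of_pos ht0 _
  rw [abs_mul, abs_of_pos hp]
  grind

theorem one_sub_exp_neg_le (x : ℝ) : 1 - exp (-x) ≤ x := by have := add_one_le_exp (-x); linarith

theorem rpow_neg_sub_le {b z d : ℝ} (hz : 0 < z) (hb : 0 < b) (hd : 0 ≤ d) :
    0 ≤ z ^ (-b) - (z * exp d) ^ (-b) ∧ z ^ (-b) - (z * exp d) ^ (-b) ≤ z ^ (-b) * (b * d) := by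
  have hp : 0 < z ^ (-b) := rpow_pos_of_pos hz _
  have e : (z * exp d) ^ (-b) = z ^ (-b) * exp (-(b * d)) := by
    rw [Real.mul_rpow hz.le (exp_pos d).le, ← Real.exp_mul]
    congr 2; ring
  have h1 : exp (-(b * d)) ≤ 1 := by simp_all
  have h2 := one_sub_exp_neg_le (b * d)
  rw [e]
  constructor
  · nlinarith
  · nlinarith

theorem log_svMin_eq (z : ℝ) :
    xiZ ξ ξc * log (svMin μ ν z) = logRem μ ν ξ ξc β βc D Dc (Cst * Cstc) z +
      xiZ ξ ξc * dZ β βc D Dc * z ^ (-betaZ β βc) - log z + xiZ ξ ξc * log (Cst * Cstc) := by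
  rw [logRem, logTail]; ring

/-- Over logarithmic length `d` the logarithm of the tail drops by `d/ξ_z` up to a remainder
`o(t^{-β_z})` and a bias increment that is a small multiple of `d`. If `d` is at least a fixed
multiple of `t^{-β_z}`, half of the drop remains, even in the presence of atoms. -/
theorem eventually_svMin_decrease (h : HallWelsh (sv μ) ξ Cst D β)
    (hc : HallWelsh (sv ν) ξc Cstc Dc βc) {γ : ℝ} (hγ : 0 < γ) :
    ∀ᶠ t in atTop, ∀ z, t / 4 ≤ z → ∀ d, γ * t ^ (-betaZ β βc) ≤ d →
      svMin μ ν (z * exp d) * (d / (2 * xiZ ξ ξc)) ≤ svMin μ ν z - svMin μ ν (z * exp d) := by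
  have hb := betaZ_pos h.beta_pos hc.beta_pos
  have hx := xiZ_pos h.xi_pos hc.xi_pos
  set b := betaZ β βc
  set x := xiZ ξ ξc
  set δ := dZ β βc D Dc
  set η := γ / (8 * 4 ^ b) with hη
  have h4 : (0 : ℝ) < 4 ^ b := by positivity
  have hη0 : 0 < η := by positivity
  have e1 := eventually_abs_le_of_tendsto (tendsto_logRem h hc) hη0
  have e2 : ∀ᶠ z : ℝ in atTop, x * |δ| * b * z ^ (-b) ≤ 1 / 4 := by
    have := (tendsto_rpow_neg_atTop hb).const_mul (x * |δ| * b)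
    rw [mul_zero] at this
    exact (this.eventually (gt_mem_nhds (by norm_num : (0:ℝ) < 1/4))).mono fun _ h => h.le
  filter_upwards [eventually_forall_ge e1, eventually_forall_ge e2, eventually_gt_atTop 0]
    with t h1 h2 ht z hz d hd
  have hz0 : 0 < z := by linarith
  have htp : 0 < t ^ (-b) := rpow_pos_of_pos ht _
  have hd0 : 0 < d := lt_of_lt_of_le (by positivity) hd
  have hzz : z ≤ z * exp d := le_mul_of_one_le_right hz0.le (one_le_exp hd0.le)
  have r1 := h1 z hz
  have r2 := h1 (z * exp d) (hz.trans hzz)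
  simp only [zero_mul, sub_zero] at r1 r2
  obtain ⟨p1, p2⟩ := rpow_neg_sub_le hz0 hb hd0.le
  have p3 := rpow_neg_le_of_div_four hb ht hz
  have p4 := h2 z hz
  have hlog : d / 2 ≤ x * (log (svMin μ ν z) - log (svMin μ ν (z * exp d))) := by
    have l1 := log_svMin_eq (μ := μ) (ν := ν) (ξ := ξ) (ξc := ξc) (β := β) (βc := βc)
      (D := D) (Dc := Dc) (Cst := Cst) (Cstc := Cstc) z
    have l2 := log_svMin_eq (μ := μ) (ν := ν) (ξ := ξ) (ξc := ξc) (β := β) (βc := βc)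
      (D := D) (Dc := Dc) (Cst := Cst) (Cstc := Cstc) (z * exp d)
    rw [log_mul hz0.ne' (exp_pos d).ne', log_exp] at l2
    have hexp : x * (log (svMin μ ν z) - log (svMin μ ν (z * exp d))) =
        d + (logRem μ ν ξ ξc β βc D Dc (Cst * Cstc) z -
          logRem μ ν ξ ξc β βc D Dc (Cst * Cstc) (z * exp d)) +
          x * δ * (z ^ (-b) - (z * exp d) ^ (-b)) := by
      linear_combination l1 - l2
    have q1 : |x * δ * (z ^ (-b) - (z * exp d) ^ (-b))| ≤ d / 4 := by
      rw [abs_mul, abs_mul, abs_of_pos hx, abs_of_nonneg p1]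
      calc x * |δ| * (z ^ (-b) - (z * exp d) ^ (-b)) ≤ x * |δ| * (z ^ (-b) * (b * d)) :=
            mul_le_mul_of_nonneg_left p2 (by positivity)
        _ = x * |δ| * b * z ^ (-b) * d := by ring
        _ ≤ 1 / 4 * d := mul_le_mul_of_nonneg_right p4 hd0.le
        _ = d / 4 := by ring
    have q2 : η * z ^ (-b) ≤ d / 8 := by
      calc η * z ^ (-b) ≤ η * (4 ^ b * t ^ (-b)) := mul_le_mul_of_nonneg_left p3 hη0.le
        _ = γ * t ^ (-b) / 8 := by rw [hη]; field_simp
        _ ≤ d / 8 := by linarith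
    have q3 : η * (z * exp d) ^ (-b) ≤ d / 8 :=
      (mul_le_mul_of_nonneg_left (by linarith) hη0.le).trans q2
    grind
  set H := svMin μ ν z with hH
  set H' := svMin μ ν (z * exp d) with hH'
  have hHp : 0 < H := svMin_pos h hc _
  have hHp' : 0 < H' := svMin_pos h hc _
  have hlog2 : d / (2 * x) ≤ log (H / H') := by
    rw [log_div hHp.ne' hHp'.ne', div_le_iff₀ (by positivity)]
    linarith
  have h5 := add_one_le_exp (log (H / H'))
  rw [exp_log (by positivity)] at h5
  have h6 : d / (2 * x) ≤ H / H' - 1 := by linarith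
  calc H' * (d / (2 * x)) ≤ H' * (H / H' - 1) := mul_le_mul_of_nonneg_left h6 hHp'.le
    _ = H - H' := by field_simp

/-- Let `g` be the deviation of the uncensored proportion beyond `z` from `p`, and `H`, `H'` the
tails at the ends of the cell. The deviation in the cell is `g(z)(H - H') + (g(z) - g(z'))H'`. Here
`g` is small, its increment is small compared with `d`, and `H'` is at most a multiple of `(H -
H')/d`. -/
theorem eventually_cell (h : HallWelsh (sv μ) ξ Cst D β) (hc : HallWelsh (sv ν) ξc Cstc Dc βc)
    (hD : dZ β βc D Dc ≠ 0) {ε γ : ℝ} (hε : 0 < ε) (hγ : 0 < γ) :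
    ∀ᶠ t in atTop, ∀ z, t / 4 ≤ z → ∀ d, γ * t ^ (-betaZ β βc) ≤ d →
      |uncMass μ ν z - uncMass μ ν (z * exp d) -
        pLim ξ ξc * (svMin μ ν z - svMin μ ν (z * exp d))| ≤
        ε * (svMin μ ν z - svMin μ ν (z * exp d)) := by
  have hb := betaZ_pos h.beta_pos hc.beta_pos
  have hx := xiZ_pos h.xi_pos hc.xi_pos
  have hg := hasExpansion_uncRatio h hc hD
  set b := betaZ β βc
  set x := xiZ ξ ξc
  set a := -(x ^ 2 * b * dZ β βc D Dc) * (kappaZ ξ ξc β βc D Dc / (1 - rhoZ ξ ξc β βc))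
  have h4 : (0 : ℝ) < 4 ^ b := by positivity
  set η := ε * γ / (16 * x * 4 ^ b) with hη
  have hη0 : 0 < η := by positivity
  set g : ℝ → ℝ := fun z => uncMass μ ν z / svMin μ ν z - pLim ξ ξc with hgd
  have e1 := eventually_abs_le_of_tendsto (F := g) hg hη0
  have e2 : ∀ᶠ z : ℝ in atTop, 2 * x * b * |a| * z ^ (-b) < ε / 4 := by
    have := (tendsto_rpow_neg_atTop hb).const_mul (2 * x * b * |a|)
    rw [mul_zero] at this
    exact this.eventually (gt_mem_nhds (by linarith))
  have e3 : ∀ᶠ z : ℝ in atTop, |g z| < ε / 4 := by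
    have := (hg.tendsto hb).sub_const (pLim ξ ξc)
    rw [sub_self] at this
    have := this.abs
    rw [abs_zero] at this
    exact this.eventually (gt_mem_nhds (by linarith))
  filter_upwards [eventually_forall_ge e1, eventually_forall_ge e2, eventually_forall_ge e3,
    eventually_svMin_decrease h hc hγ, eventually_gt_atTop 0] with t h1 h2 h3 h5 ht z hz d hd
  have hz0 : 0 < z := by linarith
  have htp : 0 < t ^ (-b) := rpow_pos_of_pos ht _
  have hd0 : 0 < d := lt_of_lt_of_le (by positivity) hd
  have hzz : z ≤ z * exp d := le_mul_of_one_le_right hz0.le (one_le_exp hd0.le)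
  obtain ⟨p1, p2⟩ := rpow_neg_sub_le hz0 hb hd0.le
  have p3 := rpow_neg_le_of_div_four hb ht hz
  have r1 := h1 z hz
  have r2 := h1 (z * exp d) (hz.trans hzz)
  have hHp : 0 < svMin μ ν z := svMin_pos h hc _
  have hHp' : 0 < svMin μ ν (z * exp d) := svMin_pos h hc _
  have hdec := h5 z hz d hd
  have g2 := h2 z hz
  have g3 := h3 z hz
  have u1 : uncMass μ ν z = (g z + pLim ξ ξc) * svMin μ ν z := by grind
  have u2 : uncMass μ ν (z * exp d) =
      (g (z * exp d) + pLim ξ ξc) * svMin μ ν (z * exp d) := by grind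
  rw [u1, u2]
  set H := svMin μ ν z
  set H' := svMin μ ν (z * exp d)
  set w := z ^ (-b)
  set w' := (z * exp d) ^ (-b)
  have hw : 0 < w := rpow_pos_of_pos hz0 _
  have hΔ : 0 ≤ H - H' := le_trans (by positivity) hdec
  have hgg : |g z - g (z * exp d)| ≤ |a| * (w * (b * d)) + 2 * η * w := by
    have e : g z - g (z * exp d) = a * (w - w') + (g z - a * w) -
        (g (z * exp d) - a * w') := by ring
    rw [e]
    have t1 : |a * (w - w')| ≤ |a| * (w * (b * d)) := by
      rw [abs_mul, abs_of_nonneg p1]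
      exact mul_le_mul_of_nonneg_left p2 (abs_nonneg _)
    have t2 : η * w' ≤ η * w := mul_le_mul_of_nonneg_left (by linarith) hη0.le
    have := abs_sub (a * (w - w') + (g z - a * w)) (g (z * exp d) - a * w')
    have := abs_add_le (a * (w - w')) (g z - a * w)
    linarith
  have hH'le : |g z - g (z * exp d)| * H' ≤ (ε / 4 + ε / 4) * (H - H') := by
    have s1 : H' ≤ 2 * x / d * (H - H') := by
      calc H' = 2 * x / d * (H' * (d / (2 * x))) := by field_simp
        _ ≤ _ := mul_le_mul_of_nonneg_left hdec (by positivity)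
    have s2 : (|a| * (w * (b * d)) + 2 * η * w) * (2 * x / d) ≤ ε / 4 + ε / 4 := by
      have v1 : (|a| * (w * (b * d)) + 2 * η * w) * (2 * x / d) =
          2 * x * b * |a| * w + 4 * x * η * w / d := by field_simp; ring
      have v2 : 4 * x * η * w / d ≤ ε / 4 := by
        rw [div_le_iff₀ hd0]
        calc 4 * x * η * w ≤ 4 * x * η * (4 ^ b * t ^ (-b)) :=
              mul_le_mul_of_nonneg_left p3 (by positivity)
          _ = ε / 4 * (γ * t ^ (-b)) := by rw [hη]; field_simp; ring
          _ ≤ ε / 4 * d := mul_le_mul_of_nonneg_left hd (by positivity)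
      rw [v1]
      linarith
    calc |g z - g (z * exp d)| * H' ≤ (|a| * (w * (b * d)) + 2 * η * w) * (2 * x / d * (H - H')) :=
          mul_le_mul hgg s1 hHp'.le (by positivity)
      _ = (|a| * (w * (b * d)) + 2 * η * w) * (2 * x / d) * (H - H') := by ring
      _ ≤ _ := mul_le_mul_of_nonneg_right s2 hΔ
  have efin : (g z + pLim ξ ξc) * H - (g (z * exp d) + pLim ξ ξc) * H' -
      pLim ξ ξc * (H - H') = g z * (H - H') + (g z - g (z * exp d)) * H' := by ring
  rw [efin]
  have := abs_add_le (g z * (H - H')) ((g z - g (z * exp d)) * H')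
  rw [abs_mul, abs_mul, abs_of_nonneg hΔ, abs_of_pos hHp'] at this
  have t1 : |g z| * (H - H') ≤ ε / 4 * (H - H') := mul_le_mul_of_nonneg_right g3.le hΔ
  grind

end Approximation

/-! ### Arbitrarily short cells under the differentiated tail expansions -/

section Differentiable

variable {μ ν : Measure ℝ} [IsProbabilityMeasure μ] [IsProbabilityMeasure ν]
  {ξ ξc Cst Cstc D Dc β βc : ℝ}

theorem HallWelshDeriv.hasExpansion (h : HallWelshDeriv (sv μ) ξ D β) :
    HasExpansion (fun x => -(x * deriv (sv μ) x) / sv μ x) (1 / ξ) (β * D) β := by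
  have h2 := h.expansion.tendsto_div_nhds_zero.add_const (β * D)
  rw [zero_add] at h2
  refine h2.congr' ?_
  filter_upwards [eventually_gt_atTop 0] with x hx
  have hxb : 0 < x ^ β := rpow_pos_of_pos hx β
  rw [Real.rpow_neg hx.le]
  field_simp
  ring

theorem hasDerivAt_log_sv_exp (h : HallWelsh (sv μ) ξ Cst D β) {u : ℝ}
    (hd : DifferentiableAt ℝ (sv μ) (exp u)) :
    HasDerivAt (fun u => log (sv μ (exp u))) (exp u * deriv (sv μ) (exp u) / sv μ (exp u)) u := by
  have h1 := (hd.hasDerivAt.comp u (Real.hasDerivAt_exp u)).log (h.sv_pos _).ne'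
  grind

/-- The mean value inequality in the variable `log z`. -/
theorem abs_sub_le_of_hasDerivAt_exp {F F' : ℝ → ℝ} {z z' C : ℝ} (hz' : 0 < z') (hzz : z' ≤ z)
    (hF : ∀ u, z' ≤ exp u → HasDerivAt (fun u => F (exp u)) (F' u) u)
    (hC : ∀ u, z' ≤ exp u → |F' u| ≤ C) :
    |F z - F z'| ≤ C * log (z / z') := by
  have hz : 0 < z := hz'.trans_le hzz
  have h1 := (convex_Icc (log z') (log z)).norm_image_sub_le_of_norm_hasDerivWithin_le
    (f := fun u => F (exp u)) (f' := F') (C := C) (x := log z') (y := log z)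
    (fun u hu => (hF u ((Real.log_le_iff_le_exp hz').1 hu.1)).hasDerivWithinAt)
    (fun u hu => hC u ((Real.log_le_iff_le_exp hz').1 hu.1))
    (Set.left_mem_Icc.2 (log_le_log hz' hzz)) (Set.right_mem_Icc.2 (log_le_log hz' hzz))
  simp only [exp_log hz, exp_log hz', norm_eq_abs] at h1
  rwa [← log_div hz.ne' hz'.ne', abs_of_nonneg (Real.log_nonneg ((one_le_div hz').2 hzz))] at h1

theorem hasDerivAt_logRem_exp (h : HallWelsh (sv μ) ξ Cst D β)
    (hc : HallWelsh (sv ν) ξc Cstc Dc βc) {u : ℝ}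
    (hd : DifferentiableAt ℝ (sv μ) (exp u)) (hdc : DifferentiableAt ℝ (sv ν) (exp u)) :
    HasDerivAt (fun u => logRem μ ν ξ ξc β βc D Dc (Cst * Cstc) (exp u))
      (1 + xiZ ξ ξc * (exp u * deriv (sv μ) (exp u) / sv μ (exp u) +
        exp u * deriv (sv ν) (exp u) / sv ν (exp u)) +
        xiZ ξ ξc * dZ β βc D Dc * (betaZ β βc * exp u ^ (-betaZ β βc))) u := by
  have e : ∀ u, logRem μ ν ξ ξc β βc D Dc (Cst * Cstc) (exp u) =
      u + xiZ ξ ξc * (log (sv μ (exp u)) + log (sv ν (exp u))) - xiZ ξ ξc * log (Cst * Cstc) -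
        xiZ ξ ξc * dZ β βc D Dc * exp (u * (-betaZ β βc)) := by
    intro u
    rw [logRem, logTail, svMin, log_exp, log_mul (h.sv_pos _).ne' (hc.sv_pos _).ne', Real.exp_mul]
  simp only [e]
  have h1 := hasDerivAt_log_sv_exp h hd
  have h2 := hasDerivAt_log_sv_exp hc hdc
  have h3 := (((hasDerivAt_id u).mul_const (-betaZ β βc)).exp).const_mul (xiZ ξ ξc * dZ β βc D Dc)
  have h4 := (((hasDerivAt_id u).add ((h1.add h2).const_mul (xiZ ξ ξc))).sub_const
    (xiZ ξ ξc * log (Cst * Cstc))).sub h3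
  refine h4.congr_deriv ?_
  rw [← Real.exp_mul]
  simp only [id]
  ring

/-- In the derivative of the remainder with respect to `log z` the constants cancel because `1/ξ_z =
1/ξ + 1/ξ_c`, and the terms of order `z^{-β_z}` cancel as well. Increments are then proportional to
the logarithmic distance, with no additive error; this is what allows a small resolution `θ`. -/
theorem eventually_logRem_incr (h : HallWelsh (sv μ) ξ Cst D β)
    (hc : HallWelsh (sv ν) ξc Cstc Dc βc) (hd : HallWelshDeriv (sv μ) ξ D β)
    (hdc : HallWelshDeriv (sv ν) ξc Dc βc) {ε : ℝ} (hε : 0 < ε) :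
    ∀ᶠ t in atTop, ∀ z' z, t / 4 ≤ z' → z' ≤ z →
      |logRem μ ν ξ ξc β βc D Dc (Cst * Cstc) z - logRem μ ν ξ ξc β βc D Dc (Cst * Cstc) z'| ≤
        ε * t ^ (-betaZ β βc) * log (z / z') := by
  have hb := betaZ_pos h.beta_pos hc.beta_pos
  have hx := xiZ_pos h.xi_pos hc.xi_pos
  have h1 := (hd.hasExpansion.weaken (min_le_left β βc)).add
    (hdc.hasExpansion.weaken (min_le_right β βc))
  have e0 : (if β ≤ min β βc then β * D else 0) + (if βc ≤ min β βc then βc * Dc else 0) =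
      betaZ β βc * dZ β βc D Dc := by
    have h1 := ite_betaZ_left (β := β) (βc := βc) (β * D)
    have h2 := ite_betaZ_right (β := β) (βc := βc) (βc * Dc)
    rw [betaZ] at h1 h2
    rw [h1, h2, dZ, betaZ]
    grind
  rw [e0, ← one_div_xiZ h.xi_pos hc.xi_pos] at h1
  change HasExpansion _ _ _ (betaZ β βc) at h1
  set b := betaZ β βc with hbd
  set x := xiZ ξ ξc with hxd
  have h4 : (0 : ℝ) < 4 ^ b := by positivity
  have h5 : Tendsto (fun z => (1 + x * (z * deriv (sv μ) z / sv μ z + z * deriv (sv ν) z / sv ν z) +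
      x * dZ β βc D Dc * (b * z ^ (-b))) * z ^ b) atTop (𝓝 0) := by
    have h2 := ((Tendsto.const_mul (-x) h1)).add_const (x * (b * dZ β βc D Dc))
    rw [show -x * (b * dZ β βc D Dc) + x * (b * dZ β βc D Dc) = 0 by ring] at h2
    refine h2.congr' ?_
    filter_upwards [eventually_gt_atTop 0] with z hz
    have e : z ^ (-b) * z ^ b = 1 := by rw [← rpow_add hz]; simp
    grind
  have h6 := eventually_abs_le_of_tendsto h5 (show 0 < ε / 4 ^ b by positivity)
  simp only [zero_mul, sub_zero] at h6
  filter_upwards [eventually_forall_ge h6, eventually_forall_ge hd.differentiable,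
    eventually_forall_ge hdc.differentiable, eventually_gt_atTop 0] with t t1 t2 t3 ht z' z hz' hzz
  have hz0 : 0 < z' := by linarith
  refine abs_sub_le_of_hasDerivAt_exp hz0 hzz (fun u hu =>
    hasDerivAt_logRem_exp h hc (t2 _ (hz'.trans hu)) (t3 _ (hz'.trans hu))) fun u hu => ?_
  refine (t1 _ (hz'.trans hu)).trans ?_
  have := rpow_neg_le_of_div_four hb ht (hz'.trans hu)
  calc ε / 4 ^ b * exp u ^ (-b) ≤ ε / 4 ^ b * (4 ^ b * t ^ (-b)) :=
        mul_le_mul_of_nonneg_left this (by positivity)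
    _ = ε * t ^ (-b) := by field_simp

/-- The number `a` is the mean decay rate of the tail over the cell, and the derivative of `log S`
in `log z` tends to `-1/ξ`. -/
theorem eventually_log_sv_incr (h : HallWelsh (sv μ) ξ Cst D β) (hd : HallWelshDeriv (sv μ) ξ D β)
    {η : ℝ} (hη : 0 < η) :
    ∀ᶠ z in atTop, ∀ d, 0 ≤ d → ∃ a, |a - 1 / ξ| ≤ η ∧
      sv μ (z * exp d) = sv μ z * exp (-(a * d)) := by
  have h1 := (Metric.tendsto_nhds.1 (hd.hasExpansion.tendsto h.beta_pos)) η hη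
  obtain ⟨z₀, hz₀⟩ := eventually_atTop.1 (h1.and hd.differentiable)
  filter_upwards [eventually_ge_atTop z₀, eventually_gt_atTop 0] with z hz hz0 d hd0
  rcases hd0.eq_or_lt with rfl | hd0
  · exact ⟨1 / ξ, by simp [hη.le], by simp⟩
  have hzz : z ≤ z * exp d := le_mul_of_one_le_right hz0.le (one_le_exp hd0.le)
  have key := abs_sub_le_of_hasDerivAt_exp (F := fun z => log (sv μ z) + 1 / ξ * log z)
    (F' := fun u => exp u * deriv (sv μ) (exp u) / sv μ (exp u) + 1 / ξ)
    (C := η) hz0 hzz (fun u hu => by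
      simp only [log_exp]
      have := (hasDerivAt_log_sv_exp h (hz₀ _ (hz.trans hu)).2).add
        ((hasDerivAt_id u).const_mul (1 / ξ))
      refine this.congr_deriv (by ring)) (fun u hu => by
      have := (hz₀ _ (hz.trans hu)).1
      rw [Real.dist_eq, abs_sub_comm] at this
      grind)
  have hs := h.sv_pos z
  have hs' := h.sv_pos (z * exp d)
  rw [mul_div_cancel_left₀ _ hz0.ne', log_exp, log_mul hz0.ne' (exp_pos d).ne', log_exp] at key
  refine ⟨(log (sv μ z) - log (sv μ (z * exp d))) / d, ?_, ?_⟩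
  · have e : (log (sv μ z) - log (sv μ (z * exp d))) / d - 1 / ξ =
        -(log (sv μ (z * exp d)) + 1 / ξ * (log z + d) - (log (sv μ z) + 1 / ξ * log z)) / d := by
      field_simp; ring
    rw [e, abs_div, abs_neg, abs_of_pos hd0, div_le_iff₀ hd0]
    exact key
  · rw [div_mul_cancel₀ _ hd0.ne', neg_sub, Real.exp_sub, exp_log hs, exp_log hs']
    field_simp

theorem uncMass_sub (z d : ℝ) (hz : z ≤ z * exp d) :
    sv ν (z * exp d) * (sv μ z - sv μ (z * exp d)) ≤ uncMass μ ν z - uncMass μ ν (z * exp d) ∧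
      uncMass μ ν z - uncMass μ ν (z * exp d) ≤ sv ν z * (sv μ z - sv μ (z * exp d)) := by
  set z' := z * exp d
  have hint : ∀ s, IntegrableOn (svLeft ν) s μ := fun s => integrable_svLeft.integrableOn
  have hu : Ioc z z' ∪ Ioi z' = Ioi z := Set.Ioc_union_Ioi_eq_Ioi hz
  have hdis : Disjoint (Ioc z z') (Ioi z') := by simp
  have e1 : uncMass μ ν z - uncMass μ ν z' = ∫ x in Ioc z z', svLeft ν x ∂μ := by
    rw [uncMass, uncMass, ← hu, setIntegral_union hdis measurableSet_Ioi (hint _) (hint _)]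
    ring
  have e2 : sv μ z - sv μ z' = μ.real (Ioc z z') := by
    rw [sv, sv, ← hu, measureReal_union hdis measurableSet_Ioi]
    ring
  have hc : ∀ c : ℝ, ∫ _x in Ioc z z', c ∂μ = c * μ.real (Ioc z z') := by
    intro c; rw [setIntegral_const, smul_eq_mul, mul_comm]
  rw [e1, e2, ← hc, ← hc]
  constructor
  · refine setIntegral_mono_on integrableOn_const (hint _) measurableSet_Ioc fun x hx => ?_
    exact (sv_anti hx.2).trans (sv_le_svLeft x)
  · refine setIntegral_mono_on (hint _) integrableOn_const measurableSet_Ioc fun x hx => ?_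
    exact svLeft_le_sv hx.1

theorem sub_sq_le_one_sub_exp_neg {x : ℝ} (hx : 0 ≤ x) : x - x ^ 2 ≤ 1 - exp (-x) := by
  have h1 := add_one_le_exp x
  have h2 : exp (-x) ≤ 1 / (1 + x) := by
    rw [exp_neg, ← one_div]
    exact one_div_le_one_div_of_le (by linarith) (by linarith)
  have h3 : 1 / (1 + x) ≤ 1 - x + x ^ 2 := by
    rw [div_le_iff₀ (by linarith)]
    nlinarith [pow_nonneg hx 3]
  linarith

/-- The limiting proportion `p` balances the two decay rates, `(1 - p)/ξ = p/ξ_c`; rates close to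
these are balanced up to the same error. -/
theorem abs_mix_sub_le {p a ac α αc η : ℝ} (hp0 : 0 ≤ p) (hp1 : p ≤ 1)
    (hpα : (1 - p) * α = p * αc) (ha : |a - α| ≤ η) (hac : |ac - αc| ≤ η) :
    |(1 - p) * a - p * ac| ≤ η := by
  have e : (1 - p) * a - p * ac = (1 - p) * (a - α) - p * (ac - αc) := by linear_combination hpα
  calc |(1 - p) * a - p * ac| ≤ |(1 - p) * (a - α)| + |p * (ac - αc)| := by
        rw [e]; exact abs_sub _ _
    _ = (1 - p) * |a - α| + p * |ac - αc| := by
        rw [abs_mul, abs_mul, abs_of_nonneg hp0, abs_of_nonneg (sub_nonneg.2 hp1)]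
    _ ≤ (1 - p) * η + p * η := add_le_add (mul_le_mul_of_nonneg_left ha (sub_nonneg.2 hp1))
          (mul_le_mul_of_nonneg_left hac hp0)
    _ = η := by ring

theorem abs_mix_le {p a ac η d m A Ac : ℝ} (hp0 : 0 ≤ p) (hp1 : p ≤ 1) (hd : 0 ≤ d)
    (hm : 0 ≤ m) (h : |(1 - p) * a - p * ac| ≤ η) (A1 : A ≤ a * d) (A2 : a * d - m ≤ A)
    (Ac1 : Ac ≤ ac * d) (Ac2 : ac * d - m ≤ Ac) :
    |(1 - p) * A - p * Ac| ≤ η * d + m := by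
  have hq : 0 ≤ 1 - p := sub_nonneg.2 hp1
  have e2 := abs_le.1 h
  have e3 := mul_le_mul_of_nonneg_right e2.2 hd
  have e4 := mul_le_mul_of_nonneg_right e2.1 hd
  have e5 := mul_le_mul_of_nonneg_left A1 hq
  have e6 := mul_le_mul_of_nonneg_left A2 hq
  have e7 := mul_le_mul_of_nonneg_left Ac1 hp0
  have e8 := mul_le_mul_of_nonneg_left Ac2 hp0
  grind

/-- The quantities `1 - exp(-a d)` and `1 - exp(-ac d)` are the relative losses of the tails of `X`
and `C` over a cell. They are linear in `d` to first order, and `M` bounds the squared rates and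
their product, so that `M d ≤ ε α / 16` absorbs every quadratic term. -/
theorem exp_cell_bounds {p α αc ε η M d a ac : ℝ} (hα : 0 < α)
    (hp0 : 0 ≤ p) (hp1 : p ≤ 1) (hpα : (1 - p) * α = p * αc)
    (hη2 : η ≤ α / 2) (hη3 : η ≤ αc) (hM : M = (2 * α + 2 * αc) ^ 2)
    (hd0 : 0 ≤ d) (hd1 : d ≤ 1 / (4 * α)) (hMd : M * d ≤ ε * α / 16)
    (ha : |a - α| ≤ η) (hac : |ac - αc| ≤ η) :
    0 ≤ 1 - exp (-(a * d)) ∧ 0 ≤ 1 - exp (-(ac * d)) ∧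
    α * d / 4 ≤ 1 - exp (-(a * d)) ∧
    (1 - exp (-(a * d))) * (1 - exp (-(ac * d))) ≤ ε * α / 16 * d ∧
    |(1 - p) * (1 - exp (-(a * d))) - p * (1 - exp (-(ac * d)))| ≤ η * d + ε * α / 16 * d := by
  have hmix := abs_mix_sub_le hp0 hp1 hpα ha hac
  rw [abs_le] at ha hac
  have hη0 : 0 ≤ η := by linarith
  have ha1 : α / 2 ≤ a := by linarith
  have ha2 : a ≤ 2 * α := by linarith
  have hac1 : 0 ≤ ac := by linarith
  have hac2 : ac ≤ 2 * αc := by linarith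
  have ha0 : 0 ≤ a := by linarith
  have had := mul_nonneg ha0 hd0
  have hacd := mul_nonneg hac1 hd0
  have hdd := mul_nonneg hd0 hd0
  have A1 := one_sub_exp_neg_le (a * d)
  have A2 := sub_sq_le_one_sub_exp_neg had
  have Ac1 := one_sub_exp_neg_le (ac * d)
  have Ac2 := sub_sq_le_one_sub_exp_neg hacd
  have A0 : 0 ≤ 1 - exp (-(a * d)) := by simp_all
  have Ac0 : 0 ≤ 1 - exp (-(ac * d)) := by simp_all
  have hMdd : M * (d * d) ≤ ε * α / 16 * d := by
    rw [← mul_assoc]; exact mul_le_mul_of_nonneg_right hMd hd0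
  have hsq : ∀ x, 0 ≤ x → x ≤ 2 * α + 2 * αc → (x * d) ^ 2 ≤ ε * α / 16 * d := by
    intro x hx0 hx
    have : x ^ 2 ≤ M := by rw [hM]; exact pow_le_pow_left₀ hx0 hx 2
    calc (x * d) ^ 2 = x ^ 2 * (d * d) := by ring
      _ ≤ M * (d * d) := mul_le_mul_of_nonneg_right this hdd
      _ ≤ _ := hMdd
  have hsqA := hsq a ha0 (by linarith)
  have hsqAc := hsq ac hac1 (by linarith)
  refine ⟨A0, Ac0, ?_, ?_, ?_⟩
  · have h1 : a * d ≤ 1 / 2 := by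
      calc a * d ≤ 2 * α * (1 / (4 * α)) := mul_le_mul ha2 hd1 hd0 (by linarith)
        _ = 1 / 2 := by field_simp; norm_num
    have h2 : (a * d) ^ 2 ≤ a * d * (1 / 2) := by rw [sq]; exact mul_le_mul_of_nonneg_left h1 had
    have h3 := mul_le_mul_of_nonneg_right ha1 hd0
    linarith
  · have hM2 : a * ac ≤ M := by
      calc a * ac ≤ (2 * α) * (2 * αc) := mul_le_mul ha2 hac2 hac1 (by linarith)
        _ ≤ M := by
          rw [hM]
          have := sq_nonneg (2 * α - 2 * αc)
          have : 0 ≤ α * αc := mul_nonneg hα.le (by linarith)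
          linarith
    calc _ ≤ (a * d) * (ac * d) := mul_le_mul A1 Ac1 Ac0 had
      _ = a * ac * (d * d) := by ring
      _ ≤ M * (d * d) := mul_le_mul_of_nonneg_right hM2 hdd
      _ ≤ _ := hMdd
  · exact abs_mix_le hp0 hp1 hd0 (le_trans (sq_nonneg _) hsqA) hmix A1 (by linarith) Ac1
      (by linarith)

/-- Here `s` is the tail of `Z` at the lower end, `A` and `Ac` are the relative losses of the two
tails, and `U` is the uncensored mass of the cell, squeezed by replacing the tail of `C` by its
values at the two ends. -/
theorem abs_cell_mix_le {p ε A Ac U s e₁ e₂ : ℝ} (hp0 : 0 ≤ p) (hp1 : p ≤ 1) (hs : 0 ≤ s)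
    (hε : 0 ≤ ε) (A0 : 0 ≤ A) (A1 : A ≤ 1) (Ac0 : 0 ≤ Ac)
    (hprod : A * Ac ≤ e₁) (hmix : |(1 - p) * A - p * Ac| ≤ e₂) (hle : e₂ + e₁ ≤ ε * A)
    (hlo : s * (A * (1 - Ac)) ≤ U) (hup : U ≤ s * A) :
    |U - p * (s * (A + Ac - A * Ac))| ≤ ε * (s * (A + Ac - A * Ac)) := by
  have hd := abs_le.1 hmix
  have hAA := mul_nonneg A0 Ac0
  have h1 : A ≤ A + Ac - A * Ac := by
    have := mul_le_of_le_one_left Ac0 A1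
    linarith
  have h2 := mul_le_mul_of_nonneg_left h1 hε
  have h3 : p * (A * Ac) ≤ A * Ac := mul_le_of_le_one_left hAA hp1
  have h4 := mul_nonneg hp0 hAA
  have f1 : A - p * (A + Ac - A * Ac) ≤ ε * (A + Ac - A * Ac) := by linarith
  have f2 : -(ε * (A + Ac - A * Ac)) ≤ A * (1 - Ac) - p * (A + Ac - A * Ac) := by linarith
  have f1' := mul_le_mul_of_nonneg_left f1 hs
  have f2' := mul_le_mul_of_nonneg_left f2 hs
  grind

/-- With decay rates under control on every scale, the shares of `X` and `C` in the loss over a cell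
are right to first order however short the cell is; only an upper bound on `d` remains. -/
theorem eventually_cell_of_deriv (h : HallWelsh (sv μ) ξ Cst D β)
    (hc : HallWelsh (sv ν) ξc Cstc Dc βc) (hd : HallWelshDeriv (sv μ) ξ D β)
    (hdc : HallWelshDeriv (sv ν) ξc Dc βc) {ε : ℝ} (hε : 0 < ε) :
    ∃ d₀ > 0, ∀ᶠ z in atTop, ∀ d, 0 ≤ d → d ≤ d₀ →
      |uncMass μ ν z - uncMass μ ν (z * exp d) -
        pLim ξ ξc * (svMin μ ν z - svMin μ ν (z * exp d))| ≤
        ε * (svMin μ ν z - svMin μ ν (z * exp d)) := by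
  have hα : 0 < 1 / ξ := one_div_pos.2 h.xi_pos
  have hαc : 0 < 1 / ξc := one_div_pos.2 hc.xi_pos
  have hp0 := pLim_pos h.xi_pos hc.xi_pos
  have hp1 := pLim_lt_one h.xi_pos hc.xi_pos
  have hpα : (1 - pLim ξ ξc) * (1 / ξ) = pLim ξ ξc * (1 / ξc) := by
    have := h.xi_pos; have := hc.xi_pos
    rw [pLim]; field_simp; ring
  obtain ⟨α, hαd⟩ : ∃ α, α = 1 / ξ := ⟨_, rfl⟩
  obtain ⟨αc, hαcd⟩ : ∃ αc, αc = 1 / ξc := ⟨_, rfl⟩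
  obtain ⟨p, hpd⟩ : ∃ p, p = pLim ξ ξc := ⟨_, rfl⟩
  rw [← hαd] at hα hpα
  rw [← hαcd] at hαc hpα
  rw [← hpd] at hp0 hp1 hpα ⊢
  obtain ⟨η, hη0, hη1, hη2, hη3⟩ : ∃ η, 0 < η ∧ η ≤ ε * α / 8 ∧ η ≤ α / 2 ∧ η ≤ αc :=
    ⟨min (ε * α / 8) (min (α / 2) αc), by positivity, min_le_left _ _,
      (min_le_right _ _).trans (min_le_left _ _), (min_le_right _ _).trans (min_le_right _ _)⟩
  obtain ⟨M, hM⟩ : ∃ M, M = (2 * α + 2 * αc) ^ 2 := ⟨_, rfl⟩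
  have hM0 : 0 < M := by rw [hM]; positivity
  refine ⟨min (1 / (4 * α)) (ε * α / (16 * M)), by positivity, ?_⟩
  filter_upwards [eventually_log_sv_incr h hd hη0, eventually_log_sv_incr hc hdc hη0,
    eventually_gt_atTop 0] with z h1 h2 hz d hd0 hdle
  obtain ⟨a, ha, hsa⟩ := h1 d hd0
  obtain ⟨ac, hac, hsc⟩ := h2 d hd0
  rw [← hαd] at ha
  rw [← hαcd] at hac
  have hMd : M * d ≤ ε * α / 16 := by
    calc M * d ≤ M * (ε * α / (16 * M)) :=
          mul_le_mul_of_nonneg_left (hdle.trans (min_le_right _ _)) hM0.le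
      _ = _ := by field_simp
  obtain ⟨b1, b2, b3, b4, b5⟩ := exp_cell_bounds hα hp0.le hp1.le hpα hη2 hη3 hM hd0
    (hdle.trans (min_le_left _ _)) hMd ha hac
  have hzz : z ≤ z * exp d := le_mul_of_one_le_right hz.le (one_le_exp hd0)
  obtain ⟨hlo, hup⟩ := uncMass_sub (μ := μ) (ν := ν) z d hzz
  have hdH : svMin μ ν z - svMin μ ν (z * exp d) = sv μ z * sv ν z *
      ((1 - exp (-(a * d))) + (1 - exp (-(ac * d))) -
        (1 - exp (-(a * d))) * (1 - exp (-(ac * d)))) := by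
    rw [svMin, svMin, hsa, hsc]; ring
  rw [hdH]
  have hηd := mul_le_mul_of_nonneg_right hη1 hd0
  have hεA := mul_le_mul_of_nonneg_left b3 hε.le
  refine abs_cell_mix_le hp0.le hp1.le (mul_pos (h.sv_pos z) (hc.sv_pos z)).le hε.le b1
    (by linarith [exp_pos (-(a * d))]) b2 b4 b5 (by linarith) ?_ ?_
  · refine le_trans (le_of_eq ?_) hlo
    rw [hsa, hsc]; ring
  · refine hup.trans (le_of_eq ?_)
    rw [hsa]; ring

end Differentiable

/-! ### The two regimes of tail approximation -/

section Approximation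

variable {μ ν : Measure ℝ} [IsProbabilityMeasure μ] [IsProbabilityMeasure ν]
  {ξ ξc Cst Cstc D Dc β βc : ℝ}

theorem eventually_logRem_bound (h : HallWelsh (sv μ) ξ Cst D β)
    (hc : HallWelsh (sv ν) ξc Cstc Dc βc) {γ : ℝ} (hγ : 0 < γ) :
    ∀ᶠ t in atTop, ∀ z, t / 4 ≤ z →
      |logRem μ ν ξ ξc β βc D Dc (Cst * Cstc) z| ≤ γ * t ^ (-betaZ β βc) := by
  have hb := betaZ_pos h.beta_pos hc.beta_pos
  set b := betaZ β βc
  have h4 : (0 : ℝ) < 4 ^ b := by positivity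
  have e1 := eventually_abs_le_of_tendsto (tendsto_logRem h hc) (show 0 < γ / 4 ^ b by positivity)
  simp only [zero_mul, sub_zero] at e1
  filter_upwards [eventually_forall_ge e1, eventually_gt_atTop 0] with t h1 ht z hz
  refine (h1 z hz).trans ?_
  calc γ / 4 ^ b * z ^ (-b) ≤ γ / 4 ^ b * (4 ^ b * t ^ (-b)) :=
          mul_le_mul_of_nonneg_left (rpow_neg_le_of_div_four hb ht hz) (by positivity)
      _ = γ * t ^ (-b) := by field_simp

/-- Without derivatives the remainder is merely `o(|q|)`, so an increment costs `ε |q|` however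
small the distance: the resolution is `1`. -/
theorem eventually_tailApprox (h : HallWelsh (sv μ) ξ Cst D β)
    (hc : HallWelsh (sv ν) ξc Cstc Dc βc) (hD : dZ β βc D Dc ≠ 0) {ε : ℝ} (hε : 0 < ε)
    {Q κ : ℝ} (hQ : Q ≠ 0) (hQκ : Q * κ = -(xiZ ξ ξc ^ 2 * betaZ β βc * dZ β βc D Dc) *
        (kappaZ ξ ξc β βc D Dc / (1 - rhoZ ξ ξc β βc))) :
    ∀ᶠ t in atTop, TailApprox μ ν ξ ξc β βc D Dc (Cst * Cstc) (Q * t ^ (-betaZ β βc)) κ ε t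
      (ε * |Q * t ^ (-betaZ β βc)| * 1) 1 := by
  have hQ0 : 0 < |Q| := abs_pos.2 hQ
  filter_upwards [eventually_level h hc hD hε hQ hQκ,
    eventually_logRem_bound h hc (show 0 < ε * |Q| / 2 by positivity),
    eventually_cell h hc hD hε (show 0 < ε * |Q| by positivity), eventually_gt_atTop 0]
    with t h1 h2 h3 ht
  have hp : 0 < t ^ (-betaZ β βc) := rpow_pos_of_pos ht _
  have eq : |Q * t ^ (-betaZ β βc)| = |Q| * t ^ (-betaZ β βc) := by rw [abs_mul, abs_of_pos hp]
  refine ⟨fun z' z hz' hz => ?_, fun z hz => ?_, fun z hz => h3 z hz _ ?_, h1⟩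
  · have a1 := h2 z (hz'.trans hz)
    have a2 := h2 z' hz'
    have hz0 : 0 < z' := by linarith
    have hl : 0 ≤ log (z / z') := Real.log_nonneg ((one_le_div hz0).2 hz)
    have := abs_sub (logRem μ ν ξ ξc β βc D Dc (Cst * Cstc) z)
      (logRem μ ν ξ ξc β βc D Dc (Cst * Cstc) z')
    rw [eq]
    have : 0 ≤ ε * (|Q| * t ^ (-betaZ β βc)) * log (z / z') := by positivity
    linarith
  · have : 0 ≤ ε * |Q| * t ^ (-betaZ β βc) := by positivity
    refine (h2 z hz).trans ?_
    rw [eq]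
    linarith
  grind

/-- The threshold for `t` does not depend on `θ`, so `θ` may later be chosen depending on `k`. -/
theorem eventually_tailApprox_of_deriv (h : HallWelsh (sv μ) ξ Cst D β)
    (hc : HallWelsh (sv ν) ξc Cstc Dc βc) (hd : HallWelshDeriv (sv μ) ξ D β)
    (hdc : HallWelshDeriv (sv ν) ξc Dc βc) (hD : dZ β βc D Dc ≠ 0) {ε : ℝ} (hε : 0 < ε)
    {Q κ : ℝ} (hQ : Q ≠ 0) (hQκ : Q * κ = -(xiZ ξ ξc ^ 2 * betaZ β βc * dZ β βc D Dc) *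
        (kappaZ ξ ξc β βc D Dc / (1 - rhoZ ξ ξc β βc))) :
    ∀ᶠ t in atTop, ∀ θ, 0 ≤ θ → θ ≤ 1 →
      TailApprox μ ν ξ ξc β βc D Dc (Cst * Cstc) (Q * t ^ (-betaZ β βc)) κ ε t
        (ε * |Q * t ^ (-betaZ β βc)| * θ) θ := by
  have hb := betaZ_pos h.beta_pos hc.beta_pos
  have hQ0 : 0 < |Q| := abs_pos.2 hQ
  obtain ⟨d₀, hd₀, hcell⟩ := eventually_cell_of_deriv h hc hd hdc hε
  have hsmall : ∀ᶠ t : ℝ in atTop, ε * |Q| * t ^ (-betaZ β βc) ≤ d₀ := by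
    have := (tendsto_rpow_neg_atTop hb).const_mul (ε * |Q|)
    rw [mul_zero] at this
    exact (this.eventually (gt_mem_nhds hd₀)).mono fun _ h => h.le
  filter_upwards [eventually_level h hc hD hε hQ hQκ,
    eventually_logRem_bound h hc (show 0 < ε * |Q| / 2 by positivity),
    eventually_forall_ge hcell, eventually_logRem_incr h hc hd hdc (show 0 < ε * |Q| by positivity),
    hsmall, eventually_gt_atTop 0]
    with t h1 h2 h3 h5 h6 ht θ hθ0 hθ1
  have hp : 0 < t ^ (-betaZ β βc) := rpow_pos_of_pos ht _
  have eq : |Q * t ^ (-betaZ β βc)| = |Q| * t ^ (-betaZ β βc) := by rw [abs_mul, abs_of_pos hp]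
  refine ⟨fun z' z hz' hz => ?_, fun z hz => ?_, fun z hz => h3 z hz _ ?_ ?_, h1⟩
  · refine (h5 z' z hz' hz).trans ?_
    rw [eq]
    have : 0 ≤ ε * (|Q| * t ^ (-betaZ β βc)) * θ := by positivity
    linarith
  · have : 0 ≤ ε * |Q| * t ^ (-betaZ β βc) := by positivity
    grind
  · positivity
  · rw [eq]
    have : 0 ≤ ε * |Q| * t ^ (-betaZ β βc) := by positivity
    nlinarith

end Approximation

/-! ### Cells of an increasing grid -/

section Cells

/-- Index of the cell `(g (m - 1), g m]` that contains `x`; the first cell is `(-∞, g 0]`. -/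
def cellOf (g : ℕ → ℝ) (x : ℝ) : ℕ := sInf {m | x ≤ g m}

variable {g : ℕ → ℝ}

theorem cellOf_le_iff (hg : Monotone g) (hu : Tendsto g atTop atTop) {x : ℝ} {m : ℕ} :
    cellOf g x ≤ m ↔ x ≤ g m := by
  have hne : {m | x ≤ g m}.Nonempty := (hu.eventually_ge_atTop x).exists
  constructor
  · intro h
    exact le_trans (Nat.sInf_mem hne) (hg h)
  · exact fun h => Nat.sInf_le h

theorem lt_cellOf_iff (hg : Monotone g) (hu : Tendsto g atTop atTop) {x : ℝ} {m : ℕ} :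
    m < cellOf g x ↔ g m < x := by
  rw [← not_le, cellOf_le_iff hg hu, not_le]

theorem cellOf_mono (hg : Monotone g) (hu : Tendsto g atTop atTop) : Monotone (cellOf g) :=
  fun _ _ h => (cellOf_le_iff hg hu).2 (h.trans ((cellOf_le_iff hg hu).1 le_rfl))

theorem measurable_cellOf (hg : Monotone g) (hu : Tendsto g atTop atTop) :
    Measurable (cellOf g) := (cellOf_mono hg hu).measurable

theorem setOf_cellOf_eq (hg : Monotone g) (hu : Tendsto g atTop atTop) (m : ℕ) :
    {x | cellOf g x = m + 1} = Ioc (g m) (g (m + 1)) := by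
  ext x
  rw [mem_ofPred_eq, Set.mem_Ioc, ← lt_cellOf_iff hg hu, ← cellOf_le_iff hg hu]
  omega

theorem setOf_cellOf_eq_zero (hg : Monotone g) (hu : Tendsto g atTop atTop) :
    {x | cellOf g x = 0} = Iic (g 0) := by
  ext x
  rw [mem_ofPred_eq, Set.mem_Iic, ← cellOf_le_iff hg hu]
  omega

theorem measure_cellOf_eq {μ₁ μ₂ : Measure ℝ} [IsFiniteMeasure μ₁] [IsFiniteMeasure μ₂]
    {g₁ g₂ : ℕ → ℝ} (hg₁ : Monotone g₁) (hu₁ : Tendsto g₁ atTop atTop) (hg₂ : Monotone g₂)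
    (hu₂ : Tendsto g₂ atTop atTop) (h : ∀ m, μ₁ (Iic (g₁ m)) = μ₂ (Iic (g₂ m))) (m : ℕ) :
    μ₁ {x | cellOf g₁ x = m} = μ₂ {x | cellOf g₂ x = m} := by
  cases m with
  | zero => rw [setOf_cellOf_eq_zero hg₁ hu₁, setOf_cellOf_eq_zero hg₂ hu₂, h]
  | succ m =>
    have e : ∀ a b : ℝ, Ioc a b = Iic b \ Iic a := fun a b => by ext x; simp [and_comm]
    rw [setOf_cellOf_eq hg₁ hu₁, setOf_cellOf_eq hg₂ hu₂, e, e,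
      measure_sdiff (Set.Iic_subset_Iic.2 (hg₁ m.le_succ)) measurableSet_Iic.nullMeasurableSet
        (measure_ne_top _ _),
      measure_sdiff (Set.Iic_subset_Iic.2 (hg₂ m.le_succ)) measurableSet_Iic.nullMeasurableSet
        (measure_ne_top _ _), h, h]

end Cells

/-! ### The geometric grid and its image on the exponential scale -/

section Grid

variable {μ ν : Measure ℝ} [IsProbabilityMeasure μ] [IsProbabilityMeasure ν]
  {ξ ξc Cst Cstc D Dc β βc t d : ℝ}

/-- The number of mesh steps from the first grid point up to `t`. Rounding down keeps the first
point at or above `t/2`. -/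
def gridM (d : ℝ) : ℕ := ⌊log 2 / d⌋₊

/-- A geometric grid with mesh `exp d`, with `t` at place `gridM d`. -/
def gridZ (t d : ℝ) (m : ℕ) : ℝ := t * exp (((m : ℝ) - gridM d) * d)

/-- The grid of the exponential scale that corresponds to `gridZ`. -/
def gridY (μ ν : Measure ℝ) (t d : ℝ) (m : ℕ) : ℝ := -log (svMin μ ν (gridZ t d m))

theorem gridZ_pos (ht : 0 < t) (m : ℕ) : 0 < gridZ t d m := by rw [gridZ]; positivity

theorem gridZ_mono (ht : 0 < t) (hd : 0 < d) : Monotone (gridZ t d) := by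
  intro a b h
  have : (a : ℝ) ≤ b := by exact_mod_cast h
  unfold gridZ
  gcongr

theorem gridZ_succ (t d : ℝ) (m : ℕ) : gridZ t d (m + 1) = gridZ t d m * exp d := by
  rw [gridZ, gridZ, mul_assoc, ← exp_add]
  push_cast
  congr 2
  ring

theorem gridZ_gridM (t d : ℝ) : gridZ t d (gridM d) = t := by simp [gridZ]

theorem half_le_gridZ (ht : 0 < t) (hd : 0 < d) (m : ℕ) : t / 2 ≤ gridZ t d m := by
  have h1 : (gridM d : ℝ) * d ≤ log 2 := by
    rw [← le_div_iff₀ hd]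
    exact Nat.floor_le (div_nonneg (Real.log_nonneg (by norm_num)) hd.le)
  have h2 : exp (-log 2) ≤ exp (((m : ℝ) - gridM d) * d) := by
    apply exp_le_exp.2
    have : 0 ≤ (m : ℝ) * d := by positivity
    linarith
  rw [exp_neg, exp_log (by norm_num)] at h2
  rw [gridZ, div_eq_mul_inv]
  simp_all

theorem gridZ_zero_le (ht : 0 < t) (hd : 0 < d) : gridZ t d 0 ≤ t / 2 * exp d := by
  have h1 : log 2 ≤ ((gridM d : ℝ) + 1) * d := by
    rw [← div_le_iff₀ hd]
    exact (Nat.lt_floor_add_one _).le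
  have h2 : exp (((0 : ℕ) - (gridM d : ℝ)) * d) ≤ exp (-log 2 + d) := by
    apply exp_le_exp.2
    push_cast
    linarith
  rw [exp_add, exp_neg, exp_log (by norm_num)] at h2
  rw [gridZ, div_eq_mul_inv, mul_assoc]
  simp_all

theorem tendsto_gridZ (ht : 0 < t) (hd : 0 < d) : Tendsto (gridZ t d) atTop atTop := by
  refine Tendsto.const_mul_atTop ht (Real.tendsto_exp_atTop.comp ?_)
  refine Tendsto.atTop_mul_const hd ?_
  exact tendsto_atTop_add_const_right _ _ tendsto_natCast_atTop_atTop

theorem tendsto_sv_atTop : Tendsto (sv μ) atTop (𝓝 0) := by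
  have h := (ProbabilityTheory.tendsto_cdf_atTop μ).const_sub 1
  rw [sub_self] at h
  refine h.congr fun x => ?_
  rw [sv, ← Set.compl_Iic, probReal_compl_eq_one_sub measurableSet_Iic,
    ProbabilityTheory.cdf_eq_real]

theorem tendsto_svMin_atTop : Tendsto (svMin μ ν) atTop (𝓝 0) := by
  have := (tendsto_sv_atTop (μ := μ)).mul (tendsto_sv_atTop (μ := ν))
  rwa [mul_zero] at this

theorem gridY_mono (hpos : ∀ z, 0 < svMin μ ν z) (ht : 0 < t) (hd : 0 < d) :
    Monotone (gridY μ ν t d) := fun _ _ h =>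
  neg_le_neg (log_le_log (hpos _) (svMin_anti (gridZ_mono ht hd h)))

theorem tendsto_gridY (hpos : ∀ z, 0 < svMin μ ν z) (ht : 0 < t) (hd : 0 < d) :
    Tendsto (gridY μ ν t d) atTop atTop := by
  refine tendsto_neg_atBot_atTop.comp (Real.tendsto_log_nhdsGT_zero.comp ?_)
  rw [tendsto_nhdsWithin_iff]
  exact ⟨tendsto_svMin_atTop.comp (tendsto_gridZ ht hd), of_forall fun m => hpos _⟩

theorem gridY_nonneg (m : ℕ) : 0 ≤ gridY μ ν t d m :=
  neg_nonneg.2 (Real.log_nonpos (svMin_nonneg _) (svMin_le_one _))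

theorem exp_neg_gridY (hpos : ∀ z, 0 < svMin μ ν z) (m : ℕ) :
    exp (-gridY μ ν t d m) = svMin μ ν (gridZ t d m) := by
  rw [gridY, neg_neg, exp_log (hpos _)]

theorem expMeasure_real_Ioi {x : ℝ} (hx : 0 ≤ x) : (expMeasure 1).real (Ioi x) = exp (-x) := by
  have : IsProbabilityMeasure (expMeasure 1) := isProbabilityMeasure_expMeasure one_pos
  rw [← Set.compl_Iic, probReal_compl_eq_one_sub measurableSet_Iic,
    ← ProbabilityTheory.cdf_eq_real, cdf_expMeasure_eq one_pos, if_pos hx]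
  simp

theorem prod_min_gt (z : ℝ) : (μ.prod ν).real {x : ℝ × ℝ | z < min x.1 x.2} = svMin μ ν z := by
  have : {x : ℝ × ℝ | z < min x.1 x.2} = Ioi z ×ˢ Ioi z := by ext x; simp
  rw [this, measureReal_prod_prod]
  rfl

/-- By Fubini's theorem: given `X = x > z`, the remaining event is `C ≥ x`. -/
theorem prod_min_gt_le (z : ℝ) :
    (μ.prod ν).real {x : ℝ × ℝ | z < min x.1 x.2 ∧ x.1 ≤ x.2} = uncMass μ ν z := by
  have hm : MeasurableSet {x : ℝ × ℝ | z < min x.1 x.2 ∧ x.1 ≤ x.2} :=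
    (measurableSet_lt measurable_const (measurable_fst.min measurable_snd)).inter
      (measurableSet_le measurable_fst measurable_snd)
  rw [measureReal_def, prod_apply hm, uncMass, integral_eq_lintegral_of_nonneg_ae
    (ae_of_all _ fun x => svLeft_nonneg x) integrable_svLeft.integrableOn.aestronglyMeasurable,
    ← lintegral_indicator measurableSet_Ioi]
  congr 1
  refine lintegral_congr fun x => ?_
  by_cases hx : x ∈ Ioi z
  · rw [indicator_of_mem hx, svLeft, ofReal_measureReal]
    congr 1
    grind
  · rw [indicator_of_notMem hx]
    have : Prod.mk x ⁻¹' {x : ℝ × ℝ | z < min x.1 x.2 ∧ x.1 ≤ x.2} = ∅ := by grind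
    rw [this, measure_empty]

/-- Conditional probability of a non-censored observation, given the cell. -/
def cellProb (μ ν : Measure ℝ) (p t d : ℝ) (m : ℕ) : ℝ :=
  -- The default `p` on cells without mass keeps the distance to `p` small on them too.
  if (μ.prod ν).real {x | cellOf (gridZ t d) (min x.1 x.2) = m} = 0 then p else
    (μ.prod ν).real {x | cellOf (gridZ t d) (min x.1 x.2) = m ∧ x.1 ≤ x.2} /
      (μ.prod ν).real {x | cellOf (gridZ t d) (min x.1 x.2) = m}

theorem cellProb_nonneg {p : ℝ} (hp : 0 ≤ p) (m : ℕ) : 0 ≤ cellProb μ ν p t d m := by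
  rw [cellProb]; split_ifs <;> positivity

theorem cellProb_le_one {p : ℝ} (hp : p ≤ 1) (m : ℕ) : cellProb μ ν p t d m ≤ 1 := by
  rw [cellProb]
  split_ifs with h
  · exact hp
  · exact div_le_one_of_le₀ (measureReal_mono fun x hx => hx.1) measureReal_nonneg

theorem cellProb_mul {p : ℝ} (m : ℕ) :
    cellProb μ ν p t d m * (μ.prod ν).real {x | cellOf (gridZ t d) (min x.1 x.2) = m} =
      (μ.prod ν).real {x | cellOf (gridZ t d) (min x.1 x.2) = m ∧ x.1 ≤ x.2} := by
  rw [cellProb]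
  split_ifs with h
  · rw [h, mul_zero]
    exact (le_antisymm (h ▸ measureReal_mono fun x hx => hx.1) measureReal_nonneg).symm
  grind

/-- Masses of cells are differences of `svMin` and `uncMass` at the end points, compared by `cell`.
The cell `0` is the half-line below the grid, where nothing is known. -/
theorem abs_cellProb_sub_le {c q κ ε θ : ℝ} (hA : TailApprox μ ν ξ ξc β βc D Dc c q κ ε t d θ)
    (hε : 0 ≤ ε) (ht : 0 < t) (hd : 0 < d) {m : ℕ} (hm : 1 ≤ m) :
    |cellProb μ ν (pLim ξ ξc) t d m - pLim ξ ξc| ≤ ε := by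
  obtain ⟨m, rfl⟩ : ∃ m', m = m' + 1 := ⟨m - 1, by omega⟩
  have hg := gridZ_mono ht hd
  have hu := tendsto_gridZ ht hd
  have hsub : gridZ t d m ≤ gridZ t d (m + 1) := hg m.le_succ
  have e1 : (μ.prod ν).real {x | cellOf (gridZ t d) (min x.1 x.2) = m + 1} =
      svMin μ ν (gridZ t d m) - svMin μ ν (gridZ t d (m + 1)) := by
    have hs : {x : ℝ × ℝ | gridZ t d (m + 1) < min x.1 x.2} ⊆ {x | gridZ t d m < min x.1 x.2} :=
      fun x hx => lt_of_le_of_lt hsub hx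
    rw [← prod_min_gt, ← prod_min_gt, ← measureReal_sdiff hs
      (measurableSet_lt measurable_const (measurable_fst.min measurable_snd))]
    congr 1
    ext x
    rw [Set.mem_sdiff, mem_ofPred_eq, mem_ofPred_eq, mem_ofPred_eq,
      ← lt_cellOf_iff hg hu, ← lt_cellOf_iff hg hu]
    omega
  have e2 : (μ.prod ν).real {x | cellOf (gridZ t d) (min x.1 x.2) = m + 1 ∧ x.1 ≤ x.2} =
      uncMass μ ν (gridZ t d m) - uncMass μ ν (gridZ t d (m + 1)) := by
    have hs : {x : ℝ × ℝ | gridZ t d (m + 1) < min x.1 x.2 ∧ x.1 ≤ x.2} ⊆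
        {x | gridZ t d m < min x.1 x.2 ∧ x.1 ≤ x.2} :=
      fun x hx => ⟨lt_of_le_of_lt hsub hx.1, hx.2⟩
    rw [← prod_min_gt_le, ← prod_min_gt_le, ← measureReal_sdiff hs
      ((measurableSet_lt measurable_const (measurable_fst.min measurable_snd)).inter
        (measurableSet_le measurable_fst measurable_snd))]
    congr 1
    ext x
    rw [Set.mem_sdiff, mem_ofPred_eq, mem_ofPred_eq, mem_ofPred_eq,
      ← lt_cellOf_iff hg hu, ← lt_cellOf_iff hg hu]
    grind
  have hc := hA.cell (gridZ t d m) (by have := half_le_gridZ ht hd m; linarith)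
  rw [← gridZ_succ, ← e1, ← e2] at hc
  rw [cellProb]
  split_ifs with h
  · simpa using hε
  · have hpos : 0 < (μ.prod ν).real {x | cellOf (gridZ t d) (min x.1 x.2) = m + 1} :=
      lt_of_le_of_ne measureReal_nonneg (Ne.symm h)
    rw [div_sub' h, abs_div, abs_of_pos hpos, div_le_iff₀ hpos, mul_comm _ (pLim ξ ξc)]
    exact hc

end Grid

section Sample

open unitInterval

variable {Ω : Type u} [MeasurableSpace Ω] {P : Measure Ω} [IsProbabilityMeasure P] {X C : ℕ → Ω → ℝ}

/-- The coupling of the censored sample with exponential and uniform variables: the cells of the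
observed values agree, and the indicators come from the uniform variables. -/
theorem exists_coupled_sample (hXm : ∀ i, Measurable (X i)) (hCm : ∀ i, Measurable (C i))
    (hXind : iIndepFun X P) (hCind : iIndepFun C P)
    (hXC : IndepFun (fun ω i => X i ω) (fun ω i => C i ω) P)
    (hXid : ∀ i, IdentDistrib (X i) (X 0) P P) (hCid : ∀ i, IdentDistrib (C i) (C 0) P P)
    (hpos : ∀ z, 0 < svMin (P.map (X 0)) (P.map (C 0)) z) {t d : ℕ → ℝ} (ht : ∀ n, 0 < t n)
    (hd : ∀ n, 0 < d n) {p : ℝ} (hp0 : 0 < p) (hp1 : p < 1) {k : ℕ → ℕ}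
    (hk : Tendsto k atTop atTop) (hkn : ∀ n, k n ≤ n) :
    ∃ (Ω' : Type u) (_ : MeasurableSpace Ω') (P' : Measure Ω') (π : Ω' → Ω),
      IsProbabilityMeasure P' ∧ MeasurePreserving π P' P ∧
      ∃ (y : ℕ → ℕ → Ω' → ℝ) (v : ℕ → ℕ → Ω' → I) (N : ℕ → Ω' → ℝ) (E : ℕ → ℕ → Ω' → ℝ),
        (∀ n, IsIidExpUnif P' (y n) (v n)) ∧ (∀ n, IsIidExp P' (E n)) ∧
        (∀ n, Measurable (N n) ∧ P'.map (N n) = gaussianReal 0 1 ∧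
          IndepFun (N n) (fun ω j => E n j ω) P') ∧
        SmallP P' (fun n ω => N n ω - (√(k n * (p * (1 - p))))⁻¹ * ∑ j ∈ Icc 1 (k n),
          (bern p (v n (orderIndex (fun i => y n i ω) n (n - j + 1)) ω) - p)) ∧
        (∀ n ω, ∀ j ∈ Icc 1 n, orderStat (fun i => y n i ω) n (n - j + 1) = tailSum (E n) n j ω) ∧
        (∀ n m, P'.real {ω | gridY (P.map (X 0)) (P.map (C 0)) (t n) (d n) m < y n 0 ω ∧
            (v n 0 ω : ℝ) ≤ cellProb (P.map (X 0)) (P.map (C 0)) p (t n) (d n)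
              (cellOf (gridY (P.map (X 0)) (P.map (C 0)) (t n) (d n)) (y n 0 ω))} =
          uncMass (P.map (X 0)) (P.map (C 0)) (gridZ (t n) (d n) m)) ∧
        ∀ᵐ ω ∂P', ∀ n i, cellOf (gridZ (t n) (d n)) (obsZ X C (π ω) i) =
            cellOf (gridY (P.map (X 0)) (P.map (C 0)) (t n) (d n)) (y n i ω) ∧
          obsE X C (π ω) i = bern (cellProb (P.map (X 0)) (P.map (C 0)) p (t n) (d n)
            (cellOf (gridY (P.map (X 0)) (P.map (C 0)) (t n) (d n)) (y n i ω))) (v n i ω) := by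
  classical
  have hPX : IsProbabilityMeasure (P.map (X 0)) := isProbabilityMeasure_map (hXm 0).aemeasurable
  have hPC : IsProbabilityMeasure (P.map (C 0)) := isProbabilityMeasure_map (hCm 0).aemeasurable
  have hexp : IsProbabilityMeasure (expMeasure 1) := isProbabilityMeasure_expMeasure one_pos
  have hpair : ∀ i, P.map (fun ω => (X i ω, C i ω)) = (P.map (X 0)).prod (P.map (C 0)) := by
    intro i
    have h := hXC.comp (measurable_pi_apply i) (measurable_pi_apply i)
    have h2 := (indepFun_iff_map_prod_eq_prod_map_map (hXm i).aemeasurable (hCm i).aemeasurable).1 h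
    rw [h2, (hXid i).map_eq, (hCid i).map_eq]
  have hSm : ∀ i, Measurable fun ω => (X i ω, C i ω) := fun i => (hXm i).prodMk (hCm i)
  generalize hμ : P.map (X 0) = μ at *
  generalize hν : P.map (C 0) = ν at *
  have hzm := fun n => gridZ_mono (ht n) (hd n)
  have hzt := fun n => tendsto_gridZ (ht n) (hd n)
  have hym := fun n => gridY_mono (μ := μ) (ν := ν) hpos (ht n) (hd n)
  have hyt := fun n => tendsto_gridY (μ := μ) (ν := ν) hpos (ht n) (hd n)
  let c : ℕ → ℝ × ℝ → ℕ × Bool := fun n x =>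
    (cellOf (gridZ (t n) (d n)) (min x.1 x.2), decide (x.1 ≤ x.2))
  have hc1 : ∀ n, Measurable fun x : ℝ × ℝ => cellOf (gridZ (t n) (d n)) (min x.1 x.2) :=
    fun n => (measurable_cellOf (hzm n) (hzt n)).comp (measurable_fst.min measurable_snd)
  have hle : MeasurableSet {x : ℝ × ℝ | x.1 ≤ x.2} := measurableSet_le measurable_fst measurable_snd
  have hc : ∀ n, Measurable (c n) := fun n => (hc1 n).prodMk (measurable_to_bool (by
      have : (fun x : ℝ × ℝ => decide (x.1 ≤ x.2)) ⁻¹' {true} = {x : ℝ × ℝ | x.1 ≤ x.2} := by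
        ext x; simp
      rw [this]; exact hle))
  have hlaw : ∀ n m, P {ω | (c n (X 0 ω, C 0 ω)).1 = m} =
      expMeasure 1 {x | cellOf (gridY μ ν (t n) (d n)) x = m} := by
    intro n m
    have hmin : Measurable fun x : ℝ × ℝ => min x.1 x.2 := measurable_fst.min measurable_snd
    have hmap : IsProbabilityMeasure ((μ.prod ν).map fun x : ℝ × ℝ => min x.1 x.2) :=
      isProbabilityMeasure_map hmin.aemeasurable
    have hcm : MeasurableSet {x | cellOf (gridZ (t n) (d n)) x = m} :=
      measurable_cellOf (hzm n) (hzt n) (measurableSet_singleton m)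
    rw [← measure_cellOf_eq (μ₁ := (μ.prod ν).map fun x : ℝ × ℝ => min x.1 x.2) (hzm n) (hzt n)
      (hym n) (hyt n), map_apply hmin hcm, ← hpair 0, map_apply (hSm 0) (hmin hcm)]
    · rfl
    · intro m
      rw [← ofReal_measureReal, ← ofReal_measureReal]
      congr 1
      rw [← compl_compl (Iic (gridZ _ _ m)), ← compl_compl (Iic (gridY _ _ _ _ m)),
        probReal_compl_eq_one_sub measurableSet_Iic.compl,
        probReal_compl_eq_one_sub measurableSet_Iic.compl, Set.compl_Iic, Set.compl_Iic,
        expMeasure_real_Ioi (gridY_nonneg m), exp_neg_gridY hpos, ← prod_min_gt (μ := μ) (ν := ν),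
        map_measureReal_apply hmin measurableSet_Ioi]
      rfl
  have hpc : ∀ n m, P {ω | c n (X 0 ω, C 0 ω) = (m, true)} = ofReal (cellProb μ ν p (t n) (d n) m) *
        P {ω | (c n (X 0 ω, C 0 ω)).1 = m} := by
    intro n m
    have hm1 : MeasurableSet {x : ℝ × ℝ | cellOf (gridZ (t n) (d n)) (min x.1 x.2) = m} :=
      hc1 n (measurableSet_singleton m)
    have hm2 : MeasurableSet {x : ℝ × ℝ | cellOf (gridZ (t n) (d n)) (min x.1 x.2) = m ∧
        x.1 ≤ x.2} := hm1.inter hle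
    have e1 : P {ω | c n (X 0 ω, C 0 ω) = (m, true)} =
        (μ.prod ν) {x | cellOf (gridZ (t n) (d n)) (min x.1 x.2) = m ∧ x.1 ≤ x.2} := by
      rw [← hpair 0, map_apply (hSm 0) hm2]
      congr 1
      ext ω
      simp [c]
    have e2 : P {ω | (c n (X 0 ω, C 0 ω)).1 = m} =
        (μ.prod ν) {x | cellOf (gridZ (t n) (d n)) (min x.1 x.2) = m} := by
      rw [← hpair 0, map_apply (hSm 0) hm1]
      rfl
    rw [e1, e2, ← ofReal_measureReal, ← ofReal_measureReal, ← cellProb_mul (p := p),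
      ENNReal.ofReal_mul (cellProb_nonneg hp0.le m)]
  obtain ⟨Ω', mΩ', P', π, hP', hπ, y, v, N, E, hyv, hE, hN, hW, hos, hae⟩ :=
    exists_coupling P hSm (iIndepFun_prodMk_of_indepFun hXm hCm hXind hCind hXC)
      (fun i => by rw [hpair, hpair]) hc (cy := fun n => cellOf (gridY μ ν (t n) (d n)))
      (fun n => measurable_cellOf (hym n) (hyt n))
      (fun n m => cellProb_nonneg (μ := μ) (ν := ν) (t := t n) (d := d n) hp0.le m)
      (fun n m => cellProb_le_one hp1.le m) hlaw hpc hp0 hp1 hk hkn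
  refine ⟨Ω', mΩ', P', π, hP', hπ, y, v, N, E, hyv, hE, hN, hW, hos, ?_, ?_⟩
  · intro n m
    have hms : MeasurableSet {x : ℝ × ℝ | gridZ (t n) (d n) m < min x.1 x.2 ∧ x.1 ≤ x.2} :=
      (measurableSet_lt measurable_const (measurable_fst.min measurable_snd)).inter hle
    have hms2 := hSm 0 hms
    rw [← prod_min_gt_le, ← hpair 0, map_measureReal_apply (hSm 0) hms,
      ← hπ.measureReal_preimage hms2.nullMeasurableSet]
    refine measureReal_congr ?_
    filter_upwards [hae] with ω hω
    have h := hω n 0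
    rw [Prod.ext_iff] at h
    obtain ⟨h1, h2⟩ := h
    refine propext ?_
    change (_ ∧ _) ↔ (_ < min (X 0 (π ω)) (C 0 (π ω)) ∧ X 0 (π ω) ≤ C 0 (π ω))
    rw [← lt_cellOf_iff (hym n) (hyt n), ← lt_cellOf_iff (hzm n) (hzt n)]
    grind
  · filter_upwards [hae] with ω hω n i
    have h := hω n i
    rw [Prod.ext_iff] at h
    obtain ⟨h1, h2⟩ := h
    simp only [c, decide_eq_decide] at h1 h2
    refine ⟨h1, ?_⟩
    rw [obsE, bern]
    simp only [h2]

end Sample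

/-! ### Log-ratios of observations in terms of the exponential variables -/

section RealEstimates

theorem abs_exp_sub_exp_le {M x y : ℝ} (hx : x ≤ M) (hy : y ≤ M) :
    |exp x - exp y| ≤ exp M * |x - y| := by
  wlog h : y ≤ x generalizing x y
  · grind
  rw [abs_of_nonneg (sub_nonneg.2 (exp_le_exp.2 h)), abs_of_nonneg (sub_nonneg.2 h)]
  have h1 := add_one_le_exp (y - x)
  have h2 : exp x - exp y = exp x * (1 - exp (y - x)) := by rw [mul_sub, ← exp_add]; ring_nf
  rw [h2]
  exact mul_le_mul (exp_le_exp.2 hx) (by linarith)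
    (sub_nonneg.2 (exp_le_one_iff.2 (by linarith))) (exp_pos _).le

theorem abs_exp_neg_sub_le {b B w w' : ℝ} (hb : 0 ≤ b) (hw : -B ≤ w) (hw' : -B ≤ w') :
    |exp (-(b * w)) - exp (-(b * w'))| ≤ exp (b * B) * b * |w - w'| := by
  have h1 := mul_le_mul_of_nonneg_left hw hb
  have h2 := mul_le_mul_of_nonneg_left hw' hb
  refine (abs_exp_sub_exp_le (M := b * B) (by linarith) (by linarith)).trans (le_of_eq ?_)
  rw [show -(b * w) - -(b * w') = -(b * (w - w')) by ring, abs_neg, abs_mul, abs_of_nonneg hb]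
  ring

/-- For an observation with `w = log(z/t)` in the cell `(w', w' + d]` and recentred exponential
counterpart `σ`, the tail relation is exact at the end points, and `h3`, `h4` state it with
monotonicity. Each of its terms varies over the cell by at most a multiple of `ε |q| θ`. -/
theorem abs_gamma_sub_le {x b B q ε θ d w w' σ R R' : ℝ} (hx : 0 < x) (hb : 0 < b)
    (hθ : 0 ≤ θ) (hε : 0 ≤ ε) (hε1 : ε ≤ 1) (hq : |q| ≤ 1) (hd : d = ε * |q| * θ)
    (hB : -B ≤ w') (h1 : w' < w) (h2 : w ≤ w' + d)
    (h3 : w' + q * exp (-(b * w')) / (x * b) - R' < x * σ)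
    (h4 : x * σ ≤ w' + d + q * exp (-(b * (w' + d))) / (x * b) - R)
    (hR : |R - R'| ≤ ε * |q| * (d + θ)) :
    |w + q * exp (-(b * w)) / (x * b) - x * σ - R| ≤ (3 + exp (b * B) / x) * (ε * |q| * θ) := by
  have hq0 := abs_nonneg q
  have hd0 : 0 ≤ d := by rw [hd]; positivity
  have hεq : ε * |q| ≤ 1 := mul_le_one₀ hε1 hq0 hq
  have hd1 : d ≤ θ := by rw [hd]; exact mul_le_of_le_one_left hθ hεq
  have hA : 0 ≤ exp (b * B) / x := by positivity
  have key : ∀ u, w' ≤ u → u ≤ w' + d →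
      |q * exp (-(b * w)) / (x * b) - q * exp (-(b * u)) / (x * b)| ≤ exp (b * B) / x * d := by
    intro u hu1 hu2
    have h5 := abs_exp_neg_sub_le (b := b) hb.le (hB.trans h1.le) (hB.trans hu1)
    have h6 : |w - u| ≤ d := abs_le.2 ⟨by linarith, by linarith⟩
    rw [show q * exp (-(b * w)) / (x * b) - q * exp (-(b * u)) / (x * b) =
      q * ((exp (-(b * w)) - exp (-(b * u))) / (x * b)) by ring, abs_mul, abs_div,
      abs_of_pos (mul_pos hx hb)]
    have h7 : |exp (-(b * w)) - exp (-(b * u))| / (x * b) ≤ exp (b * B) / x * d := by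
      rw [div_le_iff₀ (by positivity)]
      refine (h5.trans (mul_le_mul_of_nonneg_left h6 (by positivity))).trans (le_of_eq ?_)
      field_simp
    calc |q| * _ ≤ 1 * _ := mul_le_mul_of_nonneg_right hq (by positivity)
      _ ≤ _ := by rw [one_mul]; exact h7
  have k1 := abs_le.1 (key w' le_rfl (by linarith))
  have k2 := abs_le.1 (key (w' + d) (by linarith) le_rfl)
  have hR2 : ε * |q| * (d + θ) ≤ 2 * (ε * |q| * θ) := by
    have : ε * |q| * (d + θ) ≤ ε * |q| * (θ + θ) :=
      mul_le_mul_of_nonneg_left (by linarith) (by positivity)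
    linarith
  have hR' := abs_le.1 (hR.trans hR2)
  have e : (3 + exp (b * B) / x) * (ε * |q| * θ) =
      d + exp (b * B) / x * d + 2 * (ε * |q| * θ) := by rw [hd]; ring
  grind

/-- The expansion of the difference `w₁ - w₂` when both satisfy the implicit equation
`w + q exp (-b w) / (x b) = x σ + O (|q|)` with a slowly varying remainder. -/
theorem abs_implicit_sub_le {x b B q ε θ C₂ C₃ w₁ w₂ σ₁ σ₂ : ℝ} (hx : 0 < x) (hb : 0 < b)
    (hθ : 0 ≤ θ) (hε : 0 ≤ ε) (hε1 : ε ≤ 1) (hC₂ : 0 ≤ C₂) (hC₃ : 0 ≤ C₃)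
    (hB1 : -B ≤ w₁) (hB2 : -B ≤ w₂) (hw : w₂ ≤ w₁)
    (hq2 : |q| * (exp (b * B) / x + 1) ≤ 1 / 2) (hq3 : C₃ * |q| ≤ 1)
    (hδ₁ : |b * (w₁ - x * σ₁)| ≤ C₃ * |q|) (hδ₂ : |b * (w₂ - x * σ₂)| ≤ C₃ * |q|)
    (h : |w₁ - w₂ - x * (σ₁ - σ₂) + q * ((exp (-(b * w₁)) - exp (-(b * w₂))) / (x * b))| ≤
        ε * |q| * (w₁ - w₂ + C₂ * θ)) :
    |w₁ - w₂ - x * (σ₁ - σ₂) + q * ((exp (-(x * b * σ₁)) - exp (-(x * b * σ₂))) / (x * b))| ≤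
      |q| * (ε + |q|) * ((1 + (2 * C₃ + 3 * (exp (b * B) / x + 1)) * exp (b * B) / x) *
        (2 * x * (σ₁ - σ₂) + 3 * C₂ * θ)) := by
  have hq0 := abs_nonneg q
  set A := exp (b * B) with hA
  have hA0 : 0 < A := exp_pos _
  set X := w₁ - w₂ with hX
  have hX0 : 0 ≤ X := by rw [hX]; linarith
  set T := σ₁ - σ₂
  have hg : |exp (-(b * w₁)) - exp (-(b * w₂))| ≤ A * b * X := by
    have := abs_exp_neg_sub_le (b := b) hb.le hB1 hB2
    rwa [← hX, abs_of_nonneg hX0] at this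
  have hgx : |q * ((exp (-(b * w₁)) - exp (-(b * w₂))) / (x * b))| ≤
      |q| * (A / x * X) := by
    rw [abs_mul, abs_div, abs_of_pos (mul_pos hx hb)]
    refine mul_le_mul_of_nonneg_left ?_ hq0
    rw [div_le_iff₀ (by positivity)]
    refine hg.trans (le_of_eq ?_)
    field_simp
  have hCθ : 0 ≤ C₂ * θ := mul_nonneg hC₂ hθ
  have hY0 : 0 ≤ X + C₂ * θ := by positivity
  have hεX : ε * |q| * (X + C₂ * θ) ≤ |q| * (X + C₂ * θ) := by
    have := mul_le_of_le_one_left hq0 hε1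
    exact mul_le_mul_of_nonneg_right this hY0
  have hXT : |X - x * T| ≤ |q| * ((A / x + 1) * (X + C₂ * θ)) := by
    have e : X - x * T = (X - x * T + q * ((exp (-(b * w₁)) - exp (-(b * w₂))) /
      (x * b))) - q * ((exp (-(b * w₁)) - exp (-(b * w₂))) / (x * b)) := by ring
    rw [e]
    refine (abs_sub _ _).trans ?_
    have h9 : |q| * (A / x * X) ≤ |q| * (A / x * (X + C₂ * θ)) := by gcongr; linarith
    linarith
  -- The first approximation `hXT` contains `X` on the right with a factor that `hq2` makes at most
  -- `1/2`; absorbing it bounds `X` by the exponential difference `T`.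
  have hXle : X + C₂ * θ ≤ 2 * x * T + 3 * C₂ * θ := by
    have h1 := (abs_le.1 hXT).2
    have h2 : |q| * ((A / x + 1) * (X + C₂ * θ)) ≤ 1 / 2 * (X + C₂ * θ) := by
      rw [← mul_assoc]; exact mul_le_mul_of_nonneg_right hq2 hY0
    linarith
  set δ₁ := b * (w₁ - x * σ₁) with hδ₁d
  set δ₂ := b * (w₂ - x * σ₂) with hδ₂d
  have hs₁ : exp (-(x * b * σ₁)) = exp (-(b * w₁)) * exp δ₁ := by
    rw [← exp_add]; congr 1; rw [hδ₁d]; ring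
  have hs₂ : exp (-(x * b * σ₂)) = exp (-(b * w₂)) * exp δ₂ := by
    rw [← exp_add]; congr 1; rw [hδ₂d]; ring
  have hd1 : |exp δ₁ - 1| ≤ 2 * (C₃ * |q|) := by
    refine (Real.abs_exp_sub_one_le (hδ₁.trans hq3)).trans ?_
    linarith
  have hd2 : |exp δ₁ - exp δ₂| ≤ 3 * (b * (|q| * ((A / x + 1) * (X + C₂ * θ)))) := by
    have e : δ₁ - δ₂ = b * (X - x * T) := by linarith
    have h1 := abs_exp_sub_exp_le (M := 1) ((le_abs_self _).trans (hδ₁.trans hq3))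
      ((le_abs_self _).trans (hδ₂.trans hq3))
    rw [e, abs_mul, abs_of_pos hb] at h1
    have h3 : exp 1 ≤ 3 := by have := Real.exp_one_lt_d9; linarith
    exact h1.trans (mul_le_mul h3 (mul_le_mul_of_nonneg_left hXT hb.le) (by positivity)
      (by norm_num))
  have hg2 : exp (-(b * w₂)) ≤ A := exp_le_exp.2 (by
    have := mul_le_mul_of_nonneg_left hB2 hb.le; linarith)
  have hdiff : |(exp (-(x * b * σ₁)) - exp (-(x * b * σ₂))) - (exp (-(b * w₁)) - exp (-(b * w₂)))| ≤
      |q| * (A * b * (2 * C₃ + 3 * (A / x + 1)) * (X + C₂ * θ)) := by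
    rw [hs₁, hs₂, show exp (-(b * w₁)) * exp δ₁ - exp (-(b * w₂)) * exp δ₂ -
      (exp (-(b * w₁)) - exp (-(b * w₂))) =
      (exp (-(b * w₁)) - exp (-(b * w₂))) * (exp δ₁ - 1) +
      exp (-(b * w₂)) * (exp δ₁ - exp δ₂) by ring]
    refine (abs_add_le _ _).trans ?_
    rw [abs_mul, abs_mul, abs_of_pos (exp_pos (-(b * w₂)))]
    have m1 := mul_le_mul hg hd1 (abs_nonneg _) (by positivity)
    have m2 := mul_le_mul hg2 hd2 (abs_nonneg _) hA0.le
    have m3 : A * b * X * (2 * (C₃ * |q|)) ≤ A * b * (X + C₂ * θ) * (2 * (C₃ * |q|)) := by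
      gcongr; linarith
    linarith
  have e : X - x * T + q * ((exp (-(x * b * σ₁)) - exp (-(x * b * σ₂))) / (x * b)) =
      (X - x * T + q * ((exp (-(b * w₁)) - exp (-(b * w₂))) / (x * b))) +
      q * (((exp (-(x * b * σ₁)) - exp (-(x * b * σ₂))) -
      (exp (-(b * w₁)) - exp (-(b * w₂)))) / (x * b)) := by ring
  rw [e]
  refine (abs_add_le _ _).trans ?_
  have hlast : |q * (((exp (-(x * b * σ₁)) - exp (-(x * b * σ₂))) -
      (exp (-(b * w₁)) - exp (-(b * w₂)))) / (x * b))| ≤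
      |q| * |q| * ((2 * C₃ + 3 * (A / x + 1)) * A / x * (X + C₂ * θ)) := by
    rw [abs_mul, abs_div, abs_of_pos (mul_pos hx hb), mul_assoc |q| |q|]
    refine mul_le_mul_of_nonneg_left ?_ hq0
    rw [div_le_iff₀ (by positivity)]
    refine hdiff.trans (le_of_eq ?_)
    field_simp
  set K := (2 * C₃ + 3 * (A / x + 1)) * A / x with hK
  have hK0 : 0 ≤ K := by positivity
  calc _ ≤ ε * |q| * (X + C₂ * θ) + |q| * |q| * (K * (X + C₂ * θ)) := add_le_add h hlast
    _ ≤ |q| * (ε + |q|) * ((1 + K) * (X + C₂ * θ)) := by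
      have a1 : 0 ≤ |q| * |q| * (X + C₂ * θ) := by positivity
      have a2 : 0 ≤ |q| * ε * (K * (X + C₂ * θ)) := by positivity
      linarith
    _ ≤ _ := by gcongr

end RealEstimates

section Expansion

variable {μ ν : Measure ℝ} [IsProbabilityMeasure μ] [IsProbabilityMeasure ν]
  {ξ ξc Cst Cstc D Dc β βc c a t d ε q κ θ : ℝ}

/-- The definition of the remainder, rewritten exactly in the variable `log(z/t)`. The point `t` is
the first order approximation to the quantile with tail `1/a`, and `q` collects the bias at `t`. -/
theorem neg_log_svMin_eq (hx : 0 < xiZ ξ ξc) (hb : 0 < betaZ β βc) (hc : 0 < c) (ha : 0 < a)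
    (ht : t = (c * a) ^ xiZ ξ ξc)
    (hq : q = -(xiZ ξ ξc ^ 2 * betaZ β βc * dZ β βc D Dc) * t ^ (-betaZ β βc)) {z : ℝ}
    (hz : 0 < z) :
    xiZ ξ ξc * (-log (svMin μ ν z) - log a) = log (z / t) +
      q * exp (-(betaZ β βc * log (z / t))) / (xiZ ξ ξc * betaZ β βc) -
        logRem μ ν ξ ξc β βc D Dc c z := by
  have ht0 : 0 < t := by rw [ht]; positivity
  have hlt : log t = xiZ ξ ξc * (log c + log a) := by
    rw [ht, Real.log_rpow (by positivity), log_mul hc.ne' ha.ne']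
  have he : exp (-(betaZ β βc * log (z / t))) = z ^ (-betaZ β βc) / t ^ (-betaZ β βc) := by
    rw [← Real.div_rpow hz.le ht0.le, Real.rpow_def_of_pos (by positivity)]
    congr 1; ring
  have htb : t ^ (-betaZ β βc) ≠ 0 := (rpow_pos_of_pos ht0 _).ne'
  have e2 : q * exp (-(betaZ β βc * log (z / t))) / (xiZ ξ ξc * betaZ β βc) =
      -(xiZ ξ ξc * dZ β βc D Dc * z ^ (-betaZ β βc)) := by
    rw [he, hq]; field_simp
  rw [e2, logRem, logTail, log_div hz.ne' ht0.ne', hlt]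
  ring

theorem log_gridZ_div (ht : 0 < t) (m : ℕ) : log (gridZ t d m / t) = ((m : ℝ) - gridM d) * d := by
  rw [gridZ, mul_div_cancel_left₀ _ ht.ne', log_exp]

theorem abs_cell_gamma_sub_le (hx : 0 < xiZ ξ ξc) (hb : 0 < betaZ β βc) (hc : 0 < c) (ha : 0 < a)
    (ht : t = (c * a) ^ xiZ ξ ξc)
    (hq : q = -(xiZ ξ ξc ^ 2 * betaZ β βc * dZ β βc D Dc) * t ^ (-betaZ β βc)) (hq1 : |q| ≤ 1)
    (hε : 0 ≤ ε) (hε1 : ε ≤ 1) (hθ : 0 ≤ θ) (hd : d = ε * |q| * θ) (hd0 : 0 < d)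
    (hpos : ∀ z, 0 < svMin μ ν z) (hA : TailApprox μ ν ξ ξc β βc D Dc c q κ ε t d θ)
    {z y : ℝ} {m : ℕ} (hz : cellOf (gridZ t d) z = m + 1)
    (hy : cellOf (gridY μ ν t d) y = m + 1) :
    log (gridZ t d m / t) < log (z / t) ∧
    log (z / t) ≤ log (gridZ t d m / t) + d ∧
    |log (z / t) + q * exp (-(betaZ β βc * log (z / t))) /
        (xiZ ξ ξc * betaZ β βc) - xiZ ξ ξc * (y - log a) -
        logRem μ ν ξ ξc β βc D Dc c (gridZ t d (m + 1))| ≤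
      (3 + exp (betaZ β βc * log 4) / xiZ ξ ξc) * (ε * |q| * θ) := by
  have ht0 : 0 < t := by rw [ht]; positivity
  have hzm := gridZ_mono ht0 hd0
  have hzt := tendsto_gridZ ht0 hd0
  have hym := gridY_mono (μ := μ) (ν := ν) hpos ht0 hd0
  have hyt := tendsto_gridY (μ := μ) (ν := ν) hpos ht0 hd0
  have z1 : gridZ t d m < z := (lt_cellOf_iff hzm hzt).1 (by omega)
  have z2 : z ≤ gridZ t d (m + 1) := (cellOf_le_iff hzm hzt).1 (by omega)
  have y1 : gridY μ ν t d m < y := (lt_cellOf_iff hym hyt).1 (by omega)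
  have y2 : y ≤ gridY μ ν t d (m + 1) := (cellOf_le_iff hym hyt).1 (by omega)
  have g0 := gridZ_pos (d := d) ht0 m
  have g1 := gridZ_pos (d := d) ht0 (m + 1)
  have hl : log (gridZ t d (m + 1) / t) = log (gridZ t d m / t) + d := by
    rw [log_gridZ_div ht0, log_gridZ_div ht0]; push_cast; ring
  have w1 : log (gridZ t d m / t) < log (z / t) :=
    Real.log_lt_log (by positivity) (div_lt_div_of_pos_right z1 ht0)
  have w2 : log (z / t) ≤ log (gridZ t d m / t) + d := by
    rw [← hl]
    have : 0 < z := g0.trans z1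
    exact log_le_log (by positivity) (div_le_div_of_nonneg_right z2 ht0.le)
  have hh := half_le_gridZ ht0 hd0 m
  have hlow : -log 4 ≤ log (gridZ t d m / t) := by
    rw [← log_inv]
    refine log_le_log (by norm_num) ?_
    rw [le_div_iff₀ ht0]; linarith
  refine ⟨w1, w2, ?_⟩
  have f0 := neg_log_svMin_eq (μ := μ) (ν := ν) hx hb hc ha ht hq g0
  have f1 := neg_log_svMin_eq (μ := μ) (ν := ν) hx hb hc ha ht hq g1
  rw [hl] at f1
  refine abs_gamma_sub_le (w' := log (gridZ t d m / t)) (d := d)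
    (R' := logRem μ ν ξ ξc β βc D Dc c (gridZ t d m)) hx hb hθ hε hε1 hq1 hd hlow w1 w2 ?_ ?_ ?_
  · rw [← f0]
    exact mul_lt_mul_of_pos_left (sub_lt_sub_right y1 _) hx
  · rw [← f1]
    exact mul_le_mul_of_nonneg_left (sub_le_sub_right y2 _) hx.le
  · refine (hA.incr _ _ (by linarith) (hzm m.le_succ)).trans (le_of_eq ?_)
    rw [gridZ_succ, mul_div_cancel_left₀ _ g0.ne', log_exp]

/-- The constants depend only on the model, not on the scales. The four conclusions locate the image
of `t`, put the start of the grid a fixed distance below `log a`, bound the length of a cell on the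
exponential scale, and solve the implicit tail relation for differences. -/
theorem exists_log_ratio_bound (hx : 0 < xiZ ξ ξc) (hb : 0 < betaZ β βc) (hc : 0 < c)
    (hpos : ∀ z, 0 < svMin μ ν z) :
    ∃ K > 0, ∃ q₀ > 0, ∀ a t d ε q κ θ : ℝ, 0 < a → t = (c * a) ^ xiZ ξ ξc →
      q = -(xiZ ξ ξc ^ 2 * betaZ β βc * dZ β βc D Dc) * t ^ (-betaZ β βc) → |q| ≤ q₀ →
      0 ≤ ε → ε ≤ 1 → 0 ≤ θ → θ ≤ 1 → d = ε * |q| * θ → 0 < d →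
      TailApprox μ ν ξ ξc β βc D Dc c q κ ε t d θ →
      |gridY μ ν t d (gridM d) - log a| ≤ K * |q| ∧
      gridY μ ν t d 0 - log a ≤ -(log 2 / (2 * xiZ ξ ξc)) ∧
      (∀ y₁ y₂ : ℝ, 1 ≤ cellOf (gridY μ ν t d) y₂ →
        cellOf (gridY μ ν t d) y₁ = cellOf (gridY μ ν t d) y₂ → y₁ - y₂ ≤ K * (ε * |q|)) ∧
      ∀ z₁ z₂ y₁ y₂ : ℝ, z₂ ≤ z₁ → y₂ ≤ y₁ → 1 ≤ cellOf (gridZ t d) z₂ →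
        cellOf (gridZ t d) z₁ = cellOf (gridY μ ν t d) y₁ →
        cellOf (gridZ t d) z₂ = cellOf (gridY μ ν t d) y₂ →
        |log (z₁ / z₂) - xiZ ξ ξc * (y₁ - y₂) +
          q * ((exp (-(xiZ ξ ξc * betaZ β βc * (y₁ - log a))) -
            exp (-(xiZ ξ ξc * betaZ β βc * (y₂ - log a)))) /
              (xiZ ξ ξc * betaZ β βc))| ≤ |q| * (ε + |q|) * (K * (y₁ - y₂ + θ)) := by
  obtain ⟨x, hxd⟩ : ∃ x, x = xiZ ξ ξc := ⟨_, rfl⟩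
  obtain ⟨b, hbd⟩ : ∃ b, b = betaZ β βc := ⟨_, rfl⟩
  obtain ⟨A, hAd⟩ : ∃ A, A = exp (b * log 4) := ⟨_, rfl⟩
  -- `C₁` is the error within one cell; `C₂` counts two such errors and two further `θ` from passing
  -- from grid points to observations; `C₃` bounds the first order deviation divided by `|q|`; `C₄`
  -- is the factor from `abs_implicit_sub_le`.
  obtain ⟨C₁, hC₁⟩ : ∃ C, C = 3 + A / x := ⟨_, rfl⟩
  obtain ⟨C₂, hC₂⟩ : ∃ C, C = 2 * C₁ + 2 := ⟨_, rfl⟩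
  obtain ⟨C₃, hC₃⟩ : ∃ C, C = b * (C₁ + 1 + A / (x * b)) := ⟨_, rfl⟩
  obtain ⟨C₄, hC₄⟩ : ∃ C, C = 1 + (2 * C₃ + 3 * (A / x + 1)) * A / x := ⟨_, rfl⟩
  have hx' := hx
  have hb' := hb
  rw [← hxd] at hx'
  rw [← hbd] at hb'
  have hA0 : 0 < A := by rw [hAd]; positivity
  have hC₁0 : 0 < C₁ := by rw [hC₁]; positivity
  have hC₂0 : 0 < C₂ := by rw [hC₂]; positivity
  have hC₃0 : 0 < C₃ := by rw [hC₃]; positivity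
  have hC₄0 : 0 < C₄ := by rw [hC₄]; positivity
  have hl2 : 0 < log 2 := log_pos (by norm_num)
  refine ⟨max (C₄ * (2 * x + 3 * C₂)) (max ((1 + 1 / (x * b)) / x) (2 * C₁ / x)), by positivity,
    min (min 1 (1 / (2 * (A / x + 1)))) (min (1 / C₃) (log 2 / (2 * (2 + A / (x * b))))),
    by positivity, ?_⟩
  intro a t d ε q κ θ ha ht hq hqle hε hε1 hθ hθ1 hd hd0 hT
  obtain ⟨⟨hq1, hq2⟩, hq3, hq4⟩ : (|q| ≤ 1 ∧ |q| ≤ 1 / (2 * (A / x + 1))) ∧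
      |q| ≤ 1 / C₃ ∧ |q| ≤ log 2 / (2 * (2 + A / (x * b))) :=
    ⟨le_min_iff.1 (hqle.trans (min_le_left _ _)), le_min_iff.1 (hqle.trans (min_le_right _ _))⟩
  rw [le_div_iff₀ (by positivity)] at hq2 hq3 hq4
  have ht0 : 0 < t := by rw [ht]; positivity
  have hq0 := abs_nonneg q
  have hεq : ε * |q| ≤ |q| := mul_le_of_le_one_left hq0 hε1
  have hdq : d ≤ |q| := by rw [hd]; exact (mul_le_of_le_one_right (by positivity) hθ1).trans hεq
  have hzm := gridZ_mono ht0 hd0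
  have hxb : 0 < x * b := mul_pos hx' hb'
  have hlow : ∀ m, -log 4 ≤ log (gridZ t d m / t) := fun m => by
    have := half_le_gridZ ht0 hd0 m
    rw [← log_inv]
    refine log_le_log (by norm_num) ?_
    rw [le_div_iff₀ ht0]; linarith
  have hqt : ∀ m, t / 4 ≤ gridZ t d m := fun m => by
    have := half_le_gridZ ht0 hd0 m
    linarith
  refine ⟨?_, ?_, ?_, ?_⟩
  · have h1 := neg_log_svMin_eq (μ := μ) (ν := ν) hx hb hc ha ht hq ht0
    have h2 := hT.bound t (by linarith)
    rw [div_self ht0.ne', Real.log_one, mul_zero, neg_zero, Real.exp_zero, mul_one, zero_add,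
      ← hxd, ← hbd] at h1
    rw [gridY, gridZ_gridM]
    have h3 : |x * (-log (svMin μ ν t) - log a)| ≤ (1 + 1 / (x * b)) * |q| := by
      rw [h1]
      refine (abs_sub _ _).trans ?_
      rw [abs_div, abs_of_pos hxb]
      grind
    rw [abs_mul, abs_of_pos hx'] at h3
    refine le_trans ?_ (mul_le_mul_of_nonneg_right ((le_max_left _ _).trans (le_max_right _ _)) hq0)
    rw [div_mul_eq_mul_div, le_div_iff₀ hx', mul_comm]
    exact h3
  · have g0 := gridZ_pos (d := d) ht0 0
    have h1 := neg_log_svMin_eq (μ := μ) (ν := ν) hx hb hc ha ht hq g0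
    have h2 := (abs_le.1 (hT.bound _ (hqt 0))).1
    have h3 : log (gridZ t d 0 / t) ≤ -log 2 + d := by
      have := gridZ_zero_le ht0 hd0
      rw [← log_inv, ← log_exp d, ← log_mul (by norm_num) (exp_pos _).ne', log_exp]
      refine log_le_log (by positivity) ?_
      rw [div_le_iff₀ ht0]
      linarith
    have h4 : q * exp (-(betaZ β βc * log (gridZ t d 0 / t))) /
        (xiZ ξ ξc * betaZ β βc) ≤ |q| * (A / (x * b)) := by
      rw [mul_div_assoc, ← hxd, ← hbd]
      refine mul_le_mul (le_abs_self q) ?_ (by positivity) hq0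
      refine div_le_div_of_nonneg_right ?_ hxb.le
      rw [hAd]
      apply exp_le_exp.2
      have := mul_le_mul_of_nonneg_left (hlow 0) hb'.le
      linarith
    rw [gridY]
    rw [← hxd] at h1 ⊢
    have h6 : x * (-log (svMin μ ν (gridZ t d 0)) - log a) ≤ -(log 2 / 2) := by
      rw [h1, hxd]
      linarith
    rw [show -(log 2 / (2 * x)) = -(log 2 / 2) / x by field_simp, le_div_iff₀ hx']
    linarith
  · intro y₁ y₂ hm hc1
    obtain ⟨m, hm2⟩ : ∃ m, cellOf (gridY μ ν t d) y₂ = m + 1 := ⟨_, (Nat.sub_add_cancel hm).symm⟩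
    have hzc : cellOf (gridZ t d) (gridZ t d (m + 1)) = m + 1 := by
      have hzt := tendsto_gridZ ht0 hd0
      refine le_antisymm ((cellOf_le_iff hzm hzt).2 le_rfl) ((lt_cellOf_iff hzm hzt).2 ?_)
      rw [gridZ_succ]
      exact lt_mul_of_one_lt_right (gridZ_pos ht0 m) (Real.one_lt_exp_iff.2 hd0)
    have c1 := (abs_cell_gamma_sub_le hx hb hc ha ht hq hq1 hε hε1 hθ hd hd0 hpos hT
      hzc (hc1.trans hm2)).2.2
    have c2 := (abs_cell_gamma_sub_le hx hb hc ha ht hq hq1 hε hε1 hθ hd hd0 hpos hT hzc hm2).2.2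
    rw [← hxd, ← hbd, ← hAd, ← hC₁] at c1 c2
    have c1' := abs_le.1 c1
    have c2' := abs_le.1 c2
    have h5 : C₁ * (ε * |q| * θ) ≤ C₁ * (ε * |q|) :=
      mul_le_mul_of_nonneg_left (mul_le_of_le_one_right (by positivity) hθ1) hC₁0.le
    have h6 : y₁ - y₂ ≤ 2 * C₁ / x * (ε * |q|) := by
      rw [div_mul_eq_mul_div, le_div_iff₀ hx']
      linarith
    exact h6.trans (mul_le_mul_of_nonneg_right ((le_max_right _ _).trans (le_max_right _ _))
      (by positivity))
  · intro z₁ z₂ y₁ y₂ hz hy hm hc1 hc2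
    have hzt := tendsto_gridZ ht0 hd0
    obtain ⟨m₂, hm₂⟩ : ∃ m, cellOf (gridZ t d) z₂ = m + 1 := ⟨_, (Nat.sub_add_cancel hm).symm⟩
    have hmm := cellOf_mono hzm hzt hz
    obtain ⟨m₁, hm₁⟩ : ∃ m, cellOf (gridZ t d) z₁ = m + 1 :=
      ⟨_, (Nat.sub_add_cancel (hm.trans hmm)).symm⟩
    have hmle : m₂ ≤ m₁ := by omega
    have hz2 : 0 < z₂ := (gridZ_pos ht0 m₂).trans ((lt_cellOf_iff hzm hzt).1 (by omega))
    have hz1 : 0 < z₁ := hz2.trans_le hz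
    obtain ⟨a1, b1, c1⟩ := abs_cell_gamma_sub_le hx hb hc ha ht hq hq1 hε hε1 hθ hd hd0 hpos hT
      hm₁ (hc1.symm.trans hm₁)
    obtain ⟨a2, b2, c2⟩ := abs_cell_gamma_sub_le hx hb hc ha ht hq hq1 hε hε1 hθ hd hd0 hpos hT
      hm₂ (hc2.symm.trans hm₂)
    have hR := hT.incr _ _ (hqt (m₂ + 1)) (hzm (by omega : m₂ + 1 ≤ m₁ + 1))
    have g2 := gridZ_pos (d := d) ht0 (m₂ + 1)
    have g1 := gridZ_pos (d := d) ht0 (m₁ + 1)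
    have hlr : log (gridZ t d (m₁ + 1) / gridZ t d (m₂ + 1)) =
        log (gridZ t d m₁ / t) - log (gridZ t d m₂ / t) := by
      rw [log_div g1.ne' g2.ne']
      have e1 := log_div g1.ne' ht0.ne'
      have e2 := log_div g2.ne' ht0.ne'
      rw [log_gridZ_div ht0] at e1 e2
      rw [log_gridZ_div ht0, log_gridZ_div ht0]
      grind
    have hlz : log (z₁ / z₂) = log (z₁ / t) - log (z₂ / t) := by
      rw [log_div hz1.ne' hz2.ne', log_div hz1.ne' ht0.ne', log_div hz2.ne' ht0.ne']
      ring
    have hw : log (z₂ / t) ≤ log (z₁ / t) :=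
      log_le_log (by positivity) (div_le_div_of_nonneg_right hz ht0.le)
    have r1 := hT.bound _ (hqt (m₁ + 1))
    have r2 := hT.bound _ (hqt (m₂ + 1))
    have l1 := (hlow m₁).trans a1.le
    have l2 := (hlow m₂).trans a2.le
    have hdθ : d ≤ θ := by rw [hd]; exact mul_le_of_le_one_left hθ (hεq.trans hq1)
    rw [hlz]
    rw [← hxd, ← hbd] at c1 c2 ⊢
    rw [← hAd, ← hC₁] at c1 c2
    rw [hlr] at hR
    generalize log (z₁ / t) = w₁ at *
    generalize log (z₂ / t) = w₂ at *
    generalize logRem μ ν ξ ξc β βc D Dc c (gridZ t d (m₁ + 1)) = R₁ at *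
    generalize logRem μ ν ξ ξc β βc D Dc c (gridZ t d (m₂ + 1)) = R₂ at *
    have hδ : ∀ w y R, -log 4 ≤ w → |R| ≤ ε * |q| →
        |w + q * exp (-(b * w)) / (x * b) - x * (y - log a) - R| ≤
          C₁ * (ε * |q| * θ) → |b * (w - x * (y - log a))| ≤ C₃ * |q| := by
      intro w y R hlw hR hΓ
      rw [abs_mul, abs_of_pos hb', hC₃, mul_assoc]
      refine mul_le_mul_of_nonneg_left ?_ hb'.le
      have e : w - x * (y - log a) =
          ((w + q * exp (-(b * w)) / (x * b) - x * (y - log a) - R) + R) -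
            q * exp (-(b * w)) / (x * b) := by ring
      rw [e]
      have h1 : |q * exp (-(b * w)) / (x * b)| ≤ |q| * (A / (x * b)) := by
        rw [mul_div_assoc, abs_mul, abs_of_pos (div_pos (exp_pos _) hxb)]
        refine mul_le_mul_of_nonneg_left (div_le_div_of_nonneg_right ?_ hxb.le) hq0
        rw [hAd]
        apply exp_le_exp.2
        have := mul_le_mul_of_nonneg_left hlw hb'.le
        linarith
      have h2 : C₁ * (ε * |q| * θ) ≤ C₁ * |q| := by simp_all
      refine (abs_sub _ _).trans ((add_le_add (abs_add_le _ _) h1).trans ?_)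
      linarith
    have hΓ : |w₁ - w₂ - x * ((y₁ - log a) - (y₂ - log a)) +
        q * ((exp (-(b * w₁)) - exp (-(b * w₂))) / (x * b))| ≤
        ε * |q| * (w₁ - w₂ + C₂ * θ) := by
      have e : w₁ - w₂ - x * ((y₁ - log a) - (y₂ - log a)) +
        q * ((exp (-(b * w₁)) - exp (-(b * w₂))) / (x * b)) =
        ((w₁ + q * exp (-(b * w₁)) / (x * b) - x * (y₁ - log a) - R₁) -
        (w₂ + q * exp (-(b * w₂)) / (x * b) - x * (y₂ - log a) - R₂)) +
        (R₁ - R₂) := by ring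
      rw [e, hC₂]
      refine (abs_add_le _ _).trans ((add_le_add (abs_sub _ _) hR).trans ?_)
      have h5 : ε * |q| * (log (gridZ t d m₁ / t) - log (gridZ t d m₂ / t) + θ) ≤
          ε * |q| * (w₁ - w₂ + 2 * θ) :=
        mul_le_mul_of_nonneg_left (by linarith) (by positivity)
      linarith
    have main := abs_implicit_sub_le (B := log 4) hx' hb' hθ hε hε1 hC₂0.le hC₃0.le l1 l2 hw
      (by rw [← hAd]; linarith) (by linarith) (hδ w₁ y₁ R₁ l1 r1 c1) (hδ w₂ y₂ R₂ l2 r2 c2) hΓ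
    rw [← hAd, ← hC₄, show y₁ - log a - (y₂ - log a) = y₁ - y₂ by ring] at main
    refine main.trans (mul_le_mul_of_nonneg_left ?_ (by positivity))
    have hT0 : 0 ≤ y₁ - y₂ := sub_nonneg.2 hy
    have h7 : C₄ * (2 * x + 3 * C₂) * (y₁ - y₂ + θ) ≤
        max (C₄ * (2 * x + 3 * C₂)) (max ((1 + 1 / (x * b)) / x) (2 * C₁ / x)) * (y₁ - y₂ + θ) :=
      mul_le_mul_of_nonneg_right (le_max_left _ _) (by positivity)
    refine le_trans ?_ h7
    have h8 : 0 ≤ C₄ * (2 * x) * θ := by positivity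
    have h9 : 0 ≤ C₄ * (3 * C₂) * (y₁ - y₂) := by positivity
    linarith

end Expansion

/-! ### Order statistics and the choice of the scales -/

section TopSet

variable {z y e : ℕ → ℝ} {m : ℕ → ℕ} {n k : ℕ}

theorem orderIndex_lt {j : ℕ} (h : j - 1 < n) : orderIndex z n j < n := by
  rw [orderIndex, dif_pos h]; exact Fin.is_lt _

theorem orderIndex_inj {i j : ℕ} (hi : i ∈ Icc 1 n) (hj : j ∈ Icc 1 n)
    (h : orderIndex z n i = orderIndex z n j) : i = j := by
  rw [mem_Icc] at hi hj
  rw [orderIndex, orderIndex, dif_pos (by omega), dif_pos (by omega)] at h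
  have := (sort fun i : Fin n => z i).injective (Fin.val_injective h)
  grind

theorem orderStat_mono {i j : ℕ} (hij : i ≤ j) (hj : j - 1 < n) :
    orderStat z n i ≤ orderStat z n j := by
  rw [orderStat, orderStat, orderIndex, orderIndex, dif_pos (by omega), dif_pos hj]
  exact Tuple.monotone_sort (fun i : Fin n => z i) (Fin.mk_le_mk.2 (by omega))

theorem exists_orderIndex_eq {i : ℕ} (hi : i < n) :
    ∃ j ∈ Icc 1 n, orderIndex z n (n - j + 1) = i := by
  obtain ⟨a, ha⟩ := (sort fun i : Fin n => z i).surjective ⟨i, hi⟩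
  refine ⟨n - a, by rw [mem_Icc]; omega, ?_⟩
  have : n - (n - (a : ℕ)) + 1 - 1 = a := by omega
  rw [orderIndex, dif_pos (by omega)]
  grind

def topSet (z : ℕ → ℝ) (n k : ℕ) : Finset ℕ := (Icc 1 k).image fun j => orderIndex z n (n - j + 1)

theorem orderIndex_injOn (hk : k ≤ n) :
    Set.InjOn (fun j => orderIndex z n (n - j + 1)) (Icc 1 k : Finset ℕ) := by
  intro i hi j hj h
  simp only [Finset.coe_Icc, Set.mem_Icc] at hi hj
  have := orderIndex_inj (i := n - i + 1) (j := n - j + 1) (by rw [mem_Icc]; omega)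
    (by rw [mem_Icc]; omega) h
  omega

theorem sum_topSet (hk : k ≤ n) (f : ℕ → ℝ) :
    ∑ i ∈ topSet z n k, f i = ∑ j ∈ Icc 1 k, f (orderIndex z n (n - j + 1)) :=
  Finset.sum_image (orderIndex_injOn hk)

theorem card_topSet (hk : k ≤ n) : (topSet z n k).card = k := by
  rw [topSet, Finset.card_image_of_injOn (orderIndex_injOn hk), Nat.card_Icc]; omega

theorem topSet_subset (hk : k ≤ n) : topSet z n k ⊆ range n := by
  intro i hi
  obtain ⟨j, hj, rfl⟩ := Finset.mem_image.1 hi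
  rw [mem_Icc] at hj
  exact mem_range.2 (orderIndex_lt (by omega))

theorem le_of_mem_topSet (hk : k ≤ n) {i : ℕ} (hi : i ∈ topSet z n k) :
    orderStat z n (n - k + 1) ≤ z i := by
  obtain ⟨j, hj, rfl⟩ := Finset.mem_image.1 hi
  rw [mem_Icc] at hj
  exact orderStat_mono (by omega) (by omega)

theorem le_of_notMem_topSet (hk1 : 1 ≤ k) {i : ℕ} (hi : i < n) (h : i ∉ topSet z n k) :
    z i ≤ orderStat z n (n - k + 1) := by
  obtain ⟨j, hj, rfl⟩ := exists_orderIndex_eq (z := z) hi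
  rw [mem_Icc] at hj
  refine orderStat_mono ?_ (by omega)
  by_contra hcon
  exact h (Finset.mem_image.2 ⟨j, by rw [mem_Icc]; omega, rfl⟩)

theorem subset_topSet {A : Finset ℕ} (hk1 : 1 ≤ k) (hk : k ≤ n) (hA : A ⊆ range n)
    (hup : ∀ i ∈ A, ∀ i' < n, i' ∉ A → z i' < z i) (hcard : A.card ≤ k) : A ⊆ topSet z n k := by
  intro i hi
  by_contra hcon
  have hin := mem_range.1 (hA hi)
  have hsub : topSet z n k ⊆ A := by
    intro j hj
    by_contra hjA
    have h1 := hup i hi j (mem_range.1 (topSet_subset hk hj)) hjA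
    have h2 := le_of_mem_topSet hk hj
    have h3 := le_of_notMem_topSet hk1 hin hcon
    linarith
  have := Finset.card_lt_card ((Finset.ssubset_iff_of_subset hsub).2 ⟨i, hi, hcon⟩)
  rw [card_topSet hk] at this
  omega

/-- Both sorting permutations make the list of cells monotone, and the monotone rearrangement of a
list is unique. So observations of equal rank share a cell although the two permutations may differ.
-/
theorem cell_orderIndex_eq (hz : ∀ i i', z i ≤ z i' → m i ≤ m i')
    (hy : ∀ i i', y i ≤ y i' → m i ≤ m i') (j : ℕ) :
    m (orderIndex z n j) = m (orderIndex y n j) := by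
  rw [orderIndex, orderIndex]
  split_ifs with h
  · have h1 : Monotone ((fun i : Fin n => m i) ∘ sort fun i : Fin n => z i) :=
      fun a b hab => hz _ _ (Tuple.monotone_sort (fun i : Fin n => z i) hab)
    have h2 : Monotone ((fun i : Fin n => m i) ∘ sort fun i : Fin n => y i) :=
      fun a b hab => hy _ _ (Tuple.monotone_sort (fun i : Fin n => y i) hab)
    exact congrFun (Tuple.unique_monotone h1 h2) ⟨j - 1, h⟩
  · rfl

/-- Sums over the top indices of two orders with the same cells differ by at most `l`, if the top
`k - l` and the `k`-th value are in different cells. -/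
theorem abs_sum_topSet_sub_le {l : ℕ} (hlk : l < k) (hk : k ≤ n)
    (hz : ∀ i i', z i ≤ z i' → m i ≤ m i') (hy : ∀ i i', y i ≤ y i' → m i ≤ m i')
    (hm : m (orderIndex y n (n - k + 1)) < m (orderIndex y n (n - (k - l) + 1)))
    (he0 : ∀ i, 0 ≤ e i) (he1 : ∀ i, e i ≤ 1) :
    |∑ i ∈ topSet z n k, e i - ∑ i ∈ topSet y n k, e i| ≤ l := by
  classical
  -- The indices in cells strictly above that of the `k`-th value lie in the top set of either
  -- order, so the orders can disagree only on the rest.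
  set A := (range n).filter fun i => m (orderIndex y n (n - k + 1)) < m i with hA
  have hAy : A ⊆ topSet y n k := by
    intro i hi
    rw [hA, mem_filter, mem_range] at hi
    by_contra hcon
    exact absurd (hy _ _ (le_of_notMem_topSet (by omega) hi.1 hcon)) (not_le.2 hi.2)
  have hAcard : A.card ≤ k := (Finset.card_le_card hAy).trans (card_topSet hk).le
  have hAz : A ⊆ topSet z n k := by
    refine subset_topSet (by omega) hk (Finset.filter_subset _ _) (fun i hi i' hi' hni => ?_) hAcard
    rw [hA, mem_filter] at hi
    rw [hA, mem_filter, mem_range, not_and] at hni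
    by_contra hcon
    have := hz _ _ (not_lt.1 hcon)
    omega
  have hlow : k - l ≤ A.card := by
    rw [← card_topSet (z := y) (k := k - l) (n := n) (by omega)]
    refine Finset.card_le_card fun i hi => ?_
    rw [hA, mem_filter]
    exact ⟨topSet_subset (by omega) hi, hm.trans_le (hy _ _ (le_of_mem_topSet (by omega) hi))⟩
  have hb : ∀ B : Finset ℕ, A ⊆ B → B.card = k → 0 ≤ ∑ i ∈ B \ A, e i ∧ ∑ i ∈ B \ A, e i ≤ l := by
    intro B hB hBk
    refine ⟨sum_nonneg fun i _ => he0 i, ?_⟩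
    refine (Finset.sum_le_card_nsmul _ _ 1 fun i _ => he1 i).trans ?_
    rw [nsmul_eq_mul, mul_one, Finset.card_sdiff_of_subset hB, hBk]
    exact_mod_cast (by omega : k - A.card ≤ l)
  rw [← Finset.sum_sdiff hAz, ← Finset.sum_sdiff hAy]
  have h1 := hb _ hAz (card_topSet hk)
  have h2 := hb _ hAy (card_topSet hk)
  grind

/-- The top set and the points beyond `τ` differ only by points between `τ` and the `k`-th value. A
fixed threshold turns the sum into one of i.i.d. terms. -/
theorem abs_sum_topSet_sub_threshold_le (hk1 : 1 ≤ k) (hk : k ≤ n) {τ w : ℝ}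
    (hτ : |orderStat y n (n - k + 1) - τ| ≤ w) (f : ℕ → ℝ) :
    |∑ i ∈ topSet y n k, f i - ∑ i ∈ range n, (Ioi τ).indicator (fun _ => f i) (y i)| ≤
      ∑ i ∈ range n, (Set.Icc (τ - w) (τ + w)).indicator (fun _ => |f i|) (y i) := by
  classical
  have e1 : ∑ i ∈ topSet y n k, f i = ∑ i ∈ range n, if i ∈ topSet y n k then f i else 0 := by
    rw [← Finset.sum_filter, Finset.filter_mem_eq_inter, Finset.inter_eq_right.2 (topSet_subset hk)]
  rw [e1, ← sum_sub_distrib]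
  refine (Finset.abs_sum_le_sum_abs _ _).trans (sum_le_sum fun i hi => ?_)
  rw [mem_range] at hi
  rw [abs_le] at hτ
  by_cases h1 : i ∈ topSet y n k
  · have h3 := le_of_mem_topSet hk h1
    by_cases h2 : τ < y i
    · rw [if_pos h1, indicator_of_mem (by exact h2), sub_self, abs_zero]
      exact Set.indicator_nonneg (fun _ _ => abs_nonneg _) _
    · rw [if_pos h1, indicator_of_notMem (by exact h2), sub_zero, indicator_of_mem (by grind)]
  · have h3 := le_of_notMem_topSet hk1 hi h1
    by_cases h2 : τ < y i
    · rw [if_neg h1, indicator_of_mem (by exact h2), zero_sub, abs_neg, indicator_of_mem (by grind)]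
    · rw [if_neg h1, indicator_of_notMem (by exact h2), sub_self, abs_zero]
      exact Set.indicator_nonneg (fun _ _ => abs_nonneg _) _

theorem topFraction_eq (hk : k ≤ n) :
    topFraction z e n k = (1 / (k : ℝ)) * ∑ i ∈ topSet z n k, e i := by
  rw [topFraction, sum_topSet hk]; rfl

end TopSet

/-! ### Choice of the scales -/

section Scales

variable {μ ν : Measure ℝ} [IsProbabilityMeasure μ] [IsProbabilityMeasure ν]
  {ξ ξc Cst Cstc D Dc β βc : ℝ}

/-- The sum of the orders of the random term and of the bias; remainders are shown to be negligible
relative to it. -/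
def rate (k : ℕ) (q : ℝ) : ℝ := 1 / √k + |q|

/-- The scales at which the tails are approximated, for sample size `n` and `k` upper order
statistics; `δ` measures the accuracy. -/
structure ScaleAt (μ ν : Measure ℝ) (ξ ξc β βc D Dc c κ : ℝ) (n k : ℕ) (t d θ δ q : ℝ) : Prop where
  delta_pos : 0 < δ
  delta_le : δ ≤ 1
  k_pos : 1 ≤ k
  k_lt : k < n
  t_eq : t = (c * ((n : ℝ) / k)) ^ xiZ ξ ξc
  q_eq : q = -(xiZ ξ ξc ^ 2 * betaZ β βc * dZ β βc D Dc) * t ^ (-betaZ β βc)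
  q_ne : q ≠ 0
  d_eq : d = δ ^ 2 * |q| * θ
  theta_pos : 0 < θ
  theta_le : θ ≤ 1
  rate_le : rate k q ≤ δ ^ 3
  approx : TailApprox μ ν ξ ξc β βc D Dc c q κ (δ ^ 2) t d θ

theorem tendsto_div_atTop {k : ℕ → ℕ} (hk : Tendsto k atTop atTop)
    (hkn : Tendsto (fun n : ℕ => (k n : ℝ) / n) atTop (𝓝 0)) :
    Tendsto (fun n : ℕ => (n : ℝ) / k n) atTop atTop := by
  have h1 : Tendsto (fun n : ℕ => (k n : ℝ) / n) atTop (𝓝[>] 0) := by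
    rw [tendsto_nhdsWithin_iff]
    refine ⟨hkn, ?_⟩
    filter_upwards [hk.eventually_ge_atTop 1, eventually_ge_atTop 1] with n h1 h2
    have h3 : (0 : ℝ) < k n := by exact_mod_cast h1
    have h4 : (0 : ℝ) < n := by exact_mod_cast h2
    exact div_pos h3 h4
  refine (tendsto_inv_nhdsGT_zero.comp h1).congr fun n => ?_
  simp

theorem eventually_lt_of_tendsto_div {k : ℕ → ℕ}
    (hkn : Tendsto (fun n : ℕ => (k n : ℝ) / n) atTop (𝓝 0)) : ∀ᶠ n in atTop, k n < n := by
  filter_upwards [hkn.eventually (gt_mem_nhds one_pos), eventually_ge_atTop 1] with n h1 h2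
  have : (0 : ℝ) < n := by exact_mod_cast h2
  rw [div_lt_one this] at h1
  exact_mod_cast h1

/-- Each fixed accuracy holds eventually, so a diagonal choice gives `δ n → 0`. The powers separate
the scales: tails are known up to `δ²` and the rate is at most `δ³`, so even `rate/δ` tends to zero.
-/
theorem exists_scales (h : HallWelsh (sv μ) ξ Cst D β) (hc : HallWelsh (sv ν) ξc Cstc Dc βc)
    (hD : dZ β βc D Dc ≠ 0) {k : ℕ → ℕ} (hk : Tendsto k atTop atTop)
    (hkn : Tendsto (fun n : ℕ => (k n : ℝ) / n) atTop (𝓝 0)) :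
    ∃ t d θ δ : ℕ → ℝ, (∀ n, 0 < t n ∧ 0 < d n) ∧ Tendsto δ atTop (𝓝 0) ∧
      (∀ᶠ n in atTop, ScaleAt μ ν ξ ξc β βc D Dc (Cst * Cstc)
        (kappaZ ξ ξc β βc D Dc / (1 - rhoZ ξ ξc β βc)) n (k n) (t n) (d n) (θ n) (δ n)
        (q0Z ξ ξc β βc D Dc Cst Cstc ((n : ℝ) / k n))) ∧
      (HallWelshDeriv (sv μ) ξ D β → HallWelshDeriv (sv ν) ξc Dc βc →
        ∀ n, θ n ≤ 1 / ((k n : ℝ) + 1)) := by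
  classical
  have hx := xiZ_pos h.xi_pos hc.xi_pos
  have hb := betaZ_pos h.beta_pos hc.beta_pos
  have hcc : 0 < Cst * Cstc := mul_pos h.cst_pos hc.cst_pos
  set κ := kappaZ ξ ξc β βc D Dc / (1 - rhoZ ξ ξc β βc) with hκ
  set Q := -(xiZ ξ ξc ^ 2 * betaZ β βc * dZ β βc D Dc) with hQd
  have hQ : Q ≠ 0 := neg_ne_zero.2 (mul_ne_zero (mul_ne_zero (pow_ne_zero 2 hx.ne') hb.ne') hD)
  let θ : ℕ → ℝ := fun n =>
    if HallWelshDeriv (sv μ) ξ D β ∧ HallWelshDeriv (sv ν) ξc Dc βc then 1 / ((k n : ℝ) + 1) else 1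
  have hθ0 : ∀ n, 0 < θ n := fun n => by positivity
  have hθ1 : ∀ n, θ n ≤ 1 := fun n => by
    simp only [θ]; split_ifs
    · rw [div_le_one (by positivity)]; linarith
    · exact le_rfl
  let s : ℕ → ℝ := fun n => (Cst * Cstc * ((n : ℝ) / k n)) ^ xiZ ξ ξc
  have hs : Tendsto s atTop atTop :=
    (tendsto_rpow_atTop hx).comp ((tendsto_div_atTop hk hkn).const_mul_atTop hcc)
  let q : ℕ → ℝ := fun n => Q * s n ^ (-betaZ β βc)
  have hq0 : Tendsto q atTop (𝓝 0) := by
    have := ((tendsto_rpow_neg_atTop hb).comp hs).const_mul Q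
    rwa [mul_zero] at this
  have hqeq : ∀ᶠ n : ℕ in atTop, q0Z ξ ξc β βc D Dc Cst Cstc ((n : ℝ) / k n) = q n := by
    filter_upwards [(tendsto_div_atTop hk hkn).eventually_gt_atTop 0] with n hn
    simp only [q, s, q0Z]
    rw [← hQd, ← rpow_mul (by positivity), mul_assoc Q, ← Real.mul_rpow hcc.le hn.le, rhoZ]
    congr 2
    ring
  have happ : ∀ ε > 0, ∀ᶠ n in atTop, TailApprox μ ν ξ ξc β βc D Dc (Cst * Cstc) (q n) κ ε (s n)
      (ε * |q n| * θ n) (θ n) := by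
    intro ε hε
    by_cases hd : HallWelshDeriv (sv μ) ξ D β ∧ HallWelshDeriv (sv ν) ξc Dc βc
    · filter_upwards [hs.eventually (eventually_tailApprox_of_deriv h hc hd.1 hd.2 hD hε hQ
        (κ := κ) rfl)] with n hn using hn _ (hθ0 n).le (hθ1 n)
    · have : ∀ n, θ n = 1 := fun n => by grind
      simp only [this]
      exact hs.eventually (eventually_tailApprox h hc hD hε hQ (κ := κ) rfl)
  have hrate : Tendsto (fun n : ℕ => rate (k n) (q n)) atTop (𝓝 0) := by
    have h1 : Tendsto (fun n : ℕ => 1 / √(k n : ℝ)) atTop (𝓝 0) := by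
      refine Tendsto.div_atTop tendsto_const_nhds (Real.tendsto_sqrt_atTop.comp ?_)
      exact tendsto_natCast_atTop_atTop.comp hk
    have := h1.add hq0.abs
    simpa [rate] using this
  obtain ⟨δ, hδ0, hδ, hev⟩ := exists_tendsto_zero_of_forall_eventually
    (Q := fun n δ => (1 ≤ k n ∧ k n < n ∧ 0 < s n ∧
      q0Z ξ ξc β βc D Dc Cst Cstc ((n : ℝ) / k n) = q n ∧ rate (k n) (q n) ≤ δ ^ 3 ∧
      TailApprox μ ν ξ ξc β βc D Dc (Cst * Cstc) (q n) κ (δ ^ 2) (s n)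
        (δ ^ 2 * |q n| * θ n) (θ n))) (by
    intro δ hδ
    filter_upwards [hk.eventually_ge_atTop 1, eventually_lt_of_tendsto_div hkn,
      hs.eventually_gt_atTop 0, hqeq, hrate.eventually (gt_mem_nhds (pow_pos hδ 3)),
      happ (δ ^ 2) (by positivity)] with n h1 h2 h3 h4 h5 h6
    grind)
  -- The coupling is built for all `n` at once and needs positive `t` and `d` throughout; the value
  -- `1` is a default where the approximation is not yet available.
  refine ⟨fun n => if 0 < s n then s n else 1,
    fun n => if 0 < δ n ^ 2 * |q n| * θ n then δ n ^ 2 * |q n| * θ n else 1, θ, δ, fun n => ?_, hδ,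
    ?_, fun h1 h2 n => ?_⟩
  · grind
  · filter_upwards [hev, hδ.eventually (gt_mem_nhds one_pos)] with n ⟨h1, h2, h3, h4, h5, h6⟩ h7
    have hqn : q n ≠ 0 := mul_ne_zero hQ (rpow_pos_of_pos h3 _).ne'
    have hdn : 0 < δ n ^ 2 * |q n| * θ n :=
      mul_pos (mul_pos (pow_pos (hδ0 n) 2) (abs_pos.2 hqn)) (hθ0 n)
    rw [if_pos h3, if_pos hdn, h4]
    exact ⟨hδ0 n, h7.le, h1, h2, rfl, rfl, hqn, rfl, hθ0 n, hθ1 n, h5, h6⟩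
  grind

end Scales

/-! ### Differences of the marks -/

section Marks

open unitInterval

variable {a : ℝ → ℝ} {p : ℝ}

/-- The difference of the mark with success probability `a x` and the one with probability `p`. -/
def markDiff (a : ℝ → ℝ) (p : ℝ) (x : ℝ × I) : ℝ := bern (a x.1) x.2 - bern p x.2

theorem bern_nonneg (q : ℝ) (v : I) : 0 ≤ bern q v := by rw [bern]; split_ifs <;> norm_num

theorem bern_le_one (q : ℝ) (v : I) : bern q v ≤ 1 := by rw [bern]; split_ifs <;> norm_num

theorem measurable_bern_comp (ha : Measurable a) : Measurable fun x : ℝ × I => bern (a x.1) x.2 :=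
  Measurable.ite (measurableSet_le (measurable_subtype_coe.comp measurable_snd)
    (ha.comp measurable_fst)) measurable_const measurable_const

theorem measurable_markDiff (ha : Measurable a) : Measurable (markDiff a p) :=
  (measurable_bern_comp ha).sub ((measurable_bern p).comp measurable_snd)

theorem abs_markDiff_le_one (x : ℝ × I) : |markDiff a p x| ≤ 1 := by
  have h1 := bern_nonneg (a x.1) x.2
  have h2 := bern_le_one (a x.1) x.2
  have h3 := bern_nonneg p x.2
  have h4 := bern_le_one p x.2
  rw [markDiff, abs_le]
  constructor <;> linarith

/-- The values are `-1`, `0`, `1`, so second moments are probabilities that the marks differ. -/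
theorem markDiff_sq (x : ℝ × I) : markDiff a p x ^ 2 = |markDiff a p x| := by
  rw [markDiff, bern, bern]
  split_ifs <;> simp

theorem integrable_bern (q : ℝ) : Integrable (bern q) (volume : Measure I) :=
  Integrable.of_bound (measurable_bern q).aestronglyMeasurable 1 (ae_of_all _ fun v => by
    rw [norm_eq_abs, abs_of_nonneg (bern_nonneg q v)]; exact bern_le_one q v)

theorem integral_bern {q : ℝ} (h0 : 0 ≤ q) (h1 : q ≤ 1) :
    ∫ v, bern q v ∂(volume : Measure I) = q := by
  have e : bern q = indicator {v : I | (v : ℝ) ≤ q} fun _ => (1 : ℝ) := by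
    ext v
    simp only [bern, indicator, mem_ofPred_eq]
  have hm : MeasurableSet {v : I | (v : ℝ) ≤ q} :=
    measurableSet_le measurable_subtype_coe measurable_const
  rw [e, integral_indicator hm, setIntegral_const, measureReal_def, volume_coe_le h0 h1,
    ENNReal.toReal_ofReal h0, smul_eq_mul, mul_one]

theorem bern_mono {q q' : ℝ} (h : q ≤ q') (v : I) : bern q v ≤ bern q' v := by
  rw [bern, bern]
  split_ifs with h1 h2
  · exact le_rfl
  · exact absurd (h1.trans h) h2
  · exact zero_le_one
  · exact le_rfl

theorem integral_abs_bern_sub {q q' : ℝ} (h0 : 0 ≤ q) (h1 : q ≤ 1) (h0' : 0 ≤ q') (h1' : q' ≤ 1) :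
    ∫ v, |bern q v - bern q' v| ∂(volume : Measure I) = |q - q'| := by
  wlog h : q' ≤ q generalizing q q'
  · rw [abs_sub_comm, ← this h0' h1' h0 h1 (le_of_not_ge h)]
    simp_rw [abs_sub_comm]
  simp_rw [fun v => abs_of_nonneg (sub_nonneg.2 (bern_mono h v))]
  have := integral_sub (integrable_bern q) (integrable_bern q')
  rw [this, integral_bern h0 h1, integral_bern h0' h1', abs_of_nonneg (sub_nonneg.2 h)]

theorem isProb_exp : IsProbabilityMeasure (expMeasure 1) := isProbabilityMeasure_expMeasure one_pos

def markOn (S : Set ℝ) (a : ℝ → ℝ) (p : ℝ) (x : ℝ × I) : ℝ :=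
  S.indicator (fun _ => markDiff a p x) x.1

theorem measurable_markOn {S : Set ℝ} (hS : MeasurableSet S) (ha : Measurable a) :
    Measurable (markOn S a p) := by
  have : markOn S a p = (Prod.fst ⁻¹' S).indicator (markDiff a p) := by rfl
  rw [this]
  exact (measurable_markDiff ha).indicator (measurable_fst hS)

theorem abs_markOn (S : Set ℝ) (x : ℝ × I) :
    |markOn S a p x| = S.indicator (fun _ => |markDiff a p x|) x.1 := by
  rw [markOn, indicator, indicator]
  split_ifs <;> simp

theorem abs_markOn_le_one (S : Set ℝ) (x : ℝ × I) : |markOn S a p x| ≤ 1 := by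
  rw [abs_markOn]
  exact Set.indicator_le' (f := fun _ => |markDiff a p x|) (g := fun _ => (1 : ℝ))
    (fun _ _ => abs_markDiff_le_one x) (fun _ _ => zero_le_one) x.1

theorem markOn_sq (S : Set ℝ) (x : ℝ × I) : markOn S a p x ^ 2 = |markOn S a p x| := by
  rw [abs_markOn, markOn, indicator, indicator]
  split_ifs
  · exact markDiff_sq x
  · simp

/-- Two marks read from the same uniform variable differ with probability exactly the difference of
their levels. -/
theorem integral_abs_markOn_le {S : Set ℝ} (hS : MeasurableSet S) (ha : Measurable a)
    (ha0 : ∀ x, 0 ≤ a x) (ha1 : ∀ x, a x ≤ 1) (hp0 : 0 ≤ p) (hp1 : p ≤ 1) {ε : ℝ}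
    (hε : ∀ x ∈ S, |a x - p| ≤ ε) :
    ∫ x, |markOn S a p x| ∂((expMeasure 1).prod (volume : Measure I)) ≤
      ε * (expMeasure 1).real S := by
  have := isProb_exp
  have hint : Integrable (fun x => |markOn S a p x|) ((expMeasure 1).prod (volume : Measure I)) :=
    (Integrable.of_bound (measurable_markOn hS ha).aestronglyMeasurable 1 (ae_of_all _ fun x => by
      rw [norm_eq_abs]; exact abs_markOn_le_one S x)).abs
  rw [integral_prod _ hint]
  have e : ∀ x, ∫ v, |markOn S a p (x, v)| ∂(volume : Measure I) =
      S.indicator (fun x => |a x - p|) x := by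
    intro x
    simp only [abs_markOn]
    by_cases hx : x ∈ S
    · simp only [indicator_of_mem hx]
      exact integral_abs_bern_sub (ha0 x) (ha1 x) hp0 hp1
    · simp only [indicator_of_notMem hx]
      simp
  simp_rw [e]
  rw [integral_indicator hS, mul_comm, ← smul_eq_mul, ← setIntegral_const]
  refine setIntegral_mono_on ?_ integrableOn_const hS hε
  refine (Integrable.of_bound (C := 1) ?_ (ae_of_all _ fun x => ?_)).integrableOn
  · exact ((ha.sub_const p).abs).aestronglyMeasurable
  · rw [norm_eq_abs, abs_abs, abs_le]
    have := ha0 x; have := ha1 x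
    constructor <;> linarith

theorem integral_markOn {S : Set ℝ} (hS : MeasurableSet S) (ha : Measurable a)
    (hp0 : 0 ≤ p) (hp1 : p ≤ 1) :
    ∫ x, markOn S a p x ∂((expMeasure 1).prod (volume : Measure I)) =
      ((expMeasure 1).prod (volume : Measure I)).real {x | x.1 ∈ S ∧ (x.2 : ℝ) ≤ a x.1} -
        p * (expMeasure 1).real S := by
  have := isProb_exp
  have e : ∀ x : ℝ × I, markOn S a p x =
      indicator {x : ℝ × I | x.1 ∈ S ∧ (x.2 : ℝ) ≤ a x.1} (fun _ => (1 : ℝ)) x -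
      indicator {x : ℝ × I | x.1 ∈ S ∧ (x.2 : ℝ) ≤ p} (fun _ => (1 : ℝ)) x := by
    intro x
    simp only [markOn, indicator, markDiff, bern, mem_ofPred_eq]
    by_cases h : x.1 ∈ S <;> simp [h]
  have hm : ∀ f : ℝ → ℝ, Measurable f →
      MeasurableSet {x : ℝ × I | x.1 ∈ S ∧ (x.2 : ℝ) ≤ f x.1} := fun f hf =>
    (measurable_fst hS).inter (measurableSet_le (measurable_subtype_coe.comp measurable_snd)
      (hf.comp measurable_fst))
  have hp : {x : ℝ × I | x.1 ∈ S ∧ (x.2 : ℝ) ≤ p} = S ×ˢ {v : I | (v : ℝ) ≤ p} := by ext x; simp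
  have i1 := (integrable_const (1 : ℝ) (μ := (expMeasure 1).prod (volume : Measure I))).indicator
    (hm a ha)
  have i2 := (integrable_const (1 : ℝ) (μ := (expMeasure 1).prod (volume : Measure I))).indicator
    (hm (fun _ => p) measurable_const)
  simp_rw [e]
  have := integral_sub i1 i2
  rw [this, integral_indicator (hm a ha), integral_indicator (hm (fun _ => p) measurable_const),
    setIntegral_const, setIntegral_const, hp, measureReal_prod_prod,
    measureReal_def (volume : Measure I), volume_coe_le hp0 hp1, ENNReal.toReal_ofReal hp0]
  simp [mul_comm]

variable {Ω : Type*} [MeasurableSpace Ω] {P : Measure Ω} {y : ℕ → Ω → ℝ} {v : ℕ → Ω → I}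

theorem IsIidExpUnif.integral_comp (h : IsIidExpUnif P y v) {G : ℝ × I → ℝ} (hG : Measurable G)
    (i : ℕ) : ∫ ω, G (y i ω, v i ω) ∂P = ∫ x, G x ∂((expMeasure 1).prod (volume : Measure I)) := by
  rw [← h.law i, integral_map ((h.meas_fst i).prodMk (h.meas_snd i)).aemeasurable
    hG.aestronglyMeasurable]

theorem IsIidExpUnif.memLp_comp [IsProbabilityMeasure P] (h : IsIidExpUnif P y v) {G : ℝ × I → ℝ}
    (hG : Measurable G) (hG1 : ∀ x, |G x| ≤ 1) (i : ℕ) : MemLp (fun ω => G (y i ω, v i ω)) 2 P :=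
  MemLp.of_bound (hG.comp ((h.meas_fst i).prodMk (h.meas_snd i))).aestronglyMeasurable 1
    (ae_of_all _ fun _ => hG1 _)

theorem IsIidExpUnif.integral_sq_sum_sub_le [IsProbabilityMeasure P] (h : IsIidExpUnif P y v)
    {G : ℝ × I → ℝ} (hG : Measurable G) (hG1 : ∀ x, |G x| ≤ 1) (n : ℕ) :
    ∫ ω, (∑ i ∈ range n, G (y i ω, v i ω) -
      n * ∫ x, G x ∂((expMeasure 1).prod (volume : Measure I))) ^ 2 ∂P ≤
      n * ∫ x, G x ^ 2 ∂((expMeasure 1).prod (volume : Measure I)) := by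
  set m := ∫ x, G x ∂((expMeasure 1).prod (volume : Measure I)) with hm
  have h2 : ∀ i, MemLp (fun ω => G (y i ω, v i ω) - m) 2 P := fun i =>
    (h.memLp_comp hG hG1 i).sub (memLp_const m)
  have hint : ∀ i, Integrable (fun ω => G (y i ω, v i ω)) P := fun i =>
    (h.memLp_comp hG hG1 i).integrable one_le_two
  have h0 : ∀ i, ∫ ω, (G (y i ω, v i ω) - m) ∂P = 0 := fun i => by
    have := integral_sub (hint i) (integrable_const m)
    rw [this, h.integral_comp hG, integral_const, probReal_univ, one_smul, sub_self]
  have hind : iIndepFun (fun i ω => G (y i ω, v i ω) - m) P :=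
    h.indep.comp (fun _ x => G x - m) fun _ => hG.sub_const m
  have key := integral_sq_sum_of_iIndepFun hind h2 h0 (range n)
  have e : ∀ ω, ∑ i ∈ range n, (G (y i ω, v i ω) - m) =
      ∑ i ∈ range n, G (y i ω, v i ω) - n * m := fun ω => by
    rw [sum_sub_distrib]; simp
  simp_rw [e] at key
  rw [key]
  have hle : ∀ i ∈ range n, ∫ ω, (G (y i ω, v i ω) - m) ^ 2 ∂P ≤
      ∫ x, G x ^ 2 ∂((expMeasure 1).prod (volume : Measure I)) := by
    intro i _
    have e2 : ∀ ω, (G (y i ω, v i ω) - m) ^ 2 =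
        G (y i ω, v i ω) ^ 2 - (2 * m * G (y i ω, v i ω) - m ^ 2) := fun ω => by ring
    simp_rw [e2]
    have i1 : Integrable (fun ω => G (y i ω, v i ω) ^ 2) P := (h.memLp_comp hG hG1 i).integrable_sq
    have i2 : Integrable (fun ω => 2 * m * G (y i ω, v i ω)) P := (hint i).const_mul _
    have j1 := integral_sub i1 (i2.sub (integrable_const (m ^ 2)))
    have j2 := integral_sub i2 (integrable_const (m ^ 2))
    simp only [Pi.sub_apply] at j1
    rw [j1, j2, integral_const_mul, h.integral_comp hG, ← hm, integral_const, probReal_univ,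
      one_smul, h.integral_comp (G := fun x => G x ^ 2) (hG.pow_const 2)]
    have := sq_nonneg m
    linarith
  refine (sum_le_sum hle).trans (le_of_eq ?_)
  simp

end Marks

/-! ### The expansion of the fraction of non-censored data -/

section Fraction

open unitInterval

/-- A censored sample `Z, e` on the probability space of the exponential variables `y, E`, the
uniform variables `v` and the normal variables `N`. -/
structure CoupledSample {Ω : Type*} [MeasurableSpace Ω] (P : Measure Ω) (μ ν : Measure ℝ) (p : ℝ)
    (k : ℕ → ℕ) (t d : ℕ → ℝ) (Z e : Ω → ℕ → ℝ) (y : ℕ → ℕ → Ω → ℝ) (v : ℕ → ℕ → Ω → I)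
    (N : ℕ → Ω → ℝ) (E : ℕ → ℕ → Ω → ℝ) : Prop where
  iid : ∀ n, IsIidExpUnif P (y n) (v n)
  exps : ∀ n, IsIidExp P (E n)
  clt : SmallP P (fun n ω => N n ω - (√(k n * (p * (1 - p))))⁻¹ * ∑ j ∈ Icc 1 (k n),
    (bern p (v n (orderIndex (fun i => y n i ω) n (n - j + 1)) ω) - p))
  ord : ∀ n ω, ∀ j ∈ Icc 1 n, orderStat (fun i => y n i ω) n (n - j + 1) = tailSum (E n) n j ω
  level : ∀ n m, P.real {ω | gridY μ ν (t n) (d n) m < y n 0 ω ∧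
    (v n 0 ω : ℝ) ≤ cellProb μ ν p (t n) (d n) (cellOf (gridY μ ν (t n) (d n)) (y n 0 ω))} =
      uncMass μ ν (gridZ (t n) (d n) m)
  cells : ∀ᵐ ω ∂P, ∀ n i,
    cellOf (gridZ (t n) (d n)) (Z ω i) = cellOf (gridY μ ν (t n) (d n)) (y n i ω) ∧
    e ω i = bern (cellProb μ ν p (t n) (d n) (cellOf (gridY μ ν (t n) (d n)) (y n i ω))) (v n i ω)

/-- The consequences of the tail approximation that are used at a given scale. -/
structure GridFacts (μ ν : Measure ℝ) (x b K : ℝ) (n k : ℕ) (t d θ δ q : ℝ) : Prop where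
  gridM_le : |gridY μ ν t d (gridM d) - log ((n : ℝ) / k)| ≤ K * |q|
  zero_le : gridY μ ν t d 0 - log ((n : ℝ) / k) ≤ -(log 2 / (2 * x))
  same_cell : ∀ y₁ y₂ : ℝ, 1 ≤ cellOf (gridY μ ν t d) y₂ →
    cellOf (gridY μ ν t d) y₁ = cellOf (gridY μ ν t d) y₂ → y₁ - y₂ ≤ K * (δ ^ 2 * |q|)
  ratio : ∀ z₁ z₂ y₁ y₂ : ℝ, z₂ ≤ z₁ → y₂ ≤ y₁ → 1 ≤ cellOf (gridZ t d) z₂ →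
    cellOf (gridZ t d) z₁ = cellOf (gridY μ ν t d) y₁ →
    cellOf (gridZ t d) z₂ = cellOf (gridY μ ν t d) y₂ →
    |log (z₁ / z₂) - x * (y₁ - y₂) + q * ((exp (-(x * b * (y₁ - log ((n : ℝ) / k)))) -
        exp (-(x * b * (y₂ - log ((n : ℝ) / k))))) / (x * b))| ≤
      |q| * (δ ^ 2 + |q|) * (K * (y₁ - y₂ + θ))

variable {μ ν : Measure ℝ} [IsProbabilityMeasure μ] [IsProbabilityMeasure ν]
  {ξ ξc Cst Cstc D Dc β βc c κ : ℝ}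

section ScaleLemmas

variable {n k : ℕ} {t d θ δ q : ℝ}

theorem ScaleAt.k_pos' (h : ScaleAt μ ν ξ ξc β βc D Dc c κ n k t d θ δ q) : (0 : ℝ) < k := by
  exact_mod_cast h.k_pos

theorem ScaleAt.n_pos (h : ScaleAt μ ν ξ ξc β βc D Dc c κ n k t d θ δ q) : (0 : ℝ) < n := by
  have := h.k_lt
  exact_mod_cast (by omega : 0 < n)

theorem ScaleAt.q_le_rate (_ : ScaleAt μ ν ξ ξc β βc D Dc c κ n k t d θ δ q) : |q| ≤ rate k q := by
  rw [rate]; simp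

theorem ScaleAt.inv_sqrt_le_rate (_ : ScaleAt μ ν ξ ξc β βc D Dc c κ n k t d θ δ q) :
    1 / √k ≤ rate k q := by
  rw [rate]; linarith [abs_nonneg q]

theorem ScaleAt.rate_pos (h : ScaleAt μ ν ξ ξc β βc D Dc c κ n k t d θ δ q) : 0 < rate k q :=
  lt_of_lt_of_le (abs_pos.2 h.q_ne) h.q_le_rate

theorem ScaleAt.d_pos (h : ScaleAt μ ν ξ ξc β βc D Dc c κ n k t d θ δ q) : 0 < d := by
  rw [h.d_eq]
  exact mul_pos (mul_pos (pow_pos h.delta_pos 2) (abs_pos.2 h.q_ne)) h.theta_pos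

theorem ScaleAt.t_pos (h : ScaleAt μ ν ξ ξc β βc D Dc c κ n k t d θ δ q) (hc : 0 < c) : 0 < t := by
  rw [h.t_eq]
  have := h.k_pos'
  have := h.n_pos
  positivity

theorem one_div_nat_eq_sq (k : ℕ) : 1 / (k : ℝ) = (1 / √k) * (1 / √k) := by grind

end ScaleLemmas

theorem exists_gridFacts (hx : 0 < xiZ ξ ξc) (hb : 0 < betaZ β βc) (hc : 0 < c)
    (hpos : ∀ z, 0 < svMin μ ν z) {k : ℕ → ℕ} {t d θ δ q : ℕ → ℝ} (hδ : Tendsto δ atTop (𝓝 0))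
    (hs : ∀ᶠ n in atTop, ScaleAt μ ν ξ ξc β βc D Dc c κ n (k n) (t n) (d n) (θ n) (δ n) (q n)) :
    ∃ K > 0, ∀ᶠ n in atTop, GridFacts μ ν (xiZ ξ ξc) (betaZ β βc) K n (k n) (t n) (d n) (θ n)
      (δ n) (q n) := by
  obtain ⟨K, hK, q₀, hq₀, h⟩ := exists_log_ratio_bound (μ := μ) (ν := ν) (D := D) (Dc := Dc)
    hx hb hc hpos
  refine ⟨K, hK, ?_⟩
  have h3 : Tendsto (fun n => δ n ^ 3) atTop (𝓝 0) := by simpa using hδ.pow 3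
  filter_upwards [hs, h3.eventually (gt_mem_nhds hq₀)] with n hn hn2
  have hkp := hn.k_pos'
  have hnp := hn.n_pos
  have hd1 := hn.delta_le
  have hd0 := hn.delta_pos
  obtain ⟨a1, a2, a3, a4⟩ := h ((n : ℝ) / k n) (t n) (d n) (δ n ^ 2) (q n) κ (θ n)
    (by positivity) hn.t_eq hn.q_eq (hn.q_le_rate.trans (hn.rate_le.trans hn2.le)) (by positivity)
    (pow_le_one₀ hd0.le hd1) hn.theta_pos.le hn.theta_le hn.d_eq hn.d_pos hn.approx
  exact ⟨a1, a2, a3, a4⟩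

theorem IsIidExp.integral_abs_tailSum_sub_log_le {Ω : Type*} [MeasurableSpace Ω] {P : Measure Ω}
    {E : ℕ → Ω → ℝ} (h : IsIidExp P E) {k n : ℕ} (hk : 1 ≤ k) (hkn : k ≤ n) :
    ∫ ω, |tailSum E n k ω - log ((n : ℝ) / k)| ∂P ≤ 4 / √k := by
  have := h.isProb
  have hk0 : (0 : ℝ) < k := by exact_mod_cast hk
  have hkn' : (k : ℝ) ≤ n := by exact_mod_cast hkn
  have hn0 : (0 : ℝ) < n := by linarith
  have h1 := h.integral_abs_tailSum_sub_logW_le hk hkn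
  have hlog : |logW n k - log ((n : ℝ) / k)| ≤ 1 / k := by
    have e : logW n k - log ((n : ℝ) / k) = log ((n + 1 : ℕ) : ℝ) - log n := by
      rw [logW_eq hk, log_div hn0.ne' hk0.ne']; push_cast; ring
    have h2 := log_succ_sub_log_le (j := n) (by omega)
    have h3 : log n ≤ log ((n + 1 : ℕ) : ℝ) := log_le_log hn0 (by push_cast; linarith)
    rw [e, abs_of_nonneg (by linarith)]
    exact h2.trans (one_div_le_one_div_of_le hk0 hkn')
  have hi := h.integrable_tailSum n k
  have h4 : ∫ ω, |tailSum E n k ω - log ((n : ℝ) / k)| ∂P ≤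
      ∫ ω, (|tailSum E n k ω - logW n k| + 1 / k) ∂P := by
    refine integral_mono (hi.sub (integrable_const _)).abs
      ((hi.sub (integrable_const _)).abs.add (integrable_const _)) fun ω => ?_
    grind
  have h5 := integral_add (hi.sub (integrable_const (μ := P) (logW n k))).abs
    (integrable_const (μ := P) (1 / (k : ℝ)))
  simp only [Pi.sub_apply] at h5
  rw [h5, integral_const, probReal_univ, one_smul] at h4
  have hs0 : 0 < √(k : ℝ) := sqrt_pos.2 hk0
  have hs1 : 1 / √(k : ℝ) ≤ 1 := by
    rw [div_le_one hs0]
    simp_all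
  have h6 : √(2 / (k : ℝ)) ≤ 2 * (1 / √k) := by
    rw [Real.sqrt_div (by norm_num), mul_one_div]
    refine div_le_div_of_nonneg_right ?_ hs0.le
    simp
  have h7 : 1 / (k : ℝ) ≤ 1 / √k := by
    rw [one_div_nat_eq_sq]
    simp_all
  grind

theorem IsIidExp.measure_tailSum_dev_le {Ω : Type*} [MeasurableSpace Ω] {P : Measure Ω}
    {E : ℕ → Ω → ℝ} (h : IsIidExp P E) {k n : ℕ} (hk : 1 ≤ k) (hkn : k ≤ n) {x : ℝ} (hx : 0 < x) :
    P {ω | x ≤ |tailSum E n k ω - log ((n : ℝ) / k)|} ≤ ofReal (4 / √k / x) := by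
  have := h.isProb
  exact measure_abs_ge_le_of_integral_le ((h.integrable_tailSum n k).sub (integrable_const _)) hx
    (h.integral_abs_tailSum_sub_log_le hk hkn)

variable {Ω : Type*} [MeasurableSpace Ω] {P : Measure Ω} [IsProbabilityMeasure P]
  {k : ℕ → ℕ} {t d θ δ q : ℕ → ℝ} {p K x b : ℝ} {Z e : Ω → ℕ → ℝ}
  {y : ℕ → ℕ → Ω → ℝ} {v : ℕ → ℕ → Ω → I} {N : ℕ → Ω → ℝ} {E : ℕ → ℕ → Ω → ℝ}

theorem tendsto_ofReal_zero {a : ℕ → ℝ} (h : Tendsto a atTop (𝓝 0)) :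
    Tendsto (fun n => ofReal (a n)) atTop (𝓝 0) := by
  simpa using ENNReal.tendsto_ofReal h

/-- The `k`-th largest exponential variable is `log(n/k) + O_p(k^{-1/2})`, while the grid begins a
fixed distance below `log(n/k)`. -/
theorem tendsto_measure_first_cell (hS : CoupledSample P μ ν p k t d Z e y v N E)
    (hx : 0 < x) (hδ : Tendsto δ atTop (𝓝 0))
    (hs : ∀ᶠ n in atTop, ScaleAt μ ν ξ ξc β βc D Dc c κ n (k n) (t n) (d n) (θ n) (δ n) (q n))
    (hG : ∀ᶠ n in atTop, GridFacts μ ν x b K n (k n) (t n) (d n) (θ n) (δ n) (q n)) :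
    Tendsto (fun n => P {ω | tailSum (E n) n (k n) ω ≤ gridY μ ν (t n) (d n) 0}) atTop (𝓝 0) := by
  have hl2 : 0 < log 2 := log_pos (by norm_num)
  have h0 : Tendsto (fun n => 4 * δ n ^ 3 / (log 2 / (2 * x))) atTop (𝓝 0) := by
    have := ((hδ.pow 3).const_mul 4).div_const (log 2 / (2 * x))
    simpa using this
  refine tendsto_of_tendsto_of_tendsto_of_le_of_le' tendsto_const_nhds (tendsto_ofReal_zero h0)
    (of_forall fun _ => zero_le) ?_
  filter_upwards [hs, hG] with n hn hg
  have h1 := (hS.exps n).measure_tailSum_dev_le hn.k_pos hn.k_lt.le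
    (show 0 < log 2 / (2 * x) by positivity)
  refine (measure_mono fun ω hω => ?_).trans (h1.trans (ofReal_le_ofReal ?_))
  · have := hg.zero_le
    grind
  · refine div_le_div_of_nonneg_right ?_ (by positivity)
    have := hn.inv_sqrt_le_rate.trans hn.rate_le
    grind

end Fraction

/-! ### From observed indicators to marks of level `p` -/

section FractionExpansion

open unitInterval

variable {μ ν : Measure ℝ} [IsProbabilityMeasure μ] [IsProbabilityMeasure ν]
  {ξ ξc Cst Cstc D Dc β βc c κ : ℝ}
  {Ω : Type*} [MeasurableSpace Ω] {P : Measure Ω} [IsProbabilityMeasure P]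
  {k : ℕ → ℕ} {t d θ δ q : ℕ → ℝ} {p K x b : ℝ} {Z e : Ω → ℕ → ℝ}
  {y : ℕ → ℕ → Ω → ℝ} {v : ℕ → ℕ → Ω → I} {N : ℕ → Ω → ℝ} {E : ℕ → ℕ → Ω → ℝ}

/-- A length of blocks of ranks beyond that of the cells, but small on the scale of the errors. -/
def blockLen (K δ q : ℝ) (k : ℕ) : ℕ := ⌈2 * K * (δ ^ 2 * |q|) * k + δ * √k⌉₊

/-- The first summand of the length is twice the number of ranks that the length of a cell accounts
for. The second tends to infinity, being at least `δ^{-2}` because `√k ≥ δ^{-3}`. In total the block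
remains a vanishing multiple of `k` times the rate. -/
theorem ScaleAt.blockLen_facts {n k : ℕ} {t d θ δ q : ℝ}
    (h : ScaleAt μ ν ξ ξc β βc D Dc c κ n k t d θ δ q) (hK : 0 < K) :
    k * (K * (δ ^ 2 * |q|)) ≤ (blockLen K δ q k : ℝ) / 2 ∧ 1 / δ ^ 2 ≤ blockLen K δ q k ∧
      (blockLen K δ q k : ℝ) / k ≤ (2 * K * δ ^ 2 + δ + δ ^ 3) * rate k q := by
  have hk := h.k_pos'
  have hs := sqrt_pos.2 hk
  have hd := h.delta_pos
  have hle := Nat.le_ceil (2 * K * (δ ^ 2 * |q|) * k + δ * √k)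
  have hlt := Nat.ceil_lt_add_one (show 0 ≤ 2 * K * (δ ^ 2 * |q|) * k + δ * √k by positivity)
  have hr := h.rate_le
  have h1 := h.inv_sqrt_le_rate
  have hsd : 1 / δ ^ 3 ≤ √(k : ℝ) := by
    rw [div_le_iff₀ (by positivity)]
    have := h1.trans hr
    rw [div_le_iff₀ hs] at this
    linarith
  have hq0 := abs_nonneg q
  rw [blockLen]
  refine ⟨?_, ?_, ?_⟩
  · have : 0 ≤ δ * √(k : ℝ) := by positivity
    linarith
  · have h2 : 1 / δ ^ 2 = δ * (1 / δ ^ 3) := by field_simp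
    have h3 := mul_le_mul_of_nonneg_left hsd hd.le
    have : 0 ≤ 2 * K * (δ ^ 2 * |q|) * k := by positivity
    linarith
  · have e : (2 * K * (δ ^ 2 * |q|) * k + δ * √(k : ℝ) + 1) / k =
        2 * K * δ ^ 2 * |q| + δ * (1 / √(k : ℝ)) + (1 / √(k : ℝ)) * (1 / √(k : ℝ)) := by grind
    refine (div_le_div_of_nonneg_right hlt.le hk.le).trans (e.le.trans ?_)
    have m1 : 2 * K * δ ^ 2 * |q| ≤ 2 * K * δ ^ 2 * rate k q :=
      mul_le_mul_of_nonneg_left h.q_le_rate (by positivity)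
    have m2 := mul_le_mul_of_nonneg_left h1 hd.le
    have m3 : (1 / √(k : ℝ)) * (1 / √(k : ℝ)) ≤ δ ^ 3 * rate k q :=
      mul_le_mul (h1.trans hr) h1 (by positivity) (by positivity)
    linarith

/-- The observed order can be replaced by the order of the exponential variables. -/
theorem smallP_topFraction_sub (hS : CoupledSample P μ ν p k t d Z e y v N E) (hc : 0 < c)
    (hpos : ∀ z, 0 < svMin μ ν z)
    (hx : 0 < x) (hK : 0 < K) (hδ : Tendsto δ atTop (𝓝 0))
    (hs : ∀ᶠ n in atTop, ScaleAt μ ν ξ ξc β βc D Dc c κ n (k n) (t n) (d n) (θ n) (δ n) (q n))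
    (hG : ∀ᶠ n in atTop, GridFacts μ ν x b K n (k n) (t n) (d n) (θ n) (δ n) (q n)) :
    SmallP P fun n ω => (rate (k n) (q n))⁻¹ * (topFraction (Z ω) (e ω) n (k n) -
      1 / (k n : ℝ) * ∑ i ∈ topSet (fun i => y n i ω) n (k n), e ω i) := by
  have hδp : Tendsto (fun n => 2 * K * δ n ^ 2 + δ n + δ n ^ 3) atTop (𝓝 0) := by
    have := (((hδ.pow 2).const_mul (2 * K)).add hδ).add (hδ.pow 3)
    simpa using this
  have hB : Tendsto (fun n => P ({ω | tailSum (E n) n (k n) ω ≤ gridY μ ν (t n) (d n) 0} ∪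
      {ω | ∑ j ∈ Ico (k n - blockLen K (δ n) (q n) (k n)) (k n), E n j ω / j ≤
        K * (δ n ^ 2 * |q n|)})) atTop (𝓝 0) := by
    have h1 := tendsto_measure_first_cell hS hx hδ hs hG
    have h2 : Tendsto (fun n => ofReal (4 * δ n ^ 2)) atTop (𝓝 0) :=
      tendsto_ofReal_zero (by simpa using (hδ.pow 2).const_mul 4)
    have h3 := h1.add h2
    rw [add_zero] at h3
    refine tendsto_of_tendsto_of_tendsto_of_le_of_le' tendsto_const_nhds h3
      (of_forall fun _ => zero_le) ?_
    filter_upwards [hs, hδp.eventually (gt_mem_nhds one_pos)] with n hn hsm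
    obtain ⟨b1, b2, b3⟩ := hn.blockLen_facts hK
    have hkp := hn.k_pos'
    have hd := hn.delta_pos
    have hl1 : (0 : ℝ) < blockLen K (δ n) (q n) (k n) := lt_of_lt_of_le (by positivity) b2
    refine (measure_union_le _ _).trans (add_le_add le_rfl ?_)
    have hlk : (blockLen K (δ n) (q n) (k n) : ℝ) < k n := by
      have : (2 * K * δ n ^ 2 + δ n + δ n ^ 3) * rate (k n) (q n) < 1 := by
        have h1 : rate (k n) (q n) ≤ 1 := hn.rate_le.trans (pow_le_one₀ hd.le hn.delta_le)
        have h2 : 0 ≤ 2 * K * δ n ^ 2 + δ n + δ n ^ 3 := by positivity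
        exact (mul_le_of_le_one_right h2 h1).trans_lt hsm
      have := b3.trans_lt this
      rwa [div_lt_one hkp] at this
    refine ((hS.exps n).measure_block_le (by exact_mod_cast hl1) (by exact_mod_cast hlk) b1).trans
      (ofReal_le_ofReal ?_)
    rw [div_le_iff₀ hl1]
    rw [div_le_iff₀ (by positivity)] at b2
    linarith
  refine SmallP.of_le_off (smallP_of_tendsto hδp) hB ?_
  filter_upwards [hs, hG, hδp.eventually (gt_mem_nhds one_pos)] with n hn hg hsm
  filter_upwards [hS.cells] with ω hω hωB
  simp only [mem_union, mem_ofPred_eq, not_or, not_le] at hωB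
  obtain ⟨hB1, hB2⟩ := hωB
  obtain ⟨b1, b2, b3⟩ := hn.blockLen_facts hK
  have hkp := hn.k_pos'
  have hd := hn.delta_pos
  have hkn := hn.k_lt
  have hk1 := hn.k_pos
  have hr := hn.rate_pos
  obtain ⟨l, hl⟩ : ∃ l, l = blockLen K (δ n) (q n) (k n) := ⟨_, rfl⟩
  rw [← hl] at b1 b2 b3 hB2
  have hl1 : (0 : ℝ) < l := lt_of_lt_of_le (by positivity) b2
  have hlk : l < k n := by
    have h0 : (2 * K * δ n ^ 2 + δ n + δ n ^ 3) * rate (k n) (q n) < 1 := by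
      have h1 : rate (k n) (q n) ≤ 1 := hn.rate_le.trans (pow_le_one₀ hd.le hn.delta_le)
      have h2 : 0 ≤ 2 * K * δ n ^ 2 + δ n + δ n ^ 3 := by positivity
      exact (mul_le_of_le_one_right h2 h1).trans_lt hsm
    have := b3.trans_lt h0
    rw [div_lt_one hkp] at this
    exact_mod_cast this
  have ht0 := hn.t_pos hc
  have hd0 := hn.d_pos
  have hym := gridY_mono (μ := μ) (ν := ν) hpos ht0 hd0
  have hyt := tendsto_gridY (μ := μ) (ν := ν) hpos ht0 hd0
  have hzm := gridZ_mono ht0 hd0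
  have hzt := tendsto_gridZ ht0 hd0
  have o1 := hS.ord n ω (k n) (by rw [mem_Icc]; omega)
  have o2 := hS.ord n ω (k n - l) (by rw [mem_Icc]; omega)
  have hsum : tailSum (E n) n (k n - l) ω = ∑ j ∈ Ico (k n - l) (k n), E n j ω / j +
      tailSum (E n) n (k n) ω := by
    rw [tailSum, tailSum, ← Ico_succ_right_eq_Icc, ← Ico_succ_right_eq_Icc]
    exact (Finset.sum_Ico_consecutive _ (by omega) (by rw [Order.succ_eq_add_one]; omega)).symm
  have hx0 : 0 ≤ K * (δ n ^ 2 * |q n|) := by positivity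
  let m : ℕ → ℕ := fun i => cellOf (gridY μ ν (t n) (d n)) (y n i ω)
  -- The `l` spacings between these ranks together exceed the length of a cell, so the two ranks
  -- cannot share one.
  have hmlt : m (orderIndex (fun i => y n i ω) n (n - k n + 1)) <
      m (orderIndex (fun i => y n i ω) n (n - (k n - l) + 1)) := by
    simp only [m]
    have e1 : y n (orderIndex (fun i => y n i ω) n (n - k n + 1)) ω = tailSum (E n) n (k n) ω := o1
    have e2 : y n (orderIndex (fun i => y n i ω) n (n - (k n - l) + 1)) ω =
        tailSum (E n) n (k n - l) ω := o2
    rw [e1, e2]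
    refine lt_of_le_of_ne (cellOf_mono hym hyt (by linarith)) fun heq => ?_
    have := hg.same_cell _ _ (Nat.one_le_iff_ne_zero.2 (Nat.pos_iff_ne_zero.1
      ((lt_cellOf_iff hym hyt).2 hB1))) heq.symm
    linarith
  have key := abs_sum_topSet_sub_le (z := Z ω) (y := fun i => y n i ω) (e := e ω) (m := m) hlk
    hkn.le (fun i i' h => by
      simp only [m]
      rw [← (hω n i).1, ← (hω n i').1]
      exact cellOf_mono hzm hzt h) (fun i i' h => cellOf_mono hym hyt h) hmlt
    (fun i => by rw [(hω n i).2]; exact bern_nonneg _ _)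
    (fun i => by rw [(hω n i).2]; exact bern_le_one _ _)
  refine le_trans ?_ (le_abs_self _)
  rw [topFraction_eq hkn.le, ← mul_sub, abs_mul, abs_mul, abs_of_pos (inv_pos.2 hr),
    abs_of_pos (one_div_pos.2 hkp), inv_mul_le_iff₀ hr, one_div_mul_eq_div,
    mul_comm (rate (k n) (q n))]
  exact (div_le_div_of_nonneg_right key hkp.le).trans b3

/-- Destandardizing the binomial sum multiplies the coupling error by `√(p(1-p)/k)`, which is at
most the rate. -/
theorem smallP_bern_sum (hS : CoupledSample P μ ν p k t d Z e y v N E) (hp0 : 0 < p) (hp1 : p < 1)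
    (hs : ∀ᶠ n in atTop, ScaleAt μ ν ξ ξc β βc D Dc c κ n (k n) (t n) (d n) (θ n) (δ n) (q n)) :
    SmallP P fun n ω => (rate (k n) (q n))⁻¹ * (1 / (k n : ℝ) *
      ∑ i ∈ topSet (fun i => y n i ω) n (k n), bern p (v n i ω) - p -
        √(p * (1 - p)) * (N n ω / √(k n))) := by
  refine hS.clt.of_le ?_
  filter_upwards [hs] with n hn
  refine ae_of_all _ fun ω => ?_
  have hkp := hn.k_pos'
  have hr := hn.rate_pos
  have hsk := sqrt_pos.2 hkp
  have hpp : 0 < p * (1 - p) := mul_pos hp0 (by linarith)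
  have hspp := sqrt_pos.2 hpp
  rw [sum_topSet hn.k_lt.le (fun i => bern p (v n i ω)), sum_sub_distrib, sum_const,
    Nat.card_Icc, nsmul_eq_mul, Nat.add_sub_cancel, Real.sqrt_mul hkp.le]
  set S := ∑ j ∈ Icc 1 (k n), bern p (v n (orderIndex (fun i => y n i ω) n (n - j + 1)) ω)
  have e1 : 1 / (k n : ℝ) * S - p - √(p * (1 - p)) * (N n ω / √(k n)) =
      -(√(p * (1 - p)) * (1 / √(k n : ℝ)) *
        (N n ω - (√(k n : ℝ) * √(p * (1 - p)))⁻¹ * (S - k n * p))) := by grind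
  rw [e1, abs_mul, abs_neg, abs_mul, ← mul_assoc]
  refine mul_le_of_le_one_left (abs_nonneg _) ?_
  rw [abs_of_pos (inv_pos.2 hr), abs_of_pos (by positivity), inv_mul_le_iff₀ hr, mul_one]
  have h1 : √(p * (1 - p)) ≤ 1 := by
    refine Real.sqrt_le_one.2 ?_
    exact mul_le_one₀ hp1.le (by linarith) (by linarith)
  exact (mul_le_of_le_one_left (by positivity) h1).trans hn.inv_sqrt_le_rate

/-- The exponential density near `log(n/k)` is of order `k/n`. The constant is `3 · 3`: one factor
bounds `e`, the other is the length `3w` of the half-open interval that contains the window. -/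
theorem GridFacts.window_le {n k : ℕ} {t d θ δ q : ℝ} (hg : GridFacts μ ν x b K n k t d θ δ q)
    (hk : (0 : ℝ) < k) (hn : (0 : ℝ) < n) {w : ℝ} (hw0 : 0 < w)
    (h1 : K * |q| + 2 * w ≤ 1) (h2 : K * |q| + 2 * w < log 2 / (2 * x)) :
    gridY μ ν t d 0 < gridY μ ν t d (gridM d) - 2 * w ∧
    (expMeasure 1).real (Set.Icc (gridY μ ν t d (gridM d) - w) (gridY μ ν t d (gridM d) + w)) ≤
      9 * (k / n) * w := by
  have := isProb_exp
  have a1 := (abs_le.1 hg.gridM_le).1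
  have a2 := hg.zero_le
  have h0 : gridY μ ν t d 0 < gridY μ ν t d (gridM d) - 2 * w := by linarith
  refine ⟨h0, ?_⟩
  set τ := gridY μ ν t d (gridM d)
  have hτ : 0 ≤ τ - 2 * w := (gridY_nonneg (μ := μ) (ν := ν) 0).trans h0.le
  have hsub : Set.Icc (τ - w) (τ + w) ⊆ Ioi (τ - 2 * w) \ Ioi (τ + w) := by grind
  refine (measureReal_mono hsub).trans ?_
  rw [measureReal_sdiff (Set.Ioi_subset_Ioi (by linarith)) measurableSet_Ioi,
    expMeasure_real_Ioi hτ, expMeasure_real_Ioi (by linarith)]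
  have e1 : exp (-(τ + w)) = exp (-(τ - 2 * w)) * exp (-(3 * w)) := by rw [← exp_add]; congr 1; ring
  have e2 := add_one_le_exp (-(3 * w))
  have e3 : exp (-(τ - 2 * w)) ≤ 3 * (k / n) := by
    have : exp (-(τ - 2 * w)) ≤ exp (1 + log ((k : ℝ) / n)) := by
      apply exp_le_exp.2
      rw [← inv_div, log_inv]
      linarith
    rw [exp_add, exp_log (by positivity)] at this
    refine this.trans (mul_le_mul_of_nonneg_right ?_ (by positivity))
    have := Real.exp_one_lt_d9; linarith
  calc _ = exp (-(τ - 2 * w)) * (1 - exp (-(3 * w))) := by rw [e1]; ring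
    _ ≤ 3 * (k / n) * (3 * w) := by
      refine mul_le_mul e3 (by linarith) ?_ (by positivity)
      rw [sub_nonneg, exp_le_one_iff]; linarith
    _ = _ := by ring

theorem measurable_cellProb_comp (hpos : ∀ z, 0 < svMin μ ν z) {t d : ℝ} (ht : 0 < t) (hd : 0 < d)
    (p : ℝ) : Measurable fun u => cellProb μ ν p t d (cellOf (gridY μ ν t d) u) :=
  (measurable_from_nat (f := cellProb μ ν p t d)).comp
    (measurable_cellOf (gridY_mono hpos ht hd) (tendsto_gridY hpos ht hd))

/-- The marks of the top observations can be replaced by those beyond the grid point `t`. -/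
theorem smallP_window (hS : CoupledSample P μ ν (pLim ξ ξc) k t d Z e y v N E) (hc : 0 < c)
    (hpos : ∀ z, 0 < svMin μ ν z) (hx : 0 < x) (hK : 0 < K)
    (hp0 : 0 < pLim ξ ξc) (hp1 : pLim ξ ξc < 1) (hδ : Tendsto δ atTop (𝓝 0))
    (hs : ∀ᶠ n in atTop, ScaleAt μ ν ξ ξc β βc D Dc c κ n (k n) (t n) (d n) (θ n) (δ n) (q n))
    (hG : ∀ᶠ n in atTop, GridFacts μ ν x b K n (k n) (t n) (d n) (θ n) (δ n) (q n)) :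
    SmallP P fun n ω => (rate (k n) (q n))⁻¹ * (1 / (k n : ℝ) *
      (∑ i ∈ topSet (fun i => y n i ω) n (k n), (e ω i - bern (pLim ξ ξc) (v n i ω)) -
        ∑ i ∈ range n, markOn (Ioi (gridY μ ν (t n) (d n) (gridM (d n))))
          (fun u => cellProb μ ν (pLim ξ ξc) (t n) (d n) (cellOf (gridY μ ν (t n) (d n)) u))
          (pLim ξ ξc) (y n i ω, v n i ω))) := by
  have hl2 : 0 < log 2 := log_pos (by norm_num)
  set a : ℕ → ℝ → ℝ := fun n u =>
    cellProb μ ν (pLim ξ ξc) (t n) (d n) (cellOf (gridY μ ν (t n) (d n)) u) with ha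
  set τ : ℕ → ℝ := fun n => gridY μ ν (t n) (d n) (gridM (d n)) with hτ
  -- The window exceeds the fluctuation of the `k`-th order statistic by the factor `1/δ`. Per top
  -- observation the differing marks in it contribute about `δ² w`, which is `δ` times the rate.
  set w : ℕ → ℝ := fun n => rate (k n) (q n) / δ n with hw
  have hsmall : ∀ᶠ n in atTop, (K * |q n| + 2 * w n ≤ 1 ∧
      K * |q n| + 2 * w n < log 2 / (2 * x)) ∧ 0 < w n := by
    have h0 : Tendsto (fun n => K * δ n ^ 3 + 2 * δ n ^ 2) atTop (𝓝 0) := by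
      simpa using ((hδ.pow 3).const_mul K).add ((hδ.pow 2).const_mul 2)
    filter_upwards [hs, h0.eventually (gt_mem_nhds one_pos),
      h0.eventually (gt_mem_nhds (show 0 < log 2 / (2 * x) by positivity))] with n hn h1 h2
    have hd := hn.delta_pos
    have e1 : w n ≤ δ n ^ 2 := by
      rw [hw]
      dsimp only
      rw [div_le_iff₀ hd]
      exact hn.rate_le.trans (le_of_eq (by ring))
    have e2 : K * |q n| ≤ K * δ n ^ 3 :=
      mul_le_mul_of_nonneg_left (hn.q_le_rate.trans hn.rate_le) hK.le
    exact ⟨⟨by linarith, by linarith⟩, div_pos hn.rate_pos hd⟩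
  have hB : Tendsto (fun n => P {ω | w n < |tailSum (E n) n (k n) ω - τ n|}) atTop (𝓝 0) := by
    have h0 : Tendsto (fun n => 4 * δ n / (1 - K * δ n)) atTop (𝓝 0) := by
      have h1 := hδ.const_mul 4
      have h2 := (hδ.const_mul K).const_sub 1
      have := h1.div h2 (by norm_num)
      rw [mul_zero, mul_zero, zero_div] at this
      exact this
    refine tendsto_of_tendsto_of_tendsto_of_le_of_le' tendsto_const_nhds (tendsto_ofReal_zero h0)
      (of_forall fun _ => zero_le) ?_
    have h3 : Tendsto (fun n => K * δ n) atTop (𝓝 0) := by simpa using hδ.const_mul K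
    filter_upwards [hs, hG, h3.eventually (gt_mem_nhds one_pos)] with n hn hg hsm
    have hd := hn.delta_pos
    have hr := hn.rate_pos
    have hx1 : 0 < w n - K * |q n| := by
      have h1 : K * |q n| * δ n ≤ K * δ n * rate (k n) (q n) := by
        have := mul_le_mul_of_nonneg_left hn.q_le_rate (mul_nonneg hK.le hd.le)
        linarith
      have h2 : K * δ n * rate (k n) (q n) < rate (k n) (q n) := mul_lt_of_lt_one_left hr hsm
      rw [hw, sub_pos]
      dsimp only
      rw [lt_div_iff₀ hd]
      linarith
    refine (measure_mono fun ω hω => ?_).trans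
      (((hS.exps n).measure_tailSum_dev_le hn.k_pos hn.k_lt.le hx1).trans (ofReal_le_ofReal ?_))
    · simp only [mem_ofPred_eq] at hω ⊢
      have h1 := hg.gridM_le
      grind
    · rw [div_le_div_iff₀ hx1 (by linarith)]
      have e1 : 4 / √(k n : ℝ) ≤ 4 * rate (k n) (q n) := by
        have := hn.inv_sqrt_le_rate
        grind
      have e2 : rate (k n) (q n) * (1 - K * δ n) ≤ δ n * (w n - K * |q n|) := by
        have : δ n * w n = rate (k n) (q n) := by rw [hw]; field_simp
        rw [mul_sub (δ n), this]
        have := mul_le_mul_of_nonneg_left hn.q_le_rate (mul_nonneg hK.le hd.le)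
        linarith
      have e3 := mul_le_mul_of_nonneg_right e1 (show 0 ≤ 1 - K * δ n by linarith)
      linarith
  have ham : ∀ᶠ n in atTop, Measurable (a n) := by
    filter_upwards [hs] with n hn using measurable_cellProb_comp hpos (hn.t_pos hc) hn.d_pos _
  have hG1 : ∀ᶠ n in atTop, ∀ i, Integrable (fun ω =>
      |markOn (Set.Icc (τ n - w n) (τ n + w n)) (a n) (pLim ξ ξc) (y n i ω, v n i ω)|) P := by
    filter_upwards [ham] with n hn i
    exact (((hS.iid n).memLp_comp (measurable_markOn measurableSet_Icc hn)
      (abs_markOn_le_one _) i).integrable one_le_two).abs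
  have hsmallY : SmallP P fun n ω => (rate (k n) (q n))⁻¹ * (1 / (k n : ℝ) * ∑ i ∈ range n,
        |markOn (Set.Icc (τ n - w n) (τ n + w n)) (a n) (pLim ξ ξc) (y n i ω, v n i ω)|) := by
    have h9 : Tendsto (fun n => 9 * δ n) atTop (𝓝 0) := by simpa using hδ.const_mul 9
    refine smallP_of_integral_abs ?_ h9 ?_
    · filter_upwards [hG1] with n hn
      fun_prop
    · filter_upwards [hs, hG, hsmall, ham, hG1] with n hn hg hsm hm hi
      have hkp := hn.k_pos'
      have hnp := hn.n_pos
      have hr := hn.rate_pos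
      have hd := hn.delta_pos
      obtain ⟨w1, w2⟩ := hg.window_le hkp hnp hsm.2 hsm.1.1 hsm.1.2
      have hone : ∀ i, ∫ ω, |markOn (Set.Icc (τ n - w n) (τ n + w n)) (a n) (pLim ξ ξc)
          (y n i ω, v n i ω)| ∂P ≤ δ n ^ 2 * (9 * (k n / n) * w n) := by
        intro i
        rw [(hS.iid n).integral_comp (G := fun z =>
          |markOn (Set.Icc (τ n - w n) (τ n + w n)) (a n) (pLim ξ ξc) z|)
          (measurable_markOn measurableSet_Icc hm).abs]
        refine (integral_abs_markOn_le measurableSet_Icc hm (fun u => cellProb_nonneg hp0.le _)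
          (fun u => cellProb_le_one hp1.le _) hp0.le hp1.le (ε := δ n ^ 2) fun u hu => ?_).trans
          (mul_le_mul_of_nonneg_left w2 (by positivity))
        refine abs_cellProb_sub_le hn.approx (by positivity) (hn.t_pos hc) hn.d_pos ?_
        refine (lt_cellOf_iff (gridY_mono hpos (hn.t_pos hc) hn.d_pos)
          (tendsto_gridY hpos (hn.t_pos hc) hn.d_pos)).2 ?_
        grind
      have habs : ∀ ω, |(rate (k n) (q n))⁻¹ * (1 / (k n : ℝ) * ∑ i ∈ range n,
          |markOn (Set.Icc (τ n - w n) (τ n + w n)) (a n) (pLim ξ ξc) (y n i ω, v n i ω)|)| =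
          (rate (k n) (q n))⁻¹ * (1 / (k n : ℝ) * ∑ i ∈ range n,
          |markOn (Set.Icc (τ n - w n) (τ n + w n)) (a n) (pLim ξ ξc) (y n i ω, v n i ω)|) :=
        fun ω => abs_of_nonneg (mul_nonneg (inv_pos.2 hr).le (mul_nonneg (by positivity)
          (sum_nonneg fun i _ => abs_nonneg _)))
      simp_rw [habs]
      rw [integral_const_mul, integral_const_mul, integral_finsetSum _ fun i _ => hi i,
        inv_mul_le_iff₀ hr, one_div_mul_eq_div, div_le_iff₀ hkp]
      refine (sum_le_sum fun i _ => hone i).trans (le_of_eq ?_)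
      rw [sum_const, Finset.card_range, nsmul_eq_mul]
      grind
  refine hsmallY.of_le_off hB ?_
  filter_upwards [hs, hG] with n hn hg
  filter_upwards [hS.cells] with ω hω hωB
  have hkp := hn.k_pos'
  have hr := hn.rate_pos
  simp only [not_lt] at hωB
  rw [← hS.ord n ω (k n) (by rw [mem_Icc]; exact ⟨hn.k_pos, hn.k_lt.le⟩)] at hωB
  have key := abs_sum_topSet_sub_threshold_le hn.k_pos hn.k_lt.le hωB
    (fun i => markDiff (a n) (pLim ξ ξc) (y n i ω, v n i ω))
  refine le_trans ?_ (le_abs_self _)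
  rw [abs_mul, abs_mul, abs_of_pos (inv_pos.2 hr), abs_of_pos (one_div_pos.2 hkp)]
  refine mul_le_mul_of_nonneg_left (mul_le_mul_of_nonneg_left ?_ (by positivity)) (inv_pos.2 hr).le
  have e1 : ∑ i ∈ topSet (fun i => y n i ω) n (k n), (e ω i - bern (pLim ξ ξc) (v n i ω)) =
      ∑ i ∈ topSet (fun i => y n i ω) n (k n), markDiff (a n) (pLim ξ ξc) (y n i ω, v n i ω) :=
    sum_congr rfl fun i _ => by rw [(hω n i).2]; rfl
  rw [e1]
  refine key.trans (le_of_eq ?_)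
  exact sum_congr rfl fun i _ => (abs_markOn _ _).symm

/-- An i.i.d. sum: its mean is the comparison of `uncMass` and `svMin` at `t`, the field `level`,
and its variance is at most `n` times the probability `O(δ² k/n)` that a point beyond the threshold
has differing marks. -/
theorem smallP_threshold (hS : CoupledSample P μ ν (pLim ξ ξc) k t d Z e y v N E) (hc : 0 < c)
    (hpos : ∀ z, 0 < svMin μ ν z) (hξ : 0 < xiZ ξ ξc) (hK : 0 < K)
    (hp0 : 0 < pLim ξ ξc) (hp1 : pLim ξ ξc < 1) (hδ : Tendsto δ atTop (𝓝 0))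
    (hs : ∀ᶠ n in atTop, ScaleAt μ ν ξ ξc β βc D Dc c κ n (k n) (t n) (d n) (θ n) (δ n) (q n))
    (hG : ∀ᶠ n in atTop, GridFacts μ ν x b K n (k n) (t n) (d n) (θ n) (δ n) (q n)) :
    SmallP P fun n ω => (rate (k n) (q n))⁻¹ * (1 / (k n : ℝ) *
      ∑ i ∈ range n, markOn (Ioi (gridY μ ν (t n) (d n) (gridM (d n))))
          (fun u => cellProb μ ν (pLim ξ ξc) (t n) (d n) (cellOf (gridY μ ν (t n) (d n)) u))
          (pLim ξ ξc) (y n i ω, v n i ω) - q n * κ) := by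
  set a : ℕ → ℝ → ℝ := fun n u =>
    cellProb μ ν (pLim ξ ξc) (t n) (d n) (cellOf (gridY μ ν (t n) (d n)) u) with ha
  set τ : ℕ → ℝ := fun n => gridY μ ν (t n) (d n) (gridM (d n)) with hτ
  let G : ℕ → ℝ × I → ℝ := fun n => markOn (Ioi (τ n)) (a n) (pLim ξ ξc)
  let m : ℕ → ℝ := fun n => ∫ z, G n z ∂((expMeasure 1).prod (volume : Measure I))
  have hGm : ∀ᶠ n in atTop, Measurable (G n) := by
    filter_upwards [hs] with n hn
    exact measurable_markOn measurableSet_Ioi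
      (measurable_cellProb_comp hpos (hn.t_pos hc) hn.d_pos _)
  have hmean : SmallP P fun n _ => (rate (k n) (q n))⁻¹ * (1 / (k n : ℝ) * (n * m n) -
      q n * κ) := by
    refine SmallP.of_le (smallP_of_tendsto (a := fun n => δ n ^ 2) (by simpa using hδ.pow 2)) ?_
    filter_upwards [hs, hGm] with n hn hGn
    refine ae_of_all _ fun ω => ?_
    have hkp := hn.k_pos'
    have hnp := hn.n_pos
    have hr := hn.rate_pos
    have ht0 := hn.t_pos hc
    have hd0 := hn.d_pos
    have ham := measurable_cellProb_comp (μ := μ) (ν := ν) hpos ht0 hd0 (pLim ξ ξc)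
    have e1 : m n = uncMass μ ν (t n) - pLim ξ ξc * svMin μ ν (t n) := by
      simp only [m, G]
      rw [integral_markOn measurableSet_Ioi ham hp0.le hp1.le,
        expMeasure_real_Ioi (gridY_nonneg (μ := μ) (ν := ν) _)]
      simp only [hτ]
      rw [exp_neg_gridY hpos, gridZ_gridM]
      have h1 := hS.level n (gridM (d n))
      rw [gridZ_gridM] at h1
      rw [← h1, ← (hS.iid n).law 0, map_measureReal_apply
        (((hS.iid n).meas_fst 0).prodMk ((hS.iid n).meas_snd 0))]
      · rfl
      · exact (measurable_fst measurableSet_Ioi).inter (measurableSet_le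
          (measurable_subtype_coe.comp measurable_snd) (ham.comp measurable_fst))
    have e2 : t n ^ (1 / xiZ ξ ξc) / c = (n : ℝ) / k n := by
      rw [hn.t_eq, ← rpow_mul (by positivity), mul_one_div_cancel hξ.ne', Real.rpow_one,
        mul_div_cancel_left₀ _ hc.ne']
    have h3 := hn.approx.level
    rw [e2, ← e1] at h3
    rw [abs_mul, abs_of_pos (inv_pos.2 hr), inv_mul_le_iff₀ hr,
      show 1 / (k n : ℝ) * (n * m n) = (n : ℝ) / k n * m n by ring]
    refine h3.trans ?_
    rw [abs_of_nonneg (sq_nonneg (δ n)), mul_comm (rate (k n) (q n))]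
    exact mul_le_mul_of_nonneg_left hn.q_le_rate (sq_nonneg _)
  have hvar : SmallP P fun n ω => (rate (k n) (q n))⁻¹ * (1 / (k n : ℝ) *
      (∑ i ∈ range n, G n (y n i ω, v n i ω) - n * m n)) := by
    have h3 : Tendsto (fun n => 3 * δ n ^ 2) atTop (𝓝 0) := by simpa using (hδ.pow 2).const_mul 3
    have hKδ : Tendsto (fun n => K * δ n ^ 3) atTop (𝓝 0) := by simpa using (hδ.pow 3).const_mul K
    refine smallP_of_sq_integral ?_ h3 ?_
    · filter_upwards [hGm] with n hGn
      exact (((memLp_finsetSum _ fun i _ => (hS.iid n).memLp_comp hGn (abs_markOn_le_one _) i).sub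
        (memLp_const _)).const_mul _).const_mul _
    · filter_upwards [hs, hG, hGm, hKδ.eventually (gt_mem_nhds one_pos)] with n hn hg hGn hsm
      have hkp := hn.k_pos'
      have hnp := hn.n_pos
      have hr := hn.rate_pos
      have ht0 := hn.t_pos hc
      have hd0 := hn.d_pos
      have hd := hn.delta_pos
      have e : ∀ ω, ((rate (k n) (q n))⁻¹ * (1 / (k n : ℝ) *
          (∑ i ∈ range n, G n (y n i ω, v n i ω) - n * m n))) ^ 2 =
          ((rate (k n) (q n))⁻¹ * (1 / (k n : ℝ))) ^ 2 *
          (∑ i ∈ range n, G n (y n i ω, v n i ω) - n * m n) ^ 2 := fun ω => by ring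
      simp_rw [e]
      rw [integral_const_mul]
      have h1 := (hS.iid n).integral_sq_sum_sub_le hGn (abs_markOn_le_one _) n
      have h2 : ∫ z, G n z ^ 2 ∂((expMeasure 1).prod (volume : Measure I)) ≤
          δ n ^ 2 * (3 * (k n / n)) := by
        simp only [G, markOn_sq]
        refine (integral_abs_markOn_le measurableSet_Ioi
          (measurable_cellProb_comp hpos ht0 hd0 _) (fun u => cellProb_nonneg hp0.le _)
          (fun u => cellProb_le_one hp1.le _) hp0.le hp1.le (ε := δ n ^ 2) fun u hu => ?_).trans
          (mul_le_mul_of_nonneg_left ?_ (by positivity))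
        · refine abs_cellProb_sub_le hn.approx (by positivity) ht0 hd0 ?_
          have := (lt_cellOf_iff (gridY_mono hpos ht0 hd0) (tendsto_gridY hpos ht0 hd0)).2
            (show gridY μ ν (t n) (d n) (gridM (d n)) < u from hu)
          omega
        · rw [expMeasure_real_Ioi (gridY_nonneg (μ := μ) (ν := ν) _)]
          have a1 := (abs_le.1 hg.gridM_le).1
          have a2 : K * |q n| ≤ K * δ n ^ 3 :=
            mul_le_mul_of_nonneg_left (hn.q_le_rate.trans hn.rate_le) hK.le
          have a3 : exp (-τ n) ≤ exp (1 + log ((k n : ℝ) / n)) := by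
            apply exp_le_exp.2
            rw [← inv_div, log_inv]
            linarith
          rw [exp_add, exp_log (by positivity)] at a3
          refine a3.trans (mul_le_mul_of_nonneg_right ?_ (by positivity))
          have := Real.exp_one_lt_d9; linarith
      calc _ ≤ ((rate (k n) (q n))⁻¹ * (1 / (k n : ℝ))) ^ 2 * (n * (δ n ^ 2 * (3 * (k n / n)))) :=
            mul_le_mul_of_nonneg_left (h1.trans (mul_le_mul_of_nonneg_left h2 hnp.le)) (sq_nonneg _)
        _ = 3 * δ n ^ 2 * ((rate (k n) (q n))⁻¹ ^ 2 * (1 / (k n : ℝ))) := by field_simp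
        _ ≤ 3 * δ n ^ 2 * 1 := by
          refine mul_le_mul_of_nonneg_left ?_ (by positivity)
          rw [one_div_nat_eq_sq, inv_pow, inv_mul_le_iff₀ (by positivity), mul_one, sq]
          exact mul_le_mul hn.inv_sqrt_le_rate hn.inv_sqrt_le_rate (by positivity) hr.le
        _ = _ := mul_one _
  refine (hmean.add hvar).of_le (of_forall fun n => ae_of_all _ fun ω => le_of_eq ?_)
  grind

theorem smallP_topFraction (hS : CoupledSample P μ ν (pLim ξ ξc) k t d Z e y v N E) (hc : 0 < c)
    (hpos : ∀ z, 0 < svMin μ ν z) (hξ : 0 < xiZ ξ ξc) (hx : 0 < x) (hK : 0 < K)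
    (hp0 : 0 < pLim ξ ξc) (hp1 : pLim ξ ξc < 1) (hδ : Tendsto δ atTop (𝓝 0))
    (hs : ∀ᶠ n in atTop, ScaleAt μ ν ξ ξc β βc D Dc c κ n (k n) (t n) (d n) (θ n) (δ n) (q n))
    (hG : ∀ᶠ n in atTop, GridFacts μ ν x b K n (k n) (t n) (d n) (θ n) (δ n) (q n)) :
    SmallP P fun n ω => (rate (k n) (q n))⁻¹ * (topFraction (Z ω) (e ω) n (k n) - pLim ξ ξc -
      √(pLim ξ ξc * (1 - pLim ξ ξc)) * (N n ω / √(k n)) - q n * κ) := by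
  refine ((((smallP_topFraction_sub hS hc hpos hx hK hδ hs hG).add
    (smallP_window hS hc hpos hx hK hp0 hp1 hδ hs hG)).add
    (smallP_threshold hS hc hpos hξ hK hp0 hp1 hδ hs hG)).add
    (smallP_bern_sum hS hp0 hp1 hs)).of_le
    (of_forall fun n => ae_of_all _ fun ω => le_of_eq ?_)
  congr 1
  rw [sum_sub_distrib]
  ring

end FractionExpansion

/-! ### The expansion of log-ratios of upper order statistics -/

section LogRatio

open unitInterval

variable {μ ν : Measure ℝ} [IsProbabilityMeasure μ] [IsProbabilityMeasure ν]
  {ξ ξc Cst Cstc D Dc β βc c κ : ℝ}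
  {Ω : Type*} [MeasurableSpace Ω] {P : Measure Ω} [IsProbabilityMeasure P]
  {k : ℕ → ℕ} {t d θ δ q : ℕ → ℝ} {p K x b : ℝ} {Z e : Ω → ℕ → ℝ}
  {y : ℕ → ℕ → Ω → ℝ} {v : ℕ → ℕ → Ω → I} {N : ℕ → Ω → ℝ} {E : ℕ → ℕ → Ω → ℝ}

theorem smallP_tailSum_succ (hE : ∀ n, IsIidExp P (E n)) (hk : Tendsto k atTop atTop)
    (hkn : ∀ᶠ n in atTop, k n < n) :
    SmallP P fun n ω => tailSum (E n) n (k n + 1) ω - log ((n : ℝ) / k n) := by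
  have := (hE 0).isProb
  have hs : Tendsto (fun n => √(k n : ℝ)) atTop atTop :=
    Real.tendsto_sqrt_atTop.comp (tendsto_natCast_atTop_atTop.comp hk)
  have h1 : SmallP P fun n ω => tailSum (E n) n (k n) ω - log ((n : ℝ) / k n) := by
    refine smallP_of_integral_abs (a := fun n => 4 / √(k n : ℝ))
      (of_forall fun n => ((hE n).integrable_tailSum _ _).sub (integrable_const _))
      (tendsto_const_nhds.div_atTop hs) ?_
    filter_upwards [hkn, hk.eventually_ge_atTop 1] with n h1 h2
    exact (hE n).integral_abs_tailSum_sub_log_le h2 h1.le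
  have h2 : SmallP P fun n ω => E n (k n) ω / k n := by
    refine smallP_of_integral_abs (a := fun n => 1 / (k n : ℝ))
      (of_forall fun n => ((hE n).integrable _).div_const _)
      (tendsto_const_nhds.div_atTop (tendsto_natCast_atTop_atTop.comp hk)) ?_
    refine of_forall fun n => le_of_eq ?_
    have e : (fun ω => |E n (k n) ω / k n|) =ᵐ[P] fun ω => E n (k n) ω / k n := by
      filter_upwards [(hE n).ae_forall_pos] with ω hω
      exact abs_of_nonneg (div_nonneg (hω _).le (Nat.cast_nonneg _))
    rw [integral_congr_ae e, integral_div, (hE n).integral_eq]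
  refine (h1.sub h2).of_le ?_
  filter_upwards [hkn] with n hn
  refine ae_of_all _ fun ω => le_of_eq ?_
  rw [tailSum_succ hn.le]
  congr 1
  ring

/-- Observed and exponential order statistics of equal rank share a cell, so the bound on log-ratios
applies to ranks `i` and `k + 1`, whose exponential gap is the tail sum. The difference of
exponentials is then compared with the weighted tail sum. The exceptional event concerns rank `k +
1` alone, so all `i` are treated together. -/
theorem exists_log_ratio_expansion (hS : CoupledSample P μ ν p k t d Z e y v N E) (hc : 0 < c)
    (hpos : ∀ z, 0 < svMin μ ν z) (hx : 0 < x) (hb : 0 < b) (hK : 0 < K)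
    (hδ : Tendsto δ atTop (𝓝 0)) (hk : Tendsto k atTop atTop)
    (hs : ∀ᶠ n in atTop, ScaleAt μ ν ξ ξc β βc D Dc c κ n (k n) (t n) (d n) (θ n) (δ n) (q n))
    (hG : ∀ᶠ n in atTop, GridFacts μ ν x b K n (k n) (t n) (d n) (θ n) (δ n) (q n)) :
    ∃ (ζ : ℕ → Ω → ℝ) (B : ℕ → Set Ω), SmallP P ζ ∧ (∀ n ω, 0 ≤ ζ n ω) ∧
      Tendsto (fun n => P (B n)) atTop (𝓝 0) ∧
      ∀ᶠ n in atTop, ∀ᵐ ω ∂P, ω ∉ B n → 0 < orderStat (Z ω) n (n - k n) ∧ ∀ i ∈ Icc 1 (k n),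
          |log (orderStat (Z ω) n (n - i + 1) / orderStat (Z ω) n (n - k n)) -
              x * tailSum (E n) (k n) i ω - q n * wTailSum (x * b) (E n) (k n) i ω| ≤
            |q n| * ζ n ω * (tailSum (E n) (k n) i ω + θ n) := by
  have hxb : 0 < x * b := mul_pos hx hb
  have hl2 : 0 < log 2 := log_pos (by norm_num)
  have hsm := smallP_tailSum_succ hS.exps hk (hs.mono fun n hn => hn.k_lt)
  set s : ℕ → Ω → ℝ := fun n ω => tailSum (E n) n (k n + 1) ω - log ((n : ℝ) / k n) with hsd
  have hinc := smallP_supIcc_incrDiff hxb hS.exps hk hsm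
  have hdet : SmallP P fun n _ => (δ n ^ 2 + |q n|) * K := by
    have h0 : Tendsto (fun n => (δ n ^ 2 + δ n ^ 3) * K) atTop (𝓝 0) := by
      simpa using ((hδ.pow 2).add (hδ.pow 3)).mul_const K
    refine (smallP_of_tendsto h0).of_le ?_
    filter_upwards [hs] with n hn
    refine ae_of_all _ fun ω => ?_
    have := hn.delta_pos
    refine le_trans (le_of_eq (abs_of_nonneg (by positivity))) (le_trans ?_ (le_abs_self _))
    exact mul_le_mul_of_nonneg_right (by linarith [hn.q_le_rate.trans hn.rate_le]) hK.le
  refine ⟨fun n ω => |(δ n ^ 2 + |q n|) * K +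
      supIcc (k n) fun j => incrDiff (x * b) (s n ω) (E n) (k n) j ω|,
    fun n => {ω | log 2 / (2 * x) ≤ |s n ω|}, (hdet.add hinc).abs, fun n ω => abs_nonneg _,
    ENNReal.tendsto_nhds_zero.2 fun e he => hsm _ (by positivity) e he, ?_⟩
  filter_upwards [hs, hG] with n hn hg
  filter_upwards [hS.cells, (hS.exps n).ae_forall_pos] with ω hω hEpos hωB
  have ht0 := hn.t_pos hc
  have hd0 := hn.d_pos
  have hkn := hn.k_lt
  have hym := gridY_mono (μ := μ) (ν := ν) hpos ht0 hd0
  have hyt := tendsto_gridY (μ := μ) (ν := ν) hpos ht0 hd0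
  have hzm := gridZ_mono ht0 hd0
  have hzt := tendsto_gridZ ht0 hd0
  let m : ℕ → ℕ := fun i => cellOf (gridY μ ν (t n) (d n)) (y n i ω)
  have hcell : ∀ j ∈ Icc 1 n, cellOf (gridZ (t n) (d n)) (orderStat (Z ω) n (n - j + 1)) =
      cellOf (gridY μ ν (t n) (d n)) (tailSum (E n) n j ω) := by
    intro j hj
    rw [← hS.ord n ω j hj]
    have h1 := cell_orderIndex_eq (z := Z ω) (y := fun i => y n i ω) (m := m) (n := n)
      (fun i i' h => by
        simp only [m]
        rw [← (hω n i).1, ← (hω n i').1]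
        exact cellOf_mono hzm hzt h) (fun i i' h => cellOf_mono hym hyt h) (n - j + 1)
    rw [orderStat, (hω n _).1]
    exact h1
  have hidx : n - k n = n - (k n + 1) + 1 := by omega
  have hk1 : k n + 1 ∈ Icc 1 n := by rw [mem_Icc]; omega
  have hsgt : gridY μ ν (t n) (d n) 0 < tailSum (E n) n (k n + 1) ω := by
    by_contra hcon
    refine hωB ?_
    have h1 := hg.zero_le
    have h2 : 0 < log 2 / (2 * x) := by positivity
    simp only [hsd]
    rw [abs_of_nonpos (by linarith)]
    linarith
  have hc2 : 1 ≤ cellOf (gridZ (t n) (d n)) (orderStat (Z ω) n (n - k n)) := by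
    rw [hidx, hcell _ hk1]
    exact (lt_cellOf_iff hym hyt).2 hsgt
  refine ⟨(gridZ_pos ht0 0).trans ((lt_cellOf_iff hzm hzt).1 hc2), fun i hi => ?_⟩
  have hi' := mem_Icc.1 hi
  have hin : i ∈ Icc 1 n := by rw [mem_Icc]; omega
  have hT : tailSum (E n) n i ω = tailSum (E n) (k n) i ω + tailSum (E n) n (k n + 1) ω := by
    simp only [tailSum]
    rw [← Ico_succ_right_eq_Icc, ← Ico_succ_right_eq_Icc, ← Ico_succ_right_eq_Icc]
    exact (Finset.sum_Ico_consecutive _ (by rw [Order.succ_eq_add_one]; omega)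
      (by simp only [Order.succ_eq_add_one]; omega)).symm
  have hT0 : 0 ≤ tailSum (E n) (k n) i ω := tailSum_nonneg hEpos
  have r1 := hg.ratio (orderStat (Z ω) n (n - i + 1)) (orderStat (Z ω) n (n - k n))
    (tailSum (E n) n i ω) (tailSum (E n) n (k n + 1) ω) (orderStat_mono (by omega) (by omega))
    (by linarith) hc2 (hcell i hin) (by rw [hidx]; exact hcell _ hk1)
  have r2 := abs_sub_wTailSum_le (s := s n ω) hxb hEpos hi
  have e1 : tailSum (E n) n i ω - log ((n : ℝ) / k n) =
      s n ω + tailSum (E n) (k n) i ω := by rw [hT, hsd]; ring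
  rw [e1, show tailSum (E n) n (k n + 1) ω - log ((n : ℝ) / k n) = s n ω from rfl, hT,
    add_sub_cancel_right] at r1
  set T := tailSum (E n) (k n) i ω
  set W := wTailSum (x * b) (E n) (k n) i ω
  set F := supIcc (k n) fun j => incrDiff (x * b) (s n ω) (E n) (k n) j ω
  set g₁ := exp (-(x * b * (s n ω + T)))
  set g₂ := exp (-(x * b * s n ω))
  have hF : 0 ≤ F := supIcc_nonneg _ _
  set L := log (orderStat (Z ω) n (n - i + 1) / orderStat (Z ω) n (n - k n))
  have e2 : L - x * T - q n * W = (L - x * T + q n * ((g₁ - g₂) / (x * b))) +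
      q n * ((g₂ - g₁) / (x * b) - W) := by ring
  have hδ0 := hn.delta_pos
  have hθ0 := hn.theta_pos
  rw [e2]
  refine le_trans ((abs_add_le _ _).trans ?_) (mul_le_mul_of_nonneg_right
    (mul_le_mul_of_nonneg_left (le_abs_self _) (abs_nonneg _)) (by positivity))
  rw [abs_mul (q n)]
  have r3 := mul_le_mul_of_nonneg_left r2 (abs_nonneg (q n))
  have r4 : |q n| * (F * T) ≤ |q n| * (F * (T + θ n)) := by
    have := hn.theta_pos
    gcongr
    linarith
  refine (add_le_add r1 (r3.trans r4)).trans (le_of_eq ?_)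
  ring

end LogRatio

/-! ### Splitting of remainders -/

section Splitting

variable {Ω : Type*} [MeasurableSpace Ω] {P : Measure Ω} {N : ℕ → Ω → ℝ} {k : ℕ → ℕ} {q : ℕ → ℝ}

/-- The normal law has no atom at zero, so small balls about zero have small mass. -/
theorem bddP_inv_of_gaussian (hNm : ∀ n, Measurable (N n))
    (hN : ∀ n, P.map (N n) = gaussianReal 0 1) : BddP P fun n ω => (N n ω)⁻¹ := by
  have := nullSingletonClass_gaussianReal (μ := 0) (v := 1) one_ne_zero
  have h0 : Tendsto (fun m : ℕ => gaussianReal 0 1 (Metric.closedBall 0 (1 / ((m : ℝ) + 1))))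
      atTop (𝓝 0) := by
    have h1 : ⋂ m : ℕ, Metric.closedBall (0 : ℝ) (1 / ((m : ℝ) + 1)) = {0} := by
      refine Set.eq_singleton_iff_unique_mem.2 ⟨?_, fun z hz => ?_⟩
      · exact Set.mem_iInter.2 fun m => Metric.mem_closedBall_self (by positivity)
      · rw [← abs_eq_zero]
        refine le_antisymm (ge_of_tendsto tendsto_one_div_add_atTop_nhds_zero_nat
          (of_forall fun m => ?_)) (abs_nonneg _)
        simpa using Set.mem_iInter.1 hz m
    rw [← measure_singleton (μ := gaussianReal 0 1) 0, ← h1]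
    refine tendsto_measure_iInter_atTop
      (fun m => measurableSet_closedBall.nullMeasurableSet) (fun a b hab => ?_)
      ⟨0, measure_ne_top _ _⟩
    exact Metric.closedBall_subset_closedBall (Nat.one_div_le_one_div hab)
  intro e he
  obtain ⟨m, hm⟩ := (ENNReal.tendsto_nhds_zero.1 h0 e he).exists
  refine ⟨(m : ℝ) + 1, by positivity, of_forall fun n => le_trans ?_ hm⟩
  rw [← hN n, map_apply (hNm n) measurableSet_closedBall]
  refine measure_mono fun ω hω => ?_
  have h1 : (m : ℝ) + 1 ≤ |N n ω|⁻¹ := by rw [← abs_inv]; exact hω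
  have h2 : (0 : ℝ) < (m : ℝ) + 1 := by positivity
  have h3 : |N n ω| ≤ ((m : ℝ) + 1)⁻¹ := le_inv_of_le_inv₀ h2 h1
  simpa [one_div] using h3

theorem ae_ne_zero_of_gaussian (hNm : ∀ n, Measurable (N n))
    (hN : ∀ n, P.map (N n) = gaussianReal 0 1) (n : ℕ) : ∀ᵐ ω ∂P, N n ω ≠ 0 := by
  have := nullSingletonClass_gaussianReal (μ := 0) (v := 1) one_ne_zero
  refine ae_of_ae_map (hNm n).aemeasurable (p := fun z => z ≠ 0) ?_
  rw [hN n]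
  exact compl_mem_ae_iff.2 (measure_singleton _)

/-- A remainder of order `o_p(k^{-1/2} + |q|)` is a relative error in the normal term plus a
relative error in the bias term. -/
theorem SmallP.exists_split {R : ℕ → Ω → ℝ} (hR : SmallP P fun n ω => (rate (k n) (q n))⁻¹ * R n ω)
    (hNm : ∀ n, Measurable (N n)) (hN : ∀ n, P.map (N n) = gaussianReal 0 1) {c : ℝ} (hc : c ≠ 0)
    (hq : ∀ᶠ n in atTop, q n ≠ 0) :
    ∃ ε₁ ε₂ : ℕ → Ω → ℝ, SmallP P ε₁ ∧ SmallP P ε₂ ∧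
      ∀ᶠ n in atTop, ∀ᵐ ω ∂P, R n ω = c * (N n ω / √(k n)) * ε₁ n ω + q n * ε₂ n ω := by
  -- With `W = R / rate`, the remainder is `W/√k + |q| W`; the first part is divided by `c N/√k`,
  -- the second by `q`, which leaves a sign.
  refine ⟨fun n ω => c⁻¹ * ((rate (k n) (q n))⁻¹ * R n ω * (N n ω)⁻¹),
    fun n ω => (rate (k n) (q n))⁻¹ * R n ω * (|q n| / q n),
    (hR.mul_bddP (bddP_inv_of_gaussian hNm hN)).const_mul _,
    hR.of_le (of_forall fun n => ae_of_all _ fun ω => ?_), ?_⟩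
  · rw [abs_mul _ (|q n| / q n), abs_div, abs_abs]
    exact mul_le_of_le_one_right (abs_nonneg _) (div_self_le_one _)
  · filter_upwards [hq] with n h1
    filter_upwards [ae_ne_zero_of_gaussian hNm hN n] with ω h2
    have hr : 0 < rate (k n) (q n) := by
      have := abs_pos.2 h1
      rw [rate]; positivity
    have e : R n ω = (1 / √(k n : ℝ) + |q n|) * ((rate (k n) (q n))⁻¹ * R n ω) := by
      rw [← rate, mul_inv_cancel_left₀ hr.ne']
    generalize (rate (k n) (q n))⁻¹ * R n ω = W at e ⊢
    rw [e]
    field_simp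

end Splitting

/-! ### The scaled spacings -/

section Spacings

variable {Ω : Type*} [MeasurableSpace Ω] {P : Measure Ω} {k : ℕ → ℕ} {θ q : ℕ → ℝ} {x r : ℝ}
  {Z : Ω → ℕ → ℝ} {E : ℕ → ℕ → Ω → ℝ}

theorem sum_spacing_div {z : ℕ → ℝ} {n k i : ℕ} (hkn : k < n) (hi : i ∈ Icc 1 k)
    (h0 : 0 < orderStat z n (n - k)) :
    ∑ j ∈ Icc i k, spacing z n j / (j : ℝ) =
      log (orderStat z n (n - i + 1) / orderStat z n (n - k)) := by
  have hi' := mem_Icc.1 hi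
  have hp : ∀ j, 1 ≤ j → j ≤ k + 1 → 0 < orderStat z n (n - j + 1) := fun j _ hj =>
    h0.trans_le (orderStat_mono (by omega) (by omega))
  have h1 := sum_Icc_telescope (fun j => -log (orderStat z n (n - j + 1)))
    (i := i) (k := k) (by omega)
  rw [show n - (k + 1) + 1 = n - k by omega] at h1
  rw [log_div (hp i hi'.1 (by omega)).ne' h0.ne', sub_eq_neg_add, ← sub_neg_eq_add, ← h1]
  refine sum_congr rfl fun j hj => ?_
  have hj' := mem_Icc.1 hj
  have hj0 : (j : ℝ) ≠ 0 := Nat.cast_ne_zero.2 (by omega)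
  have e : n - (j + 1) + 1 = n - j := by omega
  have h2 := hp (j + 1) (by omega) (by omega)
  rw [e] at h2
  rw [spacing, mul_div_cancel_left₀ _ hj0, log_div (hp j (by omega) (by omega)).ne' h2.ne', e]
  ring

/-- The sums of `V_j/j` telescope to log-ratios. The factor is defined as the largest ratio over
`i`, so the inequality holds at every outcome and the good event serves only to show that the factor
is small. -/
theorem exists_spacing_remainder (hE : ∀ n, IsIidExp P (E n)) (hkn : ∀ᶠ n in atTop, k n < n)
    (hq : ∀ᶠ n in atTop, q n ≠ 0) (hθ : ∀ᶠ n in atTop, 0 < θ n ∧ θ n ≤ 1) {ζ : ℕ → Ω → ℝ}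
    {B : ℕ → Set Ω} (hζ : SmallP P ζ) (hζ0 : ∀ n ω, 0 ≤ ζ n ω)
    (hB : Tendsto (fun n => P (B n)) atTop (𝓝 0))
    (h : ∀ᶠ n in atTop, ∀ᵐ ω ∂P, ω ∉ B n → 0 < orderStat (Z ω) n (n - k n) ∧ ∀ i ∈ Icc 1 (k n),
        |log (orderStat (Z ω) n (n - i + 1) / orderStat (Z ω) n (n - k n)) -
            x * tailSum (E n) (k n) i ω - q n * wTailSum r (E n) (k n) i ω| ≤
          |q n| * ζ n ω * (tailSum (E n) (k n) i ω + θ n)) :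
    ∃ η : ℕ → Ω → ℝ, SmallP P η ∧ ∀ᶠ n in atTop, ∀ ω, ∀ i ∈ Icc 1 (k n),
      |∑ j ∈ Icc i (k n), (spacing (Z ω) n j -
          (x + q n * ((j : ℝ) / ((k n : ℝ) + 1)) ^ r) * E n j ω) / (j : ℝ)| ≤
        η n ω * |q n| * max (logW (k n) i) 1 := by
  set F : ℕ → Ω → ℕ → ℝ := fun n ω i => (∑ j ∈ Icc i (k n), (spacing (Z ω) n j -
    (x + q n * ((j : ℝ) / ((k n : ℝ) + 1)) ^ r) * E n j ω) / (j : ℝ)) /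
      (|q n| * max (logW (k n) i) 1) with hF
  have hM : ∀ n i, 0 < max (logW (k n) i) 1 := fun n i => lt_max_of_lt_right one_pos
  refine ⟨fun n ω => supIcc (k n) (F n ω), ?_, ?_⟩
  · refine (hζ.mul_bddP ((bddP_supIcc_tailSum hE (k := k)).add
      (bddP_of_bounded (a := fun _ => 1) 1 (by simp)))).of_le_off hB ?_
    filter_upwards [h, hkn, hq, hθ] with n h1 h2 h3 h4
    filter_upwards [h1] with ω h1 hω
    obtain ⟨h0, h1⟩ := h1 hω
    rw [abs_of_nonneg (supIcc_nonneg _ _)]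
    refine le_trans ?_ (le_abs_self _)
    have hS := supIcc_nonneg (k n) fun i => tailSum (E n) (k n) i ω / max (logW (k n) i) 1
    refine supIcc_le (mul_nonneg (hζ0 n ω) (by positivity)) fun i hi => ?_
    have h5 := le_supIcc (fun i => tailSum (E n) (k n) i ω / max (logW (k n) i) 1) hi
    have h6 := (le_abs_self _).trans h5
    have hq0 := abs_pos.2 h3
    have e : ∑ j ∈ Icc i (k n), (spacing (Z ω) n j -
        (x + q n * ((j : ℝ) / ((k n : ℝ) + 1)) ^ r) * E n j ω) / (j : ℝ) =
        log (orderStat (Z ω) n (n - i + 1) / orderStat (Z ω) n (n - k n)) -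
            x * tailSum (E n) (k n) i ω - q n * wTailSum r (E n) (k n) i ω := by
      rw [← sum_spacing_div h2 hi h0, tailSum, wTailSum, mul_sum, mul_sum,
        ← sum_sub_distrib, ← sum_sub_distrib]
      exact sum_congr rfl fun j _ => by ring
    simp only [hF]
    rw [e, abs_div, abs_of_pos (mul_pos hq0 (hM n i)), div_le_iff₀ (mul_pos hq0 (hM n i))]
    refine (h1 i hi).trans ?_
    rw [div_le_iff₀ (hM n i)] at h6
    have h7 : tailSum (E n) (k n) i ω + θ n ≤
        (supIcc (k n) (fun i => tailSum (E n) (k n) i ω / max (logW (k n) i) 1) + 1) *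
          max (logW (k n) i) 1 := by
      rw [add_mul, one_mul]
      exact add_le_add h6 (h4.2.trans (le_max_right _ _))
    refine (mul_le_mul_of_nonneg_left h7 (mul_nonneg hq0.le (hζ0 n ω))).trans (le_of_eq ?_)
    ring
  · filter_upwards [hq] with n h1 ω i hi
    have h2 := le_supIcc (F n ω) hi
    have hq0 := mul_pos (abs_pos.2 h1) (hM n i)
    simp only [hF] at h2
    rw [abs_div, abs_of_pos hq0, div_le_iff₀ hq0] at h2
    rw [mul_assoc]
    exact h2

end Spacings

/-! ### Riemann sums with antitone majorants -/

section Riemann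

def node (k i : ℕ) : ℝ := (i : ℝ) / ((k : ℝ) + 1)

def mean (k : ℕ) (f : ℕ → ℝ) : ℝ := 1 / (k : ℝ) * ∑ i ∈ Icc 1 k, f i

/-- Rounding up puts the node at or after `u`, so an antitone majorant at the node is at most its
value at `u`. -/
def rankOf (k : ℕ) (u : ℝ) : ℕ := ⌈u * ((k : ℝ) + 1)⌉₊

variable {k i : ℕ} {f g Ψ : ℕ → ℝ} {u : ℝ}

theorem node_mem (hi : i ∈ Icc 1 k) : node k i ∈ Ioo (0 : ℝ) 1 := by
  have h := mem_Icc.1 hi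
  have h1 : (1 : ℝ) ≤ i := by exact_mod_cast h.1
  have h2 : (i : ℝ) ≤ k := by exact_mod_cast h.2
  exact ⟨by rw [node]; positivity, by rw [node, div_lt_one (by positivity)]; linarith⟩

theorem log_one_div_node (k i : ℕ) : log (1 / node k i) = logW k i := by
  rw [node, logW, one_div_div]

theorem mean_congr (h : ∀ i ∈ Icc 1 k, f i = g i) : mean k f = mean k g := by
  rw [mean, mean, sum_congr rfl h]

theorem mean_add (k : ℕ) (f g : ℕ → ℝ) : mean k (fun i => f i + g i) = mean k f + mean k g := by
  rw [mean, Finset.sum_add_distrib, mul_add]; rfl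

theorem mean_const_mul (k : ℕ) (c : ℝ) (f : ℕ → ℝ) : mean k (fun i => c * f i) = c * mean k f := by
  rw [mean, ← mul_sum, mul_left_comm]; rfl

theorem mean_mono (h : ∀ i ∈ Icc 1 k, f i ≤ g i) : mean k f ≤ mean k g :=
  mul_le_mul_of_nonneg_left (sum_le_sum h) (by positivity)

theorem mean_nonneg (h : ∀ i ∈ Icc 1 k, 0 ≤ f i) : 0 ≤ mean k f :=
  mul_nonneg (by positivity) (sum_nonneg h)

theorem abs_mean_le (h : ∀ i ∈ Icc 1 k, |f i| ≤ g i) : |mean k f| ≤ mean k g := by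
  rw [mean, abs_mul, abs_of_nonneg (by positivity : 0 ≤ 1 / (k : ℝ))]
  exact mul_le_mul_of_nonneg_left ((Finset.abs_sum_le_sum_abs _ _).trans (sum_le_sum h))
    (by positivity)

theorem rankOf_pos (hu : 0 < u) : 1 ≤ rankOf k u := Nat.one_le_ceil_iff.2 (by positivity)

theorem le_node_rankOf : u ≤ node k (rankOf k u) := by
  rw [node, le_div_iff₀ (by positivity)]; exact Nat.le_ceil _

theorem tendsto_node_rankOf (hu : 0 ≤ u) : Tendsto (fun k => node k (rankOf k u)) atTop (𝓝 u) :=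
  (tendsto_nat_ceil_mul_div_atTop hu).comp
    (tendsto_atTop_add_const_right _ (1 : ℝ) tendsto_natCast_atTop_atTop)

theorem eventually_rankOf_mem (hu : u ∈ Ioo (0 : ℝ) 1) : ∀ᶠ k in atTop, rankOf k u ∈ Icc 1 k := by
  filter_upwards [(tendsto_node_rankOf hu.1.le).eventually_lt_const hu.2] with k hk
  rw [node, div_lt_one (by positivity)] at hk
  exact mem_Icc.2 ⟨rankOf_pos hu.1, by exact_mod_cast Nat.lt_succ_iff.1 (by exact_mod_cast hk)⟩

/-- The step function on `(0, 1)` with the values `f 1, …, f k, 0`. -/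
def stepFun (k : ℕ) (f : ℕ → ℝ) (u : ℝ) : ℝ := if rankOf k u ≤ k then f (rankOf k u) else 0

theorem integral_ceil (f : ℕ → ℝ) (m : ℕ) : IntervalIntegrable (fun z : ℝ => f ⌈z⌉₊) volume 0 m ∧
      ∫ z in (0 : ℝ)..m, f ⌈z⌉₊ = ∑ i ∈ Icc 1 m, f i := by
  have hle : ∀ j : ℕ, (j : ℝ) ≤ ((j + 1 : ℕ) : ℝ) := fun j => by exact_mod_cast Nat.le_succ j
  have hc : ∀ j : ℕ, Set.EqOn (fun _ : ℝ => f (j + 1)) (fun z : ℝ => f ⌈z⌉₊)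
      (Set.uIoc (j : ℝ) ((j + 1 : ℕ) : ℝ)) := by
    intro j z hz
    rw [Set.uIoc_of_le (hle j)] at hz
    have : ⌈z⌉₊ = j + 1 := (Nat.ceil_eq_iff (by omega)).2 ⟨by simpa using hz.1, hz.2⟩
    simp only [this]
  have hI : ∀ j : ℕ, IntervalIntegrable (fun z : ℝ => f ⌈z⌉₊) volume (j : ℝ) ((j + 1 : ℕ) : ℝ) :=
    fun j => (intervalIntegrable_const (c := f (j + 1))).congr (hc j)
  induction m with
  | zero => simp
  | succ m ih =>
    refine ⟨ih.1.trans (hI m), ?_⟩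
    rw [← intervalIntegral.integral_add_adjacent_intervals ih.1 (hI m), ih.2,
      ← Finset.insert_Icc_right_eq_Icc_add_one (by omega), Finset.sum_insert (by simp), add_comm]
    congr 1
    rw [← intervalIntegral.integral_congr_ae (ae_of_all _ fun z hz => hc m hz)]
    simp

theorem integral_stepFun (k : ℕ) (f : ℕ → ℝ) : IntegrableOn (stepFun k f) (Ioo 0 1) ∧
      ∫ u in Ioo (0 : ℝ) 1, stepFun k f u = 1 / ((k : ℝ) + 1) * ∑ i ∈ Icc 1 k, f i := by
  have hk : ((k : ℝ) + 1) ≠ 0 := by positivity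
  obtain ⟨h1, h2⟩ := integral_ceil (fun i => if i ≤ k then f i else 0) (k + 1)
  have h3 := h1.comp_mul_right (c := (k : ℝ) + 1)
  have h4 := intervalIntegral.integral_comp_mul_right (a := 0) (b := 1)
    (fun z : ℝ => if ⌈z⌉₊ ≤ k then f ⌈z⌉₊ else 0) hk
  push_cast at h3 h2
  rw [zero_div, div_self hk] at h3
  rw [zero_mul, one_mul, h2] at h4
  refine ⟨?_, ?_⟩
  · rw [← integrableOn_Ioc_iff_integrableOn_Ioo]
    exact (intervalIntegrable_iff_integrableOn_Ioc_of_le zero_le_one).1 h3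
  · rw [← integral_Ioc_eq_integral_Ioo, ← intervalIntegral.integral_of_le zero_le_one]
    refine h4.trans ?_
    rw [smul_eq_mul, ← Finset.insert_Icc_right_eq_Icc_add_one (by omega),
      Finset.sum_insert (by simp), one_div]
    simp only [add_le_iff_nonpos_right, nonpos_iff_eq_zero, one_ne_zero, if_false, zero_add]
    congr 1
    exact sum_congr rfl fun i hi => if_pos (mem_Icc.1 hi).2

theorem abs_stepFun_le {Ψ : ℝ → ℝ} (hΨ : AntitoneOn Ψ (Ioo 0 1))
    (h0 : ∀ u ∈ Ioo (0 : ℝ) 1, 0 ≤ Ψ u) {M : ℝ} (hM : 0 ≤ M)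
    (h : ∀ i ∈ Icc 1 k, |f i| ≤ M * Ψ (node k i)) (hu : u ∈ Ioo (0 : ℝ) 1) :
    |stepFun k f u| ≤ M * Ψ u := by
  rw [stepFun]
  split_ifs with h1
  · have h2 : rankOf k u ∈ Icc 1 k := mem_Icc.2 ⟨rankOf_pos hu.1, h1⟩
    exact (h _ h2).trans (mul_le_mul_of_nonneg_left (hΨ hu (node_mem h2) le_node_rankOf) hM)
  · simpa using mul_nonneg hM (h0 u hu)

theorem mean_le_integral {Ψ : ℝ → ℝ} (hΨ : AntitoneOn Ψ (Ioo 0 1))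
    (h0 : ∀ u ∈ Ioo (0 : ℝ) 1, 0 ≤ Ψ u) (hi : IntegrableOn Ψ (Ioo 0 1)) (k : ℕ) :
    mean k (fun i => Ψ (node k i)) ≤ 2 * ∫ u in Ioo (0 : ℝ) 1, Ψ u := by
  obtain ⟨h1, h2⟩ := integral_stepFun k fun i => Ψ (node k i)
  have h3 : 1 / ((k : ℝ) + 1) * ∑ i ∈ Icc 1 k, Ψ (node k i) ≤ ∫ u in Ioo (0 : ℝ) 1, Ψ u := by
    rw [← h2]
    refine setIntegral_mono_on h1 hi measurableSet_Ioo fun u hu => (le_abs_self _).trans ?_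
    refine (abs_stepFun_le hΨ h0 zero_le_one (fun i hi => ?_) hu).trans (one_mul _).le
    rw [one_mul, abs_of_nonneg (h0 _ (node_mem hi))]
  have h4 : 0 ≤ ∑ i ∈ Icc 1 k, Ψ (node k i) := sum_nonneg fun i hi => h0 _ (node_mem hi)
  rcases Nat.eq_zero_or_pos k with rfl | hk
  · simpa [mean] using setIntegral_nonneg measurableSet_Ioo h0
  have hk' : (1 : ℝ) ≤ k := by exact_mod_cast hk
  refine le_trans ?_ (mul_le_mul_of_nonneg_left h3 zero_le_two)
  rw [mean, ← mul_assoc]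
  refine mul_le_mul_of_nonneg_right ?_ h4
  rw [mul_one_div, div_le_div_iff₀ (by positivity) (by positivity)]
  linarith

/-- The mean is the integral of a step function up to the factor `(k+1)/k`, and dominated
convergence applies even if the majorant is unbounded at `0`. The general filter permits the kernel
parameter to move together with `k`. -/
theorem tendsto_mean {ι : Type*} {l : Filter ι} [l.IsCountablyGenerated] {κ : ι → ℕ}
    (hκ : Tendsto κ l atTop) {Ψ : ℝ → ℝ} (hΨ : AntitoneOn Ψ (Ioo 0 1))
    (h0 : ∀ u ∈ Ioo (0 : ℝ) 1, 0 ≤ Ψ u) (hi : IntegrableOn Ψ (Ioo 0 1)) {M : ℝ}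
    (hM : 0 ≤ M) {F : ι → ℕ → ℝ} {G : ℝ → ℝ}
    (hF : ∀ᶠ a in l, ∀ i ∈ Icc 1 (κ a), |F a i| ≤ M * Ψ (node (κ a) i))
    (hG : ∀ᵐ u, u ∈ Ioo (0 : ℝ) 1 → Tendsto (fun a => F a (rankOf (κ a) u)) l (𝓝 (G u))) :
    Tendsto (fun a => mean (κ a) (F a)) l (𝓝 (∫ u in Ioo (0 : ℝ) 1, G u)) := by
  have h1 : Tendsto (fun a => ∫ u in Ioo (0 : ℝ) 1, stepFun (κ a) (F a) u) l
      (𝓝 (∫ u in Ioo (0 : ℝ) 1, G u)) := by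
    refine tendsto_integral_filter_of_dominated_convergence (fun u => M * Ψ u)
      (of_forall fun a => (integral_stepFun _ _).1.aestronglyMeasurable) ?_
      (hi.const_mul M) ?_
    · filter_upwards [hF] with a ha
      exact (ae_restrict_iff' measurableSet_Ioo).2 (ae_of_all _ fun u hu =>
        abs_stepFun_le hΨ h0 hM ha hu)
    · refine (ae_restrict_iff' measurableSet_Ioo).2 (hG.mono fun u hG hu => ?_)
      refine (hG hu).congr' ?_
      filter_upwards [hκ.eventually (eventually_rankOf_mem hu)] with a ha
      rw [stepFun, if_pos (mem_Icc.1 ha).2]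
  have h2 : Tendsto (fun a => ((κ a : ℝ) + 1) / κ a) l (𝓝 1) := by
    have h3 : Tendsto (fun m : ℕ => 1 + 1 / (m : ℝ)) atTop (𝓝 1) := by
      simpa using tendsto_one_div_atTop_nhds_zero_nat.const_add (1 : ℝ)
    refine (h3.comp hκ).congr' ?_
    filter_upwards [hκ.eventually_ge_atTop 1] with a ha
    have : (κ a : ℝ) ≠ 0 := Nat.cast_ne_zero.2 (by omega)
    simp only [Function.comp]
    field_simp
  have h3 := h2.mul h1
  rw [one_mul] at h3
  refine h3.congr fun a => ?_
  rw [(integral_stepFun _ _).2, mean, ← mul_assoc]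
  congr 1
  have : (κ a : ℝ) + 1 ≠ 0 := by positivity
  field_simp

theorem tendsto_logW_rankOf (hu : u ∈ Ioo (0 : ℝ) 1) :
    Tendsto (fun k => logW k (rankOf k u)) atTop (𝓝 (log (1 / u))) := by
  simp_rw [← log_one_div_node]
  exact (tendsto_const_nhds.div (tendsto_node_rankOf hu.1.le) hu.1.ne').log
    (one_div_ne_zero hu.1.ne')

theorem log_one_div_pos (hu : u ∈ Ioo (0 : ℝ) 1) : 0 < log (1 / u) :=
  log_pos (by rw [lt_div_iff₀ hu.1]; linarith [hu.2])

theorem tendsto_rankOf (hu : 0 < u) : Tendsto (fun k => rankOf k u) atTop atTop := by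
  refine tendsto_nat_ceil_atTop.comp (Tendsto.const_mul_atTop hu
    (tendsto_atTop_add_const_right _ (1 : ℝ) tendsto_natCast_atTop_atTop))

end Riemann

/-! ### Riemann sums of kernels -/

section Kernels

/-- A kernel whose values and parameter derivatives near `p` are dominated by an antitone
integrable function. -/
structure KernelBound (K : ℝ → ℝ → ℝ) (p η : ℝ) (Ψ : ℝ → ℝ) : Prop where
  cont : ContinuousOn (fun u => K u p) (Ioo 0 1)
  eta_pos : 0 < η
  anti : AntitoneOn Ψ (Ioo 0 1)
  int : IntegrableOn Ψ (Ioo 0 1)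
  cont_deriv : ContinuousOn (fun x : ℝ × ℝ => deriv (K x.1) x.2) (Ioo 0 1 ×ˢ Ioo (p - η) (p + η))
  bound : ∀ u ∈ Ioo (0 : ℝ) 1, ∀ q ∈ Ioo (p - η) (p + η),
    DifferentiableAt ℝ (K u) q ∧ |K u q| ≤ Ψ u ∧ |deriv (K u) q| ≤ Ψ u

variable {K : ℝ → ℝ → ℝ} {p η : ℝ} {Ψ : ℝ → ℝ} {u q r : ℝ}

theorem KernelBound.self_mem (h : KernelBound K p η Ψ) : p ∈ Ioo (p - η) (p + η) := by
  have := h.eta_pos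
  constructor <;> linarith

theorem KernelBound.nonneg (h : KernelBound K p η Ψ) (u : ℝ) (hu : u ∈ Ioo (0 : ℝ) 1) :
    0 ≤ Ψ u := (abs_nonneg _).trans (h.bound u hu p h.self_mem).2.1

/-- The mean value theorem, with the degenerate case `q = p` built into `dslope`. -/
theorem exists_deriv_eq_dslope {f : ℝ → ℝ} {p q : ℝ} (hf : ∀ c ∈ uIcc p q, DifferentiableAt ℝ f c) :
    ∃ c ∈ uIcc p q, dslope f p q = deriv f c := by
  have key : ∀ {a b : ℝ}, a < b → (∀ c ∈ uIcc a b, DifferentiableAt ℝ f c) →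
      ∃ c ∈ uIcc a b, slope f a b = deriv f c := by
    intro a b hab h
    rw [Set.uIcc_of_le hab.le] at h ⊢
    obtain ⟨c, hc, hc'⟩ := exists_deriv_eq_slope f hab
      (fun z hz => (h z hz).continuousAt.continuousWithinAt)
      fun z hz => (h z (Set.Ioo_subset_Icc_self hz)).differentiableWithinAt
    exact ⟨c, Set.Ioo_subset_Icc_self hc, by rw [hc', slope_def_field]⟩
  rcases lt_trichotomy p q with h | rfl | h
  · rw [dslope_of_ne _ h.ne']; exact key h hf
  · exact ⟨p, Set.left_mem_uIcc, dslope_same _ _⟩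
  · rw [dslope_of_ne _ h.ne, slope_comm, Set.uIcc_comm]
    exact key h (Set.uIcc_comm p q ▸ hf)

theorem KernelBound.abs_dslope_le (h : KernelBound K p η Ψ) (hu : u ∈ Ioo (0 : ℝ) 1)
    (hq : q ∈ Ioo (p - η) (p + η)) : |dslope (K u) p q| ≤ Ψ u := by
  have hs : uIcc p q ⊆ Ioo (p - η) (p + η) := Set.ordConnected_Ioo.uIcc_subset h.self_mem hq
  obtain ⟨c, hc, e⟩ := exists_deriv_eq_dslope fun c hc => (h.bound u hu c (hs hc)).1
  rw [e]
  exact (h.bound u hu c (hs hc)).2.2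

theorem KernelBound.tendsto_dslope (h : KernelBound K p η Ψ) (hu : u ∈ Ioo (0 : ℝ) 1) :
    Tendsto (fun x : ℝ × ℝ => dslope (K x.1) p x.2) (𝓝 u ×ˢ 𝓝 p) (𝓝 (deriv (K u) p)) := by
  have hc : ContinuousAt (fun x : ℝ × ℝ => deriv (K x.1) x.2) (u, p) :=
    h.cont_deriv.continuousAt ((isOpen_Ioo.prod isOpen_Ioo).mem_nhds ⟨hu, h.self_mem⟩)
  intro W hW
  have h1 := hc.eventually hW
  rw [nhds_prod_eq, eventually_prod_iff] at h1
  obtain ⟨pa, ha, pb, hb, hab⟩ := h1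
  obtain ⟨ε, hε, hb⟩ := Metric.eventually_nhds_iff_ball.1 (hb.and (isOpen_Ioo.mem_nhds h.self_mem))
  rw [mem_map]
  filter_upwards [(ha.and (isOpen_Ioo.mem_nhds hu)).prod_mk (Metric.ball_mem_nhds p hε)] with x hx
  have hs : uIcc p x.2 ⊆ Metric.ball p ε := by
    rw [Real.ball_eq_Ioo]
    refine Set.ordConnected_Ioo.uIcc_subset ?_ ?_ <;> rw [← Real.ball_eq_Ioo]
    exacts [Metric.mem_ball_self hε, hx.2]
  obtain ⟨c, hc, e⟩ := exists_deriv_eq_dslope fun c hc =>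
    (h.bound x.1 hx.1.2 c (hb c (hs hc)).2).1
  rw [Set.mem_preimage, e]
  exact hab hx.1.1 (hb c (hs hc)).1

theorem tendsto_node_rankOf_fst (hu : 0 ≤ u) (l : Filter ℝ) :
    Tendsto (fun x : ℕ × ℝ => (node x.1 (rankOf x.1 u), x.2)) (atTop ×ˢ l) (𝓝 u ×ˢ l) :=
  (tendsto_node_rankOf hu).prodMap tendsto_id

/-- The norming identity is differentiated under the integral sign. -/
theorem IsKernel.integral_deriv (hK : IsKernel K) (h : KernelBound K p η Ψ) (hp0 : 0 < p)
    (hp1 : p < 1) : ∫ u in Ioo (0 : ℝ) 1, deriv (K u) p = -(1 / p ^ 2) := by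
  have hnorm : ∀ q ∈ Ioc (0 : ℝ) 1, ∫ u in Ioo (0 : ℝ) 1, K u q = 1 / q := fun q hq => by
    rw [← hK.norming q hq, intervalIntegral.integral_of_le zero_le_one,
      integral_Ioc_eq_integral_Ioo]
  have hmem : Ioc (0 : ℝ) 1 ∈ 𝓝 p := mem_of_superset (isOpen_Ioo.mem_nhds ⟨hp0, hp1⟩)
    Set.Ioo_subset_Ioc_self
  have hint : ∀ q ∈ Ioc (0 : ℝ) 1, IntegrableOn (fun u => K u q) (Ioo 0 1) := by
    intro q hq
    -- A nonintegrable function would have integral `0`, while the norming value is positive.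
    by_contra hcon
    have := hnorm q hq
    rw [integral_undef hcon] at this
    exact (one_div_pos.2 hq.1).ne this
  have hs := isOpen_Ioo.mem_nhds h.self_mem
  have h1 := (hasDerivAt_integral_of_dominated_loc_of_deriv_le (𝕜 := ℝ)
    (μ := volume.restrict (Ioo (0 : ℝ) 1)) (F := fun q u => K u q)
    (F' := fun q u => deriv (K u) q) (x₀ := p) (bound := Ψ) hs
    (mem_of_superset hmem fun q hq => (hint q hq).aestronglyMeasurable) (hint p ⟨hp0, hp1.le⟩)
    (ContinuousOn.aestronglyMeasurable (h.cont_deriv.comp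
      (f := fun u : ℝ => (u, p)) (by fun_prop) fun u hu => ⟨hu, h.self_mem⟩) measurableSet_Ioo)
    ((ae_restrict_iff' measurableSet_Ioo).2 (ae_of_all _ fun u hu q hq =>
      (h.bound u hu q hq).2.2)) h.int
    ((ae_restrict_iff' measurableSet_Ioo).2 (ae_of_all _ fun u hu q hq =>
      (h.bound u hu q hq).1.hasDerivAt))).2
  have h2 : HasDerivAt (fun q : ℝ => ∫ u in Ioo (0 : ℝ) 1, K u q) (-(p ^ 2)⁻¹) p :=
    (hasDerivAt_inv hp0.ne').congr_of_eventuallyEq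
      (mem_of_superset hmem fun q hq => (hnorm q hq).trans (one_div q))
  rw [h1.unique h2, one_div]

/-- The limit is joint in `k` and the parameter, so that the random fraction can be inserted. -/
theorem IsKernel.tendsto_mean_dslope (hK : IsKernel K) (h : KernelBound K p η Ψ) (hp0 : 0 < p)
    (hp1 : p < 1) : Tendsto (fun x : ℕ × ℝ => mean x.1 fun i => dslope (K (node x.1 i)) p x.2)
      (atTop ×ˢ 𝓝 p) (𝓝 (-(1 / p ^ 2))) := by
  rw [← hK.integral_deriv h hp0 hp1]
  refine tendsto_mean (F := fun x : ℕ × ℝ => fun i => dslope (K (node x.1 i)) p x.2)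
    tendsto_fst h.anti h.nonneg h.int zero_le_one ?_
    (ae_of_all _ fun u hu => (h.tendsto_dslope hu).comp (tendsto_node_rankOf_fst hu.1.le _))
  filter_upwards [tendsto_snd.eventually (isOpen_Ioo.mem_nhds h.self_mem)] with x hx i hi
  rw [one_mul]
  exact h.abs_dslope_le (node_mem hi) hx

/-- The mean of the weighted tail sum, and the discrete form of `∫_u^1 s^{r-1} ds`. -/
def wHarm (r : ℝ) (k i : ℕ) : ℝ := ∑ j ∈ Icc i k, ((j : ℝ) / ((k : ℝ) + 1)) ^ r / j

theorem wHarm_nonneg (r : ℝ) (k i : ℕ) : 0 ≤ wHarm r k i := sum_nonneg fun j _ => by positivity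

theorem wHarm_le (hr : 0 ≤ r) {k i : ℕ} (hi : i ∈ Icc 1 k) : wHarm r k i ≤ 2 * logW k i := by
  have hi' := mem_Icc.1 hi
  refine le_trans (sum_le_sum fun j hj => ?_) (harmTail_le_two_mul_logW hi'.1 (by omega))
  gcongr
  exact div_rpow_le_one hr (mem_Icc.1 hj).2

/-- The integrand of `∫_u^1 s^{r-1} ds` extended by zero, so that Fubini's theorem can be used on
the square. -/
def cutPow (r u s : ℝ) : ℝ := if u < s then s ^ r * (1 / s) else 0

/-- The sum is itself a mean over ranks with terms bounded by `1/u`; pointwise convergence fails at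
most at `s = u`. -/
theorem tendsto_wHarm (hr : 0 ≤ r) (hu : u ∈ Ioo (0 : ℝ) 1) :
    Tendsto (fun k => wHarm r k (rankOf k u)) atTop (𝓝 (∫ s in Ioo (0 : ℝ) 1, cutPow r u s)) := by
  have h1 := tendsto_mean (l := atTop) (κ := fun k => k) (Ψ := fun _ => 1) (M := 1 / u)
    (F := fun k j => if rankOf k u ≤ j then (k : ℝ) * (node k j ^ r / j) else 0)
    (G := cutPow r u) tendsto_id antitoneOn_const (fun _ _ => zero_le_one)
    (integrableOn_const (by simp) (by simp)) (by have := hu.1; positivity)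
    (of_forall fun k j hj => ?_) ?_
  · refine h1.congr' ?_
    filter_upwards [eventually_rankOf_mem hu] with k hk
    have hk' := mem_Icc.1 hk
    have hk0 : (k : ℝ) ≠ 0 := Nat.cast_ne_zero.2 (by omega)
    rw [mean, ← Finset.sum_filter, wHarm, ← mul_sum, one_div, inv_mul_cancel_left₀ hk0]
    refine sum_congr ?_ fun _ _ => rfl
    ext j
    simp only [mem_filter, mem_Icc]
    omega
  · have hu0 := hu.1
    have hj' := mem_Icc.1 hj
    have hj0 : (0 : ℝ) < j := Nat.cast_pos.2 hj'.1
    split_ifs with h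
    · have h2 : u * ((k : ℝ) + 1) ≤ j := (Nat.le_ceil _).trans (Nat.cast_le.2 h)
      have h3 : node k j ^ r ≤ 1 := div_rpow_le_one hr hj'.2
      have h4 : 0 ≤ node k j ^ r := Real.rpow_nonneg (node_mem hj).1.le _
      rw [abs_of_nonneg (by positivity), mul_one, mul_div_assoc', div_le_div_iff₀ hj0 hu0]
      nlinarith [mul_nonneg hu0.le (Nat.cast_nonneg (α := ℝ) k)]
    · simpa using hu0.le
  · have h2 : ∀ᵐ s : ℝ, s ≠ u := compl_mem_ae_iff.2 (measure_singleton u)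
    filter_upwards [h2] with s hsu hs
    have t1 := tendsto_node_rankOf hs.1.le
    rcases lt_or_gt_of_ne hsu with h | h
    · rw [cutPow, if_neg h.not_gt]
      refine tendsto_const_nhds.congr' ?_
      filter_upwards [t1.eventually_lt (tendsto_node_rankOf hu.1.le) h] with k hk
      rw [if_neg]
      intro h3
      refine hk.not_ge ?_
      rw [node, node]
      gcongr
    · rw [cutPow, if_pos h]
      have t2 : Tendsto (fun k : ℕ => (k : ℝ) / ((k : ℝ) + 1)) atTop (𝓝 1) :=
        tendsto_natCast_div_add_atTop 1
      have t3 := (t2.mul (t1.rpow_const (p := r) (Or.inl hs.1.ne'))).mul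
        ((tendsto_const_nhds (x := (1 : ℝ))).div t1 hs.1.ne')
      rw [one_mul] at t3
      refine t3.congr fun k => ?_
      have h4 : rankOf k u ≤ rankOf k s := Nat.ceil_mono (by gcongr)
      have h5 : (rankOf k s : ℝ) ≠ 0 :=
        Nat.cast_ne_zero.2 (by have := rankOf_pos (k := k) hs.1; omega)
      have h6 : (k : ℝ) + 1 ≠ 0 := by positivity
      simp only [Pi.div_apply]
      rw [if_pos h4, div_mul_eq_mul_div, mul_comm (k : ℝ) (_ ^ r)]
      generalize node k (rankOf k s) ^ r = A
      rw [node]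
      field_simp

theorem integral_cutPow_nonneg (r u : ℝ) : 0 ≤ ∫ s in Ioo (0 : ℝ) 1, cutPow r u s :=
  setIntegral_nonneg measurableSet_Ioo fun s hs => by
    have := hs.1
    rw [cutPow]; split_ifs <;> positivity

theorem integral_cutPow_le (hr : 0 ≤ r) (hu : u ∈ Ioo (0 : ℝ) 1) :
    ∫ s in Ioo (0 : ℝ) 1, cutPow r u s ≤ 2 * log (1 / u) :=
  le_of_tendsto_of_tendsto (tendsto_wHarm hr hu) ((tendsto_logW_rankOf hu).const_mul 2)
    ((eventually_rankOf_mem hu).mono fun _ hk => wHarm_le hr hk)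

theorem KernelBound.tendsto_mean_wHarm (h : KernelBound K p η Ψ) (hr : 0 ≤ r) :
    Tendsto (fun k => mean k fun i => K (node k i) p / logW k i * wHarm r k i) atTop
      (𝓝 (∫ u in Ioo (0 : ℝ) 1, K u p / log (1 / u) * ∫ s in Ioo (0 : ℝ) 1, cutPow r u s)) := by
  refine tendsto_mean (κ := fun k => k) (F := fun k i => K (node k i) p / logW k i * wHarm r k i)
    tendsto_id h.anti h.nonneg h.int zero_le_two
    (of_forall fun k i hi => ?_) (ae_of_all _ fun u hu => ?_)
  · have hi' := mem_Icc.1 hi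
    have hl := logW_pos hi'.1 hi'.2
    rw [abs_mul, abs_div, abs_of_pos hl, abs_of_nonneg (wHarm_nonneg _ _ _), div_mul_eq_mul_div,
      div_le_iff₀ hl]
    refine (mul_le_mul (h.bound _ (node_mem hi) p h.self_mem).2.1 (wHarm_le hr hi)
      (wHarm_nonneg _ _ _) (h.nonneg _ (node_mem hi))).trans (le_of_eq (by ring))
  · exact ((((h.cont.continuousAt (isOpen_Ioo.mem_nhds hu)).tendsto.comp
      (tendsto_node_rankOf hu.1.le)).div (tendsto_logW_rankOf hu)
      (log_one_div_pos hu).ne').mul (tendsto_wHarm hr hu))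

/-- Fubini's theorem on `u < s`. Integrability holds because the inner integral is at most `2
log(1/u)`, which cancels the denominator. -/
theorem KernelBound.integral_mul_cutPow (h : KernelBound K p η Ψ) (hr : 0 ≤ r) :
    ∫ u in Ioo (0 : ℝ) 1, K u p / log (1 / u) * ∫ s in Ioo (0 : ℝ) 1, cutPow r u s =
      ∫ s in (0 : ℝ)..1, s ^ r * tildeK K s p := by
  set lam : Measure ℝ := volume.restrict (Ioo 0 1) with hlam
  have hae : ∀ {Q : ℝ → Prop}, (∀ u ∈ Ioo (0 : ℝ) 1, Q u) → ∀ᵐ u ∂lam, Q u := fun hQ =>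
    (ae_restrict_iff' measurableSet_Ioo).2 (ae_of_all _ hQ)
  have hH : AEStronglyMeasurable (fun u => K u p / log (1 / u)) lam := by
    refine ContinuousOn.aestronglyMeasurable (h.cont.div ?_ fun u hu =>
      (log_one_div_pos hu).ne') measurableSet_Ioo
    exact ContinuousOn.log (continuousOn_const.div continuousOn_id fun u hu => hu.1.ne')
      fun u hu => one_div_ne_zero hu.1.ne'
  have hcm : Measurable fun x : ℝ × ℝ => cutPow r x.1 x.2 :=
    Measurable.ite (measurableSet_lt measurable_fst measurable_snd) (by fun_prop) measurable_const
  have hf : AEStronglyMeasurable (fun x : ℝ × ℝ => K x.1 p / log (1 / x.1) *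
      cutPow r x.1 x.2) (lam.prod lam) := hH.comp_fst.mul hcm.aestronglyMeasurable
  have hc0 : ∀ u, ∀ s ∈ Ioo (0 : ℝ) 1, 0 ≤ cutPow r u s := fun u s hs => by
    have := hs.1
    rw [cutPow]; split_ifs <;> positivity
  have hint : Integrable (fun x : ℝ × ℝ => K x.1 p / log (1 / x.1) *
      cutPow r x.1 x.2) (lam.prod lam) := by
    rw [integrable_prod_iff hf]
    refine ⟨hae fun u hu => ?_, ?_⟩
    · simp only
      refine Integrable.const_mul (f := cutPow r u) ?_ (K u p / log (1 / u))
      refine Integrable.of_bound (hcm.comp measurable_prodMk_left).aestronglyMeasurable (1 / u)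
        (hae fun s hs => ?_)
      have hu0 := hu.1
      have hs0 := hs.1
      rw [norm_eq_abs, abs_of_nonneg (hc0 u s hs), cutPow]
      split_ifs with hus
      · exact (mul_le_of_le_one_left (by positivity) (Real.rpow_le_one hs0.le hs.2.le hr)).trans
          (one_div_le_one_div_of_le hu0 hus.le)
      · positivity
    · refine (h.int.const_mul 2).mono' hf.norm.integral_prod_right' (hae fun u hu => ?_)
      have hl := log_one_div_pos hu
      have e : ∫ s, ‖K u p / log (1 / u) * cutPow r u s‖ ∂lam =
          |K u p| / log (1 / u) * ∫ s, cutPow r u s ∂lam := by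
        rw [← integral_const_mul]
        refine integral_congr_ae (hae fun s hs => ?_)
        simp only [norm_mul, norm_eq_abs, abs_div, abs_of_pos hl, abs_of_nonneg (hc0 u s hs)]
      simp only
      rw [e, norm_eq_abs, abs_of_nonneg (mul_nonneg (by positivity)
        (integral_cutPow_nonneg r u)), div_mul_eq_mul_div, div_le_iff₀ hl]
      refine (mul_le_mul (h.bound u hu p h.self_mem).2.1 (integral_cutPow_le hr hu)
        (integral_cutPow_nonneg r u) (h.nonneg u hu)).trans (le_of_eq (by ring))
  simp_rw [← integral_const_mul]
  rw [integral_integral_swap hint, intervalIntegral.integral_of_le zero_le_one,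
    integral_Ioc_eq_integral_Ioo]
  refine integral_congr_ae (hae fun s hs => ?_)
  simp only
  rw [tildeK, intervalIntegral.integral_of_le hs.1.le, integral_Ioc_eq_integral_Ioo, ← mul_assoc,
    ← integral_const_mul, hlam, show Ioo 0 s = Ioo 0 1 ∩ Set.Iio s by
      rw [Set.Ioo_inter_Iio, min_eq_right hs.2.le], ← setIntegral_indicator measurableSet_Iio]
  refine setIntegral_congr_fun measurableSet_Ioo fun u _ => ?_
  simp only [cutPow, indicator, Set.mem_Iio]
  split_ifs
  · ring
  · rw [mul_zero]

/-- The weighted first-moment bounds of the centred tail sums, relative to `log ((k+1)/i)`. -/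
def tailWeight (k i : ℕ) : ℝ := min 4 ((√(2 / i) + 1 / i) / logW k i)

/-- The bound `4` gives domination; at a fixed `u` the rank tends to infinity and the other bound
tends to zero. -/
theorem KernelBound.tendsto_mean_tailWeight (h : KernelBound K p η Ψ) :
    Tendsto (fun k => mean k fun i => Ψ (node k i) * tailWeight k i) atTop (𝓝 0) := by
  have h0 : ∀ {k i : ℕ}, i ∈ Icc 1 k → 0 ≤ tailWeight k i := fun hi =>
    le_min (by norm_num) (div_nonneg (by positivity)
      (logW_pos (mem_Icc.1 hi).1 (mem_Icc.1 hi).2).le)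
  have h1 := tendsto_mean (κ := fun k => k) (F := fun k i => Ψ (node k i) * tailWeight k i)
    (G := fun _ => 0) tendsto_id h.anti h.nonneg h.int zero_le_four
    (of_forall fun k i hi => ?_) (ae_of_all _ fun u hu => ?_)
  · simpa using h1
  · rw [abs_of_nonneg (mul_nonneg (h.nonneg _ (node_mem hi)) (h0 hi)), mul_comm]
    exact mul_le_mul_of_nonneg_right (min_le_left _ _) (h.nonneg _ (node_mem hi))
  · have t1 : Tendsto (fun m : ℕ => √(2 / (m : ℝ)) + 1 / (m : ℝ)) atTop (𝓝 0) := by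
      have := (tendsto_const_div_atTop_nhds_zero_nat (2 : ℝ)).sqrt.add
        (tendsto_const_div_atTop_nhds_zero_nat (1 : ℝ))
      simpa using this
    have t2 := ((t1.comp (tendsto_rankOf hu.1)).div (tendsto_logW_rankOf hu)
      (log_one_div_pos hu).ne').const_mul (Ψ u)
    rw [zero_div, mul_zero] at t2
    refine squeeze_zero' ?_ ?_ t2
    · filter_upwards [eventually_rankOf_mem hu] with k hk
      exact mul_nonneg (h.nonneg _ (node_mem hk)) (h0 hk)
    · filter_upwards [eventually_rankOf_mem hu] with k hk
      exact mul_le_mul (h.anti hu (node_mem hk) le_node_rankOf) (min_le_right _ _) (h0 hk)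
        (h.nonneg u hu)

end Kernels

/-! ### Kernel estimators -/

section KernelMeans

/-- Deterministic bookkeeping: `d` is the deviation of the fraction and `D` the divided difference
of the kernel, `T` and `B` are the tail sums with targets `w` and `b`, and `L` is the log-ratio.
Expanding both factors leaves errors proportional to `d`, errors proportional to `q`, and the
remainder of `L`. -/
theorem kernel_mean_bound {k : ℕ} {Kp Kq D w T B b L Ψ : ℕ → ℝ} {x d q ζ θ A J : ℝ}
    (hw : ∀ i ∈ Icc 1 k, 0 < w i) (hKp : ∀ i ∈ Icc 1 k, |Kp i| ≤ Ψ i)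
    (hKq : ∀ i ∈ Icc 1 k, |Kq i| ≤ Ψ i) (hD : ∀ i ∈ Icc 1 k, |D i| ≤ Ψ i)
    (he : ∀ i ∈ Icc 1 k, Kq i = Kp i + d * D i)
    (hB : ∀ i ∈ Icc 1 k, 0 ≤ B i ∧ B i ≤ T i)
    (hL : ∀ i ∈ Icc 1 k, |L i - x * T i - q * B i| ≤ |q| * ζ * (T i + θ)) :
    |mean k (fun i => Kq i / w i * L i) - x * mean k (fun i => Kp i / w i * T i) + x * A * d -
        q * J| ≤
      |x| * |d| * (|mean k D + A| + mean k fun i => Ψ i * (|T i - w i| / w i)) +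
        |q| * (|mean k (fun i => Kp i / w i * b i) - J| +
          (mean k fun i => Ψ i * (|B i - b i| / w i)) + |d| * mean k fun i => Ψ i * (T i / w i)) +
        |q| * (ζ * ((mean k fun i => Ψ i * (T i / w i)) + θ * mean k fun i => Ψ i / w i)) := by
  have e1 : mean k (fun i => Kq i / w i * L i) - x * mean k (fun i => Kp i / w i * T i) +
      x * A * d - q * J = x * d * ((mean k D + A) + mean k fun i => D i * ((T i - w i) / w i)) +
      q * ((mean k (fun i => Kp i / w i * b i) - J) +
        (mean k fun i => Kp i * ((B i - b i) / w i)) + d * mean k fun i => D i * (B i / w i)) +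
      mean k fun i => Kq i / w i * (L i - x * T i - q * B i) := by
    have e2 : mean k (fun i => Kq i / w i * L i) = mean k fun i => x * (Kp i / w i * T i) +
        x * d * D i + x * d * (D i * ((T i - w i) / w i)) + q * (Kp i / w i * b i) +
        q * (Kp i * ((B i - b i) / w i)) + q * d * (D i * (B i / w i)) +
        Kq i / w i * (L i - x * T i - q * B i) := by
      refine mean_congr fun i hi => ?_
      have := (hw i hi).ne'
      rw [he i hi]
      field_simp
      ring
    simp only [mean_add, mean_const_mul] at e2
    rw [e2]
    ring
  have b1 : |mean k fun i => D i * ((T i - w i) / w i)| ≤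
      mean k fun i => Ψ i * (|T i - w i| / w i) := abs_mean_le fun i hi => by
    rw [abs_mul, abs_div, abs_of_pos (hw i hi)]
    exact mul_le_mul_of_nonneg_right (hD i hi) (div_nonneg (abs_nonneg _) (hw i hi).le)
  have b2 : |mean k fun i => Kp i * ((B i - b i) / w i)| ≤
      mean k fun i => Ψ i * (|B i - b i| / w i) := abs_mean_le fun i hi => by
    rw [abs_mul, abs_div, abs_of_pos (hw i hi)]
    exact mul_le_mul_of_nonneg_right (hKp i hi) (div_nonneg (abs_nonneg _) (hw i hi).le)
  have b3 : |mean k fun i => D i * (B i / w i)| ≤ mean k fun i => Ψ i * (T i / w i) :=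
    abs_mean_le fun i hi => by
      have h1 := (hw i hi).le
      rw [abs_mul, abs_of_nonneg (div_nonneg (hB i hi).1 h1)]
      exact mul_le_mul (hD i hi) (div_le_div_of_nonneg_right (hB i hi).2 h1)
        (div_nonneg (hB i hi).1 h1) ((abs_nonneg _).trans (hD i hi))
  have b4 : |mean k fun i => Kq i / w i * (L i - x * T i - q * B i)| ≤
      |q| * (ζ * ((mean k fun i => Ψ i * (T i / w i)) + θ * mean k fun i => Ψ i / w i)) := by
    rw [← mean_const_mul, ← mean_add, ← mean_const_mul, ← mean_const_mul]
    refine abs_mean_le fun i hi => ?_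
    have h1 := (hw i hi).le
    rw [abs_mul, abs_div, abs_of_pos (hw i hi)]
    refine (mul_le_mul (div_le_div_of_nonneg_right (hKq i hi) h1) (hL i hi) (abs_nonneg _)
      (div_nonneg ((abs_nonneg _).trans (hKq i hi)) h1)).trans (le_of_eq ?_)
    ring
  rw [e1]
  refine (abs_add_le _ _).trans (add_le_add ((abs_add_le _ _).trans (add_le_add ?_ ?_)) b4)
  · rw [abs_mul, abs_mul]
    exact mul_le_mul_of_nonneg_left ((abs_add_le _ _).trans (by gcongr)) (by positivity)
  · rw [abs_mul]
    refine mul_le_mul_of_nonneg_left ((abs_add_le _ _).trans (add_le_add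
      ((abs_add_le _ _).trans (by gcongr)) ?_)) (abs_nonneg _)
    rw [abs_mul]
    exact mul_le_mul_of_nonneg_left b3 (abs_nonneg _)

variable {Ω : Type*} [MeasurableSpace Ω] {P : Measure Ω} {k : ℕ → ℕ} {E : ℕ → ℕ → Ω → ℝ}
  {K : ℝ → ℝ → ℝ} {p η r x κ s : ℝ} {Ψ : ℝ → ℝ} {θ q : ℕ → ℝ} {N : ℕ → Ω → ℝ}

theorem KernelBound.smallP_mean [IsProbabilityMeasure P] (h : KernelBound K p η Ψ)
    (hk : Tendsto k atTop atTop) {U : ℕ → ℕ → Ω → ℝ} (hi : ∀ n i, Integrable (U n i) P)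
    (hU : ∀ n, ∀ i ∈ Icc 1 (k n), ∫ ω, |U n i ω| ∂P ≤ logW (k n) i * tailWeight (k n) i) :
    SmallP P fun n ω => mean (k n) fun i => Ψ (node (k n) i) * (|U n i ω| / logW (k n) i) := by
  have hI : ∀ n i, Integrable (fun ω => Ψ (node (k n) i) * (|U n i ω| / logW (k n) i)) P :=
    fun n i => ((hi n i).abs.div_const _).const_mul _
  refine smallP_of_integral_abs (of_forall fun n =>
    (integrable_finsetSum _ fun i _ => hI n i).const_mul _)
    (h.tendsto_mean_tailWeight.comp hk) (of_forall fun n => ?_)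
  have hw : ∀ i ∈ Icc 1 (k n), 0 < logW (k n) i := fun i hi =>
    logW_pos (mem_Icc.1 hi).1 (mem_Icc.1 hi).2
  have e : ∀ ω, |mean (k n) fun i => Ψ (node (k n) i) * (|U n i ω| / logW (k n) i)| =
      1 / (k n : ℝ) * ∑ i ∈ Icc 1 (k n), Ψ (node (k n) i) * (|U n i ω| / logW (k n) i) := fun ω =>
    abs_of_nonneg (mean_nonneg fun i hi => mul_nonneg (h.nonneg _ (node_mem hi))
      (div_nonneg (abs_nonneg _) (hw i hi).le))
  simp_rw [e]
  rw [integral_const_mul, integral_finsetSum _ fun i _ => hI n i]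
  refine mean_mono fun i hi => ?_
  rw [integral_const_mul, integral_div]
  refine mul_le_mul_of_nonneg_left ?_ (h.nonneg _ (node_mem hi))
  rw [div_le_iff₀ (hw i hi), mul_comm]
  exact hU n i hi

theorem le_logW_mul_tailWeight {k i : ℕ} (hi : i ∈ Icc 1 k) {a : ℝ}
    (h1 : a ≤ 4 * logW k i) (h2 : a ≤ √(2 / i) + 1 / i) : a ≤ logW k i * tailWeight k i := by
  have hw : 0 < logW k i := logW_pos (mem_Icc.1 hi).1 (mem_Icc.1 hi).2
  rw [tailWeight, mul_min_of_nonneg _ _ hw.le, mul_div_cancel₀ _ hw.ne']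
  exact le_min (by linarith) h2

theorem rate_inv_mul_le (k : ℕ) (q : ℝ) :
    (rate k q)⁻¹ * (1 / √(k : ℝ)) ≤ 1 ∧ (rate k q)⁻¹ * |q| ≤ 1 := by
  have h0 : 0 ≤ rate k q := by rw [rate]; positivity
  rw [inv_mul_eq_div, inv_mul_eq_div]
  exact ⟨div_le_one_of_le₀ (le_add_of_nonneg_right (abs_nonneg _)) h0,
    div_le_one_of_le₀ (le_add_of_nonneg_left (by positivity)) h0⟩

/-- In `kernel_mean_bound`, the terms are a negligible factor times a quantity bounded on the scale
of the rate. The hypothesis `hθ` is what the resolution of the grid must satisfy. -/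
theorem smallP_kernel_mean (hE : ∀ n, IsIidExp P (E n)) (hk : Tendsto k atTop atTop)
    (hK : IsKernel K) (h : KernelBound K p η Ψ) (hp0 : 0 < p) (hp1 : p < 1) (hr : 0 ≤ r)
    (hθ0 : ∀ᶠ n in atTop, 0 ≤ θ n) {M : ℝ}
    (hθ : ∀ᶠ n in atTop, θ n * mean (k n) (fun i => Ψ (node (k n) i) / logW (k n) i) ≤ M)
    {ph : ℕ → Ω → ℝ} (hph : SmallP P fun n ω => ph n ω - p)
    (hphr : BddP P fun n ω => (rate (k n) (q n))⁻¹ * (ph n ω - p))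
    {L : ℕ → Ω → ℕ → ℝ} {ζ : ℕ → Ω → ℝ} {B : ℕ → Set Ω} (hζ : SmallP P ζ)
    (hζ0 : ∀ n ω, 0 ≤ ζ n ω) (hB : Tendsto (fun n => P (B n)) atTop (𝓝 0))
    (hL : ∀ᶠ n in atTop, ∀ᵐ ω ∂P, ω ∉ B n → ∀ i ∈ Icc 1 (k n),
      |L n ω i - x * tailSum (E n) (k n) i ω - q n * wTailSum r (E n) (k n) i ω| ≤
        |q n| * ζ n ω * (tailSum (E n) (k n) i ω + θ n)) :
    SmallP P fun n ω => (rate (k n) (q n))⁻¹ *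
      (mean (k n) (fun i => K (node (k n) i) (ph n ω) / logW (k n) i * L n ω i) -
        x * mean (k n) (fun i => K (node (k n) i) p / logW (k n) i * tailSum (E n) (k n) i ω) +
        x * (1 / p ^ 2) * (ph n ω - p) -
        q n * ∫ s in (0 : ℝ)..1, s ^ r * tildeK K s p) := by
  have := (hE 0).isProb
  set J := ∫ s in (0 : ℝ)..1, s ^ r * tildeK K s p with hJ
  let S₁ : ℕ → Ω → ℝ := fun n ω => mean (k n) fun i =>
    Ψ (node (k n) i) * (|tailSum (E n) (k n) i ω - logW (k n) i| / logW (k n) i)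
  let S₂ : ℕ → Ω → ℝ := fun n ω => mean (k n) fun i =>
    Ψ (node (k n) i) * (|wTailSum r (E n) (k n) i ω - wHarm r (k n) i| / logW (k n) i)
  let Tm : ℕ → Ω → ℝ := fun n ω => mean (k n) fun i =>
    Ψ (node (k n) i) * (tailSum (E n) (k n) i ω / logW (k n) i)
  let J₁ : ℕ → ℝ := fun n =>
    mean (k n) (fun i => K (node (k n) i) p / logW (k n) i * wHarm r (k n) i) - J
  let D₁ : ℕ → Ω → ℝ := fun n ω =>
    mean (k n) (fun i => dslope (K (node (k n) i)) p (ph n ω)) + 1 / p ^ 2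
  have hS₁ : SmallP P S₁ := h.smallP_mean hk
    (U := fun n i ω => tailSum (E n) (k n) i ω - logW (k n) i)
    (fun n i => ((hE n).integrable_tailSum _ _).sub (integrable_const _)) fun n i hi => by
      have hi' := mem_Icc.1 hi
      refine le_logW_mul_tailWeight hi (((hE n).integral_abs_tailSum_sub_logW_le' hi'.1
        hi'.2).trans ?_) ((hE n).integral_abs_tailSum_sub_logW_le hi'.1 hi'.2)
      linarith [logW_pos hi'.1 hi'.2]
  have hS₂ : SmallP P S₂ := h.smallP_mean hk
    (U := fun n i ω => wTailSum r (E n) (k n) i ω - wHarm r (k n) i)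
    (fun n i => ((hE n).integrable_wTailSum _ _ _).sub (integrable_const _)) fun n i hi => by
      have hi' := mem_Icc.1 hi
      refine le_logW_mul_tailWeight hi ((hE n).integral_abs_wTailSum_sub_le' hr hi'.1 hi'.2)
        (((hE n).integral_abs_wTailSum_sub_le hr hi'.1).trans ?_)
      exact le_add_of_nonneg_right (by positivity)
  have hw : ∀ n, ∀ i ∈ Icc 1 (k n), 0 < logW (k n) i := fun n i hi =>
    logW_pos (mem_Icc.1 hi).1 (mem_Icc.1 hi).2
  have hTm : BddP P Tm := by
    refine ((bddP_of_bounded (P := P) (a := fun n => mean (k n) fun i => Ψ (node (k n) i))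
      (2 * ∫ u in Ioo (0 : ℝ) 1, Ψ u) (of_forall fun n => ?_)).add hS₁.bddP).of_le
      (of_forall fun n => ?_)
    · rw [abs_of_nonneg (mean_nonneg fun i hi => h.nonneg _ (node_mem hi))]
      exact mean_le_integral h.anti h.nonneg h.int _
    · refine ae_of_all _ fun ω => le_trans ?_ (le_abs_self _)
      rw [← mean_add]
      refine abs_mean_le fun i hi => ?_
      have h1 := hw n i hi
      have h2 := h.nonneg _ (node_mem hi)
      rw [abs_mul, abs_of_nonneg h2, ← mul_one_add, abs_div, abs_of_pos h1]
      refine mul_le_mul_of_nonneg_left ?_ h2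
      rw [one_add_div h1.ne']
      refine div_le_div_of_nonneg_right ?_ h1.le
      have h3 := abs_add_le (tailSum (E n) (k n) i ω - logW (k n) i) (logW (k n) i)
      rw [sub_add_cancel, abs_of_pos h1] at h3
      linarith
  have hJ₁ : SmallP P fun n _ => J₁ n := by
    refine smallP_of_tendsto ?_
    have := (h.tendsto_mean_wHarm hr).comp hk
    rw [h.integral_mul_cutPow hr] at this
    have h1 := this.sub_const J
    rw [← hJ, sub_self] at h1
    exact h1
  have hD₁ : SmallP P D₁ := by
    have h1 := hK.tendsto_mean_dslope h hp0 hp1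
    have h2 := (h1.comp ((hk.comp tendsto_fst).prodMk tendsto_snd)).add_const (1 / p ^ 2)
    rw [neg_add_cancel] at h2
    exact hph.comp_of_tendsto
      (g := fun n z => mean (k n) (fun i => dslope (K (node (k n) i)) p z) + 1 / p ^ 2) h2
  have hY := ((hD₁.abs.add hS₁).mul_bddP (hphr.const_mul x).abs).add
    (((hJ₁.abs.add hS₂).add (hph.abs.mul_bddP hTm)).add (hζ.mul_bddP (hTm.add
      (bddP_of_bounded (a := fun _ => M) |M| (of_forall fun _ => le_rfl)))))
  have hB' : Tendsto (fun n => P (B n ∪ {ω | η ≤ |ph n ω - p|})) atTop (𝓝 0) := by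
    have h2 : Tendsto (fun n => P {ω | η ≤ |ph n ω - p|}) atTop (𝓝 0) :=
      ENNReal.tendsto_nhds_zero.2 fun e he => hph η h.eta_pos e he
    refine tendsto_of_tendsto_of_tendsto_of_le_of_le tendsto_const_nhds
      (by simpa using hB.add h2) (fun _ => zero_le) fun n => measure_union_le _ _
  refine hY.of_le_off hB' ?_
  filter_upwards [hL, hθ0, hθ] with n hL hθ0 hθ
  filter_upwards [hL, (hE n).ae_forall_pos] with ω hL hpos hω
  rw [mem_union, not_or] at hω
  have hq : ph n ω ∈ Ioo (p - η) (p + η) := by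
    have h1 : |ph n ω - p| < η := not_le.1 hω.2
    rw [abs_lt] at h1
    constructor <;> linarith
  have hb := kernel_mean_bound (b := wHarm r (k n)) (d := ph n ω - p) (A := 1 / p ^ 2)
      (J := J) (hw n)
    (fun i hi => (h.bound _ (node_mem hi) p h.self_mem).2.1)
    (fun i hi => (h.bound _ (node_mem hi) _ hq).2.1) (fun i hi => h.abs_dslope_le (node_mem hi) hq)
    (fun i _ => by
      have := sub_smul_dslope (K (node (k n) i)) p (ph n ω)
      rw [smul_eq_mul] at this
      linarith) (fun i _ => ⟨wTailSum_nonneg r hpos, wTailSum_le_tailSum hr hpos⟩) (hL hω.1)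
  have hr0 : 0 ≤ rate (k n) (q n) := by rw [rate]; positivity
  have hqr := (rate_inv_mul_le (k n) (q n)).2
  have hS₂0 : 0 ≤ S₂ n ω := mean_nonneg fun i hi => mul_nonneg (h.nonneg _ (node_mem hi))
    (div_nonneg (abs_nonneg _) (hw n i hi).le)
  have hTm0 : 0 ≤ Tm n ω := mean_nonneg fun i hi => mul_nonneg (h.nonneg _ (node_mem hi))
    (div_nonneg (tailSum_nonneg hpos) (hw n i hi).le)
  rw [abs_mul, abs_of_nonneg (inv_nonneg.2 hr0)]
  refine le_trans (mul_le_mul_of_nonneg_left hb (inv_nonneg.2 hr0)) (le_trans ?_ (le_abs_self _))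
  rw [abs_mul x, abs_mul _ (ph n ω - p), abs_of_nonneg (inv_nonneg.2 hr0)]
  have hθM : ζ n ω * (Tm n ω + θ n * mean (k n) fun i => Ψ (node (k n) i) / logW (k n) i) ≤
      ζ n ω * (Tm n ω + M) := mul_le_mul_of_nonneg_left (by linarith) (hζ0 n ω)
  have hm0 : 0 ≤ mean (k n) fun i => Ψ (node (k n) i) / logW (k n) i :=
    mean_nonneg fun i hi => div_nonneg (h.nonneg _ (node_mem hi)) (hw n i hi).le
  have h5 := mul_le_mul_of_nonneg_right hqr (add_nonneg (add_nonneg (add_nonneg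
    (abs_nonneg (J₁ n)) hS₂0) (mul_nonneg (abs_nonneg (ph n ω - p)) hTm0)) (mul_nonneg (hζ0 n ω)
      (add_nonneg hTm0 (mul_nonneg hθ0 hm0))))
  refine le_trans (le_of_eq ?_) (add_le_add_right ((h5.trans_eq (one_mul _)).trans
    (add_le_add_right hθM _)) _)
  simp only [S₁, S₂, Tm, J₁, D₁]
  ring

theorem bddP_of_gaussian (hNm : ∀ n, Measurable (N n)) (hN : ∀ n, P.map (N n) = gaussianReal 0 1)
    [IsProbabilityMeasure P] : BddP P N := by
  have hi : Integrable (fun z : ℝ => z) (gaussianReal 0 1) :=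
    (memLp_id_gaussianReal 1).integrable le_rfl
  refine bddP_of_integral_abs (∫ z, |z| ∂gaussianReal 0 1) (of_forall fun n => ?_)
    (of_forall fun n => le_of_eq ?_)
  · rw [← hN n] at hi
    exact hi.comp_measurable (hNm n)
  · rw [← hN n, integral_map (hNm n).aemeasurable (by fun_prop)]

theorem bddP_rate_inv_mul [IsProbabilityMeasure P] (hNm : ∀ n, Measurable (N n))
    (hN : ∀ n, P.map (N n) = gaussianReal 0 1)
    {ph : ℕ → Ω → ℝ} (h : SmallP P fun n ω => (rate (k n) (q n))⁻¹ *
      (ph n ω - p - s * (N n ω / √(k n)) - q n * κ)) :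
    BddP P fun n ω => (rate (k n) (q n))⁻¹ * (ph n ω - p) := by
  refine ((h.bddP.abs.add ((bddP_of_gaussian hNm hN).const_mul s).abs).add
    (bddP_of_bounded (a := fun _ => |κ|) |κ| (by simp))).of_le
    (of_forall fun n => ae_of_all _ fun ω => le_trans ?_ (le_abs_self _))
  obtain ⟨h1, h2⟩ := rate_inv_mul_le (k n) (q n)
  have h0 : 0 ≤ (rate (k n) (q n))⁻¹ := by rw [rate]; positivity
  have e : (rate (k n) (q n))⁻¹ * (ph n ω - p) = (rate (k n) (q n))⁻¹ *
      (ph n ω - p - s * (N n ω / √(k n)) - q n * κ) +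
      (rate (k n) (q n))⁻¹ * (1 / √(k n : ℝ)) * (s * N n ω) + (rate (k n) (q n))⁻¹ * q n * κ := by
    ring
  rw [e]
  refine (abs_add_le _ _).trans (add_le_add ((abs_add_le _ _).trans (add_le_add le_rfl ?_)) ?_)
  · rw [abs_mul, abs_of_nonneg (by positivity : 0 ≤ (rate (k n) (q n))⁻¹ * (1 / √(k n : ℝ)))]
    exact mul_le_of_le_one_left (abs_nonneg _) h1
  · rw [abs_mul, abs_mul, abs_of_nonneg h0]
    exact mul_le_of_le_one_left (abs_nonneg _) h2

end KernelMeans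

/-! ### Associated kernels and the two classes of kernels -/

section Estimator

variable {K : ℝ → ℝ → ℝ} {p : ℝ}

theorem kernelEstimator_eq (z e : ℕ → ℝ) (n k : ℕ) : kernelEstimator K z e n k =
    mean k fun i => K (node k i) (topFraction z e n k) / logW k i *
      log (orderStat z n (n - i + 1) / orderStat z n (n - k)) := by
  rw [kernelEstimator, mean]
  refine congrArg _ (sum_congr rfl fun i _ => ?_)
  rw [mul_one_div]; rfl

/-- Interchange of the sums over `i ≤ j`: the associated kernel collects the weights that fall on a
single `E_j`. -/
theorem mean_tildeKDisc_mul {Ω : Type*} (E : ℕ → Ω → ℝ) (k : ℕ) (ω : Ω) :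
    mean k (fun j => tildeKDisc K k j p * E j ω) =
      mean k fun i => K (node k i) p / logW k i * tailSum E k i ω := by
  rw [mean, mean]
  refine congrArg _ ?_
  have e : ∀ j ∈ Icc 1 k, tildeKDisc K k j p * E j ω =
      ∑ i ∈ Icc 1 j, K (node k i) p / logW k i * (E j ω / j) := by
    intro j hj
    have h1 : (j : ℝ) ≠ 0 := Nat.cast_ne_zero.2 (by have := (mem_Icc.1 hj).1; omega)
    have h2 : (k : ℝ) + 1 ≠ 0 := by positivity
    rw [tildeKDisc, ← Finset.sum_mul]
    simp only [mul_one_div]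
    rw [show ∑ i ∈ Icc 1 j, K (node k i) p / logW k i =
      ∑ i ∈ Icc 1 j, K (i / ((k : ℝ) + 1)) p / log (((k : ℝ) + 1) / i) from rfl]
    field_simp
  rw [sum_congr rfl e]
  simp only [tailSum, mul_sum]
  refine Finset.sum_comm' fun j i => ?_
  simp only [mem_Icc]
  omega

/-- The factor `1/(k+1)` compensates the worst size of `1/logW`. It stands for the resolution `θ`,
available only under the differentiated expansions. -/
theorem KernelRegular.exists_bound_one (h : KernelRegular K p fun _ => 1) :
    ∃ η Ψ, KernelBound K p η Ψ ∧ ∃ M, ∀ k : ℕ,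
      1 / ((k : ℝ) + 1) * mean k (fun i => Ψ (node k i) / logW k i) ≤ M := by
  obtain ⟨hc, η, hη, φ, hφ, hi, hd, hb⟩ := h
  simp only [mul_one] at hi hb
  have hK : KernelBound K p η φ := ⟨hc, hη, hφ, hi, hd, hb⟩
  refine ⟨η, φ, hK, _, fun k => le_trans ?_ (mean_le_integral hφ hK.nonneg hi k)⟩
  rw [← mean_const_mul]
  refine mean_mono fun i hi => ?_
  have hi' := mem_Icc.1 hi
  rw [mul_div_assoc', div_le_iff₀ (logW_pos hi'.1 hi'.2), mul_comm]
  exact mul_le_mul_of_nonneg_left (one_div_le_logW hi'.1 hi'.2) (hK.nonneg _ (node_mem hi))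

/-- The majorant is `φ log(1/u)`, so division by `logW` leaves `φ`. It is integrable: on `(0, 1/2]`
the logarithm is at least `log 2`, and beyond that `φ` is at most `φ(1/2)`. -/
theorem KernelRegular.exists_bound_log (h : KernelRegular K p fun u => log (1 / u)) :
    ∃ η Ψ, KernelBound K p η Ψ ∧ ∃ M, ∀ k : ℕ, mean k (fun i => Ψ (node k i) / logW k i) ≤ M := by
  obtain ⟨hc, η, hη, φ, hφ, hi, hd, hb⟩ := h
  have hp : p ∈ Ioo (p - η) (p + η) := by constructor <;> linarith
  have h0 : ∀ u ∈ Ioo (0 : ℝ) 1, 0 ≤ φ u := fun u hu => nonneg_of_mul_nonneg_left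
    ((abs_nonneg _).trans (hb u hu p hp).2.1) (log_one_div_pos hu)
  have hl2 : 0 < log 2 := log_pos one_lt_two
  have hφi : IntegrableOn φ (Ioo 0 1) := by
    refine ((hi.div_const (log 2)).add (integrable_const (φ (1 / 2)))).mono'
      (aemeasurable_restrict_of_antitoneOn measurableSet_Ioo hφ).aestronglyMeasurable
      ((ae_restrict_iff' measurableSet_Ioo).2 (ae_of_all _ fun u hu => ?_))
    have h1 := h0 u hu
    have h2 : (1 / 2 : ℝ) ∈ Ioo (0 : ℝ) 1 := by norm_num
    rw [norm_eq_abs, abs_of_nonneg h1, Pi.add_apply]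
    rcases le_total u (1 / 2) with h3 | h3
    · refine le_add_of_le_of_nonneg ?_ (h0 _ h2)
      rw [le_div_iff₀ hl2]
      refine mul_le_mul_of_nonneg_left (log_le_log two_pos ?_) h1
      rw [le_div_iff₀ hu.1]; linarith
    · exact le_add_of_nonneg_of_le (div_nonneg (mul_nonneg h1 (log_one_div_pos hu).le) hl2.le)
        (hφ h2 hu h3)
  refine ⟨η, _, ⟨hc, hη, fun u hu u' hu' huu => mul_le_mul (hφ hu hu' huu)
    (log_le_log (one_div_pos.2 hu'.1) (one_div_le_one_div_of_le hu.1 huu))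
    (log_one_div_pos hu').le (h0 u hu), hi, hd, hb⟩, _,
    fun k => le_trans (le_of_eq (mean_congr fun i hi => ?_)) (mean_le_integral hφ h0 hφi k)⟩
  have hi' := mem_Icc.1 hi
  rw [log_one_div_node, mul_div_cancel_right₀ _ (logW_pos hi'.1 hi'.2).ne']

end Estimator

section Expansion

variable {Ω : Type*} [MeasurableSpace Ω] {P : Measure Ω} [IsProbabilityMeasure P] {k : ℕ → ℕ}
  {E : ℕ → ℕ → Ω → ℝ} {K : ℝ → ℝ → ℝ} {p η r x κ : ℝ} {Ψ : ℝ → ℝ} {θ q : ℕ → ℝ} {N : ℕ → Ω → ℝ}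
  {Z e : Ω → ℕ → ℝ}

/-- The expansion of a kernel estimator, from those of the proportion of uncensored observations
and of the log-ratios of upper order statistics. -/
theorem exists_kernelEstimator_expansion (hE : ∀ n, IsIidExp P (E n)) (hk : Tendsto k atTop atTop)
    (hNm : ∀ n, Measurable (N n)) (hN : ∀ n, P.map (N n) = gaussianReal 0 1)
    (hK : IsKernel K) (h : KernelBound K p η Ψ) (hp0 : 0 < p) (hp1 : p < 1) (hr : 0 ≤ r)
    (hx : 0 < x) (hq : ∀ᶠ n in atTop, q n ≠ 0) (hθ0 : ∀ᶠ n in atTop, 0 ≤ θ n) {M : ℝ}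
    (hθ : ∀ᶠ n in atTop, θ n * mean (k n) (fun i => Ψ (node (k n) i) / logW (k n) i) ≤ M)
    (hrate : Tendsto (fun n => rate (k n) (q n)) atTop (𝓝 0))
    (hph : SmallP P fun n ω => (rate (k n) (q n))⁻¹ * (topFraction (Z ω) (e ω) n (k n) - p -
      √(p * (1 - p)) * (N n ω / √(k n)) - q n * κ))
    {ζ : ℕ → Ω → ℝ} {B : ℕ → Set Ω} (hζ : SmallP P ζ)
    (hζ0 : ∀ n ω, 0 ≤ ζ n ω) (hB : Tendsto (fun n => P (B n)) atTop (𝓝 0))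
    (hL : ∀ᶠ n in atTop, ∀ᵐ ω ∂P, ω ∉ B n → 0 < orderStat (Z ω) n (n - k n) ∧
      ∀ i ∈ Icc 1 (k n),
        |log (orderStat (Z ω) n (n - i + 1) / orderStat (Z ω) n (n - k n)) -
            x * tailSum (E n) (k n) i ω - q n * wTailSum r (E n) (k n) i ω| ≤
          |q n| * ζ n ω * (tailSum (E n) (k n) i ω + θ n)) :
    ∃ ε₁ ε₂ : ℕ → Ω → ℝ, SmallP P ε₁ ∧ SmallP P ε₂ ∧ ∀ᶠ n in atTop, ∀ᵐ ω ∂P,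
      kernelEstimator K (Z ω) (e ω) n (k n) - x / p =
        -(√(p * (1 - p)) * (x / p ^ 2) * (N n ω / √(k n)) * (1 + ε₁ n ω)) +
        x * ((1 / (k n : ℝ)) * ∑ j ∈ Icc 1 (k n),
          tildeKDisc K (k n) j p * (E n j ω - 1)) +
        q n * (-(x / p ^ 2 * κ) + (∫ s in (0 : ℝ)..1, s ^ r * tildeK K s p) + ε₂ n ω) +
        x * ((1 / (k n : ℝ)) * ∑ j ∈ Icc 1 (k n), tildeKDisc K (k n) j p - 1 / p) := by
  have hphr := bddP_rate_inv_mul hNm hN hph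
  have hph0 : SmallP P fun n ω => topFraction (Z ω) (e ω) n (k n) - p := by
    refine ((smallP_of_tendsto hrate).mul_bddP hphr).of_le ?_
    filter_upwards [hq] with n hn
    have hr : 0 < rate (k n) (q n) := by
      have := abs_pos.2 hn
      rw [rate]; positivity
    exact ae_of_all _ fun ω => by rw [mul_inv_cancel_left₀ hr.ne']
  have h1 := smallP_kernel_mean hE hk hK h hp0 hp1 hr hθ0 hθ hph0 hphr hζ hζ0 hB
    (L := fun n ω i => log (orderStat (Z ω) n (n - i + 1) / orderStat (Z ω) n (n - k n)))
    (hL.mono fun n hn => hn.mono fun ω hω hωB => (hω hωB).2)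
  simp_rw [← kernelEstimator_eq, ← mean_tildeKDisc_mul] at h1
  -- The linear term in the fraction is replaced by the expansion of the fraction.
  have h2 := h1.sub (hph.const_mul (x * (1 / p ^ 2)))
  have hc : √(p * (1 - p)) * (x / p ^ 2) ≠ 0 := by
    have : 0 < 1 - p := by linarith
    positivity
  obtain ⟨ε₁, ε₂, hε₁, hε₂, hs⟩ := SmallP.exists_split (R := fun n ω =>
    kernelEstimator K (Z ω) (e ω) n (k n) -
      x * mean (k n) (fun j => tildeKDisc K (k n) j p * E n j ω) +
      x / p ^ 2 * (√(p * (1 - p)) * (N n ω / √(k n)) + q n * κ) -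
      q n * ∫ s in (0 : ℝ)..1, s ^ r * tildeK K s p)
    (h2.of_le (of_forall fun n => ae_of_all _ fun ω => le_of_eq (by
      congr 1; ring))) hNm hN hc hq
  refine ⟨fun n ω => -ε₁ n ω, ε₂, hε₁.neg, hε₂, hs.mono fun n hn => hn.mono fun ω hω => ?_⟩
  have e1 : ∑ j ∈ Icc 1 (k n), tildeKDisc K (k n) j p * (E n j ω - 1) =
      ∑ j ∈ Icc 1 (k n), tildeKDisc K (k n) j p * E n j ω -
        ∑ j ∈ Icc 1 (k n), tildeKDisc K (k n) j p := by
    rw [← sum_sub_distrib]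
    exact sum_congr rfl fun j _ => by ring
  rw [e1]
  rw [mean] at hω
  linear_combination hω

end Expansion

end

/-! ### The theorem -/

theorem mainTheorem1 {Ω : Type u} [MeasurableSpace Ω] (P : Measure Ω) [IsProbabilityMeasure P]
    (X C : ℕ → Ω → ℝ)
    (hXm : ∀ i, Measurable (X i)) (hCm : ∀ i, Measurable (C i))
    (hXind : iIndepFun X P) (hCind : iIndepFun C P)
    (hXC : IndepFun (fun ω i => X i ω) (fun ω i => C i ω) P)
    (hXid : ∀ i, IdentDistrib (X i) (X 0) P P) (hCid : ∀ i, IdentDistrib (C i) (C 0) P P)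
    (ξ ξc β βc D Dc Cst Cstc : ℝ)
    (hX : HallWelsh (fun x => P.real {ω | x < X 0 ω}) ξ Cst D β)
    (hC : HallWelsh (fun x => P.real {ω | x < C 0 ω}) ξc Cstc Dc βc)
    (hD : dZ β βc D Dc ≠ 0)
    (k : ℕ → ℕ) (hk : Tendsto k atTop atTop)
    (hkn : Tendsto (fun n => (k n : ℝ) / n) atTop (𝓝 0)) :
    ∃ (Ω' : Type u) (_ : MeasurableSpace Ω') (P' : Measure Ω') (π : Ω' → Ω),
      MeasurePreserving π P' P ∧
      ∃ (N : ℕ → Ω' → ℝ) (E : ℕ → ℕ → Ω' → ℝ),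
        -- `N` is standard normal, the `E_j` are i.i.d. standard exponential, independent of `N`
        (∀ n, Measurable (N n) ∧ P'.map (N n) = gaussianReal 0 1 ∧
          (∀ j, Measurable (E n j) ∧ P'.map (E n j) = expMeasure 1) ∧
          iIndepFun (E n) P' ∧ IndepFun (N n) (fun ω j => E n j ω) P') ∧
        -- `N` is the normal variable in the expansion of `p_k`
        (∃ ε₁ ε₂ : ℕ → Ω' → ℝ,
          TendstoInMeasure P' ε₁ atTop (fun _ => 0) ∧
          TendstoInMeasure P' ε₂ atTop (fun _ => 0) ∧
          ∀ᶠ n in atTop, ∀ᵐ ω ∂P',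
            topFraction (obsZ X C (π ω)) (obsE X C (π ω)) n (k n) - pLim ξ ξc =
              √(pLim ξ ξc * (1 - pLim ξ ξc)) * (N n ω / √(k n)) * (1 + ε₁ n ω) +
              q0Z ξ ξc β βc D Dc Cst Cstc ((n : ℝ) / k n) *
                (kappaZ ξ ξc β βc D Dc / (1 - rhoZ ξ ξc β βc) + ε₂ n ω)) ∧
        -- the `E_j` are the exponential variables in the expansion of the scaled spacings `V_j`
        (∃ η : ℕ → Ω' → ℝ,
          TendstoInMeasure P' η atTop (fun _ => 0) ∧
          ∀ᶠ n in atTop, ∀ᵐ ω ∂P', ∀ i ∈ Finset.Icc 1 (k n),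
            |∑ j ∈ Finset.Icc i (k n),
                (spacing (obsZ X C (π ω)) n j -
                  (xiZ ξ ξc + q0Z ξ ξc β βc D Dc Cst Cstc ((n : ℝ) / k n) *
                    ((j : ℝ) / ((k n : ℝ) + 1)) ^ (-rhoZ ξ ξc β βc)) * E n j ω) / (j : ℝ)| ≤
              η n ω * |q0Z ξ ξc β βc D Dc Cst Cstc ((n : ℝ) / k n)| *
                max (Real.log (((k n : ℝ) + 1) / i)) 1) ∧
        -- the expansion of the kernel estimators
        (∀ K : ℝ → ℝ → ℝ, IsKernel K →
          (KernelRegular K (pLim ξ ξc) (fun u => Real.log (1 / u)) ∨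
            (HallWelshDeriv (fun x => P.real {ω | x < X 0 ω}) ξ D β ∧
              HallWelshDeriv (fun x => P.real {ω | x < C 0 ω}) ξc Dc βc ∧
              KernelRegular K (pLim ξ ξc) (fun _ => 1))) →
          ∃ ε₁ ε₂ : ℕ → Ω' → ℝ,
            TendstoInMeasure P' ε₁ atTop (fun _ => 0) ∧
            TendstoInMeasure P' ε₂ atTop (fun _ => 0) ∧
            ∀ᶠ n in atTop, ∀ᵐ ω ∂P',
              kernelEstimator K (obsZ X C (π ω)) (obsE X C (π ω)) n (k n) - ξ =
                -(√(pLim ξ ξc * (1 - pLim ξ ξc)) * (xiZ ξ ξc / pLim ξ ξc ^ 2) *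
                    (N n ω / √(k n)) * (1 + ε₁ n ω)) +
                xiZ ξ ξc * ((1 / (k n : ℝ)) * ∑ j ∈ Finset.Icc 1 (k n),
                    tildeKDisc K (k n) j (pLim ξ ξc) * (E n j ω - 1)) +
                q0Z ξ ξc β βc D Dc Cst Cstc ((n : ℝ) / k n) *
                  (-(kappaZ ξ ξc β βc D Dc * xiZ ξ ξc) /
                      (pLim ξ ξc ^ 2 * (1 - rhoZ ξ ξc β βc)) +
                    (∫ u in (0 : ℝ)..1, u ^ (-rhoZ ξ ξc β βc) * tildeK K u (pLim ξ ξc)) +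
                    ε₂ n ω) +
                xiZ ξ ξc * ((1 / (k n : ℝ)) * ∑ j ∈ Finset.Icc 1 (k n),
                    tildeKDisc K (k n) j (pLim ξ ξc) - 1 / pLim ξ ξc)) := by
  have hPX := isProbabilityMeasure_map (hXm 0).aemeasurable (μ := P)
  have hPC := isProbabilityMeasure_map (hCm 0).aemeasurable (μ := P)
  have eS : ∀ {Y : Ω → ℝ}, Measurable Y →
      (fun x => P.real {ω | x < Y ω}) = sv (P.map Y) := fun hY => funext fun x =>
    (map_measureReal_apply hY measurableSet_Ioi).symm
  rw [eS (hXm 0)] at hX ⊢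
  rw [eS (hCm 0)] at hC ⊢
  have hx := xiZ_pos hX.xi_pos hC.xi_pos
  have hb := betaZ_pos hX.beta_pos hC.beta_pos
  have hp0 := pLim_pos hX.xi_pos hC.xi_pos
  have hp1 := pLim_lt_one hX.xi_pos hC.xi_pos
  have hcc := mul_pos hX.cst_pos hC.cst_pos
  have hpos := svMin_pos hX hC
  -- The coupling asks for `k n ≤ n` at every `n`; truncating at `n` changes nothing eventually.
  have hkk : ∀ᶠ n in atTop, min (k n) n = k n := by
    filter_upwards [eventually_lt_of_tendsto_div hkn] with n hn
    exact min_eq_left hn.le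
  have hk' : Tendsto (fun n => min (k n) n) atTop atTop :=
    hk.congr' (hkk.mono fun _ h => h.symm)
  have hkn' : Tendsto (fun n : ℕ => ((min (k n) n : ℕ) : ℝ) / n) atTop (𝓝 0) :=
    hkn.congr' (hkk.mono fun n h => by simp only [h])
  have hle : ∀ n, min (k n) n ≤ n := fun n => min_le_right _ _
  generalize hkd : (fun n => min (k n) n) = k' at hk'
  simp only [fun n => congrFun hkd n] at hkk hkn' hle
  obtain ⟨t, d, θ, δ, htd, hδ, hs, hθd⟩ := exists_scales hX hC hD hk' hkn'
  obtain ⟨Ω', mΩ', P', π, hP', hπ, y, v, N, E, hiid, hexp, hN, hclt, hord, hlevel, hcells⟩ :=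
    exists_coupled_sample hXm hCm hXind hCind hXC hXid hCid hpos (fun n => (htd n).1)
      (fun n => (htd n).2) hp0 hp1 hk' hle
  have hS : CoupledSample P' (P.map (X 0)) (P.map (C 0)) (pLim ξ ξc) k' t d
      (fun ω => obsZ X C (π ω)) (fun ω => obsE X C (π ω)) y v N E :=
    ⟨hiid, hexp, hclt, hord, hlevel, hcells⟩
  obtain ⟨A, hA, hG⟩ := exists_gridFacts hx hb hcc hpos hδ hs
  have hph := smallP_topFraction hS hcc hpos hx hx hA hp0 hp1 hδ hs hG
  obtain ⟨ζ, B, hζ, hζ0, hB, hL⟩ :=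
    exists_log_ratio_expansion hS hcc hpos hx hb hA hδ hk' hs hG
  have hr : -rhoZ ξ ξc β βc = xiZ ξ ξc * betaZ β βc := by rw [rhoZ, neg_neg, mul_comm]
  have hq : ∀ᶠ n : ℕ in atTop, q0Z ξ ξc β βc D Dc Cst Cstc ((n : ℝ) / k' n) ≠ 0 :=
    hs.mono fun n h => h.q_ne
  have hNm := fun n => (hN n).1
  have hNl := fun n => (hN n).2.1
  have hsq : √(pLim ξ ξc * (1 - pLim ξ ξc)) ≠ 0 :=
    (sqrt_pos.2 (mul_pos hp0 (by linarith))).ne'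
  refine ⟨Ω', mΩ', P', π, hπ, N, E, fun n => ⟨(hN n).1, (hN n).2.1,
    fun j => ⟨(hexp n).meas j, (hexp n).law j⟩, (hexp n).indep, (hN n).2.2⟩, ?_, ?_, ?_⟩
  · obtain ⟨ε₁, ε₂, h1, h2, h3⟩ := hph.exists_split hNm hNl hsq hq
    refine ⟨ε₁, ε₂, h1.tendstoInMeasure, h2.tendstoInMeasure, ?_⟩
    filter_upwards [h3, hkk] with n h3 hn
    rw [hn] at h3
    filter_upwards [h3] with ω hω
    linear_combination hω
  · obtain ⟨η, hη, h⟩ := exists_spacing_remainder hexp (hs.mono fun n h => h.k_lt) hq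
      (hs.mono fun n h => ⟨h.theta_pos, h.theta_le⟩) hζ hζ0 hB hL
    refine ⟨η, hη.tendstoInMeasure, ?_⟩
    filter_upwards [h, hkk] with n h hn
    rw [hn] at h
    rw [hr]
    exact ae_of_all _ h
  · intro K hK hreg
    have hrate : Tendsto (fun n : ℕ => rate (k' n) (q0Z ξ ξc β βc D Dc Cst Cstc ((n : ℝ) / k' n)))
        atTop (𝓝 0) := squeeze_zero' (hs.mono fun n h => h.rate_pos.le)
      (hs.mono fun n h => h.rate_le) (by simpa using hδ.pow 3)
    obtain ⟨η, Ψ, hKb, M, hM⟩ : ∃ η Ψ, KernelBound K (pLim ξ ξc) η Ψ ∧ ∃ M, ∀ᶠ n in atTop,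
        θ n * mean (k' n) (fun i => Ψ (node (k' n) i) / logW (k' n) i) ≤ M := by
      have hm : ∀ {η Ψ}, KernelBound K (pLim ξ ξc) η Ψ → ∀ k,
          0 ≤ mean k fun i => Ψ (node k i) / logW k i := fun h k => mean_nonneg fun i hi =>
        div_nonneg (h.nonneg _ (node_mem hi))
          (logW_pos (mem_Icc.1 hi).1 (mem_Icc.1 hi).2).le
      -- In case (a) `θ ≤ 1` is enough. In case (b) the differentiated expansions supply `θ ≤
      -- 1/(k+1)`.
      rcases hreg with h | ⟨h1, h2, h⟩
      · obtain ⟨η, Ψ, hb, M, hM⟩ := h.exists_bound_log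
        exact ⟨η, Ψ, hb, M, hs.mono fun n hn =>
          (mul_le_of_le_one_left (hm hb _) hn.theta_le).trans (hM _)⟩
      · obtain ⟨η, Ψ, hb, M, hM⟩ := h.exists_bound_one
        exact ⟨η, Ψ, hb, M, of_forall fun n =>
          (mul_le_mul_of_nonneg_right (hθd h1 h2 n) (hm hb _)).trans (hM _)⟩
    obtain ⟨ε₁, ε₂, h1, h2, h3⟩ := exists_kernelEstimator_expansion hexp hk' hNm hNl hK hKb hp0 hp1
      (mul_pos hx hb).le hx hq (hs.mono fun n h => h.theta_pos.le) hM hrate hph hζ hζ0 hB hL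
    refine ⟨ε₁, ε₂, h1.tendstoInMeasure, h2.tendstoInMeasure, ?_⟩
    have hξ : xiZ ξ ξc / pLim ξ ξc = ξ := by
      have h4 := hX.xi_pos
      have h5 := hC.xi_pos
      rw [xiZ, pLim]
      field_simp
    have hκ : -(kappaZ ξ ξc β βc D Dc * xiZ ξ ξc) / (pLim ξ ξc ^ 2 * (1 - rhoZ ξ ξc β βc)) =
        -(xiZ ξ ξc / pLim ξ ξc ^ 2 * (kappaZ ξ ξc β βc D Dc / (1 - rhoZ ξ ξc β βc))) := by
      rw [neg_div, mul_comm (kappaZ _ _ _ _ _ _), mul_div_mul_comm]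
    filter_upwards [h3, hkk] with n h3 hn
    rw [hn] at h3
    filter_upwards [h3] with ω hω
    rw [hξ] at hω
    rw [hκ, hr]
    exact hω
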